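/- **Notation.** Let $n\ge 1$, $0<T<\infty$, $0<s<\min(1,n/2)$, and let $\Omega\subset\mathbb R^n$ be open; write $\Omega_e=\mathbb R^n\setminus\overline\Omega$ and $A_T=A\times(0,T)$. All functions are real valued. $\Omega$ is *bounded in one direction* if, up to a rigid motion, it is contained in a cylinder $\mathbb R^{n-k}\times\omega$ with $0<k\le n$ and $\omega\subset\mathbb R^k$ bounded and open. For $a\geq 0$, $1\le p<\infty$, $H^{a,p}(\mathbb R^n)$ is the Bessel potential space with norm $\|\langle D\rangle^a u\|_{L^p}$, and $H^a=H^{a,2}$; $\widetilde H^s(\Omega)$ is the closure of $C_c^\infty(\Omega)$ in $H^s(\mathbb R^n)$; $H^{-s}(\mathbb R^n)=(H^s(\mathbb R^n))^*$ and $H^{-s}(\Omega)=(\widetilde H^s(\Omega))^*$. The fractional gradient is $$\nabla^s u(x,y)=\sqrt{\tfrac{C_{n,s}}{2}}\,\frac{u(x)-u(y)}{|x-y|^{n/2+s+1}}(x-y),\qquad C_{n,s}=\frac{4^s\Gamma(n/2+s)}{\pi^{n/2}|\Gamma(-s)|},$$ and $\mathrm{div}_s$ is its adjoint, $\langle \mathrm{div}_sW,v\rangle=\int_{\mathbb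 R^{2n}}W\cdot\nabla^sv\,dxdy$. A conductivity $\gamma\in L^\infty(\mathbb R^n_T)$ is *uniformly elliptic* if $0<\gamma_0\le\gamma\le\gamma_0^{-1}$ a.e. in $\mathbb R^n_T$ for some constant $\gamma_0$. Put $\Theta_\gamma(x,y,t)=\gamma^{1/2}(x,t)\gamma^{1/2}(y,t)\mathbf 1_{n\times n}$, $m_\gamma=\gamma^{1/2}-1$ and $B_\gamma(t;u,v)=\int_{\mathbb R^{2n}}\Theta_\gamma(t)\nabla^su\cdot\nabla^sv\,dxdy$. Given $F\in L^2(0,T;H^{-s}(\Omega))$, $f\in L^2(0,T;H^s(\mathbb R^n))$, $u_0\in L^2(\Omega)$, a *solution* of $$\partial_tu+\mathrm{div}_s(\Theta_\gamma\nabla^su)=F\ \text{in }\Omega_T,\qquad u=f\ \text{in }(\Omega_e)_T,\qquad u(0)=u_0\ \text{in }\Omega\qquad(*)$$ is a function $u\in L^\infty(0,T;L^2(\Omega))\cap L^2(0,T;H^s(\mathbb R^n))$ with $u-f\in L^2(0,T;\widetilde H^s(\Omega))$ and $$-\int_{\Omega_T}u\,\partial_t\varphi\,dxdt+\int_0^TB_\gamma(t;u,\varphi)\,dt=\langle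 F,\varphi\rangle+\int_\Omega u_0(x)\varphi(x,0)\,dx\qquad\text{for all }\varphi\in C_c^\infty(\Omega\times[0,T)).$$ **Theorem (Well-posedness of the forward problem).** Let $\Omega\subset\mathbb R^n$ be an open set bounded in one direction, $0<T<\infty$, $0<s<\min(1,n/2)$, and let $\gamma\in L^\infty(\mathbb R^n_T)$ be uniformly elliptic. (i) There is a constant $C>0$ such that the following holds for all $F\in L^2(0,T;H^{-s}(\Omega))$, all $f\in L^2(0,T;H^s(\mathbb R^n))$ with $\partial_tf\in L^2(0,T;H^{-s}(\mathbb R^n))$ and all $u_0\in L^2(\Omega)$. The trace $f(0)\in L^2(\mathbb R^n)$ exists (that is, $f$ has a representative in $C([0,T];L^2(\mathbb R^n))$ whose value at $0$ is $f(0)$), $\mathrm{div}_s(\Theta_\gamma\nabla^sf)\in L^2(0,T;H^{-s}(\Omega))$, problem $(*)$ has a unique solution $u\in L^\infty(0,T;L^2(\Omega))\cap L^2(0,T;H^s(\mathbb R^n))$, and this solution satisfies $\partial_tu\in L^2(0,T;H^{-s}(\Omega))$ and $$\begin{aligned}&\|u-f\|^2_{L^\infty(0,T;L^2(\Omega))}+\|u-f\|^2_{L^2(0,T;H^s(\mathbb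 R^n))}+\|\partial_t(u-f)\|^2_{L^2(0,T;H^{-s}(\Omega))}\\ &\quad\le C\Big(\|u_0\|^2_{L^2(\Omega)}+\|f(0)\|^2_{L^2(\Omega)}+\|F\|^2_{L^2(0,T;H^{-s}(\Omega))}+\|\partial_tf\|^2_{L^2(0,T;H^{-s}(\Omega))}+\|\mathrm{div}_s(\Theta_\gamma\nabla^sf)\|^2_{L^2(0,T;H^{-s}(\Omega))}\Big).\end{aligned}$$ (ii) Assume in addition that $m_\gamma\in L^\infty(0,T;H^{4s,\frac n{2s}}(\mathbb R^n))$ and $\partial_t\gamma\in L^\infty(\mathbb R^n_T)$. Then there is a constant $C>0$ such that, for all $F\in L^2(\Omega_T)$, $f\in H^1(0,T;L^2(\mathbb R^n))\cap L^2(0,T;H^{2s}(\mathbb R^n))$ and $u_0\in H^s(\mathbb R^n)$ with $u_0-f(0)\in\widetilde H^s(\Omega)$, the unique solution $u$ of $(*)$ satisfies $u\in L^\infty(0,T;H^s(\mathbb R^n))$, $\partial_tu\in L^2(\Omega_T)$ and $$\begin{aligned}&\|\partial_t(u-f)\|^2_{L^2(\Omega_T)}+\|u-f\|^2_{L^\infty(0,T;H^s(\mathbb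 R^n))}\\ &\quad\le C\Big(\|u_0\|^2_{H^s(\mathbb R^n)}+\|F\|^2_{L^2(\Omega_T)}+\|f(0)\|^2_{H^s(\mathbb R^n)}+\|\partial_tf\|^2_{L^2(\Omega_T)}+\|f\|^2_{L^2(0,T;H^{2s}(\mathbb R^n))}\Big).\end{aligned}$$ In both parts $C$ does not depend on $F$, $f$ and $u_0$. -/

import Mathlib

open MeasureTheory Set TopologicalSpace
open scoped ENNReal NNReal ContDiff Distributions SchwartzMap FourierTransform

noncomputable section

namespace NonlocalDiffusion

/-! ### Euclidean space, real `L²` spaces -/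

/-- Euclidean space `ℝⁿ`. -/
abbrev Euc (n : ℕ) : Type := EuclideanSpace ℝ (Fin n)

/-- The real Hilbert space `L²(ℝⁿ)`. -/
abbrev L2 (n : ℕ) : Type := Lp ℝ 2 (volume : Measure (Euc n))

/-- The real Hilbert space `L²(Ω)`. -/
abbrev L2On {n : ℕ} (Ω : Opens (Euc n)) : Type :=
  Lp ℝ 2 ((volume : Measure (Euc n)).restrict (Ω : Set (Euc n)))

/-- Restriction `u ↦ u|_Ω` from `L²(ℝⁿ)` to `L²(Ω)`. -/
def restr {n : ℕ} (Ω : Opens (Euc n)) : L2 n →L[ℝ] L2On Ω :=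
  LpToLpRestrictCLM (Euc n) ℝ ℝ volume 2 (Ω : Set (Euc n))

/-- A real `L²` function, regarded as a complex valued one. -/
def complexify (n : ℕ) : L2 n →L[ℝ] Lp ℂ 2 (volume : Measure (Euc n)) :=
  Complex.ofRealCLM.compLpL 2 volume

/-- A real `L²` function, regarded as a tempered distribution. -/
def toTD {n : ℕ} (u : L2 n) : 𝓢'(Euc n, ℂ) :=
  Lp.toTemperedDistribution (complexify n u)

/-- `Ω` is bounded in one direction: `Ω` is contained in the image of a cylinder `ℝᵐ × W` with
`m + k = n`, `k > 0` and `W ⊆ ℝᵏ` bounded and open, under a rigid motion `x ↦ L x + x₀`. -/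
def BoundedInOneDirection {n : ℕ} (Ω : Set (Euc n)) : Prop :=
  ∃ (m k : ℕ) (h : m + k = n) (W : Set (Euc k)) (L : Euc n ≃ₗᵢ[ℝ] Euc n) (x₀ : Euc n),
    0 < k ∧ IsOpen W ∧ Bornology.IsBounded W ∧
      Ω ⊆ (fun x => L x + x₀) ''
        {x : Euc n | WithLp.toLp 2 (fun i : Fin k => x (Fin.cast h (Fin.natAdd m i))) ∈ W}

/-! ### The spaces `Hᵃ(ℝⁿ)`, `a ≥ 0` -/

lemma toTD_add {n : ℕ} (u v : L2 n) : toTD (u + v) = toTD u + toTD v := by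
  simp only [toTD, map_add]
  exact map_add (Lp.toTemperedDistributionCLM ℂ volume 2) _ _

lemma toTD_smul {n : ℕ} (c : ℝ) (u : L2 n) : toTD (c • u) = (c : ℂ) • toTD u := by
  simp only [toTD, map_smul]
  rw [show c • complexify n u = (c : ℂ) • complexify n u from
    (Complex.coe_smul c (complexify n u)).symm]
  exact map_smul (Lp.toTemperedDistributionCLM ℂ volume 2) _ _

lemma Lp_toTD_injective {n : ℕ} {f g : Lp ℂ 2 (volume : Measure (Euc n))}
    (h : (f : 𝓢'(Euc n, ℂ)) = g) : f = g := by
  have hk := Lp.ker_toTemperedDistributionCLM_eq_bot (E := Euc n) (F := ℂ)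
    (μ := volume) (p := 2)
  exact LinearMap.ker_eq_bot.mp hk h

/-- The real subspace of `L²(ℝⁿ)` of all `u` with `⟨D⟩ᵃ u ∈ L²(ℝⁿ)`. -/
def sobolevSubmodule (n : ℕ) (a : ℝ≥0) : Submodule ℝ (L2 n) where
  carrier := {u | TemperedDistribution.MemSobolev (a : ℝ) 2 (toTD u)}
  add_mem' {u v} hu hv := by
    simp only [mem_ofPred_eq, toTD_add] at *
    exact hu.add hv
  zero_mem' := by
    have h : toTD (0 : L2 n) = 0 := by
      simp only [toTD, map_zero]
      exact map_zero (Lp.toTemperedDistributionCLM ℂ volume 2)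
    simp only [mem_ofPred_eq, h]
    exact TemperedDistribution.memSobolev_fun_zero _ _ _ _
  smul_mem' c u hu := by
    simp only [mem_ofPred_eq, toTD_smul] at *
    exact hu.smul _

/-- The Sobolev (Bessel potential) space `Hᵃ(ℝⁿ)` of real valued functions, `a ≥ 0`. -/
def Hs (n : ℕ) (a : ℝ≥0) : Type := sobolevSubmodule n a

namespace Hs

variable {n : ℕ} {a : ℝ≥0}

instance : AddCommGroup (Hs n a) := inferInstanceAs (AddCommGroup (sobolevSubmodule n a))
instance : Module ℝ (Hs n a) := inferInstanceAs (Module ℝ (sobolevSubmodule n a))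

/-- The inclusion `Hᵃ(ℝⁿ) ⊆ L²(ℝⁿ)`. -/
def toL2ₗ (n : ℕ) (a : ℝ≥0) : Hs n a →ₗ[ℝ] L2 n := (sobolevSubmodule n a).subtype

lemma toL2ₗ_injective : Function.Injective (toL2ₗ n a) := Subtype.val_injective

lemma memSobolev (u : Hs n a) : TemperedDistribution.MemSobolev (a : ℝ) 2 (toTD (toL2ₗ n a u)) :=
  u.2

/-- The function `⟨D⟩ᵃ u ∈ L²(ℝⁿ)`. -/
def besselFun (u : Hs n a) : Lp ℂ 2 (volume : Measure (Euc n)) := (memSobolev u).choose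

lemma besselFun_spec (u : Hs n a) :
    TemperedDistribution.besselPotential (Euc n) ℂ (a : ℝ) (toTD (toL2ₗ n a u)) =
      (besselFun u : 𝓢'(Euc n, ℂ)) :=
  (memSobolev u).choose_spec

/-- The map `u ↦ ⟨D⟩ᵃ u` from `Hᵃ(ℝⁿ)` to `L²(ℝⁿ)`. -/
def bessel (n : ℕ) (a : ℝ≥0) : Hs n a →ₗ[ℝ] Lp ℂ 2 (volume : Measure (Euc n)) where
  toFun := besselFun
  map_add' u v := by
    apply Lp_toTD_injective
    rw [← besselFun_spec, map_add, toTD_add, map_add, besselFun_spec, besselFun_spec]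
    exact (map_add (Lp.toTemperedDistributionCLM ℂ volume 2) _ _).symm
  map_smul' c u := by
    apply Lp_toTD_injective
    rw [← besselFun_spec, map_smul, toTD_smul, map_smul, besselFun_spec, RingHom.id_apply,
      show c • besselFun u = (c : ℂ) • besselFun u from (Complex.coe_smul c (besselFun u)).symm]
    exact (map_smul (Lp.toTemperedDistributionCLM ℂ volume 2) _ _).symm

/-- `‖u‖_{L²} ≤ ‖⟨D⟩ᵃ u‖_{L²}`. -/
lemma norm_toL2ₗ_le (u : Hs n a) : ‖toL2ₗ n a u‖ ≤ ‖bessel n a u‖ := by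
  set v : Lp ℂ 2 (volume : Measure (Euc n)) := complexify n (toL2ₗ n a u) with hv
  set w : Lp ℂ 2 (volume : Measure (Euc n)) := besselFun u with hw
  have h1 : ‖toL2ₗ n a u‖ ≤ ‖v‖ := by
    refine Lp.norm_le_norm_of_ae_le ?_
    filter_upwards [Complex.ofRealCLM.coeFn_compLpL (p := 2) (μ := volume) (toL2ₗ n a u)]
      with x hx
    rw [hv, complexify, hx]
    simp
  refine h1.trans ?_
  change ‖v‖ ≤ ‖w‖
  have hspec : TemperedDistribution.besselPotential (Euc n) ℂ (a : ℝ) (v : 𝓢'(Euc n, ℂ)) = w :=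
    besselFun_spec u
  have hF : (𝓕 (w : 𝓢'(Euc n, ℂ))) = TemperedDistribution.smulLeftCLM ℂ
      (fun x : Euc n ↦ (((1 + ‖x‖ ^ 2) ^ ((a : ℝ) / 2) : ℝ) : ℂ)) (𝓕 (v : 𝓢'(Euc n, ℂ))) := by
    rw [← hspec]
    exact TemperedDistribution.fourier_besselPotential_eq_smulLeftCLM_fourier_apply _ _
  set g : Euc n → ℂ := fun x ↦ (((1 + ‖x‖ ^ 2) ^ (-(a : ℝ) / 2) : ℝ) : ℂ) with hg
  have hgt : g.HasTemperateGrowth := by fun_prop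
  have hgb : ∀ x, ‖g x‖ ≤ 1 := by
    intro x
    rw [hg, Complex.norm_real, Real.norm_eq_abs, abs_eq_self.mpr (by positivity)]
    refine Real.rpow_le_one_of_one_le_of_nonpos (by simp) ?_
    have := a.coe_nonneg
    linarith
  have hgm : MemLp g ∞ (volume : Measure (Euc n)) :=
    memLp_top_of_bound hgt.1.continuous.aestronglyMeasurable 1 (Filter.Eventually.of_forall hgb)
  have hinv : (hgm.toLp g) • (𝓕 w) = (𝓕 v : Lp ℂ 2 (volume : Measure (Euc n))) := by
    apply Lp_toTD_injective
    rw [Lp.toTemperedDistribution_smul_eq hgt, ← Lp.fourier_toTemperedDistribution_eq,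
      ← Lp.fourier_toTemperedDistribution_eq, hF,
      TemperedDistribution.smulLeftCLM_smulLeftCLM_apply
        (g₁ := fun x : Euc n ↦ (((1 + ‖x‖ ^ 2) ^ ((a : ℝ) / 2) : ℝ) : ℂ)) (by fun_prop) hgt]
    convert! TemperedDistribution.smulLeftCLM_const 1 (𝓕 (v : 𝓢'(Euc n, ℂ))) using 1
    · congr
      ext x
      simp only [hg, Pi.mul_apply]
      rw [← Complex.ofReal_mul, ← Real.rpow_add (by positivity),
        show (a : ℝ) / 2 + -(a : ℝ) / 2 = 0 by ring, Real.rpow_zero, Complex.ofReal_one]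
    · simp
  calc ‖v‖ = ‖𝓕 v‖ := (Lp.norm_fourier_eq v).symm
    _ = ‖(hgm.toLp g) • (𝓕 w)‖ := by rw [hinv]
    _ ≤ ‖hgm.toLp g‖ * ‖𝓕 w‖ := Lp.norm_smul_le _ _
    _ ≤ 1 * ‖𝓕 w‖ := by
        gcongr
        rw [Lp.norm_toLp]
        refine ENNReal.toReal_le_of_le_ofReal zero_le_one ?_
        rw [eLpNorm_exponent_top]
        exact eLpNormEssSup_le_of_ae_bound (Filter.Eventually.of_forall hgb)
    _ = ‖w‖ := by rw [one_mul, Lp.norm_fourier_eq]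

lemma bessel_injective : Function.Injective (bessel n a) := by
  rw [← LinearMap.ker_eq_bot, LinearMap.ker_eq_bot']
  intro u hu
  have h := norm_toL2ₗ_le u
  rw [hu, norm_zero, norm_le_zero_iff] at h
  exact toL2ₗ_injective (by rw [h, map_zero])

/-- `‖u‖_{Hᵃ} = ‖⟨D⟩ᵃ u‖_{L²}`. -/
instance : NormedAddCommGroup (Hs n a) :=
  NormedAddCommGroup.induced (Hs n a) _ (bessel n a) bessel_injective

lemma norm_def (u : Hs n a) : ‖u‖ = ‖bessel n a u‖ := rfl

instance : NormedSpace ℝ (Hs n a) where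
  norm_smul_le c u := by
    rw [norm_def, norm_def, map_smul]
    exact norm_smul_le _ _

/-- The continuous inclusion `Hᵃ(ℝⁿ) ⊆ L²(ℝⁿ)`. -/
def toL2 (n : ℕ) (a : ℝ≥0) : Hs n a →L[ℝ] L2 n :=
  (toL2ₗ n a).mkContinuous 1 fun u => by
    rw [one_mul]
    exact norm_toL2ₗ_le u

/-- Elements of `Hᵃ(ℝⁿ)` as functions on `ℝⁿ` (through a representative). -/
instance : CoeFun (Hs n a) fun _ => Euc n → ℝ := ⟨fun u => (toL2 n a u : Euc n → ℝ)⟩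

end Hs

/-! ### Test functions, `H̃ˢ(Ω)` and the dual spaces `H⁻ˢ(Ω)`, `H⁻ˢ(ℝⁿ)` -/

section TestFunctions

variable {n : ℕ} {Ω : Opens (Euc n)}

lemma memLp_test (φ : 𝓓(Ω, ℝ)) : MemLp φ 2 (volume : Measure (Euc n)) :=
  φ.continuous.memLp_of_hasCompactSupport φ.hasCompactSupport

lemma memSobolev_test (a : ℝ≥0) (φ : 𝓓(Ω, ℝ)) :
    TemperedDistribution.MemSobolev (a : ℝ) 2 (toTD ((memLp_test φ).toLp φ)) := by
  have h₁ : HasCompactSupport (Complex.ofRealCLM ∘ φ) := φ.hasCompactSupport.comp_left rfl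
  have hφ : ContDiff ℝ ∞ φ := φ.contDiff
  have h₂ : ContDiff ℝ ∞ (Complex.ofRealCLM ∘ φ) := by fun_prop
  have h : toTD ((memLp_test φ).toLp φ) = (h₁.toSchwartzMap h₂ : 𝓢'(Euc n, ℂ)) := by
    rw [← Lp.toTemperedDistribution_toLp_eq (p := 2), toTD]
    congr 1
  rw [h]
  exact SchwartzMap.memSobolev _

/-- The inclusion `C_c^∞(Ω) ⊆ Hᵃ(ℝⁿ)` (extension by zero). -/
def testToHs (Ω : Opens (Euc n)) (a : ℝ≥0) : 𝓓(Ω, ℝ) →ₗ[ℝ] Hs n a where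
  toFun φ := ⟨(memLp_test φ).toLp φ, memSobolev_test a φ⟩
  map_add' _ _ := rfl
  map_smul' _ _ := rfl

/-- `H̃ˢ(Ω)`: the closure of `C_c^∞(Ω)` in `Hˢ(ℝⁿ)`. -/
def Htilde (Ω : Opens (Euc n)) (s : ℝ≥0) : Submodule ℝ (Hs n s) :=
  (LinearMap.range (testToHs Ω s)).topologicalClosure

/-- A test function as an element of `H̃ˢ(Ω)`. -/
def testToHtilde (Ω : Opens (Euc n)) (s : ℝ≥0) (φ : 𝓓(Ω, ℝ)) : Htilde Ω s :=
  ⟨testToHs Ω s φ, Submodule.le_topologicalClosure _ ⟨φ, rfl⟩⟩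

/-- `H⁻ˢ(ℝⁿ)`, the dual space of `Hˢ(ℝⁿ)`. -/
abbrev Hneg (n : ℕ) (s : ℝ≥0) : Type := StrongDual ℝ (Hs n s)

/-- `H⁻ˢ(Ω)`, as the dual space of `H̃ˢ(Ω)`. By the Hahn-Banach theorem this is isometrically the
space of restrictions to `Ω` of elements of `H⁻ˢ(ℝⁿ)` with the quotient norm. -/
abbrev HnegOn (Ω : Opens (Euc n)) (s : ℝ≥0) : Type := StrongDual ℝ (Htilde Ω s)

/-- Restriction of elements of `H⁻ˢ(ℝⁿ)` to `Ω`. -/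
def restrNeg (Ω : Opens (Euc n)) (s : ℝ≥0) (ℓ : Hneg n s) : HnegOn Ω s :=
  ℓ.comp (Htilde Ω s).subtypeL

/-- The embedding `L²(ℝⁿ) → H⁻ˢ(ℝⁿ)`, `g ↦ (v ↦ ∫ g v)`. -/
def l2ToHneg (n : ℕ) (s : ℝ≥0) (g : L2 n) : Hneg n s :=
  (innerSL ℝ g).comp (Hs.toL2 n s)

/-- The embedding `L²(Ω) → H⁻ˢ(Ω)`, `g ↦ (v ↦ ∫_Ω g v)`. -/
def l2ToHnegOn (Ω : Opens (Euc n)) (s : ℝ≥0) (g : L2On Ω) : HnegOn Ω s :=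
  (innerSL ℝ g).comp ((restr Ω).comp ((Hs.toL2 n s).comp (Htilde Ω s).subtypeL))

end TestFunctions

/-! ### Bochner spaces over `(0,T)`, time derivatives, initial values

`u ∈ Lᵖ(0,T;X)` is expressed by `MemLp u p (timeMeasure T)` for `u : ℝ → X`, and the norm of
`Lᵖ(0,T;X)` by `eLpNorm u p (timeMeasure T)`. -/

/-- Lebesgue measure on `(0,T)`. -/
def timeMeasure (T : ℝ) : Measure ℝ := volume.restrict (Ioo 0 T)

/-- The open interval `(0,T)`. -/
def timeInterval (T : ℝ) : Opens ℝ := ⟨Ioo 0 T, isOpen_Ioo⟩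

/-- `v` is the weak time derivative of `u` on `(0,T)`:
`-∫₀ᵀ η'(t) u(t) dt = ∫₀ᵀ η(t) v(t) dt` for all `η ∈ C_c^∞((0,T))`. -/
def IsWeakTimeDeriv {X : Type*} [NormedAddCommGroup X] [NormedSpace ℝ X] (T : ℝ)
    (u v : ℝ → X) : Prop :=
  ∀ η : 𝓓(timeInterval T, ℝ),
    -∫ t, deriv η t • u t ∂(timeMeasure T) = ∫ t, η t • v t ∂(timeMeasure T)

/-- `u` agrees a.e. on `(0,T)` with a function that is continuous on `[0,T]` and has the value
`g` at `0`, that is, `u(0) = g` in the sense of traces. -/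
def HasInitialValue {X : Type*} [TopologicalSpace X] (T : ℝ) (u : ℝ → X) (g : X) : Prop :=
  ∃ h : ℝ → X, ContinuousOn h (Icc 0 T) ∧ u =ᵐ[timeMeasure T] h ∧ h 0 = g

/-- `m ∈ L^∞(0,T;H^{a,p}(ℝⁿ))` for a function `m(x,t)`, where `H^{a,p}(ℝⁿ)`, `a ≥ 0`,
`1 ≤ p < ∞`, is the Bessel potential space of all `g` with `⟨D⟩ᵃ g ∈ Lᵖ(ℝⁿ)`
(then also `g ∈ Lᵖ(ℝⁿ)`, since `a ≥ 0`). -/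
def MemLinftyBessel {n : ℕ} (a : ℝ≥0) (p : ℝ≥0∞) (T : ℝ) (m : Euc n → ℝ → ℝ) : Prop :=
  ∃ (_ : Fact (1 ≤ p)) (w : ℝ → Lp ℂ p (volume : Measure (Euc n))),
    MemLp w ∞ (timeMeasure T) ∧
    ∀ᵐ t ∂(timeMeasure T), ∃ g : Lp ℂ p (volume : Measure (Euc n)),
      (∀ᵐ x : Euc n, g x = (m x t : ℂ)) ∧
      TemperedDistribution.besselPotential (Euc n) ℂ (a : ℝ) (g : 𝓢'(Euc n, ℂ)) =
        (w t : 𝓢'(Euc n, ℂ))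

/-! ### The conductivity and the nonlocal operators -/

/-- Lebesgue measure on `ℝⁿ_T = ℝⁿ × (0,T)`. -/
def cylinderMeasure (n : ℕ) (T : ℝ) : Measure (Euc n × ℝ) :=
  (volume : Measure (Euc n × ℝ)).restrict (univ ×ˢ Ioo 0 T)

/-- `γ` is a measurable function on `ℝⁿ_T` with `0 < γ₀ ≤ γ ≤ γ₀⁻¹` a.e. for some `γ₀`; in
particular `γ ∈ L^∞(ℝⁿ_T)`. -/
def UniformlyElliptic {n : ℕ} (T : ℝ) (γ : Euc n → ℝ → ℝ) : Prop :=
  AEStronglyMeasurable (Function.uncurry γ) (cylinderMeasure n T) ∧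
    ∃ γ₀ : ℝ, 0 < γ₀ ∧ ∀ᵐ z ∂(cylinderMeasure n T), γ₀ ≤ γ z.1 z.2 ∧ γ z.1 z.2 ≤ γ₀⁻¹

/-- The open set `ℝⁿ_T = ℝⁿ × (0,T)`. -/
def cylinder (n : ℕ) (T : ℝ) : Opens (Euc n × ℝ) :=
  ⟨univ ×ˢ Ioo 0 T, isOpen_univ.prod isOpen_Ioo⟩

/-- The distributional derivative `∂_t γ` on `ℝⁿ_T` belongs to `L^∞(ℝⁿ_T)`. -/
def TimeDerivBounded {n : ℕ} (T : ℝ) (γ : Euc n → ℝ → ℝ) : Prop :=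
  ∃ g : Euc n × ℝ → ℝ, MemLp g ∞ (cylinderMeasure n T) ∧
    ∀ φ : 𝓓(cylinder n T, ℝ),
      -∫ z, γ z.1 z.2 * deriv (fun τ => φ (z.1, τ)) z.2 ∂(cylinderMeasure n T) =
        ∫ z, g z * φ z ∂(cylinderMeasure n T)

/-- The background deviation `m_γ = γ^{1/2} - 1`. -/
def backgroundDeviation {n : ℕ} (γ : Euc n → ℝ → ℝ) (x : Euc n) (t : ℝ) : ℝ :=
  √(γ x t) - 1

/-- The constant `C_{n,s} = 4ˢ Γ(n/2+s) / (π^{n/2} |Γ(-s)|)`. -/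
def fracConst (n : ℕ) (s : ℝ) : ℝ :=
  4 ^ s * Real.Gamma (n / 2 + s) / (Real.pi ^ ((n : ℝ) / 2) * |Real.Gamma (-s)|)

/-- The fractional gradient
`∇ˢu(x,y) = √(C_{n,s}/2) (u(x)-u(y)) / |x-y|^{n/2+s+1} (x-y)`. -/
def fracGrad {n : ℕ} (s : ℝ) (u : Euc n → ℝ) (z : Euc n × Euc n) : Euc n :=
  (√(fracConst n s / 2) * ((u z.1 - u z.2) / ‖z.1 - z.2‖ ^ ((n : ℝ) / 2 + s + 1))) • (z.1 - z.2)

/-- `Θ_γ(x,y,t) = γ^{1/2}(x,t) γ^{1/2}(y,t) 1_{n×n}` applied to a vector `ξ ∈ ℝⁿ`. -/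
def conductivity {n : ℕ} (γ : Euc n → ℝ → ℝ) (t : ℝ) (z : Euc n × Euc n) (ξ : Euc n) : Euc n :=
  (√(γ z.1 t) * √(γ z.2 t)) • ξ

/-- `ℓ ∈ H⁻ˢ(Ω)` is (the restriction to `Ω` of) the fractional divergence `div_s W` of a vector
field `W` on `ℝ²ⁿ`: `⟨ℓ, v⟩ = ∫ W · ∇ˢv dx dy` for all `v ∈ H̃ˢ(Ω)`. -/
def IsFracDiv {n : ℕ} (Ω : Opens (Euc n)) (s : ℝ≥0) (W : Euc n × Euc n → Euc n)
    (ℓ : HnegOn Ω s) : Prop :=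
  ∀ v : Htilde Ω s, ℓ v = ∫ z : Euc n × Euc n, inner ℝ (W z) (fracGrad s (v : Hs n s) z)

/-- The bilinear form `B_γ(t;u,v) = ∫_{ℝ²ⁿ} Θ_γ(t) ∇ˢu · ∇ˢv dx dy`. -/
def condForm {n : ℕ} (s : ℝ) (γ : Euc n → ℝ → ℝ) (t : ℝ) (u v : Euc n → ℝ) : ℝ :=
  ∫ z : Euc n × Euc n, inner ℝ (conductivity γ t z (fracGrad s u z)) (fracGrad s v z)

/-! ### Weak solutions -/

section Weak

variable {n : ℕ}

/-- `Ω × (-∞,T)`. The restrictions to `t ≥ 0` of its test functions form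
`C_c^∞(Ω × [0,T))`. -/
def spaceTime (Ω : Opens (Euc n)) (T : ℝ) : Opens (Euc n × ℝ) :=
  ⟨(Ω : Set (Euc n)) ×ˢ Iio T, Ω.isOpen.prod isOpen_Iio⟩

/-- The time slice `φ(·,t) ∈ C_c^∞(Ω)` of a space-time test function. -/
def slice {Ω : Opens (Euc n)} {T : ℝ} (φ : 𝓓(spaceTime Ω T, ℝ)) (t : ℝ) : 𝓓(Ω, ℝ) where
  toFun x := φ (x, t)
  contDiff' := φ.contDiff.comp (contDiff_id.prodMk contDiff_const)
  hasCompactSupport' :=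
    HasCompactSupport.intro (φ.hasCompactSupport.image continuous_fst) fun x hx => by
      by_contra h
      exact hx ⟨(x, t), subset_tsupport _ h, rfl⟩
  tsupport_subset' := fun x hx => by
    have h : tsupport (fun x => φ (x, t)) ⊆ (fun x : Euc n => (x, t)) ⁻¹' tsupport φ :=
      closure_minimal (fun y hy => subset_tsupport _ hy)
        ((isClosed_tsupport _).preimage (by fun_prop))
    exact (φ.tsupport_subset (h hx)).1

/-- `u ∈ L^∞(0,T;L²(Ω)) ∩ L²(0,T;Hˢ(ℝⁿ))` is a (weak) solution of
`∂_t u + div_s(Θ_γ ∇ˢu) = F` in `Ω_T`, `u = f` in `(Ω_e)_T`, `u(0) = u₀` in `Ω`. -/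
structure IsWeakSolution (Ω : Opens (Euc n)) (s : ℝ≥0) (T : ℝ) (γ : Euc n → ℝ → ℝ)
    (F : ℝ → HnegOn Ω s) (f : ℝ → Hs n s) (u₀ : L2On Ω) (u : ℝ → Hs n s) : Prop where
  memLp_two : MemLp u 2 (timeMeasure T)
  memLp_top : MemLp (fun t => restr Ω (Hs.toL2 n s (u t))) ∞ (timeMeasure T)
  /-- `u - f ∈ L²(0,T;H̃ˢ(Ω))` -/
  exterior : ∃ w : ℝ → Htilde Ω s, MemLp w 2 (timeMeasure T) ∧
    ∀ᵐ t ∂(timeMeasure T), u t - f t = w t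
  weak_eq : ∀ φ : 𝓓(spaceTime Ω T, ℝ),
    -(∫ t, (∫ x in (Ω : Set (Euc n)), u t x * deriv (fun τ => φ (x, τ)) t) ∂(timeMeasure T)) +
        ∫ t, condForm s γ t (u t) (slice φ t) ∂(timeMeasure T) =
      (∫ t, F t (testToHtilde Ω s (slice φ t)) ∂(timeMeasure T)) +
        ∫ x in (Ω : Set (Euc n)), u₀ x * φ (x, 0)

end Weak

end NonlocalDiffusion
end

open NonlocalDiffusion

noncomputable section

namespace NonlocalDiffusion

set_option linter.unusedSectionVars false

/-! ### Integration in time -/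

section Time

open Filter Topology

variable {T : ℝ} {E F X : Type*} [NormedAddCommGroup E] [NormedSpace ℝ E]
  [NormedAddCommGroup F] [NormedSpace ℝ F] [NormedAddCommGroup X] [NormedSpace ℝ X]

/-! Let `V = H̃ˢ(Ω)`, `H = L²(Ω)` and let `ι : V → H` be the embedding `embΩ`. Writing `u = f + w`
turns the problem into `w' + a(t) w = G` in the dual of `V` with `w(0) = u₀ - f(0)`. Here `a(t)` is
the form `B_γ(t)` restricted to `V`, and `G = F - ∂_t f - div_s(Θ_γ ∇ˢf)`. Equations in time are
kept in integrated form (`IsPrimitive`). The weak formulation is equivalent to the integrated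
equation, because slices of space-time test functions are differentiable curves in `V` and products
`η(t) χ(x)` already determine it (`weak_eq_of_isPrimitive`, `isPrimitive_of_weak_eq`).

Plancherel's theorem identifies the Gagliardo seminorm with a constant times the `L²` norm of `|ξ|ˢ
û`, since its symbol is radial and homogeneous (`gagliardo_fourier`, `gsymb_eq`). Hence `a(t)` is
bounded and satisfies a Gårding inequality with respect to `L²`. On a finite time interval that is
enough: an exponential weight in time, or Gronwall's lemma, absorbs the zero order term.

Part (i) rests on two facts. Existence comes from Lions' projection lemma: the adjoint operator,
applied to functions vanishing at `T`, is bounded below, so the equation is represented by a vector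
of `L²(0,T;V)` (`exists_isMildSolution`). Uniqueness, the bound in `L^∞(0,T;H)` and the trace `f(0)`
come from the Lions-Magenes lemma: the energy identity for `‖ι u‖²` makes `ι u` uniformly continuous
on a set of full measure (`lionsMagenes`).

Part (ii) needs three further ingredients. Boundedness of `∂_t γ` gives a version of `a` that is
Lipschitz in time (`exists_lipschitz_form`). Since `4s - n/p = 2s` for `p = n/(2s)`, the hypothesis
on `m_γ` makes `γ^{1/2}` Hölder continuous of an order above `s`; this is seen by writing Bessel
potentials as superpositions of heat kernels (`exists_kernel_bound`). A commutator argument then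
bounds `B_γ(t; f, v)` by `‖f‖_{H²ˢ} ‖v‖_{L²}` (`exists_abs_rootForm_le`), so `G` acts on `v` through
`‖ι v‖` only. For such `G` the pair `(w - w₀, w')` is found by a second application of Lions' lemma
(`exists_regular_solution`). The increments of the energy `a(t; w, w)` are integrable, which bounds
`w` in `L^∞(0,T;V)` (`ae_regular_norm_sq_le`). By uniqueness this regular solution is the given weak
solution minus `f`. -/

instance : IsFiniteMeasure (timeMeasure T) := by
  unfold timeMeasure; infer_instance

lemma ae_timeMeasure_mem : ∀ᵐ t ∂(timeMeasure T), t ∈ Ioo 0 T :=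
  ae_restrict_mem measurableSet_Ioo

lemma intervalIntegrable_of_timeMeasure {q : ℝ → E} (hq : Integrable q (timeMeasure T))
    {a b : ℝ} (ha : a ∈ Icc 0 T) (hb : b ∈ Icc 0 T) : IntervalIntegrable q volume a b := by
  have h : IntegrableOn q (Icc 0 T) := by
    rw [integrableOn_Icc_iff_integrableOn_Ioo]; exact hq
  exact (h.mono_set (uIcc_subset_Icc ha hb)).intervalIntegrable

lemma setIntegral_timeMeasure_Ioi {q : ℝ → E} {t : ℝ} (ht : t ∈ Icc 0 T) :
    ∫ τ, (Ioi t).indicator q τ ∂(timeMeasure T) = ∫ τ in t..T, q τ := by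
  rw [timeMeasure, setIntegral_indicator measurableSet_Ioi, intervalIntegral.integral_of_le ht.2,
    integral_Ioc_eq_integral_Ioo]
  congr 2
  ext x; simp only [mem_inter_iff, mem_Ioo, mem_Ioi]
  constructor
  · rintro ⟨⟨_, h⟩, h'⟩; exact ⟨h', h⟩
  · rintro ⟨h, h'⟩; exact ⟨⟨ht.1.trans_lt h, h'⟩, h⟩

lemma setIntegral_timeMeasure_Iio {q : ℝ → E} {t : ℝ} (ht : t ∈ Icc 0 T) :
    ∫ τ, (Iio t).indicator q τ ∂(timeMeasure T) = ∫ τ in 0..t, q τ := by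
  rw [timeMeasure, setIntegral_indicator measurableSet_Iio, intervalIntegral.integral_of_le ht.1,
    integral_Ioc_eq_integral_Ioo]
  congr 2
  ext x; simp only [mem_inter_iff, mem_Ioo, mem_Iio]
  constructor
  · rintro ⟨⟨h, _⟩, h'⟩; exact ⟨h, h'⟩
  · rintro ⟨h, h'⟩; exact ⟨⟨h, h'.trans_le ht.2⟩, h'⟩

lemma integral_timeMeasure (hT : 0 ≤ T) (q : ℝ → E) :
    ∫ t, q t ∂(timeMeasure T) = ∫ t in 0..T, q t := by
  rw [timeMeasure, intervalIntegral.integral_of_le hT, integral_Ioc_eq_integral_Ioo]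

variable [CompleteSpace E] [CompleteSpace F] [CompleteSpace X]

/-- Fubini's theorem on the triangle `0 < t < τ < T`. -/
lemma integral_bilin_primitive (B : E →L[ℝ] F →L[ℝ] X) {q : ℝ → E} {ψ : ℝ → F}
    (hq : Integrable q (timeMeasure T)) (hψ : Integrable ψ (timeMeasure T)) :
    ∫ t, B (q t) (∫ τ in t..T, ψ τ) ∂(timeMeasure T) =
      ∫ τ, B (∫ t in 0..τ, q t) (ψ τ) ∂(timeMeasure T) := by
  set μ := timeMeasure T with hμ
  set K : ℝ × ℝ → X := {z : ℝ × ℝ | z.1 < z.2}.indicator fun z => B (q z.1) (ψ z.2) with hK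
  have hms : MeasurableSet {z : ℝ × ℝ | z.1 < z.2} := measurableSet_lt measurable_fst measurable_snd
  have hint : Integrable K (μ.prod μ) := by
    refine Integrable.indicator ?_ hms
    refine Integrable.mono' ((hq.norm.mul_prod hψ.norm).const_mul ‖B‖) ?_ ?_
    · exact B.aestronglyMeasurable_comp₂ hq.1.comp_fst hψ.1.comp_snd
    · refine .of_forall fun z => ?_
      rw [← mul_assoc]
      exact B.le_opNorm₂ _ _
  have h1 : ∫ t, B (q t) (∫ τ in t..T, ψ τ) ∂μ = ∫ t, ∫ τ, K (t, τ) ∂μ ∂μ := by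
    refine integral_congr_ae ?_
    filter_upwards [ae_timeMeasure_mem] with t ht
    rw [← setIntegral_timeMeasure_Ioi (Ioo_subset_Icc_self ht),
      ← (B (q t)).integral_comp_comm (hψ.indicator measurableSet_Ioi)]
    refine integral_congr_ae (.of_forall fun τ => ?_)
    by_cases h : t < τ <;> simp [hK, indicator, h]
  have h2 : ∫ τ, B (∫ t in 0..τ, q t) (ψ τ) ∂μ = ∫ τ, ∫ t, K (t, τ) ∂μ ∂μ := by
    refine integral_congr_ae ?_
    filter_upwards [ae_timeMeasure_mem] with τ ht
    rw [← setIntegral_timeMeasure_Iio (Ioo_subset_Icc_self ht)]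
    change (B.flip (ψ τ)) _ = _
    rw [← (B.flip (ψ τ)).integral_comp_comm (hq.indicator measurableSet_Iio)]
    refine integral_congr_ae (.of_forall fun t => ?_)
    by_cases h : t < τ <;> simp [hK, indicator, h]
  rw [h1, h2]
  exact integral_integral_swap hint

/-- `Y(t) = Y₀ + ∫₀ᵗ Z` for almost every `t ∈ (0,T)`. -/
def IsPrimitive (T : ℝ) (Y Z : ℝ → X) (Y₀ : X) : Prop :=
  ∀ᵐ t ∂(timeMeasure T), Y t = Y₀ + ∫ τ in 0..t, Z τ

lemma integral_smul_primitive {q : ℝ → X} {θ : ℝ → ℝ}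
    (hq : Integrable q (timeMeasure T)) (hθ : Integrable θ (timeMeasure T)) :
    ∫ t, (∫ τ in t..T, θ τ) • q t ∂(timeMeasure T) =
      ∫ τ, θ τ • (∫ t in 0..τ, q t) ∂(timeMeasure T) :=
  integral_bilin_primitive ((ContinuousLinearMap.lsmul ℝ ℝ).flip : X →L[ℝ] ℝ →L[ℝ] X) hq hθ

lemma integrable_continuous {θ : ℝ → X} (hθ : Continuous θ) : Integrable θ (timeMeasure T) :=
  (hθ.integrableOn_Icc (a := 0) (b := T)).mono_set Ioo_subset_Icc_self

lemma continuousOn_primitive {q : ℝ → X} (hT : 0 ≤ T) (hq : Integrable q (timeMeasure T)) :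
    ContinuousOn (fun t => ∫ τ in 0..t, q τ) (Icc 0 T) := by
  have := intervalIntegral.continuousOn_primitive_interval
    (μ := volume) (f := q) (a := 0) (b := T) (by
      rw [uIcc_of_le hT, integrableOn_Icc_iff_integrableOn_Ioo]; exact hq)
  rwa [uIcc_of_le hT] at this

lemma integrable_smul_continuous {q : ℝ → X} {θ : ℝ → ℝ} (hθ : Continuous θ)
    (hq : Integrable q (timeMeasure T)) : Integrable (fun t => θ t • q t) (timeMeasure T) := by
  obtain ⟨C, hC⟩ := (isCompact_Icc (a := (0 : ℝ)) (b := T)).exists_bound_of_continuousOn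
    hθ.continuousOn
  refine hq.bdd_smul C hθ.aestronglyMeasurable ?_
  filter_upwards [ae_timeMeasure_mem] with t ht using hC t (Ioo_subset_Icc_self ht)

lemma integrable_primitive {q : ℝ → X} (hT : 0 ≤ T) (hq : Integrable q (timeMeasure T)) :
    Integrable (fun t => ∫ τ in 0..t, q τ) (timeMeasure T) :=
  ((continuousOn_primitive hT hq).integrableOn_compact isCompact_Icc).mono_set Ioo_subset_Icc_self

/-- Integration by parts against a smooth function vanishing at `T`. -/
lemma IsPrimitive.integral_deriv_smul {Y Z : ℝ → X} {Y₀ : X} (hT : 0 ≤ T)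
    (h : IsPrimitive T Y Z Y₀) (hZ : Integrable Z (timeMeasure T)) {η : ℝ → ℝ}
    (hη : ContDiff ℝ 1 η) (hηT : η T = 0) :
    -∫ t, deriv η t • Y t ∂(timeMeasure T) = (∫ t, η t • Z t ∂(timeMeasure T)) + η 0 • Y₀ := by
  have hc : Continuous (deriv η) := hη.continuous_deriv le_rfl
  have hprim : ∀ t, ∫ τ in t..T, deriv η τ = -η t := fun t => by
    rw [intervalIntegral.integral_deriv_eq_sub (fun x _ => (hη.differentiable one_ne_zero) x)
      (hc.intervalIntegrable _ _), hηT, zero_sub]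
  have h1 : ∫ t, deriv η t • Y t ∂(timeMeasure T) =
      ∫ t, (deriv η t • Y₀ + deriv η t • ∫ τ in 0..t, Z τ) ∂(timeMeasure T) := by
    refine integral_congr_ae ?_
    filter_upwards [h] with t ht
    rw [ht, smul_add]
  have h2 : ∫ t, deriv η t • Y₀ ∂(timeMeasure T) = -η 0 • Y₀ := by
    rw [integral_smul_const, integral_timeMeasure hT, hprim]
  rw [h1, integral_add ((integrable_continuous hc).smul_const _)
    (integrable_smul_continuous hc (integrable_primitive hT hZ)), h2,
    ← integral_smul_primitive hZ (integrable_continuous hc)]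
  simp only [hprim, neg_smul, integral_neg]
  abel

/-- A smooth function with support in `(0,T)` and vanishing integral is the derivative of a test
function. -/
lemma exists_test_deriv_eq {ψ : ℝ → ℝ} (hψ : ContDiff ℝ ∞ ψ) (hc : HasCompactSupport ψ)
    (hs : tsupport ψ ⊆ Ioo 0 T) (h0 : ∫ t, ψ t = 0) :
    ∃ η : 𝓓(timeInterval T, ℝ), ∀ t, deriv η t = ψ t := by
  by_cases hne : (tsupport ψ).Nonempty
  swap
  · refine ⟨0, fun t => ?_⟩
    rw [not_nonempty_iff_eq_empty, tsupport_eq_empty_iff] at hne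
    simp [hne]
  have hK : IsCompact (tsupport ψ) := hc
  obtain ⟨a, ha, ha'⟩ := hK.exists_isLeast hne
  obtain ⟨b, hb, hb'⟩ := hK.exists_isGreatest hne
  have hz : ∀ t, t ∉ Icc a b → ψ t = 0 := fun t ht =>
    image_eq_zero_of_notMem_tsupport fun h => ht ⟨ha' h, hb' h⟩
  -- Starting at the left end of the support makes the primitive vanish to the left; the vanishing
  -- total integral makes it vanish to the right of `b`.
  set H : ℝ → ℝ := fun t => ∫ τ in a..t, ψ τ with hH
  have hd : ∀ t, HasDerivAt H (ψ t) t := fun t =>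
    intervalIntegral.integral_hasDerivAt_right (hψ.continuous.intervalIntegrable _ _)
      hψ.continuous.aestronglyMeasurable.stronglyMeasurableAtFilter hψ.continuous.continuousAt
  have hderiv : deriv H = ψ := funext fun t => (hd t).deriv
  have hHz : ∀ t, t ∉ Icc a b → H t = 0 := by
    intro t ht
    rcases lt_or_ge t a with h | h
    · refine intervalIntegral.integral_zero_ae ?_
      filter_upwards [compl_mem_ae_iff.2 (measure_singleton a)] with τ hτa hτ
      rw [uIoc_of_ge h.le] at hτ
      exact hz τ fun hh => hτa (le_antisymm hτ.2 hh.1)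
    · have hbt : b < t := by
        by_contra hcon; exact ht ⟨h, not_lt.1 hcon⟩
      rw [hH, ← h0]
      change ∫ τ in a..t, ψ τ = _
      rw [intervalIntegral.integral_of_le h, ← integral_Icc_eq_integral_Ioc]
      refine setIntegral_eq_integral_of_forall_compl_eq_zero fun x hx => hz x ?_
      exact fun hh => hx ⟨hh.1, hh.2.trans hbt.le⟩
  have hcl : tsupport H ⊆ Icc a b :=
    closure_minimal (fun t ht => by by_contra h; exact ht (hHz t h)) isClosed_Icc
  refine ⟨⟨H, ?_, ?_, ?_⟩, fun t => (hd t).deriv⟩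
  · exact contDiff_infty_iff_deriv.2 ⟨fun t => (hd t).differentiableAt, hderiv ▸ hψ⟩
  · exact isCompact_Icc.of_isClosed_subset (isClosed_tsupport _) hcl
  · refine hcl.trans fun t ht => ?_
    exact ⟨(hs ha).1.trans_le ht.1, ht.2.trans_lt (hs hb).2⟩

/-- The du Bois-Reymond lemma. -/
lemma exists_ae_eq_const {p : ℝ → X} (hT : 0 < T) (hp : Integrable p (timeMeasure T))
    (h : ∀ η : 𝓓(timeInterval T, ℝ), ∫ t, deriv η t • p t ∂(timeMeasure T) = 0) :
    ∃ c : X, ∀ᵐ t ∂(timeMeasure T), p t = c := by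
  -- The normalised bump `ρ` lives on `[T/4, 3T/4]`. The constant is the mean of `p` against `ρ`,
  -- because `g - (∫ g) ρ` has vanishing integral and is therefore the derivative of a test
  -- function.
  let f : ContDiffBump (T / 2) := ⟨T / 8, T / 4, by positivity, by linarith⟩
  set ρ := f.normed volume with hρ
  have hρs : tsupport ρ ⊆ Ioo 0 T := by
    rw [hρ, f.tsupport_normed_eq, Real.closedBall_eq_Icc]
    intro t ht
    have h1 : T / 2 - T / 4 ≤ t := ht.1
    have h2 : t ≤ T / 2 + T / 4 := ht.2
    constructor <;> linarith
  have hρd : ContDiff ℝ ∞ ρ := f.contDiff_normed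
  set c := ∫ t, ρ t • p t ∂(timeMeasure T) with hc
  refine ⟨c, ?_⟩
  have hpc : Integrable (fun t => p t - c) (timeMeasure T) := hp.sub (integrable_const c)
  have key := isOpen_Ioo.ae_eq_zero_of_integral_contDiff_smul_eq_zero (U := Ioo 0 T)
    (μ := (volume : Measure ℝ)) (f := fun t => p t - c)
    (IntegrableOn.locallyIntegrableOn hpc) (by
      intro g hg hgc hgs
      set m := ∫ t, g t with hm
      have hψ : ContDiff ℝ ∞ (fun t => g t - m * ρ t) := hg.sub (contDiff_const.mul hρd)
      have hψs : tsupport (fun t => g t - m * ρ t) ⊆ tsupport g ∪ tsupport ρ := by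
        refine closure_minimal (fun t ht => ?_) ((isClosed_tsupport _).union (isClosed_tsupport _))
        by_contra hcon
        rw [mem_union, not_or] at hcon
        refine ht ?_
        simp [image_eq_zero_of_notMem_tsupport hcon.1, image_eq_zero_of_notMem_tsupport hcon.2]
      have hρc : HasCompactSupport ρ := f.hasCompactSupport_normed
      obtain ⟨η, hη⟩ := exists_test_deriv_eq (T := T) hψ
        ((hgc.isCompact.union hρc.isCompact).of_isClosed_subset (isClosed_tsupport _) hψs)
        (hψs.trans (union_subset hgs hρs)) (by
          rw [integral_sub (hg.continuous.integrable_of_hasCompactSupport hgc)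
            ((hρd.continuous.integrable_of_hasCompactSupport hρc).const_mul _),
            integral_const_mul, f.integral_normed, mul_one, sub_self])
      have h1 := h η
      simp only [hη, sub_smul, mul_smul] at h1
      have hI : Integrable (fun t => m • ρ t • p t) (timeMeasure T) :=
        (integrable_smul_continuous hρd.continuous hp).smul m
      rw [integral_sub (integrable_smul_continuous hg.continuous hp) hI, integral_smul, ← hc] at h1
      have h2 : ∫ t, g t • (p t - c) = ∫ t, g t • (p t - c) ∂(timeMeasure T) := by
        rw [timeMeasure, setIntegral_eq_integral_of_forall_compl_eq_zero]
        intro x hx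
        rw [image_eq_zero_of_notMem_tsupport (fun h => hx (hgs h)), zero_smul]
      have h3 : ∫ t, g t ∂(timeMeasure T) = m := by
        rw [timeMeasure, setIntegral_eq_integral_of_forall_compl_eq_zero]
        intro x hx
        exact image_eq_zero_of_notMem_tsupport (fun h => hx (hgs h))
      rw [h2]
      simp only [smul_sub]
      rw [integral_sub (integrable_smul_continuous hg.continuous hp)
        ((integrable_continuous hg.continuous).smul_const _), integral_smul_const, h3]
      exact h1)
  rw [timeMeasure, ae_restrict_iff' measurableSet_Ioo]
  filter_upwards [key] with t ht hmem using sub_eq_zero.1 (ht hmem)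

/-- Weak derivatives are derivatives in the integrated sense. -/
lemma IsWeakTimeDeriv.exists_isPrimitive {Y Z : ℝ → X} (hT : 0 < T)
    (hY : Integrable Y (timeMeasure T)) (hZ : Integrable Z (timeMeasure T))
    (h : IsWeakTimeDeriv T Y Z) : ∃ Y₀, IsPrimitive T Y Z Y₀ := by
  have hP : IsPrimitive T (fun t => ∫ τ in 0..t, Z τ) Z 0 := .of_forall fun t => by simp
  obtain ⟨c, hc⟩ := exists_ae_eq_const hT (hY.sub (integrable_primitive hT.le hZ)) (by
    intro η
    have h1 := hP.integral_deriv_smul hT.le hZ (η := η) (η.contDiff.of_le (by simp))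
      (image_eq_zero_of_notMem_tsupport fun hh => (η.tsupport_subset hh).2.ne rfl)
    have hc : Continuous (deriv η) := η.contDiff.continuous_deriv (by simp)
    simp only [Pi.sub_apply, smul_sub]
    rw [integral_sub (integrable_smul_continuous hc hY)
      (integrable_smul_continuous hc (integrable_primitive hT.le hZ))]
    rw [smul_zero, add_zero, ← h η, neg_inj] at h1
    rw [h1, sub_self])
  refine ⟨c, ?_⟩
  filter_upwards [hc] with t ht
  rw [← ht]; simp

lemma IsPrimitive.isWeakTimeDeriv {Y Z : ℝ → X} {Y₀ : X} (hT : 0 < T)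
    (hZ : Integrable Z (timeMeasure T)) (h : IsPrimitive T Y Z Y₀) : IsWeakTimeDeriv T Y Z := by
  intro η
  rw [h.integral_deriv_smul hT.le hZ (η.contDiff.of_le (by simp))
      (image_eq_zero_of_notMem_tsupport fun hh => (η.tsupport_subset hh).2.ne rfl),
    image_eq_zero_of_notMem_tsupport fun hh => (η.tsupport_subset hh).1.ne rfl, zero_smul,
    add_zero]

/-- Testing against functions that do not vanish at `0` also detects the initial value. -/
lemma isPrimitive_of_forall_test {Y Z : ℝ → X} {Y₀ : X} (hT : 0 < T)
    (hY : Integrable Y (timeMeasure T)) (hZ : Integrable Z (timeMeasure T))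
    (h : ∀ η : ℝ → ℝ, ContDiff ℝ ∞ η → HasCompactSupport η → tsupport η ⊆ Iio T →
      -∫ t, deriv η t • Y t ∂(timeMeasure T) =
        (∫ t, η t • Z t ∂(timeMeasure T)) + η 0 • Y₀) :
    IsPrimitive T Y Z Y₀ := by
  have hw : IsWeakTimeDeriv T Y Z := fun η => by
    rw [h η η.contDiff η.hasCompactSupport (η.tsupport_subset.trans fun t ht => ht.2),
      image_eq_zero_of_notMem_tsupport fun hh => (η.tsupport_subset hh).1.ne rfl, zero_smul,
      add_zero]
  obtain ⟨c, hc⟩ := hw.exists_isPrimitive hT hY hZ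
  -- A cut-off equal to `1` at time `0` and supported to the left of `T`: comparing the two
  -- integrations by parts leaves only the boundary values.
  let f : ContDiffBump (0 : ℝ) := ⟨T / 4, T / 2, by positivity, by linarith⟩
  have hfs : tsupport f ⊆ Iio T := by
    rw [f.tsupport_eq, Real.closedBall_eq_Icc]
    intro t ht
    have h2 : t ≤ 0 + T / 2 := ht.2
    change t < T
    linarith
  have h1 := h f f.contDiff f.hasCompactSupport hfs
  rw [hc.integral_deriv_smul hT.le hZ f.contDiff
    (image_eq_zero_of_notMem_tsupport fun hh => lt_irrefl T (hfs hh)), add_right_inj,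
    f.one_of_mem_closedBall (by simp [f.rIn_pos.le]), one_smul, one_smul] at h1
  rwa [← h1]

lemma IsPrimitive.comp (L : X →L[ℝ] E) {Y Z : ℝ → X} {Y₀ : X}
    (hZ : Integrable Z (timeMeasure T)) (h : IsPrimitive T Y Z Y₀) :
    IsPrimitive T (fun t => L (Y t)) (fun t => L (Z t)) (L Y₀) := by
  filter_upwards [h, ae_timeMeasure_mem] with t ht hm
  rw [ht, map_add, L.intervalIntegral_comp_comm
    (intervalIntegrable_of_timeMeasure hZ (left_mem_Icc.2 (hm.1.trans hm.2).le)
      (Ioo_subset_Icc_self hm))]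

lemma IsPrimitive.add {Y Z Y' Z' : ℝ → X} {Y₀ Y₀' : X}
    (hZ : Integrable Z (timeMeasure T)) (hZ' : Integrable Z' (timeMeasure T))
    (h : IsPrimitive T Y Z Y₀) (h' : IsPrimitive T Y' Z' Y₀') :
    IsPrimitive T (fun t => Y t + Y' t) (fun t => Z t + Z' t) (Y₀ + Y₀') := by
  filter_upwards [h, h', ae_timeMeasure_mem] with t ht ht' hm
  have h0 := left_mem_Icc.2 (hm.1.trans hm.2).le
  have hm' := Ioo_subset_Icc_self hm
  rw [ht, ht', intervalIntegral.integral_add (intervalIntegrable_of_timeMeasure hZ h0 hm')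
    (intervalIntegrable_of_timeMeasure hZ' h0 hm')]
  abel

lemma IsPrimitive.sub {Y Z Y' Z' : ℝ → X} {Y₀ Y₀' : X}
    (hZ : Integrable Z (timeMeasure T)) (hZ' : Integrable Z' (timeMeasure T))
    (h : IsPrimitive T Y Z Y₀) (h' : IsPrimitive T Y' Z' Y₀') :
    IsPrimitive T (fun t => Y t - Y' t) (fun t => Z t - Z' t) (Y₀ - Y₀') := by
  filter_upwards [h, h', ae_timeMeasure_mem] with t ht ht' hm
  have h0 := left_mem_Icc.2 (hm.1.trans hm.2).le
  have hm' := Ioo_subset_Icc_self hm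
  rw [ht, ht', intervalIntegral.integral_sub (intervalIntegrable_of_timeMeasure hZ h0 hm')
    (intervalIntegrable_of_timeMeasure hZ' h0 hm')]
  abel

lemma IsPrimitive.congr {Y Z Y' Z' : ℝ → X} {Y₀ : X} (h : IsPrimitive T Y Z Y₀)
    (hY : Y =ᵐ[timeMeasure T] Y') (hZ : Z =ᵐ[timeMeasure T] Z') : IsPrimitive T Y' Z' Y₀ := by
  filter_upwards [h, hY, ae_timeMeasure_mem] with t ht ht' hm
  rw [← ht', ht, ← setIntegral_timeMeasure_Iio (Ioo_subset_Icc_self hm),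
    ← setIntegral_timeMeasure_Iio (Ioo_subset_Icc_self hm)]
  congr 1
  refine integral_congr_ae ?_
  filter_upwards [hZ] with τ hτ
  by_cases hh : τ ∈ Iio t <;> simp [hh, hτ]

end Time

/-! ### The Lions-Magenes lemma -/

section LionsMagenes

open Filter Topology

variable {T : ℝ} {V H : Type*} [NormedAddCommGroup V] [NormedSpace ℝ V]
  [NormedAddCommGroup H] [InnerProductSpace ℝ H]

/-- The embedding `g ↦ (g, ι ·)` of `H` into the dual of `V`. -/
def dualEmb (ι : V →L[ℝ] H) : H →L[ℝ] StrongDual ℝ V :=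
  ((ContinuousLinearMap.compL ℝ V H ℝ).flip ι).comp (innerSL ℝ)

@[simp] lemma dualEmb_apply (ι : V →L[ℝ] H) (g : H) (v : V) : dualEmb ι g v = inner ℝ g (ι v) := rfl

/-- Translation by `h` on `L²(ℝ;V)`. -/
def translate (h : ℝ) (f : Lp V 2 (volume : Measure ℝ)) : Lp V 2 (volume : Measure ℝ) :=
  Lp.compMeasurePreserving (fun t => t + h) (measurePreserving_add_right volume h) f

lemma coeFn_translate (h : ℝ) (f : Lp V 2 (volume : Measure ℝ)) :
    translate h f =ᵐ[volume] fun t => f (t + h) :=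
  Lp.coeFn_compMeasurePreserving f _

lemma continuous_translate (f : Lp V 2 (volume : Measure ℝ)) :
    Continuous fun h => translate h f := by
  let g : C(ℝ, C(ℝ, ℝ)) := (ContinuousMap.mk (fun a : ℝ × ℝ => a.2 + a.1)).curry
  exact (continuous_const (y := f)).compMeasurePreservingLp g.continuous
    (fun h => measurePreserving_add_right volume h) (by simp)

lemma ae_translate {p : ℝ → Prop} (h : ℝ) (hp : ∀ᵐ t : ℝ, p t) : ∀ᵐ t : ℝ, p (t + h) :=
  (measurePreserving_add_right volume h).quasiMeasurePreserving.ae hp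

/-- The shear `(t, s) ↦ (t, t + s)` preserves Lebesgue measure and reduces the claim to a tensor
product. This justifies exchanging the average over increments with the integral in time. -/
lemma integrable_translate_apply {W : ℝ → StrongDual ℝ V} {y : ℝ → V} (hW : Integrable W)
    (hy : Integrable y) : Integrable (fun z : ℝ × ℝ => W (z.1 + z.2) (y z.1))
      (volume.prod volume) := by
  have h : Integrable (fun z : ℝ × ℝ => W z.2 (y z.1)) (volume.prod volume) := by
    refine Integrable.mono' (hy.norm.mul_prod hW.norm) ?_ (.of_forall fun z => ?_)
    · exact (ContinuousLinearMap.id ℝ (StrongDual ℝ V)).aestronglyMeasurable_comp₂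
        hW.1.comp_snd hy.1.comp_fst
    · rw [mul_comm]; exact (W z.2).le_opNorm _
  exact (measurePreserving_prod_add volume volume).integrable_comp_of_integrable h

end LionsMagenes

section LionsMagenes

open Filter Topology

variable {T : ℝ} {V H : Type*} [NormedAddCommGroup V] [NormedSpace ℝ V]
  [NormedAddCommGroup H] [InnerProductSpace ℝ H]

/-- Joint continuity is used because the integrand depends on the step `h` as well as on the
variable of integration. -/
lemma tendsto_average_of_continuous {G : ℝ → ℝ → ℝ} (hG : Continuous (Function.uncurry G)) :
    Tendsto (fun h => h⁻¹ * ∫ s in 0..h, G s h) (𝓝[>] 0) (𝓝 (G 0 0)) := by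
  rw [Metric.tendsto_nhdsWithin_nhds]
  intro ε hε
  obtain ⟨δ, hδ, hd⟩ := Metric.continuous_iff.1 hG (0, 0) (ε / 2) (half_pos hε)
  refine ⟨δ, hδ, fun {h} hh hdist => ?_⟩
  have h0 : 0 < h := hh
  rw [Real.dist_eq, sub_zero, abs_of_pos h0] at hdist
  have hc : Continuous fun s => G s h := hG.comp (by fun_prop : Continuous fun s : ℝ => (s, h))
  have h1 : h⁻¹ * (∫ s in 0..h, G s h) - G 0 0 = h⁻¹ * ∫ s in 0..h, (G s h - G 0 0) := by
    rw [intervalIntegral.integral_sub (hc.intervalIntegrable _ _) (by simp)]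
    simp
    field_simp
  rw [Real.dist_eq, h1, abs_mul, abs_of_pos (inv_pos.2 h0)]
  have h2 : ‖∫ s in 0..h, (G s h - G 0 0)‖ ≤ ε / 2 * |h - 0| := by
    refine intervalIntegral.norm_integral_le_of_norm_le_const fun s hs => ?_
    rw [uIoc_of_le h0.le] at hs
    have := hd (s, h) (by
      rw [Prod.dist_eq, max_lt_iff, Real.dist_eq, Real.dist_eq, sub_zero, sub_zero,
        abs_of_pos hs.1, abs_of_pos h0]
      exact ⟨hs.2.trans_lt hdist, hdist⟩)
    rw [Real.dist_eq] at this
    exact this.le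
  rw [sub_zero, abs_of_pos h0, Real.norm_eq_abs] at h2
  calc h⁻¹ * |∫ s in 0..h, (G s h - G 0 0)| ≤ h⁻¹ * (ε / 2 * h) := by gcongr
    _ = ε / 2 := by field_simp
    _ < ε := half_lt_self hε

/-- Averages of time increments, tested against an `L²` function. -/
lemma integral_average_eq {W : ℝ → StrongDual ℝ V} {y : ℝ → V} (hW : Integrable W)
    (hy : Integrable y) (h : ℝ) (hh : 0 ≤ h) :
    ∫ t, (∫ r in t..t + h, W r) (y t) = ∫ s in 0..h, ∫ t, W (t + s) (y t) := by
  have hI := integrable_translate_apply hW hy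
  have h1 : ∀ t, (∫ r in t..t + h, W r) (y t) = ∫ s in Ioc 0 h, W (t + s) (y t) := by
    intro t
    have : ∫ r in t..t + h, W r = ∫ s in 0..h, W (t + s) := by
      rw [intervalIntegral.integral_comp_add_left W t, add_zero]
    rw [this, ← intervalIntegral.integral_of_le hh]
    have hWs : IntervalIntegrable (fun s => W (t + s)) volume 0 h :=
      (hW.comp_add_left t).intervalIntegrable
    exact ContinuousLinearMap.intervalIntegral_apply hWs (y t) |>.symm ▸ rfl
  simp only [h1, intervalIntegral.integral_of_le hh]
  refine integral_integral_swap ?_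
  have : volume.prod (volume.restrict (Ioc 0 h)) =
      (volume.prod volume : Measure (ℝ × ℝ)).restrict (univ ×ˢ Ioc 0 h) := by
    rw [← Measure.prod_restrict, Measure.restrict_univ]
  rw [this]
  exact hI.restrict

/-- Discrete integration by parts: the shift is moved from the merely integrable `e` to `η`, whose
difference quotients are dominated by its Lipschitz constant. -/
lemma tendsto_integral_slope {e : ℝ → ℝ} (he : Integrable e) {η : ℝ → ℝ} (hη : ContDiff ℝ 1 η)
    (hc : HasCompactSupport η) :
    Tendsto (fun h => h⁻¹ * ∫ t, η t * (e (t + h) - e t)) (𝓝[>] 0) (𝓝 (-∫ t, deriv η t * e t)) := by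
  obtain ⟨K, hK⟩ := hη.lipschitzWith_of_hasCompactSupport hc one_ne_zero
  obtain ⟨C, hC⟩ := hc.exists_bound_of_continuous hη.continuous
  have hηe : Integrable fun t => η t * e t :=
    he.bdd_mul (c := C) hη.continuous.aestronglyMeasurable (.of_forall hC)
  have hshift : ∀ h, h⁻¹ * ∫ t, η t * (e (t + h) - e t) =
      ∫ t, (h⁻¹ * (η (t - h) - η t)) * e t := by
    intro h
    have h1 : Integrable fun t => η t * e (t + h) :=
      (he.comp_add_right h).bdd_mul (c := C) hη.continuous.aestronglyMeasurable (.of_forall hC)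
    have h2 : Integrable fun t => η (t - h) * e t :=
      he.bdd_mul (c := C) (hη.continuous.comp (continuous_id.sub continuous_const)).aestronglyMeasurable
        (.of_forall fun t => hC _)
    have h3 : ∫ t, η t * e (t + h) = ∫ t, η (t - h) * e t := by
      rw [← integral_add_right_eq_self (fun t => η (t - h) * e t) h]
      simp
    simp only [mul_sub, sub_mul, mul_assoc]
    rw [integral_sub h1 hηe, h3, integral_sub (h2.const_mul _) (hηe.const_mul _),
      integral_const_mul, integral_const_mul]
    ring
  simp only [hshift]
  rw [← integral_neg]
  refine tendsto_integral_filter_of_dominated_convergence (fun t => K * |e t|) ?_ ?_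
    (he.norm.const_mul _) ?_
  · refine .of_forall fun h => ?_
    exact (Continuous.aestronglyMeasurable (by
      have := hη.continuous; fun_prop)).mul he.1
  · filter_upwards [self_mem_nhdsWithin] with h hh
    refine .of_forall fun t => ?_
    rw [norm_mul, Real.norm_eq_abs (e t)]
    refine mul_le_mul_of_nonneg_right ?_ (abs_nonneg _)
    have h0 : 0 < h := hh
    rw [norm_mul, norm_inv, Real.norm_of_nonneg h0.le, inv_mul_le_iff₀ h0]
    have := hK.norm_sub_le (t - h) t
    rwa [sub_sub_cancel_left, norm_neg, Real.norm_of_nonneg h0.le, mul_comm] at this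
  · refine .of_forall fun t => ?_
    rw [← neg_mul]
    refine Tendsto.mul_const _ ?_
    have hd : HasDerivAt η (deriv η t) t := ((hη.differentiable one_ne_zero) t).hasDerivAt
    have h1 : HasDerivAt (fun h => η (t - h)) (-deriv η t) 0 :=
      HasDerivAt.comp_const_sub t 0 (by simpa using hd)
    have h3 := h1.tendsto_slope_zero_right
    simpa using h3

variable [CompleteSpace V]

lemma memLp_indicator_timeMeasure {p : ℝ≥0∞} {u : ℝ → V} (hu : MemLp u p (timeMeasure T)) :
    MemLp ((Ioo 0 T).indicator u) p volume := by
  unfold timeMeasure at hu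
  exact (memLp_indicator_iff_restrict measurableSet_Ioo).2 hu

lemma integrable_indicator_timeMeasure {u : ℝ → V} (hu : Integrable u (timeMeasure T)) :
    Integrable ((Ioo 0 T).indicator u) := by
  unfold timeMeasure at hu
  exact (integrable_indicator_iff measurableSet_Ioo).2 hu

/-- The duality pairing of translates depends continuously on the translations. -/
lemma exists_continuous_pairing {U : ℝ → V} {W : ℝ → StrongDual ℝ V} {η : ℝ → ℝ}
    (hU : MemLp U 2 volume) (hW : MemLp W 2 volume) (hη : MemLp η ∞ (volume : Measure ℝ)) :
    ∃ G : ℝ → ℝ → ℝ, Continuous (Function.uncurry G) ∧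
      ∀ s k, G s k = ∫ t, W (t + s) (η t • (U t + U (t + k))) := by
  obtain ⟨M, hM⟩ : ∃ M : Lp V 2 (volume : Measure ℝ) →L[ℝ] Lp V 2 (volume : Measure ℝ),
      ∀ f, M f =ᵐ[volume] fun t => η t • f t := by
    refine ⟨(ContinuousLinearMap.lsmul ℝ ℝ : ℝ →L[ℝ] V →L[ℝ] V).holderL volume ∞ 2 2
      (hη.toLp η), fun f => ?_⟩
    filter_upwards [ContinuousLinearMap.coeFn_holder (r := 2)
      (ContinuousLinearMap.lsmul ℝ ℝ : ℝ →L[ℝ] V →L[ℝ] V) (hη.toLp η) f,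
      hη.coeFn_toLp] with t h1 h2
    refine h1.trans ?_
    rw [h2]; rfl
  obtain ⟨P, hP⟩ : ∃ P : Lp (StrongDual ℝ V) 2 (volume : Measure ℝ) →L[ℝ]
      Lp V 2 (volume : Measure ℝ) →L[ℝ] ℝ, ∀ w f, P w f = ∫ t, w t (f t) :=
    ⟨(ContinuousLinearMap.id ℝ (StrongDual ℝ V)).lpPairing (volume : Measure ℝ) 2 2,
      fun w f => ContinuousLinearMap.lpPairing_eq_integral _ _ _⟩
  obtain ⟨f, hf⟩ : ∃ f : Lp V 2 (volume : Measure ℝ), f =ᵐ[volume] U := ⟨_, hU.coeFn_toLp⟩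
  obtain ⟨w, hw⟩ : ∃ w : Lp (StrongDual ℝ V) 2 (volume : Measure ℝ), w =ᵐ[volume] W :=
    ⟨_, hW.coeFn_toLp⟩
  refine ⟨fun s k => P (translate s w) (M (f + translate k f)), ?_, fun s k => ?_⟩
  · have h1 : Continuous fun z : ℝ × ℝ => translate z.1 w :=
      (continuous_translate w).comp continuous_fst
    have h2 : Continuous fun z : ℝ × ℝ => M (f + translate z.2 f) :=
      M.continuous.comp (continuous_const.add ((continuous_translate f).comp continuous_snd))
    exact (P.continuous.comp h1).clm_apply h2
  · simp only [hP]
    refine integral_congr_ae ?_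
    filter_upwards [coeFn_translate s w, ae_translate s hw, hM (f + translate k f),
      Lp.coeFn_add f (translate k f), hf, coeFn_translate k f,
      ae_translate k hf] with t h1 h2 h3 h4 h5 h6 h7
    rw [h1, h2, h3, h4, Pi.add_apply, h5, h6, h7]

/-- If the time derivative of `u ∈ L²(0,T;V)` is `v ∈ L²(0,T;V*)`, then `‖u‖²` has the weak time
derivative `2⟨v,u⟩`. -/
lemma isWeakTimeDeriv_norm_sq (ι : V →L[ℝ] H) {u : ℝ → V} {v : ℝ → StrongDual ℝ V}
    {g₀ : StrongDual ℝ V} (hu : MemLp u 2 (timeMeasure T)) (hv : MemLp v 2 (timeMeasure T))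
    (h : IsPrimitive T (fun t => dualEmb ι (ι (u t))) v g₀) :
    IsWeakTimeDeriv T (fun t => ‖ι (u t)‖ ^ 2) (fun t => 2 * v t (u t)) := by
  intro η
  obtain ⟨U, hU⟩ : ∃ U, U = (Ioo 0 T).indicator u := ⟨_, rfl⟩
  obtain ⟨W, hW⟩ : ∃ W, W = (Ioo 0 T).indicator v := ⟨_, rfl⟩
  have hU2 : MemLp U 2 volume := by
    rw [hU]; exact memLp_indicator_timeMeasure hu
  have hW2 : MemLp W 2 volume := by
    rw [hW]; exact memLp_indicator_timeMeasure hv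
  have hU1 : Integrable U := by
    rw [hU]; exact integrable_indicator_timeMeasure (hu.integrable (by norm_num))
  have hW1 : Integrable W := by
    rw [hW]; exact integrable_indicator_timeMeasure (hv.integrable (by norm_num))
  have hηd : ContDiff ℝ 1 η := η.contDiff.of_le (by simp)
  have hηc : HasCompactSupport η := η.hasCompactSupport
  obtain ⟨C, hC⟩ := hηc.exists_bound_of_continuous hηd.continuous
  have hηm : MemLp η ∞ (volume : Measure ℝ) :=
    memLp_top_of_bound hηd.continuous.aestronglyMeasurable C (.of_forall hC)
  obtain ⟨e, he⟩ : ∃ e : ℝ → ℝ, e = fun t => ‖ι (U t)‖ ^ 2 := ⟨_, rfl⟩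
  have he1 : Integrable e := by
    have : MemLp (fun t => ι (U t)) 2 volume := ι.comp_memLp' hU2
    rw [he]; exact this.integrable_norm_pow (by norm_num)
  -- the limit of the difference quotients of `e`
  have lim1 := tendsto_integral_slope he1 hηd hηc
  obtain ⟨G, hG, hGeq⟩ := exists_continuous_pairing hU2 hW2 hηm
  have lim2 := tendsto_average_of_continuous hG
  -- both families agree for small increments
  obtain ⟨δ, hδ, hδs⟩ : ∃ δ > 0, ∀ t ∈ tsupport η, t + δ < T := by
    by_cases hne : (tsupport η).Nonempty
    · obtain ⟨b, hb, hb'⟩ := hηc.isCompact.exists_isGreatest hne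
      have hbT : b < T := (η.tsupport_subset hb).2
      refine ⟨(T - b) / 2, by linarith, fun t ht => ?_⟩
      have := hb' ht
      linarith
    · exact ⟨1, one_pos, fun t ht => absurd ⟨t, ht⟩ hne⟩
  have h' : ∀ᵐ t : ℝ, t ∈ Ioo 0 T → dualEmb ι (ι (u t)) = g₀ + ∫ τ in 0..t, v τ :=
    (ae_restrict_iff' measurableSet_Ioo).1 h
  have hiW : ∀ t ∈ Icc 0 T, ∫ τ in 0..t, v τ = ∫ τ in 0..t, W τ := by
    intro t ht
    refine intervalIntegral.integral_congr_ae ?_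
    filter_upwards [compl_mem_ae_iff.2 (measure_singleton T)] with τ hτT hτ
    rw [uIoc_of_le ht.1] at hτ
    rw [hW, indicator_of_mem (show τ ∈ Ioo 0 T from
      ⟨hτ.1, lt_of_le_of_ne (hτ.2.trans ht.2) hτT⟩)]
  have heq : (fun k => k⁻¹ * ∫ t, η t * (e (t + k) - e t)) =ᶠ[𝓝[>] 0]
      fun k => k⁻¹ * ∫ s in 0..k, G s k := by
    filter_upwards [Ioo_mem_nhdsGT hδ] with k hk
    have hy : Integrable fun t => η t • (U t + U (t + k)) :=
      (hU1.add (hU1.comp_add_right k)).bdd_smul C hηd.continuous.aestronglyMeasurable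
        (.of_forall hC)
    simp only [hGeq]
    rw [← integral_average_eq hW1 hy k hk.1.le]
    congr 1
    refine integral_congr_ae ?_
    filter_upwards [h', ae_translate k h'] with t h1 h2
    by_cases hts : t ∈ tsupport η
    swap
    · simp [image_eq_zero_of_notMem_tsupport hts]
    have ht : t ∈ Ioo 0 T := η.tsupport_subset hts
    have htk : t + k ∈ Ioo 0 T := by
      have := hδs t hts
      exact ⟨by linarith [ht.1, hk.1], by linarith [hk.2]⟩
    have h3 : ∫ r in t..t + k, W r = dualEmb ι (ι (u (t + k))) - dualEmb ι (ι (u t)) := by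
      rw [h1 ht, h2 htk, hiW t (Ioo_subset_Icc_self ht), hiW _ (Ioo_subset_Icc_self htk),
        add_sub_add_left_eq_sub, intervalIntegral.integral_interval_sub_left
        hW1.intervalIntegrable hW1.intervalIntegrable]
    have hUt : U t = u t := by rw [hU]; exact indicator_of_mem ht u
    have hUk : U (t + k) = u (t + k) := by rw [hU]; exact indicator_of_mem htk u
    -- With `x = ι u(t+k)` and `y = ι u(t)`, symmetry of the inner product gives `(x - y, x + y) =
    -- ‖x‖² - ‖y‖²`. This is why the increment of the derivative is paired with the sum of the two
    -- values of `u`.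
    rw [h3]
    simp only [he, hUt, hUk, map_smul, map_add, _root_.sub_apply, dualEmb_apply,
      smul_eq_mul, ← real_inner_self_eq_norm_sq]
    rw [real_inner_comm (ι (u t)) (ι (u (t + k)))]
    ring
  have hfin := tendsto_nhds_unique (lim1.congr' heq) lim2
  have hl : ∫ t, deriv η t * e t = ∫ t, deriv η t • ‖ι (u t)‖ ^ 2 ∂(timeMeasure T) := by
    rw [timeMeasure, ← integral_indicator measurableSet_Ioo]
    refine integral_congr_ae (.of_forall fun t => ?_)
    by_cases ht : t ∈ Ioo 0 T <;> simp [he, hU, ht]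
  have hr : G 0 0 = ∫ t, η t • (2 * v t (u t)) ∂(timeMeasure T) := by
    rw [hGeq, timeMeasure, ← integral_indicator measurableSet_Ioo]
    refine integral_congr_ae (.of_forall fun t => ?_)
    by_cases ht : t ∈ Ioo 0 T
    · simp only [add_zero, hU, hW, indicator_of_mem ht, map_smul, map_add, smul_eq_mul]
      ring
    · simp [hU, hW, ht]
  rw [← hl, ← hr, hfin]

/-- A property that holds almost everywhere on `(0,T)` holds on a dense set. -/
lemma subset_closure_of_ae (hT : 0 < T) {p : ℝ → Prop} (hp : ∀ᵐ t ∂(timeMeasure T), p t) :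
    Icc 0 T ⊆ closure {t | t ∈ Ioo 0 T ∧ p t} := by
  have h1 : ∀ᵐ t : ℝ, t ∈ Ioo 0 T → p t := (ae_restrict_iff' measurableSet_Ioo).1 hp
  have h2 := (Measure.dense_of_ae h1).open_subset_closure_inter (isOpen_Ioo (a := 0) (b := T))
  rw [← closure_Ioo hT.ne]
  refine closure_minimal (h2.trans (closure_mono fun t ht => ?_)) isClosed_closure
  exact ⟨ht.1, ht.2 ht.1⟩

/-- A function that is uniformly continuous on a dense subset of `[0,T]` extends continuously. -/
lemma exists_continuousOn_extension {X : Type*} [MetricSpace X] [CompleteSpace X] {S : Set ℝ}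
    (hS : Icc 0 T ⊆ closure S) {f : ℝ → X}
    (hf : ∀ ε > 0, ∃ δ > 0, ∀ s ∈ S, ∀ t ∈ S, s < t → t - s < δ → dist (f s) (f t) ≤ ε) :
    ∃ h : ℝ → X, ContinuousOn h (Icc 0 T) ∧ ∀ t ∈ S, h t = f t := by
  have hf' : ∀ ε > 0, ∃ δ > 0, ∀ s ∈ S, ∀ t ∈ S, dist s t < δ → dist (f s) (f t) ≤ ε := by
    intro ε hε
    obtain ⟨δ, hδ, h⟩ := hf ε hε
    refine ⟨δ, hδ, fun s hs t ht hst => ?_⟩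
    rcases lt_trichotomy s t with h1 | h1 | h1
    · exact h s hs t ht h1 (by rw [dist_comm, Real.dist_eq] at hst; exact (le_abs_self _).trans_lt hst)
    · subst h1; simp [hε.le]
    · rw [dist_comm]
      exact h t ht s hs h1 (by rw [Real.dist_eq] at hst; exact (le_abs_self _).trans_lt hst)
  refine ⟨extendFrom S f, continuousOn_extendFrom hS fun x hx => ?_, fun t ht => ?_⟩
  · have hne : (𝓝[S] x).NeBot := mem_closure_iff_nhdsWithin_neBot.1 (hS hx)
    refine CompleteSpace.complete (f := map f (𝓝[S] x)) ?_
    rw [Metric.cauchy_iff]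
    refine ⟨inferInstance, fun ε hε => ?_⟩
    obtain ⟨δ, hδ, h⟩ := hf' (ε / 2) (half_pos hε)
    refine ⟨f '' (S ∩ Metric.ball x (δ / 2)), image_mem_map (inter_mem self_mem_nhdsWithin
      (mem_nhdsWithin_of_mem_nhds (Metric.ball_mem_nhds _ (half_pos hδ)))), ?_⟩
    rintro _ ⟨s, hs, rfl⟩ _ ⟨t, ht, rfl⟩
    have h1 : dist s t < δ := by
      have h2 := dist_triangle_right s t x
      have h3 := Metric.mem_ball.1 hs.2
      have h4 := Metric.mem_ball.1 ht.2
      linarith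
    exact (h s hs.1 t ht.1 h1).trans_lt (half_lt_self hε)
  · refine extendFrom_eq (subset_closure ht) ?_
    rw [Metric.tendsto_nhdsWithin_nhds]
    intro ε hε
    obtain ⟨δ, hδ, h⟩ := hf' (ε / 2) (half_pos hε)
    exact ⟨δ, hδ, fun {s} hs hst => (h s hs t ht hst).trans_lt (half_lt_self hε)⟩

/-- A function cannot exceed its mean almost everywhere. It is used to find a time at which `‖u‖²`
is controlled by its average over a short interval. -/
lemma exists_mem_mul_le_integral {p : ℝ → Prop} (hp : ∀ᵐ t ∂(timeMeasure T), p t) {n : ℝ → ℝ}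
    (hn : Integrable n (timeMeasure T)) {a b : ℝ} (ha : 0 ≤ a) (hab : a < b) (hb : b ≤ T) :
    ∃ r, r ∈ Ioo a b ∧ p r ∧ n r * (b - a) ≤ ∫ t in a..b, n t := by
  by_contra! hcon
  have hm : Ioo a b ⊆ Ioo 0 T := Ioo_subset_Ioo ha hb
  have hp' : ∀ᵐ t ∂(volume.restrict (Ioo a b)), p t := ae_restrict_of_ae_restrict_of_subset hm hp
  have hn' : IntegrableOn n (Ioo a b) := IntegrableOn.mono_set hn hm
  set c := (∫ t in a..b, n t) / (b - a) with hc
  have hlt : ∀ᵐ t ∂(volume.restrict (Ioo a b)), c < n t := by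
    filter_upwards [hp', ae_restrict_mem measurableSet_Ioo] with t h1 h2
    rw [hc, div_lt_iff₀ (sub_pos.2 hab)]
    exact hcon t h2 h1
  have h1 : 0 < ∫ t in Ioo a b, (n t - c) := by
    rw [integral_pos_iff_support_of_nonneg_ae]
    · have : (Function.support fun t => n t - c) =ᵐ[volume.restrict (Ioo a b)] univ := by
        filter_upwards [hlt] with t ht
        simp only [eq_iff_iff]
        exact ⟨fun _ => trivial, fun _ => (sub_pos.2 ht).ne'⟩
      rw [measure_congr this]
      simp [hab]
    · filter_upwards [hlt] with t ht using (sub_pos.2 ht).le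
    · exact hn'.sub (integrable_const c)
  rw [integral_sub hn' (integrable_const c), setIntegral_const, ← integral_Ioc_eq_integral_Ioo,
    ← intervalIntegral.integral_of_le hab.le] at h1
  simp only [measureReal_def, Real.volume_Ioo, ENNReal.toReal_ofReal (sub_pos.2 hab).le,
    smul_eq_mul, hc] at h1
  rw [mul_div_cancel₀ _ (sub_pos.2 hab).ne', sub_self] at h1
  exact lt_irrefl _ h1

/-- The **Lions-Magenes lemma**. -/
theorem lionsMagenes [CompleteSpace H] (hT : 0 < T) (ι : V →L[ℝ] H) {u : ℝ → V}
    {v : ℝ → StrongDual ℝ V} {g₀ : StrongDual ℝ V} (hu : MemLp u 2 (timeMeasure T))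
    (hv : MemLp v 2 (timeMeasure T)) (h : IsPrimitive T (fun t => dualEmb ι (ι (u t))) v g₀) :
    ∃ U : ℝ → H, ContinuousOn U (Icc 0 T) ∧ (∀ᵐ t ∂(timeMeasure T), ι (u t) = U t) ∧
      (∀ t ∈ Icc 0 T, dualEmb ι (U t) = g₀ + ∫ τ in 0..t, v τ) ∧
      (∀ t ∈ Icc 0 T, ‖U t‖ ^ 2 = ‖U 0‖ ^ 2 + ∫ τ in 0..t, 2 * v τ (u τ)) ∧
      U 0 ∈ closure (range ι) := by
  have hu1 : Integrable (fun t => ‖u t‖ ^ 2) (timeMeasure T) := hu.integrable_norm_pow (by norm_num)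
  have hv1 : Integrable (fun t => ‖v t‖ ^ 2) (timeMeasure T) := hv.integrable_norm_pow (by norm_num)
  have hvi : Integrable v (timeMeasure T) := hv.integrable (by norm_num)
  have hvu : Integrable (fun t => v t (u t)) (timeMeasure T) :=
    memLp_one_iff_integrable.1
      ((ContinuousLinearMap.id ℝ (StrongDual ℝ V)).memLp_of_bilin 1 hv hu)
  have hvu2 := hvu.const_mul 2
  have he : Integrable (fun t => ‖ι (u t)‖ ^ 2) (timeMeasure T) :=
    (ι.comp_memLp' hu).integrable_norm_pow (by norm_num)
  obtain ⟨e₀, he₀⟩ := (isWeakTimeDeriv_norm_sq ι hu hv h).exists_isPrimitive hT he hvu2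
  have hae := h.and he₀
  obtain ⟨S, hS⟩ : ∃ S, S = {t | t ∈ Ioo 0 T ∧ (dualEmb ι (ι (u t)) = g₀ + ∫ τ in 0..t, v τ) ∧
    ‖ι (u t)‖ ^ 2 = e₀ + ∫ τ in 0..t, 2 * v τ (u τ)} := ⟨_, rfl⟩
  have hSd : Icc 0 T ⊆ closure S := hS ▸ subset_closure_of_ae hT hae
  have hSI : S ⊆ Icc 0 T := fun t ht => by rw [hS] at ht; exact Ioo_subset_Icc_self ht.1
  -- the increment formula
  have hinc : ∀ s ∈ S, ∀ t ∈ S, ‖ι (u t) - ι (u s)‖ ^ 2 =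
      ∫ τ in s..t, (2 * v τ (u τ) - 2 * v τ (u s)) := by
    intro s hs t ht
    have hs' := hSI hs
    have ht' := hSI ht
    rw [hS] at hs ht
    have i0 := left_mem_Icc.2 hT.le
    have hvs : Integrable (fun τ => 2 * v τ (u s)) (timeMeasure T) :=
      (((ContinuousLinearMap.apply ℝ ℝ (u s)).integrable_comp hvi)).const_mul 2
    have h1 : ∫ τ in s..t, v τ = dualEmb ι (ι (u t)) - dualEmb ι (ι (u s)) := by
      rw [hs.2.1, ht.2.1, add_sub_add_left_eq_sub, intervalIntegral.integral_interval_sub_left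
        (intervalIntegrable_of_timeMeasure hvi i0 ht') (intervalIntegrable_of_timeMeasure hvi i0 hs')]
    have h2 : ∫ τ in s..t, 2 * v τ (u τ) = ‖ι (u t)‖ ^ 2 - ‖ι (u s)‖ ^ 2 := by
      rw [hs.2.2, ht.2.2, add_sub_add_left_eq_sub, intervalIntegral.integral_interval_sub_left
        (intervalIntegrable_of_timeMeasure hvu2 i0 ht')
        (intervalIntegrable_of_timeMeasure hvu2 i0 hs')]
    have h3 : ∫ τ in s..t, 2 * v τ (u s) = 2 * (∫ τ in s..t, v τ) (u s) := by
      rw [intervalIntegral.integral_const_mul, ContinuousLinearMap.intervalIntegral_apply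
        (intervalIntegrable_of_timeMeasure hvi hs' ht')]
    rw [intervalIntegral.integral_sub (intervalIntegrable_of_timeMeasure hvu2 hs' ht')
      (intervalIntegrable_of_timeMeasure hvs hs' ht'), h2, h3, h1, norm_sub_sq_real]
    simp only [_root_.sub_apply, dualEmb_apply, real_inner_self_eq_norm_sq]
    ring
  -- uniform continuity
  have hN : Integrable (fun t => ‖u t‖ ^ 2 + ‖v t‖ ^ 2) (timeMeasure T) := hu1.add hv1
  have huc := isCompact_Icc.uniformContinuousOn_of_continuous (continuousOn_primitive hT.le hN)
  rw [Metric.uniformContinuousOn_iff] at huc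
  obtain ⟨U, hU, hUS⟩ := exists_continuousOn_extension (f := fun t => ι (u t)) hSd (by
    intro ε hε
    -- The increment between `s` and `t` is split at a reference time `r` of an interval `(a, b)`
    -- shorter than `δ`. By `2xy ≤ x² + y²`, each half has square at most `∫ (‖u‖² + ‖v‖²) + ‖u r‖²
    -- (b - a) + ∫ ‖v‖²`, which is at most `2 · ε²/8 = (ε/2)²`.
    obtain ⟨δ, hδ, hd⟩ := huc (ε ^ 2 / 8) (by positivity)
    refine ⟨δ / 4, by positivity, fun s hs t ht hst hdist => ?_⟩
    have hs0 : s ∈ Ioo 0 T := by rw [hS] at hs; exact hs.1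
    have ht0 : t ∈ Ioo 0 T := by rw [hS] at ht; exact ht.1
    obtain ⟨a, ha0, has, ha⟩ : ∃ a, 0 ≤ a ∧ a < s ∧ s - δ / 4 ≤ a :=
      ⟨max 0 (s - δ / 4), le_max_left _ _, max_lt hs0.1 (by linarith), le_max_right _ _⟩
    obtain ⟨b, hbT, htb, hb⟩ : ∃ b, b ≤ T ∧ t < b ∧ b ≤ t + δ / 4 :=
      ⟨min T (t + δ / 4), min_le_left _ _, lt_min ht0.2 (by linarith), min_le_right _ _⟩
    have hab : a < b := by linarith
    have haI : a ∈ Icc 0 T := ⟨ha0, by linarith⟩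
    have hbI : b ∈ Icc 0 T := ⟨by linarith, hbT⟩
    have i0 := left_mem_Icc.2 hT.le
    have hNi := fun {x y : ℝ} (hx : x ∈ Icc 0 T) (hy : y ∈ Icc 0 T) =>
      intervalIntegrable_of_timeMeasure hN hx hy
    have hsmall : ∫ τ in a..b, (‖u τ‖ ^ 2 + ‖v τ‖ ^ 2) ≤ ε ^ 2 / 8 := by
      have := hd b hbI a haI (by rw [Real.dist_eq, abs_of_pos (by linarith)]; linarith)
      rw [Real.dist_eq, intervalIntegral.integral_interval_sub_left (hNi i0 hbI) (hNi i0 haI)] at this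
      exact (le_abs_self _).trans this.le
    -- The increment formula contains `‖u‖` at one fixed time, which is not controlled for an
    -- arbitrary time; at `r` it is below its mean.
    obtain ⟨r, hr, hrS, hrn⟩ := exists_mem_mul_le_integral (hae.and ae_timeMeasure_mem) hu1
      ha0 hab hbT
    have hrS' : r ∈ S := by rw [hS]; exact ⟨hrS.2, hrS.1⟩
    have hu_le : ∫ τ in a..b, ‖u τ‖ ^ 2 ≤ ∫ τ in a..b, (‖u τ‖ ^ 2 + ‖v τ‖ ^ 2) :=
      intervalIntegral.integral_mono_on hab.le (intervalIntegrable_of_timeMeasure hu1 haI hbI)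
        (hNi haI hbI) fun τ _ => le_add_of_nonneg_right (sq_nonneg _)
    have key : ∀ t ∈ S, t ∈ Ioo a b → ‖ι (u t) - ι (u r)‖ ≤ ε / 2 := by
      intro t ht htab
      have hvr : Integrable (fun τ => ‖u r‖ ^ 2 + ‖v τ‖ ^ 2) (timeMeasure T) :=
        (integrable_const _).add hv1
      have hcr : Integrable (fun τ => ‖u τ‖ ^ 2 + ‖v τ‖ ^ 2 + (‖u r‖ ^ 2 + ‖v τ‖ ^ 2))
          (timeMeasure T) := hN.add hvr
      have h1 : ‖∫ τ in r..t, (2 * v τ (u τ) - 2 * v τ (u r))‖ ≤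
          |∫ τ in r..t, (‖u τ‖ ^ 2 + ‖v τ‖ ^ 2 + (‖u r‖ ^ 2 + ‖v τ‖ ^ 2))| := by
        refine intervalIntegral.norm_integral_le_abs_of_norm_le (.of_forall fun τ => ?_)
          (intervalIntegrable_of_timeMeasure hcr (hSI hrS') (hSI ht))
        have e1 := (v τ).le_opNorm (u τ)
        have e2 := (v τ).le_opNorm (u r)
        rw [Real.norm_eq_abs] at e1 e2 ⊢
        have e3 := abs_le.1 e1
        have e4 := abs_le.1 e2
        rw [abs_le]
        constructor <;>
          nlinarith [sq_nonneg (‖v τ‖ - ‖u τ‖), sq_nonneg (‖v τ‖ - ‖u r‖)]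
      have h2 : |∫ τ in r..t, (‖u τ‖ ^ 2 + ‖v τ‖ ^ 2 + (‖u r‖ ^ 2 + ‖v τ‖ ^ 2))| ≤
          ∫ τ in a..b, (‖u τ‖ ^ 2 + ‖v τ‖ ^ 2 + (‖u r‖ ^ 2 + ‖v τ‖ ^ 2)) := by
        refine (intervalIntegral.abs_integral_mono_interval ?_ (.of_forall fun τ => by positivity)
          (intervalIntegrable_of_timeMeasure hcr haI hbI)).trans (le_of_eq (abs_of_nonneg ?_))
        · rw [uIoc_of_le hab.le]
          intro x hx
          rw [uIoc, mem_Ioc] at hx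
          exact ⟨(lt_min hr.1 htab.1).trans hx.1, hx.2.trans (max_le hr.2.le htab.2.le)⟩
        · exact intervalIntegral.integral_nonneg hab.le fun τ _ => by positivity
      have h3 : ∫ τ in a..b, (‖u τ‖ ^ 2 + ‖v τ‖ ^ 2 + (‖u r‖ ^ 2 + ‖v τ‖ ^ 2)) ≤ ε ^ 2 / 4 := by
        have e1 : ∫ τ in a..b, (‖u τ‖ ^ 2 + ‖v τ‖ ^ 2 + (‖u r‖ ^ 2 + ‖v τ‖ ^ 2)) =
            (∫ τ in a..b, (‖u τ‖ ^ 2 + ‖v τ‖ ^ 2)) + (‖u r‖ ^ 2 * (b - a) +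
              ∫ τ in a..b, ‖v τ‖ ^ 2) := by
          rw [intervalIntegral.integral_add (hNi haI hbI) (intervalIntegrable_of_timeMeasure
            hvr haI hbI), intervalIntegral.integral_add (f := fun _ => ‖u r‖ ^ 2)
            intervalIntegrable_const (intervalIntegrable_of_timeMeasure hv1 haI hbI)]
          simp [mul_comm]
        have e2 : ∫ τ in a..b, (‖u τ‖ ^ 2 + ‖v τ‖ ^ 2) =
            (∫ τ in a..b, ‖u τ‖ ^ 2) + ∫ τ in a..b, ‖v τ‖ ^ 2 :=
          intervalIntegral.integral_add (intervalIntegrable_of_timeMeasure hu1 haI hbI)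
            (intervalIntegrable_of_timeMeasure hv1 haI hbI)
        rw [e1]
        linarith
      have h4 : ‖ι (u t) - ι (u r)‖ ^ 2 ≤ (ε / 2) ^ 2 := by
        rw [hinc r hrS' t ht]
        refine (Real.le_norm_self _).trans (h1.trans (h2.trans (h3.trans (le_of_eq ?_))))
        ring
      exact (sq_le_sq₀ (norm_nonneg _) (by positivity)).1 h4
    have hs1 := key s hs ⟨has, by linarith⟩
    have ht1 := key t ht ⟨by linarith, htb⟩
    rw [dist_eq_norm, ← sub_sub_sub_cancel_right (ι (u s)) (ι (u t)) (ι (u r))]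
    exact (norm_sub_le _ _).trans (by linarith))
  have hcg : ContinuousOn (fun t => g₀ + ∫ τ in 0..t, v τ) (Icc 0 T) :=
    continuousOn_const.add (continuousOn_primitive hT.le hvi)
  have hce : ContinuousOn (fun t => e₀ + ∫ τ in 0..t, 2 * v τ (u τ)) (Icc 0 T) :=
    continuousOn_const.add (continuousOn_primitive hT.le hvu2)
  have hE : EqOn (fun t => ‖U t‖ ^ 2) (fun t => e₀ + ∫ τ in 0..t, 2 * v τ (u τ)) (Icc 0 T) := by
    refine EqOn.of_subset_closure (s := S) (fun t ht => ?_) (hU.norm.pow 2) hce hSI hSd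
    have ht' := ht
    rw [hS] at ht'
    exact (congrArg (fun x => ‖x‖ ^ 2) (hUS t ht)).trans ht'.2.2
  refine ⟨U, hU, ?_, fun t ht => ?_, fun t ht => ?_, ?_⟩
  · filter_upwards [hae, ae_timeMeasure_mem] with t ht ht'
    exact (hUS t (hS ▸ ⟨ht', ht⟩)).symm
  · refine EqOn.of_subset_closure (s := S) (f := fun t => dualEmb ι (U t)) (fun t ht => ?_)
      ((dualEmb ι).continuous.comp_continuousOn hU) hcg hSI hSd ht
    have ht' := ht
    rw [hS] at ht'
    exact (congrArg (dualEmb ι) (hUS t ht)).trans ht'.2.1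
  · have h0 : ‖U 0‖ ^ 2 = e₀ := by
      have := hE (left_mem_Icc.2 hT.le)
      simpa using this
    rw [h0]
    exact hE ht
  · have h0 : (0 : ℝ) ∈ closure S := hSd (left_mem_Icc.2 hT.le)
    have h1 : ContinuousWithinAt U S 0 := (hU 0 (left_mem_Icc.2 hT.le)).mono hSI
    refine closure_mono ?_ (h1.mem_closure_image h0)
    rintro _ ⟨t, ht, rfl⟩
    exact ⟨u t, (hUS t ht).symm⟩

/-- Both vectors have the same inner products with the range of `ι`, so `x` is the orthogonal
projection of `w` onto its closure. With this, initial values can be compared although `ι` is not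
assumed to have dense range. -/
lemma norm_le_of_mem_closure_range {ι : V →L[ℝ] H} {x w : H} (hx : x ∈ closure (range ι))
    (h : dualEmb ι x = dualEmb ι w) : ‖x‖ ≤ ‖w‖ := by
  have h1 : ∀ y ∈ closure (range ι), inner ℝ (x - w) y = 0 := by
    refine fun y hy => closure_minimal (s := range ι) (t := {y | inner ℝ (x - w) y = 0}) ?_ ?_ hy
    · rintro _ ⟨z, rfl⟩
      have := congrArg (fun ℓ => ℓ z) h
      simp only [dualEmb_apply] at this
      simp [inner_sub_left, this]
    · exact isClosed_eq (by fun_prop) continuous_const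
  have h2 := h1 x hx
  rw [inner_sub_left, real_inner_self_eq_norm_sq, sub_eq_zero] at h2
  have h3 := real_inner_le_norm w x
  rw [← h2, sq] at h3
  by_cases h0 : ‖x‖ = 0
  · rw [h0]; exact norm_nonneg _
  · exact le_of_mul_le_mul_right h3 (lt_of_le_of_ne (norm_nonneg _) (Ne.symm h0))

end LionsMagenes

/-! ### Abstract parabolic equations -/

section Hilbert

open Filter Topology

variable {α V H X Φ : Type*} [MeasurableSpace α] {μ : Measure α}
  [NormedAddCommGroup V] [InnerProductSpace ℝ V] [CompleteSpace V]
  [NormedAddCommGroup H] [InnerProductSpace ℝ H]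
  [NormedAddCommGroup X] [InnerProductSpace ℝ X] [CompleteSpace X]
  [AddCommGroup Φ] [Module ℝ Φ]

/-- Distinct orthonormal vectors are `√2` apart, so the balls of radius `1/2` around them form a
disjoint family of nonempty open sets. -/
lemma Orthonormal.countable_of_separable [SeparableSpace V] {w : Set V}
    (hw : Orthonormal ℝ ((↑) : w → V)) : w.Countable := by
  refine Set.PairwiseDisjoint.countable_of_isOpen (s := fun v => Metric.ball v (1 / 2)) ?_
    (fun v _ => Metric.isOpen_ball) (fun v _ => Metric.nonempty_ball.2 (by norm_num))
  intro v hv v' hv' hne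
  refine Metric.ball_disjoint_ball ?_
  have h1 : inner ℝ v v' = (0 : ℝ) := hw.2 (i := ⟨v, hv⟩) (j := ⟨v', hv'⟩) (by simpa using hne)
  have h2 : ‖v‖ = 1 := hw.1 ⟨v, hv⟩
  have h3 : ‖v'‖ = 1 := hw.1 ⟨v', hv'⟩
  have h4 : ‖v - v'‖ ^ 2 = 2 := by rw [norm_sub_sq_real, h1, h2, h3]; norm_num
  rw [dist_eq_norm]
  nlinarith [norm_nonneg (v - v')]

/-- In a separable Hilbert space, weak measurability implies strong measurability. -/
lemma aestronglyMeasurable_of_inner [SeparableSpace V] {x : α → V}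
    (h : ∀ v, AEStronglyMeasurable (fun t => inner ℝ v (x t)) μ) : AEStronglyMeasurable x μ := by
  obtain ⟨w, b, hb⟩ := exists_hilbertBasis ℝ V
  have hw : w.Countable := Orthonormal.countable_of_separable (hb ▸ b.orthonormal)
  have : Countable w := hw
  refine aestronglyMeasurable_of_tendsto_ae (u := (atTop : Filter (Finset w)))
    (f := fun s t => ∑ i ∈ s, (inner ℝ (b i) (x t) : ℝ) • b i) (fun s => ?_)
    (.of_forall fun t => ?_)
  · exact Finset.aestronglyMeasurable_fun_sum _ fun i _ => (h (b i)).smul_const _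
  · have := b.hasSum_repr (x t)
    simp only [b.repr_apply_apply] at this
    exact this

lemma aestronglyMeasurable_dual [SeparableSpace V] {x : α → StrongDual ℝ V}
    (h : ∀ v, AEStronglyMeasurable (fun t => x t v) μ) : AEStronglyMeasurable x μ := by
  have h1 : AEStronglyMeasurable (fun t => (InnerProductSpace.toDual ℝ V).symm (x t)) μ := by
    refine aestronglyMeasurable_of_inner fun v => ?_
    refine (h v).congr (.of_forall fun t => ?_)
    simp only []
    rw [real_inner_comm, InnerProductSpace.toDual_symm_apply]
  have h2 := (InnerProductSpace.toDual ℝ V).continuous.comp_aestronglyMeasurable h1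
  simpa using h2

/-- A weakly measurable family of bilinear forms, applied to a measurable function. -/
lemma aestronglyMeasurable_form [SeparableSpace V] {W : Type*} [NormedAddCommGroup W]
    [InnerProductSpace ℝ W] [CompleteSpace W] [SeparableSpace W]
    {a : α → W →L[ℝ] V →L[ℝ] ℝ}
    (ha : ∀ u v, AEStronglyMeasurable (fun t => a t u v) μ) {w : α → W}
    (hw : AEStronglyMeasurable w μ) : AEStronglyMeasurable (fun t => a t (w t)) μ := by
  refine aestronglyMeasurable_dual fun v => ?_
  have h1 : AEStronglyMeasurable (fun t => (a t).flip v) μ :=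
    aestronglyMeasurable_dual fun u => ha u v
  exact (ContinuousLinearMap.id ℝ (StrongDual ℝ W)).aestronglyMeasurable_comp₂ h1 hw

/-- **Lions' projection lemma**. -/
lemma exists_inner_eq_of_le_norm (K : Φ →ₗ[ℝ] X) (L : Φ →ₗ[ℝ] ℝ) {C : ℝ} (hC : 0 ≤ C)
    (h : ∀ φ, |L φ| ≤ C * ‖K φ‖) : ∃ x : X, ‖x‖ ≤ C ∧ ∀ φ, inner ℝ x (K φ) = L φ := by
  have hker : LinearMap.ker K ≤ LinearMap.ker L := fun φ hφ => by
    have h1 := h φ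
    rw [LinearMap.mem_ker] at hφ ⊢
    rw [hφ, norm_zero, mul_zero] at h1
    exact abs_nonpos_iff.1 h1
  -- The estimate makes `L` factor through `K`. The resulting bounded functional on the range is
  -- extended by Hahn-Banach without increasing its norm and represented by Riesz.
  let f₀ : LinearMap.range K →ₗ[ℝ] ℝ :=
    ((LinearMap.ker K).liftQ L hker).comp (K.quotKerEquivRange.symm : _ →ₗ[ℝ] _)
  have hf₀ : ∀ φ, f₀ ⟨K φ, φ, rfl⟩ = L φ := fun φ => by
    have : K.quotKerEquivRange.symm ⟨K φ, φ, rfl⟩ = (LinearMap.ker K).mkQ φ := by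
      rw [LinearEquiv.symm_apply_eq]; rfl
    simp only [f₀, LinearMap.comp_apply, LinearEquiv.coe_coe, this]
    simp
  let f₁ : StrongDual ℝ (LinearMap.range K) := f₀.mkContinuous C (by
    rintro ⟨_, φ, rfl⟩
    rw [hf₀]; exact h φ)
  obtain ⟨g, hg, hgn⟩ := exists_extension_norm_eq _ f₁
  refine ⟨(InnerProductSpace.toDual ℝ X).symm g, ?_, fun φ => ?_⟩
  · rw [LinearIsometryEquiv.norm_map, hgn]
    exact LinearMap.mkContinuous_norm_le _ hC _
  · rw [InnerProductSpace.toDual_symm_apply]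
    exact (hg ⟨K φ, φ, rfl⟩).trans (hf₀ φ)

lemma norm_toLp_sq {E : Type*} [NormedAddCommGroup E] {f : α → E} (hf : MemLp f 2 μ) :
    ‖hf.toLp f‖ ^ 2 = ∫ t, ‖f t‖ ^ 2 ∂μ := by
  rw [Lp.norm_toLp, hf.eLpNorm_eq_integral_rpow_norm (by norm_num) (by norm_num),
    ENNReal.toReal_ofReal (by positivity), ← Real.rpow_natCast, ← Real.rpow_mul (by positivity)]
  simp

lemma integral_mul_le_norm_toLp {E F : Type*} [NormedAddCommGroup E] [NormedAddCommGroup F]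
    {f : α → E} {g : α → F} (hf : MemLp f 2 μ) (hg : MemLp g 2 μ) :
    ∫ t, ‖f t‖ * ‖g t‖ ∂μ ≤ ‖hf.toLp f‖ * ‖hg.toLp g‖ := by
  have h1 := real_inner_le_norm (hf.norm.toLp _) (hg.norm.toLp _)
  have h2 : inner ℝ (hf.norm.toLp _) (hg.norm.toLp _) = ∫ t, ‖f t‖ * ‖g t‖ ∂μ := by
    rw [L2.inner_def]
    refine integral_congr_ae ?_
    filter_upwards [hf.norm.coeFn_toLp, hg.norm.coeFn_toLp] with t h3 h4
    rw [h3, h4]; simp [mul_comm]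
  rw [h2] at h1
  simpa [Lp.norm_toLp, eLpNorm_norm] using h1

lemma integrable_norm_mul_norm {E F : Type*} [NormedAddCommGroup E] [NormedAddCommGroup F]
    {f : α → E} {g : α → F} (hf : MemLp f 2 μ) (hg : MemLp g 2 μ) :
    Integrable (fun t => ‖f t‖ * ‖g t‖) μ :=
  MemLp.integrable_mul hf.norm hg.norm

lemma integrable_dual_apply {E : Type*} [NormedAddCommGroup E] [NormedSpace ℝ E]
    {f : α → StrongDual ℝ E} {g : α → E} (hf : MemLp f 2 μ) (hg : MemLp g 2 μ) :
    Integrable (fun t => f t (g t)) μ :=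
  memLp_one_iff_integrable.1 ((ContinuousLinearMap.id ℝ (StrongDual ℝ E)).memLp_of_bilin 1 hf hg)

lemma abs_integral_dual_apply_le {E : Type*} [NormedAddCommGroup E] [NormedSpace ℝ E]
    {f : α → StrongDual ℝ E} {g : α → E} (hf : MemLp f 2 μ) (hg : MemLp g 2 μ) :
    |∫ t, f t (g t) ∂μ| ≤ ‖hf.toLp f‖ * ‖hg.toLp g‖ :=
  (norm_integral_le_of_norm_le (integrable_norm_mul_norm hf hg)
    (.of_forall fun t => (f t).le_opNorm (g t))).trans (integral_mul_le_norm_toLp hf hg)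

end Hilbert

/-! ### Energy bounds and uniqueness for parabolic forms -/

section Parabolic

open Filter Topology

variable {T : ℝ} {V H : Type*} [NormedAddCommGroup V] [InnerProductSpace ℝ V] [CompleteSpace V]
  [NormedAddCommGroup H] [InnerProductSpace ℝ H]

/-- A bounded, weakly measurable family of bilinear forms on `V` that satisfies a Gårding
inequality with respect to `ι : V → H`. -/
structure IsParabolicForm (T : ℝ) (ι : V →L[ℝ] H) (a : ℝ → V →L[ℝ] V →L[ℝ] ℝ) (M α l : ℝ) :
    Prop where
  meas : ∀ u v, AEStronglyMeasurable (fun t => a t u v) (timeMeasure T)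
  bound : ∀ t, ‖a t‖ ≤ M
  garding : ∀ t u, α * ‖u‖ ^ 2 ≤ a t u u + l * ‖ι u‖ ^ 2
  alpha_pos : 0 < α
  l_nonneg : 0 ≤ l

variable {ι : V →L[ℝ] H} {a : ℝ → V →L[ℝ] V →L[ℝ] ℝ} {M α l : ℝ}

lemma IsParabolicForm.bound_nonneg (ha : IsParabolicForm T ι a M α l) : 0 ≤ M :=
  le_trans (norm_nonneg (a 0)) (ha.bound 0)

lemma IsParabolicForm.norm_apply_le (ha : IsParabolicForm T ι a M α l) (t : ℝ) (u : V) :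
    ‖a t u‖ ≤ M * ‖u‖ := (a t).le_of_opNorm_le (ha.bound t) u

lemma IsParabolicForm.memLp [SeparableSpace V] (ha : IsParabolicForm T ι a M α l) {p : ℝ≥0∞}
    {w : ℝ → V} (hw : MemLp w p (timeMeasure T)) :
    MemLp (fun t => a t (w t)) p (timeMeasure T) :=
  hw.of_le_mul (aestronglyMeasurable_form ha.meas hw.1) (.of_forall fun t => ha.norm_apply_le t _)

lemma IsParabolicForm.memLp_flip [SeparableSpace V] (ha : IsParabolicForm T ι a M α l) {p : ℝ≥0∞}
    {w : ℝ → V} (hw : MemLp w p (timeMeasure T)) :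
    MemLp (fun t => (a t).flip (w t)) p (timeMeasure T) := by
  refine hw.of_le_mul (c := M)
    (aestronglyMeasurable_form (a := fun t => (a t).flip) (fun u v => ha.meas v u) hw.1)
    (.of_forall fun t => (a t).flip.le_of_opNorm_le ?_ _)
  rw [ContinuousLinearMap.opNorm_flip]; exact ha.bound t

lemma memLp_continuousOn {E : Type*} [NormedAddCommGroup E] {f : ℝ → E}
    (hf : ContinuousOn f (Icc 0 T)) (p : ℝ≥0∞) : MemLp f p (timeMeasure T) := by
  obtain ⟨C, hC⟩ := isCompact_Icc.exists_bound_of_continuousOn hf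
  refine MemLp.of_bound ?_ C ?_
  · have := hf.aestronglyMeasurable_of_isCompact (μ := volume) isCompact_Icc measurableSet_Icc
    exact this.mono_measure (Measure.restrict_mono Ioo_subset_Icc_self le_rfl)
  · filter_upwards [ae_timeMeasure_mem] with t ht using hC t (Ioo_subset_Icc_self ht)

/-- Energy bound for functions with a time derivative in the dual space. -/
lemma ae_norm_sq_le [CompleteSpace H] (hT : 0 < T) {u : ℝ → V} {v : ℝ → StrongDual ℝ V} {w₀ : H}
    (hu : MemLp u 2 (timeMeasure T)) (hv : MemLp v 2 (timeMeasure T))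
    (h : IsPrimitive T (fun t => dualEmb ι (ι (u t))) v (dualEmb ι w₀)) :
    ∀ᵐ t ∂(timeMeasure T), ‖ι (u t)‖ ^ 2 ≤ ‖w₀‖ ^ 2 + ‖hu.toLp u‖ ^ 2 + ‖hv.toLp v‖ ^ 2 := by
  obtain ⟨U, hU, hUu, hUg, hUe, hU0⟩ := lionsMagenes hT ι hu hv h
  have h0 : ‖U 0‖ ≤ ‖w₀‖ := norm_le_of_mem_closure_range hU0 (by
    have := hUg 0 (left_mem_Icc.2 hT.le); simpa using this)
  have hu1 : Integrable (fun t => ‖u t‖ ^ 2) (timeMeasure T) := hu.integrable_norm_pow (by norm_num)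
  have hv1 : Integrable (fun t => ‖v t‖ ^ 2) (timeMeasure T) := hv.integrable_norm_pow (by norm_num)
  filter_upwards [hUu, ae_timeMeasure_mem] with t ht hm
  rw [ht, hUe t (Ioo_subset_Icc_self hm), norm_toLp_sq hu, norm_toLp_sq hv, add_assoc,
    ← integral_add hu1 hv1, ← setIntegral_timeMeasure_Iio (Ioo_subset_Icc_self hm)]
  have h1 : ∫ τ, (Iio t).indicator (fun τ => 2 * v τ (u τ)) τ ∂(timeMeasure T) ≤
      ∫ τ, (‖u τ‖ ^ 2 + ‖v τ‖ ^ 2) ∂(timeMeasure T) := by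
    refine integral_mono (((integrable_dual_apply hv hu).const_mul 2).indicator measurableSet_Iio)
      (hu1.add hv1) fun τ => ?_
    by_cases hτ : τ ∈ Iio t
    · rw [indicator_of_mem hτ]
      have e1 := (le_abs_self _).trans ((v τ).le_opNorm (u τ))
      nlinarith [sq_nonneg (‖v τ‖ - ‖u τ‖)]
    · rw [indicator_of_notMem hτ]
      positivity
  have h2 : ‖U 0‖ ^ 2 ≤ ‖w₀‖ ^ 2 := by gcongr
  linarith

/-- Uniqueness for the homogeneous equation. -/
lemma IsParabolicForm.eq_zero [SeparableSpace V] [CompleteSpace H] (hT : 0 < T)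
    (ha : IsParabolicForm T ι a M α l) {w : ℝ → V} (hw : MemLp w 2 (timeMeasure T))
    (h : IsPrimitive T (fun t => dualEmb ι (ι (w t))) (fun t => -a t (w t)) 0) :
    w =ᵐ[timeMeasure T] 0 := by
  have hv : MemLp (fun t => -a t (w t)) 2 (timeMeasure T) := (ha.memLp hw).neg
  obtain ⟨U, hU, hUu, hUg, hUe, hU0⟩ := lionsMagenes hT ι hw hv h
  have i0 := left_mem_Icc.2 hT.le
  have h0 : ‖U 0‖ = 0 := by
    have := norm_le_of_mem_closure_range (w := 0) hU0 (by have := hUg 0 i0; simpa using this)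
    simpa using this
  have hw1 : Integrable (fun t => ‖w t‖ ^ 2) (timeMeasure T) := hw.integrable_norm_pow (by norm_num)
  have hU1 : Integrable (fun t => ‖U t‖ ^ 2) (timeMeasure T) :=
    (memLp_continuousOn hU 2).integrable_norm_pow (by norm_num)
  have hva : Integrable (fun t => 2 * (-a t (w t)) (w t)) (timeMeasure T) :=
    (integrable_dual_apply hv hw).const_mul 2
  -- Energy identity combined with Gårding's inequality. The dissipation term is kept: it is what
  -- finally forces `w = 0` in `V`, since `U = 0` alone would only give `ι w = 0`.
  have key : ∀ t ∈ Icc 0 T, ‖U t‖ ^ 2 ≤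
      2 * l * (∫ τ in 0..t, ‖U τ‖ ^ 2) - 2 * α * ∫ τ in 0..t, ‖w τ‖ ^ 2 := by
    intro t ht
    have iU := intervalIntegrable_of_timeMeasure hU1 i0 ht
    have iw := intervalIntegrable_of_timeMeasure hw1 i0 ht
    rw [hUe t ht, h0, ← intervalIntegral.integral_const_mul, ← intervalIntegral.integral_const_mul,
      ← intervalIntegral.integral_sub (iU.const_mul _) (iw.const_mul _)]
    rw [zero_pow two_ne_zero, zero_add]
    refine intervalIntegral.integral_mono_ae_restrict ht.1
      (intervalIntegrable_of_timeMeasure hva i0 ht) ((iU.const_mul _).sub (iw.const_mul _)) ?_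
    have h1 : ∀ᵐ τ ∂(volume.restrict (Icc 0 t)), ι (w τ) = U τ := by
      rw [← Measure.restrict_congr_set Ioo_ae_eq_Icc]
      exact ae_restrict_of_ae_restrict_of_subset (Ioo_subset_Ioo_right ht.2) hUu
    filter_upwards [h1] with τ hτ
    have h2 := ha.garding τ (w τ)
    rw [hτ] at h2
    simp only [_root_.neg_apply]
    linarith
  -- Gronwall
  set y : ℝ → ℝ := fun t => ∫ τ in 0..t, ‖U τ‖ ^ 2 with hy
  have hyc : ContinuousOn y (Icc 0 T) := continuousOn_primitive hT.le hU1
  have hwn : ∀ t ∈ Icc 0 T, 0 ≤ ∫ τ in 0..t, ‖w τ‖ ^ 2 := fun t ht =>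
    intervalIntegral.integral_nonneg ht.1 fun τ _ => sq_nonneg _
  have hyd : ∀ t ∈ Ioo 0 T, HasDerivAt y (‖U t‖ ^ 2) t := fun t ht => by
    have hcont : ContinuousOn (fun t => ‖U t‖ ^ 2) (Icc 0 T) := hU.norm.pow 2
    refine intervalIntegral.integral_hasDerivAt_right
      (intervalIntegrable_of_timeMeasure hU1 i0 (Ioo_subset_Icc_self ht)) ?_
      (hcont.continuousAt (Icc_mem_nhds ht.1 ht.2))
    exact (hcont.mono Ioo_subset_Icc_self).stronglyMeasurableAtFilter isOpen_Ioo t ht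
  have hanti : AntitoneOn (fun t => Real.exp (-(2 * l * t)) * y t) (Icc 0 T) := by
    refine antitoneOn_of_deriv_nonpos (convex_Icc 0 T) ?_ ?_ ?_
    · exact (Continuous.continuousOn (by fun_prop)).mul hyc
    · rw [interior_Icc]
      intro t ht
      have := (hyd t ht).differentiableAt
      exact (DifferentiableAt.mul (by fun_prop) this).differentiableWithinAt
    · rw [interior_Icc]
      intro t ht
      have h1 : HasDerivAt (fun t => Real.exp (-(2 * l * t))) (Real.exp (-(2 * l * t)) * -(2 * l)) t := by
        have := ((hasDerivAt_id' t).const_mul (2 * l)).neg.exp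
        simpa using this
      rw [(h1.fun_mul (hyd t ht)).deriv]
      have h2 := key t (Ioo_subset_Icc_self ht)
      have h3 := hwn t (Ioo_subset_Icc_self ht)
      have h4 : ‖U t‖ ^ 2 ≤ 2 * l * y t := by
        have := mul_nonneg (mul_nonneg zero_le_two ha.alpha_pos.le) h3
        simp only [hy]; linarith
      have h5 := Real.exp_pos (-(2 * l * t))
      nlinarith
  have hy0 : y T ≤ 0 := by
    have := hanti i0 (right_mem_Icc.2 hT.le) hT.le
    simp only [hy, intervalIntegral.integral_same, mul_zero] at this
    by_contra! hcon
    exact absurd this (not_le.2 (mul_pos (Real.exp_pos _) hcon))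
  have hyT : 0 ≤ y T := intervalIntegral.integral_nonneg hT.le fun τ _ => sq_nonneg _
  have hwT := key T (right_mem_Icc.2 hT.le)
  have hfin : ∫ τ, ‖w τ‖ ^ 2 ∂(timeMeasure T) = 0 := by
    rw [integral_timeMeasure hT.le]
    refine le_antisymm ?_ (hwn T (right_mem_Icc.2 hT.le))
    change _ ≤ 2 * l * y T - _ at hwT
    rw [le_antisymm hy0 hyT] at hwT
    have h1 := sq_nonneg ‖U T‖
    have h2 := ha.alpha_pos
    by_contra! hcon
    nlinarith [mul_pos h2 hcon]
  rw [integral_eq_zero_iff_of_nonneg (fun _ => sq_nonneg _) hw1] at hfin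
  filter_upwards [hfin] with t ht
  simpa using ht

end Parabolic

/-! ### Existence of solutions by Lions' projection lemma -/

section Existence

open Filter Topology

variable {T : ℝ} {V H : Type*} [NormedAddCommGroup V] [InnerProductSpace ℝ V] [CompleteSpace V]
  [NormedAddCommGroup H] [InnerProductSpace ℝ H]
variable {ι : V →L[ℝ] H} {a : ℝ → V →L[ℝ] V →L[ℝ] ℝ} {M α l : ℝ}

/-- A locally integrable function on `(0,T)` that is orthogonal to all continuous functions
vanishes. -/
lemma ae_eq_zero_of_forall_continuous {E : Type*} [NormedAddCommGroup E] [NormedSpace ℝ E]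
    [CompleteSpace E] {R : ℝ → E} (hR : Integrable R (timeMeasure T))
    (h : ∀ η : ℝ → ℝ, Continuous η → ∫ t, η t • R t ∂(timeMeasure T) = 0) :
    R =ᵐ[timeMeasure T] 0 := by
  have key := isOpen_Ioo.ae_eq_zero_of_integral_contDiff_smul_eq_zero (U := Ioo 0 T)
    (μ := (volume : Measure ℝ)) (f := R) (IntegrableOn.locallyIntegrableOn hR) (by
      intro g hg _ hgs
      rw [← h g hg.continuous, timeMeasure, setIntegral_eq_integral_of_forall_compl_eq_zero]
      intro x hx
      rw [image_eq_zero_of_notMem_tsupport (fun h => hx (hgs h)), zero_smul])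
  exact (ae_restrict_iff' measurableSet_Ioo).2 key

lemma hasDerivAt_tail {E : Type*} [NormedAddCommGroup E] [NormedSpace ℝ E] [CompleteSpace E]
    {ψ : ℝ → E} (hψ : Continuous ψ) (t : ℝ) : HasDerivAt (fun t => ∫ τ in t..T, ψ τ) (-ψ t) t :=
  intervalIntegral.integral_hasDerivAt_left (hψ.intervalIntegrable _ _)
    hψ.aestronglyMeasurable.stronglyMeasurableAtFilter hψ.continuousAt

lemma continuous_tail {E : Type*} [NormedAddCommGroup E] [NormedSpace ℝ E] [CompleteSpace E]
    {ψ : ℝ → E} (hψ : Continuous ψ) : Continuous (fun t => ∫ τ in t..T, ψ τ) :=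
  continuous_iff_continuousAt.2 fun t => (hasDerivAt_tail hψ t).continuousAt

lemma memLp_continuous {E : Type*} [NormedAddCommGroup E] {f : ℝ → E}
    (hf : Continuous f) (p : ℝ≥0∞) : MemLp f p (timeMeasure T) :=
  memLp_continuousOn hf.continuousOn p

/-- Solutions of `w' + a(t) w = G`, `w(0) = w₀`. -/
def IsMildSolution (T : ℝ) (ι : V →L[ℝ] H) (a : ℝ → V →L[ℝ] V →L[ℝ] ℝ) (G : ℝ → StrongDual ℝ V)
    (w₀ : H) (w : ℝ → V) : Prop :=
  IsPrimitive T (fun t => dualEmb ι (ι (w t))) (fun t => G t - a t (w t)) (dualEmb ι w₀)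

section Lions

variable (ha : IsParabolicForm T ι a M α l)

/-- The representative of the adjoint parabolic operator, applied to `t ↦ ∫ₜᵀ ψ`. -/
def adjointFun (T : ℝ) (ι : V →L[ℝ] H) (a : ℝ → V →L[ℝ] V →L[ℝ] ℝ) (ψ : C(ℝ, V)) (t : ℝ) : V :=
  (InnerProductSpace.toDual ℝ V).symm (dualEmb ι (ι (ψ t))) +
    (InnerProductSpace.toDual ℝ V).symm ((a t).flip (∫ τ in t..T, ψ τ))

lemma inner_adjointFun (ψ : C(ℝ, V)) (t : ℝ) (x : V) :
    inner ℝ x (adjointFun T ι a ψ t) =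
      inner ℝ (ι (ψ t)) (ι x) + a t x (∫ τ in t..T, ψ τ) := by
  rw [real_inner_comm, adjointFun, inner_add_left, InnerProductSpace.toDual_symm_apply,
    InnerProductSpace.toDual_symm_apply]
  rfl

lemma _root_.MeasureTheory.MemLp.toDual_symm {μ : Measure ℝ} {p : ℝ≥0∞} {q : ℝ → StrongDual ℝ V}
    (hq : MemLp q p μ) : MemLp (fun t => (InnerProductSpace.toDual ℝ V).symm (q t)) p μ := by
  refine hq.congr_norm ?_ (.of_forall fun t => ?_)
  · exact (InnerProductSpace.toDual ℝ V).symm.continuous.comp_aestronglyMeasurable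
      hq.aestronglyMeasurable
  · exact ((InnerProductSpace.toDual ℝ V).symm.norm_map _).symm

include ha in
lemma memLp_adjointFun [SeparableSpace V] (ψ : C(ℝ, V)) :
    MemLp (adjointFun T ι a ψ) 2 (timeMeasure T) := by
  have h1 : Continuous (fun t => dualEmb ι (ι (ψ t))) :=
    (dualEmb ι).continuous.comp (ι.continuous.comp ψ.continuous)
  have h2 : Continuous fun t => ∫ τ in t..T, ψ τ := continuous_tail ψ.continuous
  exact (memLp_continuous h1 2).toDual_symm.add (ha.memLp_flip (memLp_continuous h2 2)).toDual_symm

/-- `adjointFun` as a linear map into `L²(0,T;V)`. -/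
def adjointMap [SeparableSpace V] : C(ℝ, V) →ₗ[ℝ] Lp V 2 (timeMeasure T) where
  toFun ψ := (memLp_adjointFun ha ψ).toLp _
  map_add' ψ ψ' := by
    rw [← MemLp.toLp_add]
    refine MemLp.toLp_congr _ _ (.of_forall fun t => ?_)
    simp only [adjointFun, ContinuousMap.add_apply, Pi.add_apply]
    rw [intervalIntegral.integral_add (ψ.continuous.intervalIntegrable _ _)
      (ψ'.continuous.intervalIntegrable _ _), map_add ι, map_add (dualEmb ι),
      map_add ((a t).flip), add_add_add_comm]
    exact congrArg₂ (· + ·) ((InnerProductSpace.toDual ℝ V).symm.toLinearEquiv.toLinearMap.map_add _ _)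
      ((InnerProductSpace.toDual ℝ V).symm.toLinearEquiv.toLinearMap.map_add _ _)
  map_smul' c ψ := by
    rw [RingHom.id_apply, ← MemLp.toLp_const_smul]
    refine MemLp.toLp_congr _ _ (.of_forall fun t => ?_)
    simp only [adjointFun, ContinuousMap.smul_apply, Pi.smul_apply]
    rw [intervalIntegral.integral_smul, map_smul ι, map_smul (dualEmb ι), map_smul ((a t).flip),
      smul_add]
    exact congrArg₂ (· + ·)
      ((InnerProductSpace.toDual ℝ V).symm.toLinearEquiv.toLinearMap.map_smul c _)
      ((InnerProductSpace.toDual ℝ V).symm.toLinearEquiv.toLinearMap.map_smul c _)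

/-- The right hand side of the parabolic equation, tested with `t ↦ ∫ₜᵀ ψ`. -/
def rhsMap {G : ℝ → StrongDual ℝ V} (hG : MemLp G 2 (timeMeasure T)) (w₀ : H) :
    C(ℝ, V) →ₗ[ℝ] ℝ where
  toFun ψ := (∫ t, G t (∫ τ in t..T, ψ τ) ∂(timeMeasure T)) + inner ℝ w₀ (ι (∫ τ in 0..T, ψ τ))
  map_add' ψ ψ' := by
    have h := fun ψ : C(ℝ, V) => integrable_dual_apply hG
      (memLp_continuous (T := T) (continuous_tail (T := T) ψ.continuous) 2)
    simp only [ContinuousMap.add_apply]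
    simp_rw [fun t => intervalIntegral.integral_add (ψ.continuous.intervalIntegrable (μ := volume)
      t T) (ψ'.continuous.intervalIntegrable t T), map_add, inner_add_right]
    rw [integral_add (h ψ) (h ψ')]
    ring
  map_smul' c ψ := by
    simp only [ContinuousMap.smul_apply, intervalIntegral.integral_smul, map_smul, inner_smul_right,
      RingHom.id_apply, smul_eq_mul, integral_const_mul]
    ring

include ha in
/-- Existence for the abstract parabolic problem. -/
theorem exists_isMildSolution [SeparableSpace V] [CompleteSpace H] (hT : 0 < T)
    {G : ℝ → StrongDual ℝ V} (hG : MemLp G 2 (timeMeasure T)) (w₀ : H) :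
    ∃ (w : ℝ → V) (hw : MemLp w 2 (timeMeasure T)), IsMildSolution T ι a G w₀ w ∧
      ‖hw.toLp w‖ ≤ Real.exp (2 * l * T) * (‖hG.toLp G‖ / α + √(2 / α) * ‖w₀‖) := by
  have hα := ha.alpha_pos
  set E := Real.exp (2 * l * T) with hE
  have hE0 : 0 < E := Real.exp_pos _
  obtain ⟨x, hxn, hx⟩ := exists_inner_eq_of_le_norm (adjointMap ha) (rhsMap (ι := ι) hG w₀)
    (C := E * (‖hG.toLp G‖ / α + √(2 / α) * ‖w₀‖)) (by positivity) (by
    intro ψ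
    obtain ⟨φ, hφ⟩ : ∃ φ : ℝ → V, φ = fun t => ∫ τ in t..T, ψ τ := ⟨_, rfl⟩
    have hφc : Continuous φ := by rw [hφ]; exact continuous_tail ψ.continuous
    have hφd : ∀ t, HasDerivAt φ (-ψ t) t := by rw [hφ]; exact hasDerivAt_tail ψ.continuous
    have hφT : φ T = 0 := by rw [hφ]; simp
    have hφm : MemLp φ 2 (timeMeasure T) := memLp_continuous hφc 2
    -- The multiplier of the a priori estimate. Since `ψ = -φ'`, integrating `(ι ψ, ι φ)` against
    -- the weight `exp(2lt)` yields `‖ι φ(0)‖² / 2` and the term `l ‖ι φ‖²` that Gårding's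
    -- inequality requires.
    have hym : MemLp (fun t => Real.exp (2 * l * t) • φ t) 2 (timeMeasure T) :=
      memLp_continuous (by fun_prop) 2
    set n := ‖hφm.toLp φ‖ with hn
    set b := ‖ι (φ 0)‖ with hb
    set k := ‖adjointMap ha ψ‖ with hk
    have hn2 : n ^ 2 = ∫ t, ‖φ t‖ ^ 2 ∂(timeMeasure T) := norm_toLp_sq hφm
    have hφi : Integrable (fun t => ‖φ t‖ ^ 2) (timeMeasure T) :=
      integrable_continuous (by fun_prop)
    -- upper bound for the pairing
    have hup : inner ℝ (hym.toLp _) (adjointMap ha ψ) ≤ E * n * k := by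
      refine (real_inner_le_norm _ _).trans (mul_le_mul_of_nonneg_right ?_ (norm_nonneg _))
      have h1 : ‖hym.toLp _‖ ^ 2 ≤ (E * n) ^ 2 := by
        rw [norm_toLp_sq hym, mul_pow, hn2, ← integral_const_mul]
        refine integral_mono_ae (integrable_continuous (by fun_prop)) (hφi.const_mul _) ?_
        filter_upwards [ae_timeMeasure_mem] with t ht
        rw [norm_smul, mul_pow, Real.norm_of_nonneg (Real.exp_pos _).le]
        have : Real.exp (2 * l * t) ≤ E := by
          rw [hE, Real.exp_le_exp]
          exact mul_le_mul_of_nonneg_left ht.2.le (mul_nonneg zero_le_two ha.l_nonneg)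
        gcongr
      exact (sq_le_sq₀ (norm_nonneg _) (by positivity)).1 h1
    -- lower bound for the pairing
    have hlow : b ^ 2 / 2 + α * n ^ 2 ≤ inner ℝ (hym.toLp _) (adjointMap ha ψ) := by
      have h1 : inner ℝ (hym.toLp _) (adjointMap ha ψ) =
          ∫ t, Real.exp (2 * l * t) * (inner ℝ (ι (ψ t)) (ι (φ t)) + a t (φ t) (φ t))
            ∂(timeMeasure T) := by
        rw [L2.inner_def]
        refine integral_congr_ae ?_
        filter_upwards [hym.coeFn_toLp, (memLp_adjointFun ha ψ).coeFn_toLp] with t h1 h2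
        have h2' : (adjointMap ha ψ) t = adjointFun T ι a ψ t := h2
        rw [h1, h2', inner_adjointFun, hφ]
        simp only [map_smul, inner_smul_right, _root_.smul_apply, smul_eq_mul]
        ring
      have haφ : Integrable (fun t => a t (φ t) (φ t)) (timeMeasure T) :=
        integrable_dual_apply (ha.memLp hφm) hφm
      have hι1 : Continuous fun t => inner ℝ (ι (ψ t)) (ι (φ t)) := by fun_prop
      have hι2 : Continuous fun t => ‖ι (φ t)‖ ^ 2 := by fun_prop
      have hex : Continuous fun t => Real.exp (2 * l * t) := by fun_prop
      have hd : ∀ t, HasDerivAt (fun t => Real.exp (2 * l * t) * ‖ι (φ t)‖ ^ 2)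
          (2 * (Real.exp (2 * l * t) * (l * ‖ι (φ t)‖ ^ 2 - inner ℝ (ι (ψ t)) (ι (φ t))))) t := by
        intro t
        have e1 : HasDerivAt (fun t => Real.exp (2 * l * t)) (Real.exp (2 * l * t) * (2 * l)) t := by
          simpa using ((hasDerivAt_id' t).const_mul (2 * l)).exp
        have e2 : HasDerivAt (fun t => ι (φ t)) (ι (-ψ t)) t := ι.hasFDerivAt.comp_hasDerivAt t (hφd t)
        have e3 := e1.fun_mul e2.norm_sq
        refine e3.congr_deriv ?_
        rw [map_neg, inner_neg_right, real_inner_comm]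
        ring
      have hftc : ∫ t, 2 * (Real.exp (2 * l * t) *
          (l * ‖ι (φ t)‖ ^ 2 - inner ℝ (ι (ψ t)) (ι (φ t)))) ∂(timeMeasure T) = -b ^ 2 := by
        rw [integral_timeMeasure hT.le,
          intervalIntegral.integral_eq_sub_of_hasDerivAt (fun t _ => hd t)
            (Continuous.intervalIntegrable (by fun_prop) _ _), hφT]
        simp [hb]
      have h2 : ∫ t, (α * ‖φ t‖ ^ 2 + (-1 / 2) * (2 * (Real.exp (2 * l * t) *
          (l * ‖ι (φ t)‖ ^ 2 - inner ℝ (ι (ψ t)) (ι (φ t)))))) ∂(timeMeasure T) ≤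
          ∫ t, Real.exp (2 * l * t) * (inner ℝ (ι (ψ t)) (ι (φ t)) + a t (φ t) (φ t))
            ∂(timeMeasure T) := by
        refine integral_mono_ae (integrable_continuous (by fun_prop))
          (integrable_smul_continuous hex ((integrable_continuous hι1).add haφ)) ?_
        filter_upwards [ae_timeMeasure_mem] with t ht
        have g1 := ha.garding t (φ t)
        have g2 : 1 ≤ Real.exp (2 * l * t) := Real.one_le_exp
          (mul_nonneg (mul_nonneg zero_le_two ha.l_nonneg) ht.1.le)
        have g3 : 0 ≤ α * ‖φ t‖ ^ 2 := by positivity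
        nlinarith
      have h3 : Integrable (fun t => (-1 / 2 : ℝ) * (2 * (Real.exp (2 * l * t) *
          (l * ‖ι (φ t)‖ ^ 2 - inner ℝ (ι (ψ t)) (ι (φ t)))))) (timeMeasure T) :=
        integrable_continuous (by fun_prop)
      rw [integral_add (hφi.const_mul _) h3, integral_const_mul, integral_const_mul, hftc,
        ← hn2] at h2
      rw [h1]
      linarith
    have hboth := hlow.trans hup
    have hn0 : 0 ≤ n := norm_nonneg _
    have hb0 : 0 ≤ b := norm_nonneg _
    have hk0 : 0 ≤ k := norm_nonneg _
    -- The inequality `b²/2 + α n² ≤ E n k` bounds `n` directly and, after inserting that bound,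
    -- also `b² ≤ 2 E² k² / α`. These are the two summands of the constant.
    have hnk : n ≤ E * k / α := by
      rw [le_div_iff₀ hα]
      by_cases h0 : n = 0
      · rw [h0, zero_mul]; positivity
      · have : 0 < n := lt_of_le_of_ne hn0 (Ne.symm h0)
        nlinarith [sq_nonneg b]
    have hbk : b ≤ E * √(2 / α) * k := by
      refine (sq_le_sq₀ hb0 (by positivity)).1 ?_
      rw [mul_pow, mul_pow, Real.sq_sqrt (by positivity)]
      have h1 : b ^ 2 ≤ 2 * (E * n * k) := by nlinarith [mul_nonneg hα.le (sq_nonneg n)]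
      refine h1.trans ?_
      calc 2 * (E * n * k) ≤ 2 * (E * (E * k / α) * k) := by gcongr
        _ = _ := by ring
    have hL : |rhsMap (ι := ι) hG w₀ ψ| ≤ ‖hG.toLp G‖ * n + ‖w₀‖ * b := by
      change |(∫ t, G t (∫ τ in t..T, ψ τ) ∂(timeMeasure T)) +
        inner ℝ w₀ (ι (∫ τ in 0..T, ψ τ))| ≤ _
      have e1 := abs_integral_dual_apply_le hG hφm
      have e2 := abs_real_inner_le_norm w₀ (ι (φ 0))
      have e3 : ∀ t, ∫ τ in t..T, ψ τ = φ t := fun t => by rw [hφ]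
      simp only [e3]
      exact (abs_add_le _ _).trans (add_le_add e1 e2)
    calc _ ≤ _ := hL
      _ ≤ ‖hG.toLp G‖ * (E * k / α) + ‖w₀‖ * (E * √(2 / α) * k) := by gcongr
      _ = _ := by ring)
  have hxm : MemLp x 2 (timeMeasure T) := Lp.memLp x
  refine ⟨x, hxm, ?_, by rwa [Lp.toLp_coeFn]⟩
  have hq : MemLp (fun t => G t - a t (x t)) 2 (timeMeasure T) := hG.sub (ha.memLp hxm)
  have hqi := hq.integrable (by norm_num)
  have hJ : Integrable (fun t => dualEmb ι (ι (x t))) (timeMeasure T) :=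
    ((dualEmb ι).comp ι).integrable_comp (hxm.integrable (by norm_num))
  have hR : Integrable (fun t => dualEmb ι (ι (x t)) -
      (dualEmb ι w₀ + ∫ τ in 0..t, (G τ - a τ (x τ)))) (timeMeasure T) :=
    hJ.sub ((integrable_const _).add (integrable_primitive hT.le hqi))
  -- Testing with `ψ = η χ`, whose tail is `(∫ₜᵀ η) χ`, and applying Fubini on the triangle shows
  -- that the residual of the integrated equation is orthogonal to every continuous `η`.
  have hzero := ae_eq_zero_of_forall_continuous hR (by
    intro η hη
    have i1 := integrable_smul_continuous hη hJ
    have i2 : Integrable (fun t => η t • dualEmb ι w₀) (timeMeasure T) :=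
      integrable_smul_continuous hη (integrable_const _)
    have i3 := integrable_smul_continuous hη (integrable_primitive hT.le hqi)
    have i23 : Integrable (fun t => η t • dualEmb ι w₀ +
        η t • ∫ τ in 0..t, (G τ - a τ (x τ))) (timeMeasure T) := i2.add i3
    simp only [smul_sub, smul_add]
    rw [integral_sub i1 i23, integral_add i2 i3,
      ← integral_smul_primitive hqi (integrable_continuous hη), sub_eq_zero]
    have i4 : Integrable (fun t => (∫ τ in t..T, η τ) • (G t - a t (x t))) (timeMeasure T) :=
      integrable_smul_continuous (continuous_tail hη) hqi
    ext χ
    let ψ : C(ℝ, V) := ⟨fun t => η t • χ, by fun_prop⟩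
    have hψ : ∀ t, ∫ τ in t..T, ψ τ = (∫ τ in t..T, η τ) • χ := fun t =>
      intervalIntegral.integral_smul_const _ _
    have h1 := hx ψ
    have h2 : inner ℝ x (adjointMap ha ψ) = ∫ t, (η t * inner ℝ (ι (x t)) (ι χ) +
        (∫ τ in t..T, η τ) * a t (x t) χ) ∂(timeMeasure T) := by
      rw [L2.inner_def]
      refine integral_congr_ae ?_
      filter_upwards [(memLp_adjointFun ha ψ).coeFn_toLp] with t h2
      have h2' : (adjointMap ha ψ) t = adjointFun T ι a ψ t := h2
      rw [h2', inner_adjointFun, hψ]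
      change inner ℝ (ι (η t • χ)) _ + _ = _
      rw [map_smul, inner_smul_left, map_smul, real_inner_comm]
      rfl
    have h3 : rhsMap (ι := ι) hG w₀ ψ = (∫ t, (∫ τ in t..T, η τ) * G t χ ∂(timeMeasure T)) +
        (∫ τ in 0..T, η τ) * inner ℝ w₀ (ι χ) := by
      change (∫ t, G t (∫ τ in t..T, ψ τ) ∂(timeMeasure T)) + inner ℝ w₀ (ι (∫ τ in 0..T, ψ τ)) = _
      simp only [hψ, map_smul, inner_smul_right, smul_eq_mul]
    rw [h2, h3] at h1
    have hapχ := ContinuousLinearMap.apply ℝ ℝ χ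
    have j1 : Integrable (fun t => η t * inner ℝ (ι (x t)) (ι χ)) (timeMeasure T) :=
      (ContinuousLinearMap.apply ℝ ℝ χ).integrable_comp i1
    have j2 : Integrable (fun t => (∫ τ in t..T, η τ) * a t (x t) χ) (timeMeasure T) :=
      (ContinuousLinearMap.apply ℝ ℝ χ).integrable_comp (integrable_smul_continuous
        (continuous_tail hη) ((ha.memLp hxm).integrable (by norm_num)))
    have j3 : Integrable (fun t => (∫ τ in t..T, η τ) * G t χ) (timeMeasure T) :=
      (ContinuousLinearMap.apply ℝ ℝ χ).integrable_comp (integrable_smul_continuous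
        (continuous_tail hη) (hG.integrable (by norm_num)))
    rw [integral_add j1 j2] at h1
    rw [_root_.add_apply, ContinuousLinearMap.integral_apply i1, ContinuousLinearMap.integral_apply i2,
      ContinuousLinearMap.integral_apply i4]
    simp only [_root_.smul_apply, _root_.sub_apply, dualEmb_apply, smul_eq_mul, mul_sub]
    rw [integral_sub j3 j2, integral_mul_const, integral_timeMeasure hT.le η]
    linarith)
  filter_upwards [hzero] with t ht
  exact sub_eq_zero.1 ht

end Lions
end Existence

/-! ### Regular solutions: coercivity and the variational problem for forms Lipschitz in time -/

section Regularity

open Filter Topology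

variable {T : ℝ} {V H : Type*} [NormedAddCommGroup V] [InnerProductSpace ℝ V]
  [NormedAddCommGroup H] [InnerProductSpace ℝ H]
variable {ι : V →L[ℝ] H} {a : ℝ → V →L[ℝ] V →L[ℝ] ℝ} {M α l : ℝ} {L : ℝ≥0}

lemma abs_form_sub_le (hL : LipschitzWith L a) (s t : ℝ) (u v : V) :
    |a t u v - a s u v| ≤ L * |t - s| * (‖u‖ * ‖v‖) := by
  have h1 := (a t - a s).le_opNorm₂ u v
  have h2 : ‖a t - a s‖ ≤ L * |t - s| := by
    have := hL.dist_le_mul t s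
    rwa [dist_eq_norm, Real.dist_eq] at this
  calc |a t u v - a s u v| = ‖(a t - a s) u v‖ := rfl
    _ ≤ ‖a t - a s‖ * (‖u‖ * ‖v‖) := by rw [← mul_assoc]; exact h1
    _ ≤ _ := by gcongr

/-- Product rule, in integrated form, for a bilinear form that is Lipschitz in time. -/
lemma form_sub_le_integral (hT : 0 ≤ T) (hL : LipschitzWith L a) {u v u' v' : ℝ → V}
    (hu : ∀ t, HasDerivAt u (u' t) t) (hv : ∀ t, HasDerivAt v (v' t) t)
    (hu' : Continuous u') (hv' : Continuous v') :
    a T (u T) (v T) - a 0 (u 0) (v 0) ≤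
      ∫ t, (a t (u' t) (v t) + a t (u t) (v' t) + L * (‖u t‖ * ‖v t‖)) ∂(timeMeasure T) := by
  have hac := hL.continuous
  have huc : Continuous u := continuous_iff_continuousAt.2 fun t => (hu t).continuousAt
  have hvc : Continuous v := continuous_iff_continuousAt.2 fun t => (hv t).continuousAt
  obtain ⟨d, hd⟩ : ∃ d : ℝ → ℝ, d = fun t => a t (u' t) (v t) + a t (u t) (v' t) +
    L * (‖u t‖ * ‖v t‖) := ⟨_, rfl⟩
  have hdc : Continuous d := by rw [hd]; fun_prop
  have hB : ∀ x, HasDerivAt (fun t => a 0 (u 0) (v 0) + ∫ τ in 0..t, d τ) (d x) x := fun x =>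
    (hdc.integral_hasStrictDerivAt 0 x).hasDerivAt.const_add _
  -- The form is only Lipschitz in time, so `t ↦ a(t; u, v)` need not be differentiable. An upper
  -- bound for its right difference quotients is enough: the time increment of `a` contributes `L
  -- ‖u‖ ‖v‖`, the rest is a derivative with `a` frozen.
  have key := image_le_of_liminf_slope_right_le_deriv_boundary
    (f := fun t => a t (u t) (v t)) (a := 0) (b := T) (by fun_prop)
    (B := fun t => a 0 (u 0) (v 0) + ∫ τ in 0..t, d τ) (B' := d) (by simp)
    (fun x _ => (hB x).continuousAt.continuousWithinAt)
    (fun x _ => (hB x).hasDerivWithinAt) (by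
      intro x hx r hr
      refine Eventually.frequently ?_
      have h1 : Tendsto (slope (fun z => a x (u z) (v z)) x) (𝓝[>] x)
          (𝓝 (a x (u x) (v' x) + a x (u' x) (v x))) :=
        (hasDerivAt_iff_tendsto_slope.1
          ((a x).hasDerivAt_of_bilinear (fun _ => hu x) (fun _ => hv x))).mono_left
          (nhdsWithin_mono _ fun z hz => ne_of_gt hz)
      have h2 : Tendsto (fun z => L * (‖u z‖ * ‖v z‖)) (𝓝[>] x) (𝓝 (L * (‖u x‖ * ‖v x‖))) :=
        ((by fun_prop : Continuous fun z => (L : ℝ) * (‖u z‖ * ‖v z‖)).tendsto x).mono_left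
          nhdsWithin_le_nhds
      have h3 := (h1.add h2).eventually_lt_const (u := r) (by
        rw [hd] at hr; simp only at hr; linarith)
      filter_upwards [h3, self_mem_nhdsWithin] with z hz hzx
      refine lt_of_le_of_lt ?_ hz
      have hpos : 0 < z - x := sub_pos.2 hzx
      have h4 := (le_abs_self _).trans (abs_form_sub_le hL x z (u z) (v z))
      rw [abs_of_pos hpos] at h4
      rw [slope_def_field, slope_def_field, ← sub_le_iff_le_add', ← sub_div, div_le_iff₀ hpos]
      linarith)
    (right_mem_Icc.2 hT)
  rw [integral_timeMeasure hT]
  rw [hd] at key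
  linarith

/-- The one-sided estimate is applied to `a` and to `-a`. -/
lemma abs_integral_form_sub_le (hT : 0 ≤ T) (hL : LipschitzWith L a) {u v u' v' : ℝ → V}
    (hu : ∀ t, HasDerivAt u (u' t) t) (hv : ∀ t, HasDerivAt v (v' t) t)
    (hu' : Continuous u') (hv' : Continuous v') :
    |(∫ t, (a t (u' t) (v t) + a t (u t) (v' t)) ∂(timeMeasure T)) -
      (a T (u T) (v T) - a 0 (u 0) (v 0))| ≤ ∫ t, L * (‖u t‖ * ‖v t‖) ∂(timeMeasure T) := by
  have hac := hL.continuous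
  have huc : Continuous u := continuous_iff_continuousAt.2 fun t => (hu t).continuousAt
  have hvc : Continuous v := continuous_iff_continuousAt.2 fun t => (hv t).continuousAt
  have i1 : Integrable (fun t => a t (u' t) (v t) + a t (u t) (v' t)) (timeMeasure T) :=
    integrable_continuous (by fun_prop)
  have i2 : Integrable (fun t => L * (‖u t‖ * ‖v t‖)) (timeMeasure T) :=
    integrable_continuous (by fun_prop)
  have h1 := form_sub_le_integral hT hL hu hv hu' hv'
  have h2 := form_sub_le_integral hT hL.neg hu hv hu' hv'
  rw [integral_add i1 i2] at h1
  have h3 : ∫ t, ((-a) t (u' t) (v t) + (-a) t (u t) (v' t) + L * (‖u t‖ * ‖v t‖))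
      ∂(timeMeasure T) = -(∫ t, (a t (u' t) (v t) + a t (u t) (v' t)) ∂(timeMeasure T)) +
        ∫ t, L * (‖u t‖ * ‖v t‖) ∂(timeMeasure T) := by
    have i3 : Integrable (fun t => -(a t (u' t) (v t) + a t (u t) (v' t))) (timeMeasure T) := i1.neg
    rw [← integral_neg, ← integral_add i3 i2]
    refine integral_congr_ae (.of_forall fun t => ?_)
    simp only [Pi.neg_apply, _root_.neg_apply]
    ring
  rw [h3] at h2
  simp only [Pi.neg_apply, _root_.neg_apply] at h2
  rw [abs_le]
  constructor <;> linarith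

/-- Continuous functions as elements of `L²(0,T;E)`. -/
def contLp (T : ℝ) (E : Type*) [NormedAddCommGroup E] [NormedSpace ℝ E] :
    C(ℝ, E) →ₗ[ℝ] Lp E 2 (timeMeasure T) where
  toFun ψ := (memLp_continuous ψ.continuous 2).toLp ψ
  map_add' _ _ := rfl
  map_smul' _ _ := rfl

lemma coeFn_contLp {E : Type*} [NormedAddCommGroup E] [NormedSpace ℝ E] (ψ : C(ℝ, E)) :
    contLp T E ψ =ᵐ[timeMeasure T] ψ := (memLp_continuous ψ.continuous 2).coeFn_toLp

lemma norm_contLp_sq {E : Type*} [NormedAddCommGroup E] [NormedSpace ℝ E] (ψ : C(ℝ, E)) :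
    ‖contLp T E ψ‖ ^ 2 = ∫ t, ‖ψ t‖ ^ 2 ∂(timeMeasure T) :=
  norm_toLp_sq (memLp_continuous ψ.continuous 2)

lemma inner_contLp {E : Type*} [NormedAddCommGroup E] [InnerProductSpace ℝ E]
    (f : Lp E 2 (timeMeasure T)) (ψ : C(ℝ, E)) :
    inner ℝ f (contLp T E ψ) = ∫ t, inner ℝ (f t) (ψ t) ∂(timeMeasure T) := by
  rw [L2.inner_def]
  refine integral_congr_ae ?_
  filter_upwards [coeFn_contLp ψ] with t ht
  rw [ht]

variable [CompleteSpace V]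

/-- The coercivity estimate behind the `H¹(0,T;H)` regularity. -/
lemma regularity_lower_bound (hT : 0 ≤ T) (ha : IsParabolicForm T ι a M α l)
    (hs : ∀ t u v, a t u v = a t v u) (hL : LipschitzWith L a) {κ : ℝ}
    (hκ : κ * α = L + l ^ 2 * ‖ι‖ ^ 2 + 1) (hκ0 : 0 ≤ κ) {ψ φ : ℝ → V} (hψ : Continuous ψ)
    (hφ : ∀ t, HasDerivAt φ (ψ t) t) (hφ0 : φ 0 = 0) :
    Real.exp (-κ * T) * (∫ t, ‖ι (ψ t)‖ ^ 2 ∂(timeMeasure T) + ∫ t, ‖φ t‖ ^ 2 ∂(timeMeasure T) +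
      α * ‖φ T‖ ^ 2) ≤
      2 * ∫ t, Real.exp (-κ * t) * (‖ι (ψ t)‖ ^ 2 + a t (φ t) (ψ t)) ∂(timeMeasure T) := by
  have hac := hL.continuous
  have hφc : Continuous φ := continuous_iff_continuousAt.2 fun t => (hφ t).continuousAt
  -- Adding the zero order term of Gårding's inequality makes the form coercive with constant `α`
  -- without changing its Lipschitz constant.
  obtain ⟨b, hb⟩ : ∃ b : ℝ → V →L[ℝ] V →L[ℝ] ℝ,
    b = fun t => a t + l • (dualEmb ι).comp ι := ⟨_, rfl⟩
  have hbe : ∀ t u v, b t u v = a t u v + l * inner ℝ (ι u) (ι v) := fun t u v => by rw [hb]; rfl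
  have hbL : LipschitzWith L b := by
    rw [hb]
    refine LipschitzWith.of_dist_le_mul fun s t => ?_
    rw [dist_add_right]; exact hL.dist_le_mul s t
  have hρ : ∀ t, HasDerivAt (fun t => Real.exp (-κ * t)) (Real.exp (-κ * t) * (-κ)) t := fun t => by
    simpa using ((hasDerivAt_id' t).const_mul (-κ)).exp
  -- The product rule is applied to `exp(-κt) b(t; φ, φ)`, which vanishes at `0`. The weight
  -- contributes `-κ b(t; φ, φ)`, at most `-κ α ‖φ‖²`. By the choice of `κ` this pays for the
  -- Lipschitz error `L`, for `l² ‖ι‖²` (from splitting `2l (ι φ, ι ψ)`), and leaves `‖φ‖²`.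
  have h1 := form_sub_le_integral hT hbL
    (u := fun t => Real.exp (-κ * t) • φ t) (v := φ)
    (u' := fun t => Real.exp (-κ * t) • ψ t + (Real.exp (-κ * t) * (-κ)) • φ t) (v' := ψ)
    (fun t => (hρ t).smul (hφ t)) hφ (by fun_prop) hψ
  have hbs : ∀ t, b t (ψ t) (φ t) = b t (φ t) (ψ t) := fun t => by
    rw [hbe, hbe, hs, real_inner_comm]
  have hG : ∀ t u, α * ‖u‖ ^ 2 ≤ b t u u := fun t u => by
    rw [hbe, real_inner_self_eq_norm_sq]; exact ha.garding t u
  have h2 : ∫ t, (b t (Real.exp (-κ * t) • ψ t + (Real.exp (-κ * t) * (-κ)) • φ t) (φ t) +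
        b t (Real.exp (-κ * t) • φ t) (ψ t) + L * (‖Real.exp (-κ * t) • φ t‖ * ‖φ t‖))
        ∂(timeMeasure T) ≤
      ∫ t, (2 * (Real.exp (-κ * t) * (‖ι (ψ t)‖ ^ 2 + a t (φ t) (ψ t))) -
        Real.exp (-κ * T) * (‖ι (ψ t)‖ ^ 2 + ‖φ t‖ ^ 2)) ∂(timeMeasure T) := by
    have hbc := hbL.continuous
    refine integral_mono_ae (integrable_continuous (by fun_prop))
      (integrable_continuous (by fun_prop)) ?_
    filter_upwards [ae_timeMeasure_mem] with t ht
    have g0 : Real.exp (-κ * T) ≤ Real.exp (-κ * t) := by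
      rw [Real.exp_le_exp]; nlinarith [ht.2]
    have g1 := hG t (φ t)
    have g2 : 0 < Real.exp (-κ * t) := Real.exp_pos _
    have g3 : ‖ι (φ t)‖ ^ 2 ≤ ‖ι‖ ^ 2 * ‖φ t‖ ^ 2 := by
      rw [← mul_pow]; gcongr; exact ι.le_opNorm _
    have g4 := real_inner_le_norm (ι (φ t)) (ι (ψ t))
    simp only [map_add, map_smul, _root_.add_apply, _root_.smul_apply, smul_eq_mul, norm_smul,
      Real.norm_of_nonneg g2.le, hbs]
    generalize Real.exp (-κ * t) = r at *
    have g5 : l * inner ℝ (ι (φ t)) (ι (ψ t)) ≤ (‖ι (ψ t)‖ ^ 2 + l ^ 2 * ‖ι (φ t)‖ ^ 2) / 2 := by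
      have := mul_le_mul_of_nonneg_left g4 ha.l_nonneg
      nlinarith [sq_nonneg (‖ι (ψ t)‖ - l * ‖ι (φ t)‖)]
    have g6 : κ * b t (φ t) (φ t) ≥ (L + l ^ 2 * ‖ι‖ ^ 2 + 1) * ‖φ t‖ ^ 2 := by
      rw [← hκ, mul_assoc]; exact mul_le_mul_of_nonneg_left g1 hκ0
    have g7 : l ^ 2 * ‖ι (φ t)‖ ^ 2 ≤ l ^ 2 * (‖ι‖ ^ 2 * ‖φ t‖ ^ 2) :=
      mul_le_mul_of_nonneg_left g3 (sq_nonneg l)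
    have g8 : 2 * b t (φ t) (ψ t) - κ * b t (φ t) (φ t) + L * ‖φ t‖ ^ 2 ≤
        2 * (‖ι (ψ t)‖ ^ 2 + a t (φ t) (ψ t)) - (‖ι (ψ t)‖ ^ 2 + ‖φ t‖ ^ 2) := by
      rw [hbe t (φ t) (ψ t)]; linarith
    have g9 := mul_le_mul_of_nonneg_left g8 g2.le
    have g10 : Real.exp (-κ * T) * (‖ι (ψ t)‖ ^ 2 + ‖φ t‖ ^ 2) ≤
        r * (‖ι (ψ t)‖ ^ 2 + ‖φ t‖ ^ 2) := by gcongr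
    nlinarith
  have i1 : Integrable (fun t => 2 * (Real.exp (-κ * t) * (‖ι (ψ t)‖ ^ 2 + a t (φ t) (ψ t))))
    (timeMeasure T) := integrable_continuous (by fun_prop)
  have i2 : Integrable (fun t => ‖ι (ψ t)‖ ^ 2) (timeMeasure T) :=
    integrable_continuous (by fun_prop)
  have i3 : Integrable (fun t => ‖φ t‖ ^ 2) (timeMeasure T) := integrable_continuous (by fun_prop)
  have i4 : Integrable (fun t => Real.exp (-κ * T) * (‖ι (ψ t)‖ ^ 2 + ‖φ t‖ ^ 2))
    (timeMeasure T) := (i2.add i3).const_mul _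
  rw [integral_sub i1 i4, integral_const_mul, integral_const_mul, integral_add i2 i3] at h2
  have h3 := hG T (φ T)
  have h5 := h1.trans h2
  simp only [hφ0, map_zero, sub_zero, map_smul, _root_.smul_apply, smul_eq_mul] at h5
  have h4 := mul_le_mul_of_nonneg_left h3 (Real.exp_pos (-κ * T)).le
  nlinarith

/-- The components of the operator whose adjoint is inverted in the regularity theorem. -/
def regularityMap (T : ℝ) (ι : V →L[ℝ] H) [CompleteSpace H] (hac : Continuous a) (κ : ℝ) :
    C(ℝ, V) × C(ℝ, H) →ₗ[ℝ] WithLp 2 (Lp V 2 (timeMeasure T) × Lp H 2 (timeMeasure T)) :=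
  let K₁ : C(ℝ, V) × C(ℝ, H) →ₗ[ℝ] C(ℝ, V) :=
    { toFun := fun q => ⟨fun t => Real.exp (-κ * t) •
          (InnerProductSpace.toDual ℝ V).symm ((a t).flip (q.1 t)) + ι.adjoint (q.2 t), by
        have h1 : Continuous fun t => (a t).flip (q.1 t) :=
          ((ContinuousLinearMap.flipₗᵢ ℝ V V ℝ).continuous.comp hac).clm_apply q.1.continuous
        have h2 := (InnerProductSpace.toDual ℝ V).symm.continuous.comp h1
        exact ((by fun_prop : Continuous fun t => Real.exp (-κ * t)).smul h2).add (by fun_prop)⟩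
      map_add' := fun q q' => by
        ext t
        have := (InnerProductSpace.toDual ℝ V).symm.toLinearEquiv.toLinearMap.map_add
          ((a t).flip (q.1 t)) ((a t).flip (q'.1 t))
        change Real.exp (-κ * t) • (InnerProductSpace.toDual ℝ V).symm
          ((a t).flip (q.1 t + q'.1 t)) + ι.adjoint (q.2 t + q'.2 t) = (_ + _) + (_ + _)
        rw [map_add ((a t).flip), map_add ι.adjoint, add_add_add_comm, ← smul_add]
        exact congrArg₂ (· + ·) (congrArg _ this) rfl
      map_smul' := fun c q => by
        ext t
        have := (InnerProductSpace.toDual ℝ V).symm.toLinearEquiv.toLinearMap.map_smul c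
          ((a t).flip (q.1 t))
        change Real.exp (-κ * t) • (InnerProductSpace.toDual ℝ V).symm
          ((a t).flip (c • q.1 t)) + ι.adjoint (c • q.2 t) = c • (_ + _)
        rw [map_smul ((a t).flip), map_smul ι.adjoint, smul_add, smul_comm c]
        exact congrArg₂ (· + ·) (congrArg _ this) rfl }
  let K₂ : C(ℝ, V) × C(ℝ, H) →ₗ[ℝ] C(ℝ, H) :=
    { toFun := fun q => ⟨fun t => Real.exp (-κ * t) • ι (q.1 t) - ∫ τ in t..T, q.2 τ, by
        have := continuous_tail (T := T) q.2.continuous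
        fun_prop⟩
      map_add' := fun q q' => by
        ext t
        change Real.exp (-κ * t) • ι (q.1 t + q'.1 t) - ∫ τ in t..T, (q.2 τ + q'.2 τ) =
          (_ - _) + (_ - _)
        rw [intervalIntegral.integral_add (q.2.continuous.intervalIntegrable _ _)
          (q'.2.continuous.intervalIntegrable _ _), map_add, smul_add, add_sub_add_comm]
      map_smul' := fun c q => by
        ext t
        change Real.exp (-κ * t) • ι (c • q.1 t) - ∫ τ in t..T, c • q.2 τ = c • (_ - _)
        rw [intervalIntegral.integral_smul, map_smul, smul_sub, smul_comm c] }
  (WithLp.linearEquiv 2 ℝ _).symm.toLinearMap.comp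
    (((contLp T V).comp K₁).prod ((contLp T H).comp K₂))

/-- The unknown is a pair `x = (z, p)`, meant to be `z = w - w₀` and `p = w'`. The terms with `ψ`
are the weighted equation `p + a z = q`; those with `η` are the constraint `ι z = ∫₀ᵗ p`. -/
lemma inner_regularityMap [CompleteSpace H] (hac : Continuous a) (κ : ℝ)
    (x : WithLp 2 (Lp V 2 (timeMeasure T) × Lp H 2 (timeMeasure T))) (ψ : C(ℝ, V)) (η : C(ℝ, H)) :
    inner ℝ x (regularityMap T ι hac κ (ψ, η)) =
      ∫ t, (Real.exp (-κ * t) * a t (x.fst t) (ψ t) + inner ℝ (ι (x.fst t)) (η t))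
        ∂(timeMeasure T) +
      ∫ t, (Real.exp (-κ * t) * inner ℝ (x.snd t) (ι (ψ t)) -
        inner ℝ (x.snd t) (∫ τ in t..T, η τ)) ∂(timeMeasure T) := by
  rw [WithLp.prod_inner_apply]
  refine congrArg₂ (· + ·) ((inner_contLp _ _).trans ?_) ((inner_contLp _ _).trans ?_)
  · refine integral_congr_ae (.of_forall fun t => ?_)
    change inner ℝ (x.fst t) (Real.exp (-κ * t) • (InnerProductSpace.toDual ℝ V).symm
      ((a t).flip (ψ t)) + ι.adjoint (η t)) = _
    rw [inner_add_right, inner_smul_right, real_inner_comm, InnerProductSpace.toDual_symm_apply,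
      ContinuousLinearMap.adjoint_inner_right]
    rfl
  · refine integral_congr_ae (.of_forall fun t => ?_)
    change inner ℝ (x.snd t) (Real.exp (-κ * t) • ι (ψ t) - ∫ τ in t..T, η τ) = _
    rw [inner_sub_right, inner_smul_right]

end Regularity

/-! ### Solvability and meaning of the variational problem -/

section Regularity

open Filter Topology

variable {T : ℝ} {V H : Type*} [NormedAddCommGroup V] [InnerProductSpace ℝ V]
  [NormedAddCommGroup H] [InnerProductSpace ℝ H]
variable {ι : V →L[ℝ] H} {a : ℝ → V →L[ℝ] V →L[ℝ] ℝ} {M α l : ℝ} {L : ℝ≥0}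
variable [CompleteSpace V]

/-- The right hand side in the regularity theorem. -/
def regularityRhs (T κ : ℝ) {q : ℝ → StrongDual ℝ V} (hq : MemLp q 2 (timeMeasure T)) :
    C(ℝ, V) →ₗ[ℝ] ℝ where
  toFun ψ := ∫ t, Real.exp (-κ * t) * q t (ψ t) ∂(timeMeasure T)
  map_add' ψ ψ' := by
    have h : ∀ ψ : C(ℝ, V), Integrable (fun t => Real.exp (-κ * t) * q t (ψ t)) (timeMeasure T) :=
      fun ψ => integrable_smul_continuous (θ := fun t => Real.exp (-κ * t))
        (by fun_prop) (integrable_dual_apply hq (memLp_continuous (T := T) ψ.continuous 2))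
    rw [← integral_add (h ψ) (h ψ')]
    refine integral_congr_ae (.of_forall fun t => ?_)
    simp only [ContinuousMap.add_apply, map_add]
    ring
  map_smul' c ψ := by
    rw [RingHom.id_apply, smul_eq_mul, ← integral_const_mul]
    refine integral_congr_ae (.of_forall fun t => ?_)
    simp only [ContinuousMap.smul_apply, map_smul, smul_eq_mul]
    ring

/-- As `w₀` lies only in `V`, the functional `a(t; w₀, ·)` is not controlled by the norm of `H`, and
`ψ = φ'` is estimated only there. Integrating by parts moves the derivative to the weight and to the
Lipschitz form, so that only norms of `φ` in `V` remain. -/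
lemma abs_integral_exp_form_le (hT : 0 ≤ T) (ha : IsParabolicForm T ι a M α l)
    (hL : LipschitzWith L a) {κ : ℝ} (hκ0 : 0 ≤ κ) (w₀ : V) {ψ φ : ℝ → V} (hψ : Continuous ψ)
    (hφ : ∀ t, HasDerivAt φ (ψ t) t) (hφ0 : φ 0 = 0) :
    |∫ t, Real.exp (-κ * t) * a t w₀ (ψ t) ∂(timeMeasure T)| ≤
      ‖w₀‖ * (M * ‖φ T‖ + (κ * M + L) * ∫ t, ‖φ t‖ ∂(timeMeasure T)) := by
  have hac := hL.continuous
  have hφc : Continuous φ := continuous_iff_continuousAt.2 fun t => (hφ t).continuousAt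
  have hρ : ∀ t, HasDerivAt (fun t => Real.exp (-κ * t)) (Real.exp (-κ * t) * (-κ)) t := fun t => by
    simpa using ((hasDerivAt_id' t).const_mul (-κ)).exp
  have h1 := abs_integral_form_sub_le hT hL (u := fun t => Real.exp (-κ * t) • w₀) (v := φ)
    (u' := fun t => (Real.exp (-κ * t) * (-κ)) • w₀) (v' := ψ)
    (fun t => (hρ t).smul_const w₀) hφ (by fun_prop) hψ
  simp only [hφ0, map_zero, sub_zero, map_smul, _root_.smul_apply, smul_eq_mul] at h1
  have i1 : Integrable (fun t => Real.exp (-κ * t) * -κ * a t w₀ (φ t)) (timeMeasure T) :=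
    integrable_continuous (by fun_prop)
  have i2 : Integrable (fun t => Real.exp (-κ * t) * a t w₀ (ψ t)) (timeMeasure T) :=
    integrable_continuous (by fun_prop)
  have i3 : Integrable (fun t => ‖φ t‖) (timeMeasure T) := integrable_continuous (by fun_prop)
  rw [integral_add i1 i2] at h1
  have hM := ha.bound_nonneg
  have hρ1 : ∀ t, 0 ≤ t → Real.exp (-κ * t) ≤ 1 := fun t ht => by
    rw [Real.exp_le_one_iff]; nlinarith
  have hform : ∀ t v, |a t w₀ v| ≤ M * ‖w₀‖ * ‖v‖ := fun t v =>
    ((a t w₀).le_opNorm v).trans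
      (mul_le_mul_of_nonneg_right (ha.norm_apply_le t w₀) (norm_nonneg v))
  have h2 : |∫ t, Real.exp (-κ * t) * -κ * a t w₀ (φ t) ∂(timeMeasure T)| ≤
      ∫ t, κ * (M * ‖w₀‖) * ‖φ t‖ ∂(timeMeasure T) := by
    rw [← Real.norm_eq_abs]
    refine norm_integral_le_of_norm_le (i3.const_mul _) ?_
    filter_upwards [ae_timeMeasure_mem] with t ht
    rw [norm_mul, norm_mul, Real.norm_of_nonneg (Real.exp_pos _).le, norm_neg,
      Real.norm_of_nonneg hκ0]
    calc _ ≤ 1 * κ * (M * ‖w₀‖ * ‖φ t‖) := by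
          gcongr
          · exact hρ1 t ht.1.le
          · exact hform t _
      _ = _ := by ring
  have h3 : ∫ t, L * (‖Real.exp (-κ * t) • w₀‖ * ‖φ t‖) ∂(timeMeasure T) ≤
      ∫ t, L * ‖w₀‖ * ‖φ t‖ ∂(timeMeasure T) := by
    refine integral_mono_ae (integrable_continuous (by fun_prop)) (i3.const_mul _) ?_
    filter_upwards [ae_timeMeasure_mem] with t ht
    rw [norm_smul, Real.norm_of_nonneg (Real.exp_pos _).le]
    calc _ ≤ L * (1 * ‖w₀‖ * ‖φ t‖) := by gcongr; exact hρ1 t ht.1.le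
      _ = _ := by ring
  have h4 : |Real.exp (-κ * T) * a T w₀ (φ T)| ≤ 1 * (M * ‖w₀‖ * ‖φ T‖) := by
    rw [abs_mul, abs_of_pos (Real.exp_pos _)]
    gcongr
    · exact hρ1 T hT
    · exact hform T _
  rw [integral_const_mul] at h2
  rw [integral_const_mul (L * ‖w₀‖)] at h3
  have h5 := abs_le.1 (h1.trans h3)
  have h6 := abs_le.1 h2
  have h7 := abs_le.1 h4
  rw [abs_le]
  constructor <;> nlinarith

/-- Solvability of the variational problem behind the regularity theorem. -/
theorem exists_regularity_pair [SeparableSpace V] [CompleteSpace H] (hT : 0 < T)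
    (ha : IsParabolicForm T ι a M α l)
    (hs : ∀ t u v, a t u v = a t v u) (hL : LipschitzWith L a) :
    ∃ κ C : ℝ, 0 ≤ C ∧ ∀ (G : ℝ → StrongDual ℝ V) (g : ℝ → ℝ) (w₀ : V)
      (hq : MemLp (fun t => G t - a t w₀) 2 (timeMeasure T)), MemLp G 2 (timeMeasure T) →
      ∀ (hg : MemLp g 2 (timeMeasure T)),
      (∀ᵐ t ∂(timeMeasure T), ∀ v, |G t v| ≤ g t * ‖ι v‖) →
      ∃ x : WithLp 2 (Lp V 2 (timeMeasure T) × Lp H 2 (timeMeasure T)),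
        ‖x‖ ≤ C * (‖hg.toLp g‖ + ‖w₀‖) ∧ ∀ q, inner ℝ x (regularityMap T ι hL.continuous κ q) =
          regularityRhs T κ hq q.1 := by
  have hα := ha.alpha_pos
  have hM := ha.bound_nonneg
  have hac := hL.continuous
  obtain ⟨κ, hκd⟩ : ∃ κ : ℝ, κ = (L + l ^ 2 * ‖ι‖ ^ 2 + 1) / α := ⟨_, rfl⟩
  have hκ : κ * α = L + l ^ 2 * ‖ι‖ ^ 2 + 1 := by rw [hκd]; field_simp
  have hκ0 : 0 ≤ κ := by rw [hκd]; positivity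
  -- The `1/2` undoes the factor `2` of `regularity_lower_bound`; `min 1 α` treats `‖y‖²` and `α
  -- ‖φ(T)‖²` together.
  obtain ⟨c, hc⟩ : ∃ c : ℝ, c = Real.exp (-κ * T) * min 1 α / 2 := ⟨_, rfl⟩
  have hc0 : 0 < c := by rw [hc]; have : 0 < min 1 α := lt_min one_pos hα; positivity
  obtain ⟨C₁, hC₁⟩ : ∃ C₁ : ℝ, C₁ = (1 + M + (κ * M + L) * √T) / c := ⟨_, rfl⟩
  have hC₁0 : 0 ≤ C₁ := by rw [hC₁]; positivity
  refine ⟨κ, C₁, hC₁0, fun G g w₀ hq hG hg hGg => ?_⟩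
  exact exists_inner_eq_of_le_norm (regularityMap T ι hac κ)
    ((regularityRhs T κ hq).comp (LinearMap.fst ℝ _ _)) (C := C₁ * (‖hg.toLp g‖ + ‖w₀‖))
    (by positivity) (by
    rintro ⟨ψ, η⟩
    obtain ⟨φ, hφe⟩ : ∃ φ : ℝ → V, φ = fun t => ∫ τ in 0..t, ψ τ := ⟨_, rfl⟩
    have hφd : ∀ t, HasDerivAt φ (ψ t) t := fun t => by
      rw [hφe]; exact (ψ.continuous.integral_hasStrictDerivAt 0 t).hasDerivAt
    have hφ0 : φ 0 = 0 := by rw [hφe]; simp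
    have hφc : Continuous φ := continuous_iff_continuousAt.2 fun t => (hφd t).continuousAt
    obtain ⟨k, hk⟩ : ∃ k : ℝ, k = ‖regularityMap T ι hac κ (ψ, η)‖ := ⟨_, rfl⟩
    have hιψ : Continuous fun t => ι (ψ t) := by fun_prop
    -- The multiplier `(φ, ι φ')` satisfies the constraint exactly, so all terms with `η` cancel by
    -- Fubini on the triangle and only the coercive expression in `ψ` survives.
    obtain ⟨y, hy⟩ : ∃ y : WithLp 2 (Lp V 2 (timeMeasure T) × Lp H 2 (timeMeasure T)),
      y = WithLp.toLp 2 (contLp T V ⟨φ, hφc⟩, contLp T H ⟨_, hιψ⟩) := ⟨_, rfl⟩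
    have hy1 : y.fst =ᵐ[timeMeasure T] φ := by rw [hy]; exact coeFn_contLp _
    have hy2 : y.snd =ᵐ[timeMeasure T] fun t => ι (ψ t) := by rw [hy]; exact coeFn_contLp _
    have hyn : ‖y‖ ^ 2 = ∫ t, ‖ι (ψ t)‖ ^ 2 ∂(timeMeasure T) + ∫ t, ‖φ t‖ ^ 2 ∂(timeMeasure T) := by
      rw [WithLp.prod_norm_sq_eq_of_L2, hy, add_comm]
      exact congrArg₂ (· + ·) (norm_contLp_sq _) (norm_contLp_sq _)
    have hE : inner ℝ y (regularityMap T ι hac κ (ψ, η)) =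
        ∫ t, Real.exp (-κ * t) * (‖ι (ψ t)‖ ^ 2 + a t (φ t) (ψ t)) ∂(timeMeasure T) := by
      have htail := continuous_tail (T := T) η.continuous
      have j1 : Integrable (fun t => Real.exp (-κ * t) * a t (φ t) (ψ t)) (timeMeasure T) :=
        integrable_continuous (by fun_prop)
      have j2 : Integrable (fun t => inner ℝ (ι (φ t)) (η t)) (timeMeasure T) :=
        integrable_continuous (by fun_prop)
      have j3 : Integrable (fun t => Real.exp (-κ * t) * inner ℝ (ι (ψ t)) (ι (ψ t)))
        (timeMeasure T) := integrable_continuous (by fun_prop)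
      have j4 : Integrable (fun t => inner ℝ (ι (ψ t)) (∫ τ in t..T, η τ)) (timeMeasure T) :=
        integrable_continuous (by fun_prop)
      have e1 : ∫ t, (Real.exp (-κ * t) * a t (y.fst t) (ψ t) + inner ℝ (ι (y.fst t)) (η t))
          ∂(timeMeasure T) = ∫ t, (Real.exp (-κ * t) * a t (φ t) (ψ t) + inner ℝ (ι (φ t)) (η t))
          ∂(timeMeasure T) := integral_congr_ae (by filter_upwards [hy1] with t h; rw [h])
      have e2 : ∫ t, (Real.exp (-κ * t) * inner ℝ (y.snd t) (ι (ψ t)) -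
          inner ℝ (y.snd t) (∫ τ in t..T, η τ)) ∂(timeMeasure T) =
          ∫ t, (Real.exp (-κ * t) * inner ℝ (ι (ψ t)) (ι (ψ t)) -
          inner ℝ (ι (ψ t)) (∫ τ in t..T, η τ)) ∂(timeMeasure T) :=
        integral_congr_ae (by filter_upwards [hy2] with t h; rw [h])
      have e3 : ∫ t, inner ℝ (ι (ψ t)) (∫ τ in t..T, η τ) ∂(timeMeasure T) =
          ∫ τ, inner ℝ (∫ t in 0..τ, ι (ψ t)) (η τ) ∂(timeMeasure T) :=
        integral_bilin_primitive (innerSL ℝ)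
          (integrable_continuous (T := T) hιψ) (integrable_continuous (T := T) η.continuous)
      have e4 : ∀ t, ∫ τ in 0..t, ι (ψ τ) = ι (φ t) := fun t => by
        rw [hφe]
        exact ι.intervalIntegral_comp_comm (ψ.continuous.intervalIntegrable _ _)
      simp only [e4] at e3
      rw [inner_regularityMap, e1, e2, integral_add j1 j2, integral_sub j3 j4, e3]
      simp only [mul_add, real_inner_self_eq_norm_sq] at j3 ⊢
      rw [integral_add j3 j1]
      ring
    have hlow := regularity_lower_bound hT.le ha hs hL hκ hκ0 ψ.continuous hφd hφ0
    rw [← hE, ← hyn] at hlow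
    have hup : inner ℝ y (regularityMap T ι hac κ (ψ, η)) ≤ ‖y‖ * k := by
      rw [hk]; exact real_inner_le_norm _ _
    have hmain : c * (‖y‖ ^ 2 + ‖φ T‖ ^ 2) ≤ ‖y‖ * k := by
      refine le_trans ?_ hup
      have m1 : min 1 α * (‖y‖ ^ 2 + ‖φ T‖ ^ 2) ≤ ‖y‖ ^ 2 + α * ‖φ T‖ ^ 2 := by
        have := mul_le_mul_of_nonneg_right (min_le_left 1 α) (sq_nonneg ‖y‖)
        have := mul_le_mul_of_nonneg_right (min_le_right 1 α) (sq_nonneg ‖φ T‖)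
        linarith
      have m2 := mul_le_mul_of_nonneg_left m1 (Real.exp_pos (-κ * T)).le
      rw [hc]
      linarith
    have hk0 : 0 ≤ k := by rw [hk]; exact norm_nonneg _
    have hyk : ‖y‖ ≤ k / c := by
      rw [le_div_iff₀ hc0]
      by_cases h0 : ‖y‖ = 0
      · rw [h0, zero_mul]; exact hk0
      · have : 0 < ‖y‖ := lt_of_le_of_ne (norm_nonneg _) (Ne.symm h0)
        nlinarith [mul_nonneg hc0.le (sq_nonneg ‖φ T‖)]
    have hφk : ‖φ T‖ ≤ k / c := by
      refine (sq_le_sq₀ (norm_nonneg _) (by positivity)).1 ?_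
      have m1 : c * ‖φ T‖ ^ 2 ≤ k / c * k := by
        have := mul_le_mul_of_nonneg_right hyk hk0
        nlinarith [mul_nonneg hc0.le (sq_nonneg ‖y‖)]
      rw [div_pow, le_div_iff₀ (by positivity)]
      have m2 := mul_le_mul_of_nonneg_left m1 hc0.le
      have m3 : c * (k / c * k) = k ^ 2 := by field_simp
      linarith
    change |∫ t, Real.exp (-κ * t) * (G t - a t w₀) (ψ t) ∂(timeMeasure T)| ≤ _
    have hψm : MemLp ψ 2 (timeMeasure T) := memLp_continuous ψ.continuous 2
    have k1 : Integrable (fun t => Real.exp (-κ * t) * G t (ψ t)) (timeMeasure T) :=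
      integrable_smul_continuous (by fun_prop) (integrable_dual_apply hG hψm)
    have k2 : Integrable (fun t => Real.exp (-κ * t) * a t w₀ (ψ t)) (timeMeasure T) :=
      integrable_continuous (by fun_prop)
    simp only [_root_.sub_apply, mul_sub]
    rw [integral_sub k1 k2]
    have b2 := abs_integral_exp_form_le hT.le ha hL hκ0 w₀ ψ.continuous hφd hφ0
    have hιm : MemLp (fun t => ι (ψ t)) 2 (timeMeasure T) := memLp_continuous hιψ 2
    have hφm : MemLp φ 2 (timeMeasure T) := memLp_continuous hφc 2
    have b1 : |∫ t, Real.exp (-κ * t) * G t (ψ t) ∂(timeMeasure T)| ≤ ‖hg.toLp g‖ * ‖y‖ := by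
      have m1 : |∫ t, Real.exp (-κ * t) * G t (ψ t) ∂(timeMeasure T)| ≤
          ∫ t, ‖g t‖ * ‖ι (ψ t)‖ ∂(timeMeasure T) := by
        rw [← Real.norm_eq_abs]
        refine norm_integral_le_of_norm_le (integrable_norm_mul_norm hg hιm) ?_
        filter_upwards [ae_timeMeasure_mem, hGg] with t ht h
        rw [norm_mul, Real.norm_of_nonneg (Real.exp_pos _).le, Real.norm_eq_abs]
        have h1 : Real.exp (-κ * t) ≤ 1 := by
          rw [Real.exp_le_one_iff]; nlinarith [ht.1]
        calc _ ≤ 1 * (g t * ‖ι (ψ t)‖) := by gcongr; exact h _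
          _ ≤ _ := by rw [one_mul]; gcongr; exact le_abs_self _
      refine m1.trans ((integral_mul_le_norm_toLp hg hιm).trans ?_)
      gcongr
      refine (sq_le_sq₀ (norm_nonneg _) (norm_nonneg _)).1 ?_
      rw [hyn, norm_toLp_sq hιm]
      have : 0 ≤ ∫ t, ‖φ t‖ ^ 2 ∂(timeMeasure T) := integral_nonneg fun t => sq_nonneg _
      linarith
    have b3 : ∫ t, ‖φ t‖ ∂(timeMeasure T) ≤ √T * ‖y‖ := by
      have h1m : MemLp (fun _ : ℝ => (1 : ℝ)) 2 (timeMeasure T) := memLp_const 1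
      have m1 := integral_mul_le_norm_toLp h1m hφm
      simp only [norm_one, one_mul] at m1
      refine m1.trans (mul_le_mul ?_ ?_ (norm_nonneg _) (Real.sqrt_nonneg _))
      · refine Real.le_sqrt_of_sq_le ?_
        rw [norm_toLp_sq h1m]
        simp [timeMeasure, hT.le]
      · refine (sq_le_sq₀ (norm_nonneg _) (norm_nonneg _)).1 ?_
        rw [hyn, norm_toLp_sq hφm]
        have : 0 ≤ ∫ t, ‖ι (ψ t)‖ ^ 2 ∂(timeMeasure T) := integral_nonneg fun t => sq_nonneg _
        linarith
    refine (abs_sub _ _).trans ((add_le_add b1 b2).trans ?_)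
    have hL0 : (0 : ℝ) ≤ L := L.2
    calc _ ≤ ‖hg.toLp g‖ * (k / c) + ‖w₀‖ * (M * (k / c) + (κ * M + L) * (√T * (k / c))) := by
          gcongr
          exact b3.trans (by gcongr)
      _ ≤ (1 + M + (κ * M + L) * √T) / c * (‖hg.toLp g‖ + ‖w₀‖) * k := by
          rw [show (1 + M + (κ * M + L) * √T) / c * (‖hg.toLp g‖ + ‖w₀‖) * k =
            (1 + M + (κ * M + L) * √T) * (‖hg.toLp g‖ + ‖w₀‖) * (k / c) by ring]
          have : 0 ≤ (M + (κ * M + L) * √T) * ‖hg.toLp g‖ * (k / c) := by positivity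
          have : 0 ≤ ‖w₀‖ * (k / c) := by positivity
          nlinarith
      _ = _ := by rw [← hC₁, hk])

/-- The constraint encoded in the variational problem. -/
lemma regularity_constraint [CompleteSpace H] (hT : 0 < T) (hac : Continuous a) {κ : ℝ}
    {q : ℝ → StrongDual ℝ V} (hq : MemLp q 2 (timeMeasure T))
    {x : WithLp 2 (Lp V 2 (timeMeasure T) × Lp H 2 (timeMeasure T))}
    (hx : ∀ r, inner ℝ x (regularityMap T ι hac κ r) = regularityRhs T κ hq r.1) :
    ∀ᵐ t ∂(timeMeasure T), ι (x.fst t) = ∫ τ in 0..t, x.snd τ := by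
  have hz : MemLp x.fst 2 (timeMeasure T) := Lp.memLp _
  have hp : MemLp x.snd 2 (timeMeasure T) := Lp.memLp _
  have hzi := hz.integrable (q := 2) (by norm_num)
  have hpi := hp.integrable (q := 2) (by norm_num)
  have hιz : Integrable (fun t => ι (x.fst t)) (timeMeasure T) := ι.integrable_comp hzi
  have hR : Integrable (fun t => ι (x.fst t) - ∫ τ in 0..t, x.snd τ) (timeMeasure T) :=
    hιz.sub (integrable_primitive hT.le hpi)
  have := ae_eq_zero_of_forall_continuous hR (by
    intro θ hθ
    have i1 := integrable_smul_continuous hθ hιz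
    have i2 := integrable_smul_continuous hθ (integrable_primitive hT.le hpi)
    have i3 : Integrable (fun t => (∫ τ in t..T, θ τ) • x.snd t) (timeMeasure T) :=
      integrable_smul_continuous (continuous_tail hθ) hpi
    simp only [smul_sub]
    rw [integral_sub i1 i2, ← integral_smul_primitive hpi (integrable_continuous hθ)]
    refine ext_inner_right ℝ fun h => ?_
    have h1 := hx (0, ⟨fun t => θ t • h, by fun_prop⟩)
    rw [inner_regularityMap, map_zero] at h1
    simp only [ContinuousMap.zero_apply, map_zero, inner_zero_right, mul_zero, zero_add, zero_sub,
      ContinuousMap.coe_mk, intervalIntegral.integral_smul_const, inner_smul_right,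
      integral_neg] at h1
    rw [inner_sub_left, inner_zero_left, real_inner_comm, ← integral_inner i1,
      real_inner_comm, ← integral_inner i3]
    simp only [inner_smul_right]
    have c1 : ∀ t, inner ℝ h (ι (x.fst t)) = inner ℝ (ι (x.fst t)) h := fun t => real_inner_comm _ _
    have c2 : ∀ t, inner ℝ h (x.snd t) = inner ℝ (x.snd t) h := fun t => real_inner_comm _ _
    simp only [c1, c2]
    linarith)
  filter_upwards [this] with t ht using sub_eq_zero.1 ht

/-- The equation encoded in the variational problem. -/
lemma regularity_equation [CompleteSpace H] (hac : Continuous a) {κ : ℝ}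
    {q : ℝ → StrongDual ℝ V} (hq : MemLp q 2 (timeMeasure T))
    {x : WithLp 2 (Lp V 2 (timeMeasure T) × Lp H 2 (timeMeasure T))}
    (haz : Integrable (fun t => a t (x.fst t)) (timeMeasure T))
    (hx : ∀ r, inner ℝ x (regularityMap T ι hac κ r) = regularityRhs T κ hq r.1) :
    ∀ᵐ t ∂(timeMeasure T), dualEmb ι (x.snd t) + a t (x.fst t) = q t := by
  have hp : MemLp x.snd 2 (timeMeasure T) := Lp.memLp _
  have hpi := hp.integrable (q := 2) (by norm_num)
  have hqi : Integrable q (timeMeasure T) := hq.integrable (by norm_num)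
  have hdp : Integrable (fun t => dualEmb ι (x.snd t)) (timeMeasure T) :=
    (dualEmb ι).integrable_comp hpi
  obtain ⟨Q, hQe⟩ : ∃ Q : ℝ → StrongDual ℝ V,
    Q = fun t => dualEmb ι (x.snd t) + a t (x.fst t) - q t := ⟨_, rfl⟩
  have hQ : Integrable Q (timeMeasure T) := by
    rw [hQe]; exact Integrable.sub (Integrable.add hdp haz) hqi
  have hQ' : Integrable (fun t => Real.exp (-κ * t) • Q t) (timeMeasure T) :=
    integrable_smul_continuous (by fun_prop) hQ
  have := ae_eq_zero_of_forall_continuous hQ' (by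
    intro θ hθ
    have i1 := integrable_smul_continuous hθ hQ'
    ext v
    rw [ContinuousLinearMap.integral_apply i1]
    have h1 := hx (⟨fun t => θ t • v, by fun_prop⟩, 0)
    rw [inner_regularityMap] at h1
    have hre : regularityRhs T κ hq ⟨fun t => θ t • v, by fun_prop⟩ =
      ∫ t, Real.exp (-κ * t) * q t (θ t • v) ∂(timeMeasure T) := rfl
    rw [hre] at h1
    simp only [ContinuousMap.zero_apply, inner_zero_right, add_zero, sub_zero,
      ContinuousMap.coe_mk, map_smul, inner_smul_right, smul_eq_mul,
      intervalIntegral.integral_zero] at h1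
    have hρθ : Continuous fun t => Real.exp (-κ * t) * θ t := by fun_prop
    have ap : ∀ {q : ℝ → StrongDual ℝ V}, Integrable q (timeMeasure T) →
        Integrable (fun t => Real.exp (-κ * t) * (θ t * q t v)) (timeMeasure T) := fun hq => by
      have := (ContinuousLinearMap.apply ℝ ℝ v).integrable_comp
        (integrable_smul_continuous hρθ hq)
      simpa [mul_assoc] using this
    have j1 := ap haz
    have j2 := ap hdp
    have j3 := ap hqi
    simp only [dualEmb_apply] at j2
    have j12 : Integrable (fun t => Real.exp (-κ * t) * (θ t * a t (x.fst t) v) +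
      Real.exp (-κ * t) * (θ t * inner ℝ (x.snd t) (ι v))) (timeMeasure T) := j1.add j2
    rw [← integral_add j1 j2, ← sub_eq_zero, ← integral_sub j12 j3] at h1
    rw [_root_.zero_apply, ← h1]
    refine integral_congr_ae (.of_forall fun t => ?_)
    simp only [hQe, _root_.smul_apply, _root_.sub_apply, _root_.add_apply, dualEmb_apply,
      smul_eq_mul]
    ring)
  filter_upwards [this] with t ht
  have h1 := (smul_eq_zero.1 ht).resolve_left (Real.exp_pos _).ne'
  rw [hQe] at h1
  exact sub_eq_zero.1 h1

/-- Existence of regular solutions of the abstract parabolic problem. -/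
theorem exists_regular_solution [SeparableSpace V] [CompleteSpace H] (hT : 0 < T)
    (ha : IsParabolicForm T ι a M α l)
    (hs : ∀ t u v, a t u v = a t v u) (hL : LipschitzWith L a) :
    ∃ C : ℝ, 0 ≤ C ∧ ∀ (G : ℝ → StrongDual ℝ V) (g : ℝ → ℝ) (w₀ : V),
      MemLp G 2 (timeMeasure T) → ∀ (hg : MemLp g 2 (timeMeasure T)),
      (∀ᵐ t ∂(timeMeasure T), ∀ v, |G t v| ≤ g t * ‖ι v‖) →
      ∃ (w : ℝ → V) (p : ℝ → H) (hw : MemLp w 2 (timeMeasure T)) (hp : MemLp p 2 (timeMeasure T)),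
        IsPrimitive T (fun t => ι (w t)) p (ι w₀) ∧
        (∀ᵐ t ∂(timeMeasure T), dualEmb ι (p t) = G t - a t (w t)) ∧
        ‖hw.toLp w‖ ≤ C * (‖hg.toLp g‖ + ‖w₀‖) ∧ ‖hp.toLp p‖ ≤ C * (‖hg.toLp g‖ + ‖w₀‖) := by
  have hac := hL.continuous
  obtain ⟨κ, C₁, hC₁0, key⟩ := exists_regularity_pair hT ha hs hL
  refine ⟨C₁ + √T + 1, by positivity, fun G g w₀ hG hg hGg => ?_⟩
  have hw₀ : MemLp (fun t => a t w₀) 2 (timeMeasure T) := memLp_continuous (by fun_prop) 2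
  have hq : MemLp (fun t => G t - a t w₀) 2 (timeMeasure T) := MemLp.sub hG hw₀
  obtain ⟨x, hxn, hx⟩ := key G g w₀ hq hG hg hGg
  have hz : MemLp x.fst 2 (timeMeasure T) := Lp.memLp _
  have hp : MemLp x.snd 2 (timeMeasure T) := Lp.memLp _
  have hcon := regularity_constraint hT hac hq hx
  have haz : Integrable (fun t => a t (x.fst t)) (timeMeasure T) :=
    (ha.memLp hz).integrable (by norm_num)
  have heq : ∀ᵐ t ∂(timeMeasure T), dualEmb ι (x.snd t) = G t - a t (x.fst t + w₀) := by
    filter_upwards [regularity_equation hac hq haz hx] with t ht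
    rw [map_add, eq_sub_iff_add_eq, ← add_assoc, ht, sub_add_cancel]
  have hw : MemLp (fun t => x.fst t + w₀) 2 (timeMeasure T) := hz.add (memLp_const w₀)
  have hx2 := WithLp.prod_norm_sq_eq_of_L2 x
  have hx1 : ‖x.fst‖ ≤ ‖x‖ := by
    refine (sq_le_sq₀ (norm_nonneg _) (norm_nonneg _)).1 ?_
    nlinarith [sq_nonneg ‖x.snd‖]
  have hx3 : ‖x.snd‖ ≤ ‖x‖ := by
    refine (sq_le_sq₀ (norm_nonneg _) (norm_nonneg _)).1 ?_
    nlinarith [sq_nonneg ‖x.fst‖]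
  have hb : 0 ≤ ‖hg.toLp g‖ := norm_nonneg _
  have hmono : C₁ * (‖hg.toLp g‖ + ‖w₀‖) + √T * ‖w₀‖ ≤ (C₁ + √T + 1) * (‖hg.toLp g‖ + ‖w₀‖) := by
    have := mul_nonneg (Real.sqrt_nonneg T) hb
    nlinarith [norm_nonneg w₀]
  refine ⟨_, _, hw, hp, ?_, heq, ?_, ?_⟩
  · filter_upwards [hcon] with t ht
    rw [map_add, ht, add_comm]
  · have h1 : hw.toLp _ = x.fst + (memLp_const w₀ : MemLp _ 2 (timeMeasure T)).toLp _ := by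
      have := MemLp.toLp_add hz (memLp_const w₀)
      rw [Lp.toLp_coeFn] at this
      exact this
    rw [h1]
    refine (norm_add_le _ _).trans (le_trans (add_le_add (hx1.trans hxn) ?_) hmono)
    refine (sq_le_sq₀ (norm_nonneg _) (by positivity)).1 ?_
    rw [norm_toLp_sq, mul_pow, Real.sq_sqrt hT.le]
    simp [timeMeasure, hT.le]
  · rw [Lp.toLp_coeFn]
    refine (hx3.trans hxn).trans (le_trans ?_ hmono)
    have := mul_nonneg (Real.sqrt_nonneg T) (norm_nonneg w₀)
    linarith

end Regularity

/-! ### Boundedness in time with values in `V` -/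

section Regularity

open Filter Topology

variable {T : ℝ} {V H : Type*} [NormedAddCommGroup V] [InnerProductSpace ℝ V]
  [NormedAddCommGroup H] [InnerProductSpace ℝ H]
variable {ι : V →L[ℝ] H} {a : ℝ → V →L[ℝ] V →L[ℝ] ℝ} {M α l : ℝ} {L : ℝ≥0}
variable [CompleteSpace V] [CompleteSpace H]

lemma ae_add_mem_of_timeMeasure {P : ℝ → Prop} (h : ∀ᵐ t ∂(timeMeasure T), P t) (σ : ℝ) :
    ∀ᵐ t, t + σ ∈ Ioo 0 T → P (t + σ) := by
  rw [timeMeasure, ae_restrict_iff' measurableSet_Ioo] at h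
  exact (measurePreserving_add_right volume σ).quasiMeasurePreserving.ae h

/-- Telescoping: integrated increments of step `h` see only the two end intervals of length `h`. -/
lemma integral_shift_sub {E : ℝ → ℝ} (hE : Integrable E (timeMeasure T)) {t₁ t₀ h : ℝ}
    (h1 : 0 < t₁) (h10 : t₁ ≤ t₀) (hh : 0 < h) (h0 : t₀ + h < T) :
    ∫ τ in t₁..t₀, (E (τ + h) - E τ) = (∫ τ in t₀..(t₀ + h), E τ) - ∫ τ in t₁..(t₁ + h), E τ := by
  have hi : ∀ {a b : ℝ}, a ∈ Icc 0 T → b ∈ Icc 0 T → IntervalIntegrable E volume a b :=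
    fun ha hb => intervalIntegrable_of_timeMeasure hE ha hb
  have m1 : t₁ ∈ Icc 0 T := ⟨h1.le, by linarith⟩
  have m2 : t₀ ∈ Icc 0 T := ⟨by linarith, by linarith⟩
  have m3 : t₁ + h ∈ Icc 0 T := ⟨by linarith, by linarith⟩
  have m4 : t₀ + h ∈ Icc 0 T := ⟨by linarith, h0.le⟩
  have i1 : IntervalIntegrable (fun τ => E (τ + h)) volume t₁ t₀ := by
    have := (hi m3 m4).comp_add_right h
    simpa using this
  rw [intervalIntegral.integral_sub i1 (hi m1 m2), intervalIntegral.integral_comp_add_right]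
  have e1 := intervalIntegral.integral_add_adjacent_intervals (hi m1 m3) (hi m3 m4)
  have e2 := intervalIntegral.integral_add_adjacent_intervals (hi m1 m2) (hi m2 m4)
  linarith

lemma intervalIntegral_le_integral_timeMeasure {E : ℝ → ℝ} (hT : 0 ≤ T)
    (hE : Integrable E (timeMeasure T))
    (h0 : ∀ t, 0 ≤ E t) {a b : ℝ} (ha : 0 ≤ a) (hab : a ≤ b) (hb : b ≤ T) :
    ∫ τ in a..b, E τ ≤ ∫ t, E t ∂(timeMeasure T) := by
  rw [integral_timeMeasure hT]
  exact intervalIntegral.integral_mono_interval ha hab hb (.of_forall h0)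
    (intervalIntegrable_of_timeMeasure hE (left_mem_Icc.2 hT) (right_mem_Icc.2 hT))

/-- The increments of the energy `a(t; w, w)` of a regular solution. -/
lemma abs_integral_energy_sub_le (hT : 0 < T) (ha : IsParabolicForm T ι a M α l)
    (hs : ∀ t u v, a t u v = a t v u) (hL : LipschitzWith L a) [SeparableSpace V]
    {w : ℝ → V} {p : ℝ → H} {k : ℝ → ℝ} {h₀ : H} (hw : MemLp w 2 (timeMeasure T))
    (hp : MemLp p 2 (timeMeasure T)) (hk : MemLp k 2 (timeMeasure T))
    (hprim : IsPrimitive T (fun t => ι (w t)) p h₀)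
    (hwk : ∀ᵐ t ∂(timeMeasure T), ∀ v, |a t (w t) v| ≤ k t * ‖ι v‖) {t₁ t₀ h : ℝ}
    (h1 : 0 < t₁) (h10 : t₁ ≤ t₀) (hh : 0 < h) (h0 : t₀ + h < T) :
    |(∫ τ in t₀..(t₀ + h), a τ (w τ) (w τ)) - ∫ τ in t₁..(t₁ + h), a τ (w τ) (w τ)| ≤
      h * (∫ t, ‖k t‖ ^ 2 ∂(timeMeasure T) + ∫ t, ‖p t‖ ^ 2 ∂(timeMeasure T) +
        L * ∫ t, ‖w t‖ ^ 2 ∂(timeMeasure T)) := by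
  have hpi : Integrable p (timeMeasure T) := hp.integrable (by norm_num)
  have he : Integrable (fun t => a t (w t) (w t)) (timeMeasure T) :=
    integrable_dual_apply (ha.memLp hw) hw
  have hp2 : Integrable (fun t => ‖p t‖ ^ 2) (timeMeasure T) := hp.integrable_norm_pow (by norm_num)
  have hk2 : Integrable (fun t => ‖k t‖ ^ 2) (timeMeasure T) := hk.integrable_norm_pow (by norm_num)
  have hw2 : Integrable (fun t => ‖w t‖ ^ 2) (timeMeasure T) := hw.integrable_norm_pow (by norm_num)
  obtain ⟨m, hm⟩ : ∃ m : ℝ → ℝ, m = fun t => ‖k t‖ ^ 2 / 2 + L * ‖w t‖ ^ 2 / 2 := ⟨_, rfl⟩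
  have hmi : Integrable m (timeMeasure T) := by
    rw [hm]; exact (hk2.div_const 2).add ((hw2.const_mul _).div_const 2)
  have hm0 : ∀ t, 0 ≤ m t := fun t => by rw [hm]; positivity
  have hmint : 2 * ∫ t, m t ∂(timeMeasure T) = ∫ t, ‖k t‖ ^ 2 ∂(timeMeasure T) +
      L * ∫ t, ‖w t‖ ^ 2 ∂(timeMeasure T) := by
    rw [hm, integral_add (hk2.div_const 2) ((hw2.const_mul _).div_const 2), integral_div,
      integral_div, integral_const_mul]
    ring
  -- The contribution of `‖p‖²` over `(τ, τ + h)` is written as an increment of `Φ`; after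
  -- integration in `τ` it telescopes and yields the factor `h`.
  obtain ⟨Φ, hΦ⟩ : ∃ Φ : ℝ → ℝ, Φ = fun t => ∫ τ in 0..t, ‖p τ‖ ^ 2 := ⟨_, rfl⟩
  have hΦc : ContinuousOn Φ (Icc 0 T) := by rw [hΦ]; exact continuousOn_primitive hT.le hp2
  have hΦi : Integrable Φ (timeMeasure T) := by
    rw [hΦ]; exact integrable_primitive hT.le hp2
  rw [← integral_shift_sub he h1 h10 hh h0]
  have hsub : ∀ {E : ℝ → ℝ}, Integrable E (timeMeasure T) →
      IntervalIntegrable E volume t₁ t₀ ∧ IntervalIntegrable (fun τ => E (τ + h)) volume t₁ t₀ := by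
    intro E hE
    refine ⟨intervalIntegrable_of_timeMeasure hE ⟨h1.le, by linarith⟩ ⟨by linarith, by linarith⟩, ?_⟩
    have := (intervalIntegrable_of_timeMeasure hE (a := t₁ + h) (b := t₀ + h)
      ⟨by linarith, by linarith⟩ ⟨by linarith, h0.le⟩).comp_add_right h
    simpa using this
  have hΔ : IntervalIntegrable (fun τ => Φ (τ + h) - Φ τ) volume t₁ t₀ :=
    (hsub hΦi).2.sub (hsub hΦi).1
  have hms : IntervalIntegrable (fun τ => h * (m (τ + h) + m τ)) volume t₁ t₀ :=
    ((hsub hmi).2.add (hsub hmi).1).const_mul h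
  have hbound : |∫ τ in t₁..t₀, (a (τ + h) (w (τ + h)) (w (τ + h)) - a τ (w τ) (w τ))| ≤
      ∫ τ in t₁..t₀, (h * (m (τ + h) + m τ) + (Φ (τ + h) - Φ τ)) := by
    rw [← Real.norm_eq_abs]
    refine intervalIntegral.norm_integral_le_of_norm_le h10 ?_ (hms.add hΔ)
    filter_upwards [ae_add_mem_of_timeMeasure hprim h, ae_add_mem_of_timeMeasure hprim 0,
      ae_add_mem_of_timeMeasure hwk h, ae_add_mem_of_timeMeasure hwk 0] with τ a1 a2 a3 a4 hτ
    have b0 : τ ∈ Ioo 0 T := ⟨by linarith [hτ.1], by linarith [hτ.2]⟩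
    have b1 : τ + h ∈ Ioo 0 T := ⟨by linarith [hτ.1], by linarith [hτ.2]⟩
    rw [add_zero] at a2 a4
    replace a1 := a1 b1; replace a2 := a2 b0; replace a3 := a3 b1; replace a4 := a4 b0
    have hinc : ι (w (τ + h)) - ι (w τ) = ∫ σ in τ..(τ + h), p σ := by
      rw [a1, a2, add_sub_add_left_eq_sub]
      exact intervalIntegral.integral_interval_sub_left
        (intervalIntegrable_of_timeMeasure hpi (left_mem_Icc.2 hT.le) ⟨b1.1.le, b1.2.le⟩)
        (intervalIntegrable_of_timeMeasure hpi (left_mem_Icc.2 hT.le) ⟨b0.1.le, b0.2.le⟩)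
    have hip2 := intervalIntegrable_of_timeMeasure hp2 (⟨b0.1.le, b0.2.le⟩ : τ ∈ Icc 0 T)
      (⟨b1.1.le, b1.2.le⟩ : τ + h ∈ Icc 0 T)
    have hip := (intervalIntegrable_of_timeMeasure hpi (⟨b0.1.le, b0.2.le⟩ : τ ∈ Icc 0 T)
      (⟨b1.1.le, b1.2.le⟩ : τ + h ∈ Icc 0 T)).norm
    have hΦd : Φ (τ + h) - Φ τ = ∫ σ in τ..(τ + h), ‖p σ‖ ^ 2 := by
      rw [hΦ]
      exact intervalIntegral.integral_interval_sub_left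
        (intervalIntegrable_of_timeMeasure hp2 (left_mem_Icc.2 hT.le) ⟨b1.1.le, b1.2.le⟩)
        (intervalIntegrable_of_timeMeasure hp2 (left_mem_Icc.2 hT.le) ⟨b0.1.le, b0.2.le⟩)
    have hninc : ‖ι (w (τ + h) - w τ)‖ ≤ ∫ σ in τ..(τ + h), ‖p σ‖ := by
      rw [map_sub, hinc]
      exact intervalIntegral.norm_integral_le_integral_norm (by linarith)
    have hk1 : (‖k (τ + h)‖ + ‖k τ‖) * ‖ι (w (τ + h) - w τ)‖ ≤
        h * (‖k (τ + h)‖ ^ 2 / 2 + ‖k τ‖ ^ 2 / 2) + (Φ (τ + h) - Φ τ) := by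
      refine (mul_le_mul_of_nonneg_left hninc (by positivity)).trans ?_
      rw [hΦd, ← intervalIntegral.integral_const_mul]
      have : h * (‖k (τ + h)‖ ^ 2 / 2 + ‖k τ‖ ^ 2 / 2) =
          ∫ σ in τ..(τ + h), (‖k (τ + h)‖ ^ 2 / 2 + ‖k τ‖ ^ 2 / 2) := by
        rw [intervalIntegral.integral_const, smul_eq_mul]; ring
      rw [this, ← intervalIntegral.integral_add intervalIntegrable_const hip2]
      refine intervalIntegral.integral_mono_on (by linarith) (hip.const_mul _)
        (intervalIntegrable_const.add hip2) fun σ _ => ?_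
      nlinarith [sq_nonneg (‖k (τ + h)‖ - ‖p σ‖), sq_nonneg (‖k τ‖ - ‖p σ‖)]
    -- By symmetry, the increment of the energy consists of the functionals `a(t; w(t), ·)` at the
    -- two times, both applied to the increment of `w`, and of a time increment of the form. Those
    -- functionals are bounded by the norm of `H`, in which the increment of `w` is at most the
    -- integral of `‖p‖`.
    have hdec : a (τ + h) (w (τ + h)) (w (τ + h)) - a τ (w τ) (w τ) =
        a (τ + h) (w (τ + h)) (w (τ + h) - w τ) + a τ (w τ) (w (τ + h) - w τ) +
        (a (τ + h) (w (τ + h)) (w τ) - a τ (w (τ + h)) (w τ)) := by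
      rw [map_sub, map_sub, hs τ (w (τ + h)) (w τ)]; ring
    have c1 := a3 (w (τ + h) - w τ)
    have c2 := a4 (w (τ + h) - w τ)
    have c3 := abs_form_sub_le hL τ (τ + h) (w (τ + h)) (w τ)
    rw [add_sub_cancel_left, abs_of_pos hh] at c3
    have d1 : k (τ + h) * ‖ι (w (τ + h) - w τ)‖ ≤ ‖k (τ + h)‖ * ‖ι (w (τ + h) - w τ)‖ := by
      gcongr; exact le_abs_self _
    have d2 : k τ * ‖ι (w (τ + h) - w τ)‖ ≤ ‖k τ‖ * ‖ι (w (τ + h) - w τ)‖ := by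
      gcongr; exact le_abs_self _
    have d3 : L * h * (‖w (τ + h)‖ * ‖w τ‖) ≤
        h * (L * ‖w (τ + h)‖ ^ 2 / 2 + L * ‖w τ‖ ^ 2 / 2) := by
      have : 0 ≤ (L : ℝ) * h := mul_nonneg L.2 hh.le
      nlinarith [mul_nonneg this (sq_nonneg (‖w (τ + h)‖ - ‖w τ‖))]
    rw [hdec, Real.norm_eq_abs, hm]
    refine (abs_add_le _ _).trans ((add_le_add (abs_add_le _ _) le_rfl).trans ?_)
    linarith
  refine hbound.trans ?_
  have hB1 : ∫ τ in t₁..t₀, h * (m (τ + h) + m τ) ≤ h * (2 * ∫ t, m t ∂(timeMeasure T)) := by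
    rw [intervalIntegral.integral_const_mul, intervalIntegral.integral_add (hsub hmi).2 (hsub hmi).1,
      intervalIntegral.integral_comp_add_right]
    have := intervalIntegral_le_integral_timeMeasure hT.le hmi hm0 (a := t₁ + h) (b := t₀ + h)
      (by linarith) (by linarith) h0.le
    have := intervalIntegral_le_integral_timeMeasure hT.le hmi hm0 (a := t₁) (b := t₀)
      h1.le h10 (by linarith)
    gcongr
    linarith
  have hB2 : ∫ τ in t₁..t₀, (Φ (τ + h) - Φ τ) ≤ h * ∫ t, ‖p t‖ ^ 2 ∂(timeMeasure T) := by
    rw [integral_shift_sub hΦi h1 h10 hh h0]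
    have e1 : ∫ τ in t₀..(t₀ + h), Φ τ ≤ ∫ τ in t₀..(t₀ + h), ∫ t, ‖p t‖ ^ 2 ∂(timeMeasure T) := by
      refine intervalIntegral.integral_mono_on (by linarith)
        (intervalIntegrable_of_timeMeasure hΦi ⟨by linarith, by linarith⟩ ⟨by linarith, h0.le⟩)
        intervalIntegrable_const fun σ hσ => ?_
      rw [hΦ]
      exact intervalIntegral_le_integral_timeMeasure hT.le hp2 (fun _ => sq_nonneg _) le_rfl
        (by linarith [hσ.1]) (by linarith [hσ.2])
    have e2 : 0 ≤ ∫ τ in t₁..(t₁ + h), Φ τ := by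
      refine intervalIntegral.integral_nonneg (by linarith) fun σ hσ => ?_
      rw [hΦ]
      exact intervalIntegral.integral_nonneg (by linarith [hσ.1]) fun _ _ => sq_nonneg _
    rw [intervalIntegral.integral_const, smul_eq_mul, add_sub_cancel_left] at e1
    linarith
  rw [intervalIntegral.integral_add hms hΔ]
  rw [hmint] at hB1
  linarith

/-- Regular solutions are bounded with values in `V`. -/
lemma ae_regular_norm_sq_le (hT : 0 < T) (ha : IsParabolicForm T ι a M α l)
    (hs : ∀ t u v, a t u v = a t v u) (hL : LipschitzWith L a) [SeparableSpace V]
    {w : ℝ → V} {p : ℝ → H} {k : ℝ → ℝ} {h₀ : H} (hw : MemLp w 2 (timeMeasure T))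
    (hp : MemLp p 2 (timeMeasure T)) (hk : MemLp k 2 (timeMeasure T))
    (hprim : IsPrimitive T (fun t => ι (w t)) p h₀)
    (hwk : ∀ᵐ t ∂(timeMeasure T), ∀ v, |a t (w t) v| ≤ k t * ‖ι v‖) :
    ∀ᵐ t ∂(timeMeasure T), T * (α * ‖w t‖ ^ 2 - l * ‖ι (w t)‖ ^ 2) ≤
      M * ∫ t, ‖w t‖ ^ 2 ∂(timeMeasure T) + T * (∫ t, ‖k t‖ ^ 2 ∂(timeMeasure T) +
        ∫ t, ‖p t‖ ^ 2 ∂(timeMeasure T) + L * ∫ t, ‖w t‖ ^ 2 ∂(timeMeasure T)) := by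
  obtain ⟨B, hB⟩ : ∃ B : ℝ, B = ∫ t, ‖k t‖ ^ 2 ∂(timeMeasure T) +
    ∫ t, ‖p t‖ ^ 2 ∂(timeMeasure T) + L * ∫ t, ‖w t‖ ^ 2 ∂(timeMeasure T) := ⟨_, rfl⟩
  rw [← hB]
  obtain ⟨e, hee⟩ : ∃ e : ℝ → ℝ, e = fun t => a t (w t) (w t) := ⟨_, rfl⟩
  have he : Integrable e (timeMeasure T) := by
    rw [hee]; exact integrable_dual_apply (ha.memLp hw) hw
  have hw2 : Integrable (fun t => ‖w t‖ ^ 2) (timeMeasure T) := hw.integrable_norm_pow (by norm_num)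
  have hei := intervalIntegrable_of_timeMeasure he (left_mem_Icc.2 hT.le) (right_mem_Icc.2 hT.le)
  -- The energy is only an integrable function; its values are recovered from averages by Lebesgue's
  -- differentiation theorem.
  have hleb : ∀ᵐ t ∂(timeMeasure T), Tendsto (fun h => h⁻¹ * ∫ τ in t..(t + h), e τ) (𝓝[>] 0)
      (𝓝 (e t)) := by
    have h1 := ae_restrict_of_ae (μ := volume) (s := Ioo 0 T) hei.ae_hasDerivAt_integral
    rw [uIcc_of_le hT.le] at h1
    filter_upwards [h1, ae_timeMeasure_mem] with t h2 ht
    have h3 := (h2 (Ioo_subset_Icc_self ht) 0 (left_mem_Icc.2 hT.le)).tendsto_slope_zero_right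
    refine h3.congr' ?_
    have h4 : ∀ᶠ h in 𝓝[>] (0 : ℝ), h < T - t :=
      (eventually_lt_nhds (sub_pos.2 ht.2)).filter_mono nhdsWithin_le_nhds
    filter_upwards [h4, self_mem_nhdsWithin] with h h5 h6
    have h6' : 0 < h := h6
    rw [smul_eq_mul, intervalIntegral.integral_interval_sub_left
      (intervalIntegrable_of_timeMeasure he (left_mem_Icc.2 hT.le)
        ⟨by linarith [ht.1], by linarith⟩)
      (intervalIntegrable_of_timeMeasure he (left_mem_Icc.2 hT.le) ⟨ht.1.le, ht.2.le⟩)]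
  have hord : ∀ t₁ t₀, t₁ ∈ Ioo 0 T → t₀ ∈ Ioo 0 T → t₁ ≤ t₀ →
      Tendsto (fun h => h⁻¹ * ∫ τ in t₁..(t₁ + h), e τ) (𝓝[>] 0) (𝓝 (e t₁)) →
      Tendsto (fun h => h⁻¹ * ∫ τ in t₀..(t₀ + h), e τ) (𝓝[>] 0) (𝓝 (e t₀)) →
      |e t₀ - e t₁| ≤ B := by
    intro t₁ t₀ m1 m0 h10 l1 l0
    refine le_of_tendsto (l0.sub l1).abs ?_
    have h4 : ∀ᶠ h in 𝓝[>] (0 : ℝ), h < T - t₀ :=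
      (eventually_lt_nhds (sub_pos.2 m0.2)).filter_mono nhdsWithin_le_nhds
    filter_upwards [h4, self_mem_nhdsWithin] with h h5 h6
    have h6' : 0 < h := h6
    have := abs_integral_energy_sub_le hT ha hs hL hw hp hk hprim hwk m1.1 h10 h6' (by linarith)
    rw [← hB] at this
    rw [← mul_sub, abs_mul, abs_of_pos (inv_pos.2 h6'), inv_mul_le_iff₀ h6', hee]
    exact this
  filter_upwards [hleb, ae_timeMeasure_mem] with t₀ l0 m0
  -- The energy at `t₀` is compared with the energy at almost every other time. Integrating over
  -- `t₁` then bounds it by the norm of `w` in `L²(0,T;V)`, so no value at a particular time is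
  -- needed.
  have hle : ∀ᵐ t₁ ∂(timeMeasure T), e t₀ ≤ M * ‖w t₁‖ ^ 2 + B := by
    filter_upwards [hleb, ae_timeMeasure_mem] with t₁ l1 m1
    have h1 : |e t₀ - e t₁| ≤ B := by
      rcases le_total t₁ t₀ with h | h
      · exact hord _ _ m1 m0 h l1 l0
      · rw [abs_sub_comm]; exact hord _ _ m0 m1 h l0 l1
    have h2 : e t₁ ≤ M * ‖w t₁‖ ^ 2 := by
      rw [hee]
      refine (le_abs_self _).trans (((a t₁ (w t₁)).le_opNorm (w t₁)).trans ?_)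
      rw [pow_two, ← mul_assoc]
      exact mul_le_mul_of_nonneg_right (ha.norm_apply_le t₁ (w t₁)) (norm_nonneg _)
    linarith [(abs_le.1 h1).2]
  have hint : ∫ _, e t₀ ∂(timeMeasure T) ≤ ∫ t, (M * ‖w t‖ ^ 2 + B) ∂(timeMeasure T) :=
    integral_mono_ae (integrable_const (e t₀)) ((hw2.const_mul M).add (integrable_const B)) hle
  have hadd : ∫ t, (M * ‖w t‖ ^ 2 + B) ∂(timeMeasure T) =
      M * ∫ t, ‖w t‖ ^ 2 ∂(timeMeasure T) + T * B := by
    rw [integral_add (hw2.const_mul M) (integrable_const B), integral_const_mul]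
    simp [timeMeasure, hT.le]
  rw [hadd] at hint
  have hc : ∫ _, e t₀ ∂(timeMeasure T) = T * e t₀ := by simp [timeMeasure, hT.le]
  rw [hc] at hint
  refine le_trans (mul_le_mul_of_nonneg_left ?_ hT.le) hint
  have := ha.garding t₀ (w t₀)
  rw [hee]
  linarith

end Regularity

/-! ### The spaces `Hᵃ(ℝⁿ)` on the Fourier side -/

section Bessel

open Filter Topology

variable {n : ℕ} {a b : ℝ≥0}

/-- The Fourier transform of a real valued `L²` function. -/
def fhat (u : L2 n) : Lp ℂ 2 (volume : Measure (Euc n)) := 𝓕 (complexify n u)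

/-- The weight `(1+|ξ|²)^{a/2}`. -/
def wgt (n : ℕ) (a : ℝ) (ξ : Euc n) : ℝ := (1 + ‖ξ‖ ^ 2) ^ (a / 2)

lemma wgt_pos (a : ℝ) (ξ : Euc n) : 0 < wgt n a ξ := by unfold wgt; positivity

lemma wgt_add (a b : ℝ) (ξ : Euc n) : wgt n (a + b) ξ = wgt n a ξ * wgt n b ξ := by
  unfold wgt; rw [← Real.rpow_add (by positivity)]; ring_nf

lemma wgt_neg_mul (a : ℝ) (ξ : Euc n) : wgt n (-a) ξ * wgt n a ξ = 1 := by
  rw [← wgt_add, neg_add_cancel, wgt, zero_div, Real.rpow_zero]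

lemma one_le_sq_norm (ξ : Euc n) : (1 : ℝ) ≤ 1 + ‖ξ‖ ^ 2 := le_add_of_nonneg_right (sq_nonneg _)

lemma wgt_mono {a b : ℝ} (hab : a ≤ b) (ξ : Euc n) : wgt n a ξ ≤ wgt n b ξ :=
  Real.rpow_le_rpow_of_exponent_le (one_le_sq_norm ξ) (by linarith)

lemma continuous_wgt (a : ℝ) : Continuous (wgt n a) := by
  unfold wgt
  exact Continuous.rpow_const (by fun_prop) fun ξ => Or.inl (by positivity)

lemma wgt_hasTemperateGrowth (a : ℝ) :
    (fun ξ : Euc n => ((wgt n a ξ : ℝ) : ℂ)).HasTemperateGrowth := by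
  unfold wgt
  fun_prop

lemma wgt_neg_memLp (_ha : 0 ≤ (a : ℝ)) :
    MemLp (fun ξ : Euc n => ((wgt n (-a) ξ : ℝ) : ℂ)) ∞ (volume : Measure (Euc n)) := by
  refine memLp_top_of_bound (wgt_hasTemperateGrowth _).1.continuous.aestronglyMeasurable 1
    (.of_forall fun ξ => ?_)
  rw [Complex.norm_real, Real.norm_of_nonneg (wgt_pos _ _).le]
  exact Real.rpow_le_one_of_one_le_of_nonpos (one_le_sq_norm ξ) (by linarith)

lemma fourier_toTD (u : L2 n) : 𝓕 (toTD u) = (fhat u : 𝓢'(Euc n, ℂ)) :=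
  Lp.fourier_toTemperedDistribution_eq _

/-- Multiplication by `(1+|ξ|²)^{-a/2}` on `L²`. -/
def negWgtMul (n : ℕ) (a : ℝ≥0) (f : Lp ℂ 2 (volume : Measure (Euc n))) :
    Lp ℂ 2 (volume : Measure (Euc n)) :=
  ((wgt_neg_memLp (n := n) a.2).toLp _ : Lp ℂ ∞ (volume : Measure (Euc n))) • f

lemma coeFn_negWgtMul (f : Lp ℂ 2 (volume : Measure (Euc n))) :
    ∀ᵐ ξ, negWgtMul n a f ξ = (wgt n (-a) ξ : ℂ) * f ξ := by
  filter_upwards [Lp.coeFn_lpSMul (r := 2) ((wgt_neg_memLp (n := n) a.2).toLp _) f,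
    (wgt_neg_memLp (n := n) a.2).coeFn_toLp] with ξ h1 h2
  rw [negWgtMul, h1, Pi.smul_apply', h2, smul_eq_mul]

lemma negWgtMul_toTD (f : Lp ℂ 2 (volume : Measure (Euc n))) :
    (negWgtMul n a f : 𝓢'(Euc n, ℂ)) =
      TemperedDistribution.smulLeftCLM ℂ (fun ξ : Euc n => ((wgt n (-a) ξ : ℝ) : ℂ))
        (f : 𝓢'(Euc n, ℂ)) :=
  Lp.toTemperedDistribution_smul_eq (wgt_hasTemperateGrowth _) _ _

lemma smulLeft_wgt_inv (T : 𝓢'(Euc n, ℂ)) {c d : ℝ} (hcd : c + d = 0) :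
    TemperedDistribution.smulLeftCLM ℂ (fun ξ : Euc n => ((wgt n d ξ : ℝ) : ℂ))
      (TemperedDistribution.smulLeftCLM ℂ (fun ξ : Euc n => ((wgt n c ξ : ℝ) : ℂ)) T) = T := by
  rw [TemperedDistribution.smulLeftCLM_smulLeftCLM_apply (wgt_hasTemperateGrowth _)
    (wgt_hasTemperateGrowth _)]
  have : ((fun ξ : Euc n => ((wgt n c ξ : ℝ) : ℂ)) * fun ξ : Euc n => ((wgt n d ξ : ℝ) : ℂ)) =
      fun _ => (1 : ℂ) := by
    ext ξ
    rw [Pi.mul_apply, ← Complex.ofReal_mul, ← wgt_add, hcd, wgt, zero_div, Real.rpow_zero,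
      Complex.ofReal_one]
  simp only [this, TemperedDistribution.smulLeftCLM_const, one_smul]

lemma Hs.fourier_bessel_toTD (u : Hs n a) :
    ((𝓕 (Hs.bessel n a u) : Lp ℂ 2 (volume : Measure (Euc n))) : 𝓢'(Euc n, ℂ)) =
      TemperedDistribution.smulLeftCLM ℂ (fun ξ : Euc n => ((wgt n a ξ : ℝ) : ℂ))
        (fhat (Hs.toL2ₗ n a u) : 𝓢'(Euc n, ℂ)) := by
  rw [← Lp.fourier_toTemperedDistribution_eq]
  change 𝓕 ((Hs.besselFun u : 𝓢'(Euc n, ℂ))) = _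
  rw [← Hs.besselFun_spec u,
    TemperedDistribution.fourier_besselPotential_eq_smulLeftCLM_fourier_apply, fourier_toTD]
  rfl

/-- The weight of negative order is bounded and therefore acts on `L²`, while the weight of positive
order acts a priori only on distributions. For this reason the relation between `û` and the
transform of `⟨D⟩ᵃ u` is first stated in this direction. -/
lemma Hs.fhat_eq_negWgtMul (u : Hs n a) :
    fhat (Hs.toL2 n a u) = negWgtMul n a (𝓕 (Hs.bessel n a u)) := by
  apply Lp_toTD_injective
  rw [negWgtMul_toTD, Hs.fourier_bessel_toTD, smulLeft_wgt_inv _ (add_neg_cancel _)]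
  rfl

/-- The Fourier transform of `⟨D⟩ᵃ u`. -/
lemma Hs.fourier_bessel_ae (u : Hs n a) :
    ∀ᵐ ξ, (𝓕 (Hs.bessel n a u) : Lp ℂ 2 (volume : Measure (Euc n))) ξ =
      (wgt n a ξ : ℂ) * fhat (Hs.toL2 n a u) ξ := by
  filter_upwards [coeFn_negWgtMul (a := a) (𝓕 (Hs.bessel n a u))] with ξ h
  rw [Hs.fhat_eq_negWgtMul, h, ← mul_assoc, ← Complex.ofReal_mul, mul_comm (wgt n a ξ),
    wgt_neg_mul, Complex.ofReal_one, one_mul]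

/-- A criterion for membership in `Hᵃ(ℝⁿ)`. -/
lemma Hs.exists_of_fourier {u : L2 n} {f : Lp ℂ 2 (volume : Measure (Euc n))}
    (h : fhat u = negWgtMul n a f) :
    ∃ v : Hs n a, Hs.toL2 n a v = u ∧ 𝓕 (Hs.bessel n a v) = f := by
  have h1 : TemperedDistribution.smulLeftCLM ℂ (fun ξ : Euc n => ((wgt n a ξ : ℝ) : ℂ))
      (𝓕 (toTD u)) = (f : 𝓢'(Euc n, ℂ)) := by
    rw [fourier_toTD, h, negWgtMul_toTD, smulLeft_wgt_inv _ (neg_add_cancel _)]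
  have hm : TemperedDistribution.MemSobolev (a : ℝ) 2 (toTD u) :=
    TemperedDistribution.memSobolev_iff_exists_smulLeftCLM_fourier.2 ⟨f, h1⟩
  obtain ⟨v, hv⟩ : ∃ v : Hs n a, Hs.toL2ₗ n a v = u := ⟨⟨u, hm⟩, rfl⟩
  refine ⟨v, hv, ?_⟩
  apply Lp_toTD_injective
  rw [Hs.fourier_bessel_toTD, hv, ← h1, fourier_toTD]

lemma Hs.exists_of_memLp {u : L2 n}
    (h : MemLp (fun ξ => (wgt n a ξ : ℂ) * fhat u ξ) 2 (volume : Measure (Euc n))) :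
    ∃ v : Hs n a, Hs.toL2 n a v = u := by
  obtain ⟨v, hv, -⟩ := Hs.exists_of_fourier (u := u) (f := h.toLp _) (a := a) (by
    refine Lp.ext ?_
    filter_upwards [coeFn_negWgtMul (a := a) (h.toLp _), h.coeFn_toLp] with ξ h1 h2
    rw [h1, h2, ← mul_assoc, ← Complex.ofReal_mul, wgt_neg_mul, Complex.ofReal_one, one_mul])
  exact ⟨v, hv⟩

instance Hs.instInnerProductSpace : InnerProductSpace ℝ (Hs n a) where
  inner u v := inner ℝ (Hs.bessel n a u) (Hs.bessel n a v)
  norm_sq_eq_re_inner u := by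
    rw [Hs.norm_def]; exact norm_sq_eq_re_inner (𝕜 := ℝ) _
  conj_inner_symm u v := inner_conj_symm (𝕜 := ℝ) _ _
  add_left u v w := by rw [map_add]; exact inner_add_left _ _ _
  smul_left u v r := by rw [map_smul]; exact inner_smul_left (𝕜 := ℝ) _ _ _

lemma Hs.inner_def (u v : Hs n a) :
    inner ℝ u v = inner ℝ (Hs.bessel n a u) (Hs.bessel n a v) := rfl

/-- `u ↦ ⟨D⟩ᵃ u` as an isometry. -/
def besselIsom (n : ℕ) (a : ℝ≥0) : Hs n a →ₗᵢ[ℝ] Lp ℂ 2 (volume : Measure (Euc n)) where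
  toLinearMap := Hs.bessel n a
  norm_map' _ := rfl

lemma continuous_fhat : Continuous (fhat : L2 n → Lp ℂ 2 (volume : Measure (Euc n))) :=
  (Lp.fourierTransformₗᵢ (Euc n) ℂ).continuous.comp (complexify n).continuous

lemma continuous_negWgtMul : Continuous (negWgtMul n a) := by
  refine (LipschitzWith.of_dist_le_mul (K := 1) fun f g => ?_).continuous
  rw [dist_eq_norm, dist_eq_norm, NNReal.coe_one, one_mul]
  refine Lp.norm_le_norm_of_ae_le ?_
  filter_upwards [coeFn_negWgtMul (a := a) f, coeFn_negWgtMul (a := a) g,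
    Lp.coeFn_sub f g, Lp.coeFn_sub (negWgtMul n a f) (negWgtMul n a g)] with ξ h1 h2 h3 h4
  rw [h4, h3, Pi.sub_apply, Pi.sub_apply, h1, h2, ← mul_sub, norm_mul, Complex.norm_real,
    Real.norm_of_nonneg (wgt_pos _ _).le]
  refine mul_le_of_le_one_left (norm_nonneg _) ?_
  exact Real.rpow_le_one_of_one_le_of_nonpos (one_le_sq_norm ξ) (by have := a.2; linarith)

/-- The range of `⟨D⟩ᵃ` is closed in `L²`: if `⟨D⟩ᵃ u_k` converges then so does `u_k`, and
continuity of multiplication by the bounded negative weight identifies the limit as an element of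
the range. -/
instance Hs.instCompleteSpace : CompleteSpace (Hs n a) := by
  rw [completeSpace_iff_isComplete_range (besselIsom n a).isometry.isUniformInducing]
  refine IsClosed.isComplete (IsSeqClosed.isClosed fun f g hf hg => ?_)
  choose u hu using hf
  have hu' : ∀ k, Hs.bessel n a (u k) = f k := hu
  have hcau : CauchySeq u := by
    refine (besselIsom n a).isometry.isUniformInducing.cauchy_map_iff.1 ?_
    have : (besselIsom n a) ∘ u = f := funext hu
    rw [Filter.map_map, this]; exact hg.cauchySeq
  obtain ⟨u₀, hu₀⟩ := cauchySeq_tendsto_of_complete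
    ((Hs.toL2 n a).uniformContinuous.comp_cauchySeq hcau)
  have h1 : Tendsto (fun k => fhat (Hs.toL2 n a (u k))) atTop (𝓝 (fhat u₀)) :=
    (continuous_fhat.tendsto u₀).comp hu₀
  have h2 : Tendsto (fun k => fhat (Hs.toL2 n a (u k))) atTop (𝓝 (negWgtMul n a (𝓕 g))) := by
    simp only [Hs.fhat_eq_negWgtMul, hu']
    exact ((continuous_negWgtMul.comp
      (Lp.fourierTransformₗᵢ (Euc n) ℂ).continuous).tendsto g).comp hg
  obtain ⟨v, -, hv⟩ := Hs.exists_of_fourier (tendsto_nhds_unique h1 h2)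
  exact ⟨v, (Lp.fourierTransformₗᵢ (Euc n) ℂ).injective hv⟩

instance Hs.instSecondCountable : SecondCountableTopology (Hs n a) :=
  haveI : Fact ((2 : ℝ≥0∞) ≠ ⊤) := ⟨by norm_num⟩
  (besselIsom n a).isometry.isEmbedding.isInducing.secondCountableTopology

lemma norm_fhat (u : L2 n) : ‖fhat u‖ = ‖u‖ := by
  rw [fhat, Lp.norm_fourier_eq, Lp.norm_def, Lp.norm_def]
  congr 1
  refine eLpNorm_congr_norm_ae ?_
  filter_upwards [Complex.ofRealCLM.coeFn_compLpL (p := 2) (μ := volume) u] with x hx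
  rw [complexify, hx]
  simp

lemma norm_Lp_sq {X E : Type*} [MeasurableSpace X] {μ : Measure X} [NormedAddCommGroup E]
    (f : Lp E 2 μ) : ‖f‖ ^ 2 = ∫ x, ‖f x‖ ^ 2 ∂μ := by
  conv_lhs => rw [← Lp.toLp_coeFn f (Lp.memLp f)]
  exact norm_toLp_sq _

lemma Hs.norm_sq_eq (u : Hs n a) :
    ‖u‖ ^ 2 = ∫ ξ, wgt n a ξ ^ 2 * ‖fhat (Hs.toL2 n a u) ξ‖ ^ 2 := by
  rw [Hs.norm_def, ← Lp.norm_fourier_eq, norm_Lp_sq]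
  refine integral_congr_ae ?_
  filter_upwards [Hs.fourier_bessel_ae u] with ξ h
  rw [h, norm_mul, mul_pow, Complex.norm_real, Real.norm_of_nonneg (wgt_pos _ _).le]

lemma Hs.memLp_wgt_mul (u : Hs n a) :
    MemLp (fun ξ => (wgt n a ξ : ℂ) * fhat (Hs.toL2 n a u) ξ) 2 (volume : Measure (Euc n)) :=
  (Lp.memLp (𝓕 (Hs.bessel n a u))).ae_eq (Hs.fourier_bessel_ae u)

lemma Hs.toL2_injective : Function.Injective (Hs.toL2 n a) := Hs.toL2ₗ_injective

lemma Hs.exists_incl (hab : a ≤ b) (u : Hs n b) : ∃ v : Hs n a, Hs.toL2 n a v = Hs.toL2 n b u := by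
  refine Hs.exists_of_memLp ((Hs.memLp_wgt_mul u).mono ?_ (.of_forall fun ξ => ?_))
  · exact ((Complex.continuous_ofReal.comp (continuous_wgt _)).aestronglyMeasurable).mul
      (Lp.aestronglyMeasurable _)
  · simp only [norm_mul, Complex.norm_real, Real.norm_of_nonneg (wgt_pos _ _).le]
    gcongr
    exact wgt_mono (by exact_mod_cast hab) ξ

/-- The inclusion `Hᵇ(ℝⁿ) ⊆ Hᵃ(ℝⁿ)`, `a ≤ b`. -/
def Hs.incl (hab : a ≤ b) : Hs n b →L[ℝ] Hs n a :=
  LinearMap.mkContinuous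
    { toFun := fun u => (Hs.exists_incl hab u).choose
      map_add' := fun u v => Hs.toL2_injective
        ((Hs.exists_incl hab (u + v)).choose_spec.trans (by
          rw [map_add, map_add, (Hs.exists_incl hab u).choose_spec,
            (Hs.exists_incl hab v).choose_spec]))
      map_smul' := fun c u => Hs.toL2_injective
        ((Hs.exists_incl hab (c • u)).choose_spec.trans (by
          rw [RingHom.id_apply, map_smul, map_smul, (Hs.exists_incl hab u).choose_spec])) } 1 (fun u => by
    obtain ⟨v, hv⟩ : ∃ v, v = (Hs.exists_incl hab u).choose := ⟨_, rfl⟩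
    have hvs : Hs.toL2 n a v = Hs.toL2 n b u := by
      rw [hv]; exact (Hs.exists_incl hab u).choose_spec
    change ‖(Hs.exists_incl hab u).choose‖ ≤ _
    rw [one_mul, ← hv]
    refine (sq_le_sq₀ (norm_nonneg _) (norm_nonneg _)).1 ?_
    rw [Hs.norm_sq_eq, Hs.norm_sq_eq, hvs]
    have key : ∀ {c : ℝ≥0} (w : Hs n c), Integrable fun ξ =>
        wgt n c ξ ^ 2 * ‖fhat (Hs.toL2 n c w) ξ‖ ^ 2 := fun w => by
      refine (Hs.memLp_wgt_mul w).integrable_norm_pow (by norm_num) |>.congr (.of_forall fun ξ => ?_)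
      simp only [norm_mul, mul_pow, Complex.norm_real, Real.norm_of_nonneg (wgt_pos _ _).le]
    have k1 := key v
    rw [hvs] at k1
    refine integral_mono k1 (key u) fun ξ => ?_
    have := wgt_mono (n := n) (a := a) (b := b) (by exact_mod_cast hab) ξ
    have := (wgt_pos (n := n) a ξ).le
    dsimp only
    gcongr)

@[simp] lemma Hs.toL2_incl (hab : a ≤ b) (u : Hs n b) :
    Hs.toL2 n a (Hs.incl hab u) = Hs.toL2 n b u := (Hs.exists_incl hab u).choose_spec

lemma inner_complex_Lp (f g : Lp ℂ 2 (volume : Measure (Euc n))) :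
    inner ℝ f g = ∫ ξ, (f ξ * (starRingEnd ℂ) (g ξ)).re := by
  rw [L2.inner_def]
  refine integral_congr_ae (.of_forall fun ξ => ?_)
  simp only [Complex.inner, Complex.mul_re, Complex.conj_re, Complex.conj_im]
  ring

lemma inner_fourier_real (f g : Lp ℂ 2 (volume : Measure (Euc n))) :
    inner ℝ (𝓕 f : Lp ℂ 2 (volume : Measure (Euc n))) (𝓕 g) = inner ℝ f g := by
  have h : ∀ f : Lp ℂ 2 (volume : Measure (Euc n)),
      ‖(𝓕 f : Lp ℂ 2 (volume : Measure (Euc n)))‖ = ‖f‖ := Lp.norm_fourier_eq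
  rw [real_inner_eq_norm_add_mul_self_sub_norm_mul_self_sub_norm_mul_self_div_two,
    real_inner_eq_norm_add_mul_self_sub_norm_mul_self_sub_norm_mul_self_div_two]
  have h1 : (𝓕 f : Lp ℂ 2 (volume : Measure (Euc n))) + 𝓕 g = 𝓕 (f + g) :=
    ((Lp.fourierTransformₗᵢ (Euc n) ℂ).map_add f g).symm
  rw [h1, h, h, h]

/-- `⟨u, χ⟩_{Hᵃ} = ⟨u, ⟨D⟩^{2a} χ⟩_{L²}`. -/
lemma Hs.inner_incl (hab : b = 2 * a) (hle : a ≤ b) (u : Hs n a) (χ : Hs n b) :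
    inner ℝ u (Hs.incl hle χ) = inner ℝ (complexify n (Hs.toL2 n a u)) (Hs.bessel n b χ) := by
  rw [Hs.inner_def, ← inner_fourier_real (Hs.bessel n a u), ← inner_fourier_real (complexify n _),
    inner_complex_Lp, inner_complex_Lp]
  refine integral_congr_ae ?_
  filter_upwards [Hs.fourier_bessel_ae u, Hs.fourier_bessel_ae (Hs.incl hle χ),
    Hs.fourier_bessel_ae χ] with ξ h1 h2 h3
  have h4 : wgt n b ξ = wgt n a ξ * wgt n a ξ := by
    rw [← wgt_add, hab]; congr 1; push_cast; ring
  rw [h1, h2, h3, Hs.toL2_incl, h4]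
  congr 1
  simp only [map_mul, Complex.conj_ofReal, Complex.ofReal_mul, fhat]
  ring

end Bessel

/-! ### The space `H̃ˢ(Ω)` and its embedding in `L²(Ω)` -/

section Domain

variable {n : ℕ} {Ω : Opens (Euc n)} {s : ℝ≥0}

/-- The embedding `H̃ˢ(Ω) ⊆ L²(Ω)`. -/
def embΩ (Ω : Opens (Euc n)) (s : ℝ≥0) : Htilde Ω s →L[ℝ] L2On Ω :=
  (restr Ω).comp ((Hs.toL2 n s).comp (Htilde Ω s).subtypeL)

lemma isClosed_Htilde : IsClosed (Htilde Ω s : Set (Hs n s)) :=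
  Submodule.isClosed_topologicalClosure _

instance : CompleteSpace (Htilde Ω s) := isClosed_Htilde.completeSpace_coe

instance : SecondCountableTopology (Htilde Ω s) := inferInstance

lemma restr_ae (u : L2 n) : ∀ᵐ x ∂(volume.restrict (Ω : Set (Euc n))), restr Ω u x = u x :=
  (LpToLpRestrictCLM_coeFn ℝ (Ω : Set (Euc n)) u)

/-- Elements of `H̃ˢ(Ω)` vanish outside `Ω`. -/
lemma Htilde.norm_emb (v : Htilde Ω s) : ‖embΩ Ω s v‖ = ‖Hs.toL2 n s v‖ := by
  obtain ⟨v, hv⟩ := v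
  change ‖restr Ω (Hs.toL2 n s v)‖ = ‖Hs.toL2 n s v‖
  refine closure_minimal (s := (LinearMap.range (testToHs Ω s) : Set (Hs n s)))
    (t := {v | ‖restr Ω (Hs.toL2 n s v)‖ = ‖Hs.toL2 n s v‖}) ?_ (isClosed_eq (by fun_prop)
      (by fun_prop)) hv
  rintro _ ⟨φ, rfl⟩
  refine (sq_eq_sq₀ (norm_nonneg _) (norm_nonneg _)).1 ?_
  have h1 : ∀ᵐ x, Hs.toL2 n s (testToHs Ω s φ) x = φ x := (memLp_test φ).coeFn_toLp
  rw [norm_Lp_sq, norm_Lp_sq]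
  calc _ = ∫ x in (Ω : Set (Euc n)), ‖φ x‖ ^ 2 := integral_congr_ae (by
        filter_upwards [restr_ae (Hs.toL2 n s (testToHs Ω s φ)), ae_restrict_of_ae h1] with x h h'
        rw [h, h'])
    _ = ∫ x, ‖φ x‖ ^ 2 := setIntegral_eq_integral_of_forall_compl_eq_zero fun x hx => by
        rw [image_eq_zero_of_notMem_tsupport fun h => hx (φ.tsupport_subset h)]; simp
    _ = _ := integral_congr_ae (by filter_upwards [h1] with x h; rw [h])

end Domain

/-! ### The Gagliardo seminorm and its Fourier symbol -/

section Gagliardo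

open Filter Topology

variable {n : ℕ}

/-- The character `ξ ↦ exp(2πi⟨h,ξ⟩)`. -/
def chr (h ξ : Euc n) : ℂ := (Real.fourierChar (inner ℝ h ξ) : ℂ)

lemma continuous_chr : Continuous fun z : Euc n × Euc n => chr z.1 z.2 := by
  unfold chr
  exact continuous_subtype_val.comp (Real.continuous_fourierChar.comp (by fun_prop))

lemma norm_chr (h ξ : Euc n) : ‖chr h ξ‖ = 1 := Circle.norm_coe _

lemma memLp_chr (h : Euc n) : MemLp (chr h) ⊤ (volume : Measure (Euc n)) :=
  memLp_top_of_bound (continuous_chr.comp (by fun_prop :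
    Continuous fun ξ : Euc n => (h, ξ))).aestronglyMeasurable 1
    (.of_forall fun ξ => (norm_chr h ξ).le)

/-- Translation on `L²`. -/
def transl (h : Euc n) (f : Lp ℂ 2 (volume : Measure (Euc n))) :
    Lp ℂ 2 (volume : Measure (Euc n)) :=
  Lp.compMeasurePreserving (fun x => x + h) (measurePreserving_add_right volume h) f

lemma coeFn_transl (h : Euc n) (f : Lp ℂ 2 (volume : Measure (Euc n))) :
    ∀ᵐ x, transl h f x = f (x + h) :=
  Lp.coeFn_compMeasurePreserving f _

/-- Translation, the Fourier transform and multiplication by a character are continuous on `L²`, so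
it is enough to treat the dense set of Schwartz functions, where the transform is an integral. -/
lemma fourier_transl (h : Euc n) (f : Lp ℂ 2 (volume : Measure (Euc n))) :
    ∀ᵐ ξ, (𝓕 (transl h f) : Lp ℂ 2 (volume : Measure (Euc n))) ξ =
      chr h ξ * (𝓕 f : Lp ℂ 2 (volume : Measure (Euc n))) ξ := by
  obtain ⟨m, hm⟩ : ∃ m : Lp ℂ 2 (volume : Measure (Euc n)) →L[ℂ] Lp ℂ 2 (volume : Measure (Euc n)),
    m = (ContinuousLinearMap.mul ℂ ℂ).holderL volume ⊤ 2 2 ((memLp_chr h).toLp _) := ⟨_, rfl⟩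
  have hme : ∀ g, ∀ᵐ ξ, m g ξ = chr h ξ * g ξ := fun g => by
    filter_upwards [(ContinuousLinearMap.mul ℂ ℂ).coeFn_holder (r := 2) ((memLp_chr h).toLp _) g,
      (memLp_chr h).coeFn_toLp] with ξ h1 h2
    rw [hm]
    change ((ContinuousLinearMap.mul ℂ ℂ).holder 2 ((memLp_chr h).toLp _) g) ξ = _
    rw [h1, h2]
    rfl
  suffices h1 : 𝓕 (transl h f) = m (𝓕 f) by rw [h1]; exact hme _
  refine DenseRange.induction_on (p := fun f => 𝓕 (transl h f) = m (𝓕 f))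
    (SchwartzMap.denseRange_toLpCLM (p := 2) (μ := (volume : Measure (Euc n)))
      (F := ℂ) ENNReal.ofNat_ne_top) f ?_ ?_
  · exact isClosed_eq ((Lp.fourierTransformₗᵢ (Euc n) ℂ).continuous.comp
      (Lp.isometry_compMeasurePreserving (measurePreserving_add_right volume h)).continuous)
      (m.continuous.comp (Lp.fourierTransformₗᵢ (Euc n) ℂ).continuous)
  · intro φ
    change 𝓕 (transl h (φ.toLp 2)) = m (𝓕 (φ.toLp 2))
    have h1 : transl h (φ.toLp 2) = (φ.compSubConstCLM ℂ (-h)).toLp 2 := by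
      refine Lp.ext ?_
      have hq := (measurePreserving_add_right (volume : Measure (Euc n)) h).quasiMeasurePreserving.ae
        (SchwartzMap.coeFn_toLp φ 2 volume)
      filter_upwards [coeFn_transl h (φ.toLp 2), hq,
        SchwartzMap.coeFn_toLp (φ.compSubConstCLM ℂ (-h)) 2] with x h2 h3 h4
      rw [h2, h3, h4, SchwartzMap.compSubConstCLM_apply, sub_neg_eq_add]
    rw [h1, SchwartzMap.toLp_fourier_eq, SchwartzMap.toLp_fourier_eq]
    refine Lp.ext ?_
    filter_upwards [SchwartzMap.coeFn_toLp (𝓕 (φ.compSubConstCLM ℂ (-h))) 2,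
      SchwartzMap.coeFn_toLp (𝓕 φ) 2, hme ((𝓕 φ).toLp 2)] with ξ h2 h3 h4
    rw [h2, h4, h3, SchwartzMap.fourier_coe, SchwartzMap.fourier_coe]
    have h5 : (φ.compSubConstCLM ℂ (-h) : Euc n → ℂ) = (φ : Euc n → ℂ) ∘ fun x => x + h := by
      ext x; simp [SchwartzMap.compSubConstCLM_apply]
    rw [h5]
    exact congrFun (VectorFourier.fourierIntegral_comp_add_right Real.fourierChar volume
      (innerₗ (Euc n)) φ h) ξ

lemma lintegral_enorm_sq {X E : Type*} [MeasurableSpace X] {μ : Measure X} [NormedAddCommGroup E]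
    (f : X → E) : ∫⁻ x, ‖f x‖ₑ ^ 2 ∂μ = eLpNorm f 2 μ ^ 2 := by
  rw [eLpNorm_eq_lintegral_rpow_enorm_toReal (by norm_num) (by norm_num), ← ENNReal.rpow_natCast,
    ← ENNReal.rpow_mul]
  simp

lemma lintegral_translate_sub (f : Lp ℂ 2 (volume : Measure (Euc n))) (h : Euc n) :
    ∫⁻ x, ‖f (x + h) - f x‖ₑ ^ 2 = ∫⁻ ξ, ‖chr h ξ - 1‖ₑ ^ 2 *
      ‖(𝓕 f : Lp ℂ 2 (volume : Measure (Euc n))) ξ‖ₑ ^ 2 := by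
  have h1 : ∫⁻ x, ‖f (x + h) - f x‖ₑ ^ 2 = ‖transl h f - f‖ₑ ^ 2 := by
    rw [Lp.enorm_def, ← lintegral_enorm_sq]
    refine lintegral_congr_ae ?_
    filter_upwards [coeFn_transl h f, Lp.coeFn_sub (transl h f) f] with x h1 h2
    rw [h2, Pi.sub_apply, h1]
  have h2 : ‖(𝓕 (transl h f) : Lp ℂ 2 (volume : Measure (Euc n))) - 𝓕 f‖ₑ = ‖transl h f - f‖ₑ := by
    have : (𝓕 (transl h f) : Lp ℂ 2 (volume : Measure (Euc n))) - 𝓕 f = 𝓕 (transl h f - f) :=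
      ((Lp.fourierTransformₗᵢ (Euc n) ℂ).map_sub _ _).symm
    rw [this, ← ofReal_norm, ← ofReal_norm, Lp.norm_fourier_eq]
  rw [h1, ← h2, Lp.enorm_def, ← lintegral_enorm_sq]
  refine lintegral_congr_ae ?_
  filter_upwards [fourier_transl h f, Lp.coeFn_sub (𝓕 (transl h f)) (𝓕 f)] with ξ h1 h2
  rw [h2, Pi.sub_apply, h1, ← mul_pow, ← enorm_mul, sub_mul, one_mul]

/-- The kernel `|h|^{-(n+2s)}`. -/
def gker (n : ℕ) (s : ℝ) (h : Euc n) : ℝ≥0∞ := ENNReal.ofReal (‖h‖ ^ (-(n + 2 * s)))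

lemma measurable_gker (s : ℝ) : Measurable (gker n s) := by
  unfold gker; fun_prop

lemma gker_neg (s : ℝ) (h : Euc n) : gker n s (-h) = gker n s h := by
  unfold gker; rw [norm_neg]

/-- The Fourier symbol of the Gagliardo seminorm. -/
def gsymb (s : ℝ) (ξ : Euc n) : ℝ≥0∞ := ∫⁻ h, ‖chr h ξ - 1‖ₑ ^ 2 * gker n s h

lemma lintegral_prod_sub (F : Euc n → Euc n → ℝ≥0∞) (hF : Measurable (Function.uncurry F)) :
    ∫⁻ z : Euc n × Euc n, F z.1 z.2 = ∫⁻ h, ∫⁻ y, F (y + h) y := by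
  change ∫⁻ z : Euc n × Euc n, Function.uncurry F z ∂(volume.prod volume) = _
  rw [lintegral_prod_symm _ hF.aemeasurable]
  simp only [Function.uncurry_apply_pair]
  have h1 : ∀ y, ∫⁻ x, F x y = ∫⁻ h, F (y + h) y := fun y =>
    (lintegral_add_left_eq_self (fun x => F x y) y).symm
  simp only [h1]
  rw [lintegral_lintegral_swap]
  exact (hF.comp (g := Function.uncurry F) ((measurable_fst.add measurable_snd).prodMk
    measurable_fst)).aemeasurable

/-- Substitute `x = y + h`, use Plancherel in `y` for fixed `h`, and exchange the integrals by
Tonelli. Both sides may be infinite, which later yields a criterion for membership in `Hˢ`. -/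
lemma gagliardo_fourier (s : ℝ) (f : Lp ℂ 2 (volume : Measure (Euc n))) :
    ∫⁻ z : Euc n × Euc n, ‖f z.1 - f z.2‖ₑ ^ 2 * gker n s (z.1 - z.2) =
      ∫⁻ ξ, gsymb s ξ * ‖(𝓕 f : Lp ℂ 2 (volume : Measure (Euc n))) ξ‖ₑ ^ 2 := by
  have hf := (Lp.stronglyMeasurable f).measurable
  have hf' := (Lp.stronglyMeasurable (𝓕 f : Lp ℂ 2 (volume : Measure (Euc n)))).measurable
  have hk := measurable_gker (n := n) s
  rw [lintegral_prod_sub (fun x y => ‖f x - f y‖ₑ ^ 2 * gker n s (x - y)) (by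
    unfold Function.uncurry; fun_prop)]
  have h1 : ∀ h, ∫⁻ y, ‖f (y + h) - f y‖ₑ ^ 2 * gker n s (y + h - y) =
      ∫⁻ ξ, ‖chr h ξ - 1‖ₑ ^ 2 * gker n s h *
        ‖(𝓕 f : Lp ℂ 2 (volume : Measure (Euc n))) ξ‖ₑ ^ 2 := by
    intro h
    simp only [add_sub_cancel_left]
    rw [lintegral_mul_const _ (by fun_prop), lintegral_translate_sub, ← lintegral_mul_const _ (by
      have : Measurable (chr h) := (continuous_chr.comp (by fun_prop :
        Continuous fun ξ : Euc n => (h, ξ))).measurable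
      fun_prop)]
    refine lintegral_congr fun ξ => ?_
    ring
  simp only [h1]
  have hc := (continuous_chr (n := n)).measurable
  rw [lintegral_lintegral_swap]
  · refine lintegral_congr fun ξ => ?_
    rw [lintegral_mul_const _ (by
      have : Measurable fun h => chr h ξ := (continuous_chr.comp (by fun_prop :
        Continuous fun h : Euc n => (h, ξ))).measurable
      fun_prop), gsymb]
  · refine Measurable.aemeasurable ?_
    have a1 : Measurable fun z : Euc n × Euc n => ‖chr z.1 z.2 - 1‖ₑ ^ 2 :=
      ((hc.sub_const 1).enorm).pow_const 2
    have a2 : Measurable fun z : Euc n × Euc n => gker n s z.1 := hk.comp measurable_fst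
    have a3 : Measurable fun z : Euc n × Euc n =>
        ‖(𝓕 f : Lp ℂ 2 (volume : Measure (Euc n))) z.2‖ₑ ^ 2 :=
      ((hf'.comp measurable_snd).enorm).pow_const 2
    exact (a1.mul a2).mul a3

/-! ### The symbol is a multiple of `|ξ|^{2s}` -/

lemma lintegral_smul_comp (F : Euc n → ℝ≥0∞) (hF : Measurable F) {r : ℝ} (hr : 0 < r) :
    ∫⁻ x, F (r • x) = ENNReal.ofReal ((r ^ n)⁻¹) * ∫⁻ x, F x := by
  have h := Measure.map_addHaar_smul (volume : Measure (Euc n)) hr.ne'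
  rw [← lintegral_map hF (measurable_const_smul r), h, lintegral_smul_measure, smul_eq_mul]
  congr 2
  rw [abs_of_pos (by positivity)]
  simp

/-- The kernel is radial and homogeneous. A reflection takes `ξ` to `‖ξ‖ e`; the dilation by `‖ξ‖`
contributes `‖ξ‖^{n+2s}` from the kernel and `‖ξ‖^{-n}` from the Jacobian. -/
lemma gsymb_eq (s : ℝ) (hs : 0 < s) {e : Euc n} (he : ‖e‖ = 1) (ξ : Euc n) :
    gsymb s ξ = ENNReal.ofReal (‖ξ‖ ^ (2 * s)) * gsymb s e := by
  by_cases hξ : ξ = 0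
  · have h0 : ∀ h : Euc n, chr h 0 = 1 := fun h => by simp [chr]
    rw [hξ, norm_zero, Real.zero_rpow (by positivity), ENNReal.ofReal_zero, zero_mul, gsymb]
    simp [h0]
  have hr : 0 < ‖ξ‖ := norm_pos_iff.2 hξ
  obtain ⟨A, hA⟩ : ∃ A : Euc n ≃ₗᵢ[ℝ] Euc n, A ξ = ‖ξ‖ • e :=
    ⟨_, Submodule.reflection_sub (by rw [norm_smul, norm_norm, he, mul_one])⟩
  have hm : Measurable fun h : Euc n => ‖chr h e - 1‖ₑ ^ 2 * gker n s h := by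
    have : Measurable fun h => chr h e := (continuous_chr.comp (by fun_prop :
        Continuous fun h : Euc n => (h, e))).measurable
    have := measurable_gker (n := n) s
    fun_prop
  have h1 : ∀ h : Euc n, ‖chr h ξ - 1‖ₑ ^ 2 * gker n s h = ENNReal.ofReal (‖ξ‖ ^ (n + 2 * s)) *
      (‖chr (A (‖ξ‖ • h)) e - 1‖ₑ ^ 2 * gker n s (A (‖ξ‖ • h))) := by
    intro h
    have e1 : chr h ξ = chr (A (‖ξ‖ • h)) e := by
      unfold chr
      rw [← A.inner_map_map h ξ, hA, map_smul, inner_smul_left, inner_smul_right]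
      rfl
    have e2 : gker n s h = ENNReal.ofReal (‖ξ‖ ^ (n + 2 * s)) * gker n s (A (‖ξ‖ • h)) := by
      unfold gker
      rw [A.norm_map, norm_smul, norm_norm, ← ENNReal.ofReal_mul (by positivity),
        Real.mul_rpow hr.le (norm_nonneg _), ← mul_assoc, ← Real.rpow_add hr, add_neg_cancel,
        Real.rpow_zero, one_mul]
    rw [e1, e2]
    ring
  have h2 : gsymb s ξ = ENNReal.ofReal (‖ξ‖ ^ (n + 2 * s)) *
      ∫⁻ h, (‖chr (A (‖ξ‖ • h)) e - 1‖ₑ ^ 2 * gker n s (A (‖ξ‖ • h))) := by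
    rw [gsymb, ← lintegral_const_mul']
    · exact lintegral_congr h1
    · exact ENNReal.ofReal_ne_top
  rw [h2, lintegral_smul_comp (fun h => ‖chr (A h) e - 1‖ₑ ^ 2 * gker n s (A h))
    (hm.comp A.continuous.measurable) hr,
    A.measurePreserving.lintegral_comp (f := fun h => ‖chr h e - 1‖ₑ ^ 2 * gker n s h) hm,
    ← mul_assoc, ← ENNReal.ofReal_mul (by positivity)]
  congr 2
  rw [Real.rpow_add hr, Real.rpow_natCast]
  field_simp

/-- Integrability of `min(1,|h|^β) |h|^{-(n+2s)}` for `β > 2s > 0`. -/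
lemma lintegral_min_gker_lt_top {s β : ℝ} (hs : 0 < s) (hβ : 2 * s < β) (hn : 0 < n) :
    ∫⁻ h : Euc n, ENNReal.ofReal (min 1 (‖h‖ ^ β)) * gker n s h < ⊤ := by
  have : Nontrivial (Euc n) := by
    have : Nonempty (Fin n) := ⟨⟨0, hn⟩⟩
    infer_instance
  have hint : Integrable (fun h : Euc n => (fun r : ℝ => min 1 (r ^ β) * r ^ (-(n + 2 * s))) ‖h‖)
      volume := by
    refine (integrable_fun_norm_addHaar (volume : Measure (Euc n))
      (f := fun r : ℝ => min 1 (r ^ β) * r ^ (-(n + 2 * s)))).2 ?_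
    rw [finrank_euclideanSpace_fin]
    have e1 : ∀ r : ℝ, 0 < r → r ^ (n - 1) • (min 1 (r ^ β) * r ^ (-(n + 2 * s))) =
        min 1 (r ^ β) * r ^ (-1 - 2 * s) := by
      intro r hr
      rw [smul_eq_mul, ← Real.rpow_natCast, mul_left_comm, ← Real.rpow_add hr,
        Nat.cast_sub hn]
      congr 2
      push_cast
      ring
    -- In polar coordinates the exponent is `β - 1 - 2s > -1` near `0` and `-1 - 2s < -1` at
    -- infinity.
    have e2 : IntegrableOn (fun r : ℝ => min 1 (r ^ β) * r ^ (-1 - 2 * s)) (Ioi 0) := by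
      have hsplit : Ioi (0 : ℝ) = Ioo 0 2 ∪ Ioi 1 := by
        ext r; simp only [mem_Ioi, mem_union, mem_Ioo]
        constructor
        · intro h; by_cases h1 : r < 2
          · exact Or.inl ⟨h, h1⟩
          · exact Or.inr (by linarith)
        · rintro (h | h) <;> [exact h.1; linarith]
      have hmeas : Measurable fun r : ℝ => min 1 (r ^ β) * r ^ (-1 - 2 * s) := by fun_prop
      rw [hsplit]
      refine IntegrableOn.union ?_ ?_
      · have := (intervalIntegral.integrableOn_Ioo_rpow_iff (s := β + (-1 - 2 * s)) (t := 2)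
          two_pos).2 (by linarith)
        refine Integrable.mono' this hmeas.aestronglyMeasurable ?_
        filter_upwards [ae_restrict_mem measurableSet_Ioo] with r hr
        have hr0 : 0 < r := hr.1
        rw [Real.norm_of_nonneg (mul_nonneg (le_min zero_le_one (by positivity)) (by positivity)),
          Real.rpow_add hr0]
        gcongr
        exact min_le_right _ _
      · have := integrableOn_Ioi_rpow_of_lt (a := -1 - 2 * s) (c := 1) (by linarith) one_pos
        refine Integrable.mono' this hmeas.aestronglyMeasurable ?_
        filter_upwards [ae_restrict_mem measurableSet_Ioi] with r hr
        have hr0 : 0 < r := lt_trans one_pos hr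
        rw [Real.norm_of_nonneg (mul_nonneg (le_min zero_le_one (by positivity)) (by positivity))]
        exact mul_le_of_le_one_left (by positivity) (min_le_left _ _)
    exact e2.congr_fun (fun r hr => (e1 r hr).symm) measurableSet_Ioi
  have h2 := hint.2
  rw [hasFiniteIntegral_iff_enorm] at h2
  refine lt_of_le_of_lt (lintegral_mono fun h => ?_) h2
  dsimp only
  rw [gker, ← ENNReal.ofReal_mul (le_min zero_le_one (by positivity)),
    Real.enorm_of_nonneg (mul_nonneg (le_min zero_le_one (by positivity)) (by positivity))]

lemma norm_chr_sub_one_sq_le (h ξ : Euc n) :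
    ‖chr h ξ - 1‖ ^ 2 ≤ (2 * Real.pi * (1 + ‖ξ‖)) ^ 2 * min 1 (‖h‖ ^ (2 : ℝ)) := by
  have h1 : ‖chr h ξ - 1‖ ≤ 2 := by
    refine (norm_sub_le _ _).trans ?_
    rw [norm_chr, norm_one]; norm_num
  have h2 : ‖chr h ξ - 1‖ ≤ 2 * Real.pi * ‖ξ‖ * ‖h‖ := by
    unfold chr
    rw [Real.fourierChar_apply, mul_comm _ Complex.I]
    refine Real.norm_exp_I_mul_ofReal_sub_one_le.trans ?_
    rw [norm_mul, norm_mul, Real.norm_of_nonneg Real.pi_pos.le]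
    have := norm_inner_le_norm (𝕜 := ℝ) h ξ
    calc _ ≤ ‖(2 : ℝ)‖ * Real.pi * (‖h‖ * ‖ξ‖) := by gcongr
      _ = _ := by norm_num; ring
  have hpi := Real.pi_gt_three
  have hξ := norm_nonneg ξ
  rw [Real.rpow_two, mul_min_of_nonneg _ _ (sq_nonneg _), mul_one]
  refine le_min ?_ ?_
  · gcongr
    nlinarith [mul_nonneg Real.pi_pos.le hξ]
  · rw [← mul_pow]
    gcongr
    refine h2.trans ?_
    gcongr
    linarith

lemma gsymb_lt_top {s : ℝ} (hs : 0 < s) (hs1 : s < 1) (hn : 0 < n) (e : Euc n) :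
    gsymb s e < ⊤ := by
  have h := lintegral_min_gker_lt_top hs (β := 2) (by linarith) hn
  have h1 : gsymb s e ≤ ENNReal.ofReal ((2 * Real.pi * (1 + ‖e‖)) ^ 2) *
      ∫⁻ h : Euc n, ENNReal.ofReal (min 1 (‖h‖ ^ (2 : ℝ))) * gker n s h := by
    rw [← lintegral_const_mul' _ _ ENNReal.ofReal_ne_top]
    refine lintegral_mono fun h => ?_
    rw [← mul_assoc, ← ENNReal.ofReal_mul (by positivity)]
    gcongr
    rw [← ofReal_norm, ← ENNReal.ofReal_pow (norm_nonneg _)]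
    exact ENNReal.ofReal_le_ofReal (norm_chr_sub_one_sq_le h e)
  exact lt_of_le_of_lt h1 (ENNReal.mul_lt_top ENNReal.ofReal_lt_top h)

/-- If the integral vanished, the continuous character `h ↦ exp(2πi⟨h,e⟩)` would be identically `1`,
but at `h = e/2` it equals `-1`. -/
lemma gsymb_pos {s : ℝ} {e : Euc n} (he : ‖e‖ = 1) : 0 < gsymb s e := by
  rw [pos_iff_ne_zero]
  intro h0
  have hc : Continuous fun h : Euc n => chr h e :=
    continuous_chr.comp (by fun_prop : Continuous fun h : Euc n => (h, e))
  have hm : Measurable fun h : Euc n => ‖chr h e - 1‖ₑ ^ 2 * gker n s h := by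
    have := hc.measurable
    have := measurable_gker (n := n) s
    fun_prop
  rw [gsymb, lintegral_eq_zero_iff hm] at h0
  have : Nontrivial (Euc n) := ⟨e, 0, fun h => by rw [h, norm_zero] at he; exact zero_ne_one he⟩
  have h1 : (fun h : Euc n => chr h e) =ᵐ[volume] fun _ => 1 := by
    have hne : ∀ᵐ h : Euc n, h ≠ 0 := Measure.ae_ne volume 0
    filter_upwards [h0, hne] with h h2 h3
    have h4 : gker n s h ≠ 0 := by
      have : 0 < ‖h‖ := norm_pos_iff.2 h3
      rw [gker, ENNReal.ofReal_ne_zero_iff]; positivity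
    have h5 := (mul_eq_zero.1 h2).resolve_right h4
    have h6 := enorm_eq_zero.1 ((pow_eq_zero_iff two_ne_zero).1 h5)
    exact sub_eq_zero.1 h6
  have h2 := congrFun (Measure.eq_of_ae_eq h1 hc continuous_const) ((2⁻¹ : ℝ) • e)
  simp only [chr, inner_smul_left, real_inner_self_eq_norm_sq, he, Real.fourierChar_apply] at h2
  norm_num at h2
  rw [show (2 : ℂ) * Real.pi * (1 / 2) * Complex.I = Real.pi * Complex.I by ring,
    Complex.exp_pi_mul_I] at h2
  norm_num at h2

end Gagliardo

/-! ### Difference quotients as a map from `Hˢ(ℝⁿ)` to `L²(ℝ²ⁿ)` -/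

section Gagliardo

open Filter Topology

variable {n : ℕ} {s : ℝ≥0}

/-- The admissible orders. -/
def Adm (n : ℕ) (s : ℝ≥0) : Prop := 0 < s ∧ s < 1 ∧ 0 < n

/-- The difference quotient `(u(x)-u(y)) / |x-y|^{n/2+s}`. -/
def quot (s : ℝ) (u : Euc n → ℝ) (z : Euc n × Euc n) : ℝ :=
  (u z.1 - u z.2) * ‖z.1 - z.2‖ ^ (-((n : ℝ) / 2 + s))

lemma ae_fst {P : Euc n → Prop} (h : ∀ᵐ x, P x) : ∀ᵐ z : Euc n × Euc n, P z.1 :=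
  Measure.quasiMeasurePreserving_fst.ae h

lemma ae_snd {P : Euc n → Prop} (h : ∀ᵐ x, P x) : ∀ᵐ z : Euc n × Euc n, P z.2 :=
  Measure.quasiMeasurePreserving_snd.ae h

lemma quot_congr {σ : ℝ} {u v : Euc n → ℝ} (h : ∀ᵐ x, u x = v x) :
    ∀ᵐ z : Euc n × Euc n, quot σ u z = quot σ v z := by
  filter_upwards [ae_fst h, ae_snd h] with z h1 h2
  rw [quot, h1, h2, quot]

lemma aestronglyMeasurable_quot {σ : ℝ} {u : Euc n → ℝ}
    (hu : AEStronglyMeasurable u (volume : Measure (Euc n))) :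
    AEStronglyMeasurable (quot σ u) (volume : Measure (Euc n × Euc n)) := by
  have h1 : AEStronglyMeasurable (fun z : Euc n × Euc n => u z.1) volume :=
    hu.comp_quasiMeasurePreserving Measure.quasiMeasurePreserving_fst
  have h2 : AEStronglyMeasurable (fun z : Euc n × Euc n => u z.2) volume :=
    hu.comp_quasiMeasurePreserving Measure.quasiMeasurePreserving_snd
  have h3 : Measurable fun z : Euc n × Euc n => ‖z.1 - z.2‖ ^ (-((n : ℝ) / 2 + σ)) := by fun_prop
  exact (h1.sub h2).mul h3.aestronglyMeasurable

lemma enorm_quot_sq (σ : ℝ) (u : Euc n → ℝ) (z : Euc n × Euc n) :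
    ‖quot σ u z‖ₑ ^ 2 = ‖u z.1 - u z.2‖ₑ ^ 2 * gker n σ (z.1 - z.2) := by
  rw [quot, enorm_mul, mul_pow, gker]
  congr 1
  rw [Real.enorm_of_nonneg (by positivity), ← ENNReal.ofReal_pow (by positivity),
    ← Real.rpow_natCast, ← Real.rpow_mul (norm_nonneg _)]
  congr 2
  push_cast
  ring

lemma lintegral_quot_sq (σ : ℝ) (u : L2 n) :
    ∫⁻ z : Euc n × Euc n, ‖quot σ u z‖ₑ ^ 2 = ∫⁻ ξ, gsymb σ ξ * ‖fhat u ξ‖ₑ ^ 2 := by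
  rw [fhat, ← gagliardo_fourier]
  have h : ∀ᵐ x, complexify n u x = (u x : ℂ) := by
    filter_upwards [Complex.ofRealCLM.coeFn_compLpL (p := 2) (μ := volume) u] with x hx
    rw [complexify, hx]; rfl
  refine lintegral_congr_ae ?_
  filter_upwards [ae_fst h, ae_snd h] with z h1 h2
  rw [enorm_quot_sq, h1, h2, ← Complex.ofReal_sub]
  congr 2
  rw [← ofReal_norm, ← ofReal_norm, Complex.norm_real]

lemma norm_rpow_eq (ξ : Euc n) (a : ℝ) : ‖ξ‖ ^ a = (‖ξ‖ ^ 2) ^ (a / 2) := by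
  rw [← Real.rpow_natCast, ← Real.rpow_mul (norm_nonneg _)]
  congr 1; push_cast; ring

lemma norm_rpow_le_wgt {a : ℝ} (ha : 0 ≤ a) (ξ : Euc n) : ‖ξ‖ ^ a ≤ wgt n a ξ := by
  rw [norm_rpow_eq, wgt]
  gcongr
  linarith

/-- Subadditivity of `x ↦ xᵃ` for `0 ≤ a ≤ 1`. It yields Gårding's inequality with constant `1` for
the seminorm `‖|ξ|ˢ û‖`. -/
lemma wgt_sq_le {a : ℝ} (ha : 0 ≤ a) (ha1 : a ≤ 1) (ξ : Euc n) :
    wgt n a ξ ^ 2 ≤ 1 + (‖ξ‖ ^ a) ^ 2 := by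
  have h : ∀ x : ℝ, 0 ≤ x → (x ^ (a / 2)) ^ 2 = x ^ a := fun x hx => by
    rw [← Real.rpow_natCast, ← Real.rpow_mul hx]; congr 1; push_cast; ring
  rw [norm_rpow_eq, wgt, h _ (by positivity), h _ (by positivity)]
  refine (Real.rpow_add_le_add_rpow zero_le_one (sq_nonneg _) ha ha1).trans ?_
  rw [Real.one_rpow]

lemma memLp_riesz (u : Hs n s) :
    MemLp (fun ξ => ((‖ξ‖ ^ (s : ℝ) : ℝ) : ℂ) * fhat (Hs.toL2 n s u) ξ) 2
      (volume : Measure (Euc n)) := by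
  have hm : Measurable fun ξ : Euc n => ((‖ξ‖ ^ (s : ℝ) : ℝ) : ℂ) := by fun_prop
  refine (Hs.memLp_wgt_mul u).mono (hm.aestronglyMeasurable.mul (Lp.aestronglyMeasurable _))
    (.of_forall fun ξ => ?_)
  simp only [norm_mul, Complex.norm_real, Real.norm_of_nonneg (wgt_pos _ _).le]
  rw [Real.norm_of_nonneg (by positivity)]
  gcongr
  exact norm_rpow_le_wgt s.2 ξ

lemma fhat_add (u v : L2 n) : fhat (u + v) = fhat u + fhat v := by
  unfold fhat; rw [map_add]; exact (Lp.fourierTransformₗᵢ (Euc n) ℂ).map_add _ _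

lemma fhat_smul (c : ℝ) (u : L2 n) : fhat (c • u) = (c : ℂ) • fhat u := by
  unfold fhat
  rw [map_smul, show c • complexify n u = (c : ℂ) • complexify n u from
    (Complex.coe_smul c (complexify n u)).symm]
  exact (Lp.fourierTransformₗᵢ (Euc n) ℂ).map_smul _ _

/-- The map `u ↦ |ξ|ˢ û`. -/
def rieszMap (n : ℕ) (s : ℝ≥0) : Hs n s →ₗ[ℝ] Lp ℂ 2 (volume : Measure (Euc n)) where
  toFun u := (memLp_riesz u).toLp _
  map_add' u v := by
    rw [← MemLp.toLp_add]
    refine MemLp.toLp_congr _ _ ?_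
    rw [map_add, fhat_add]
    filter_upwards [Lp.coeFn_add (fhat (Hs.toL2 n s u)) (fhat (Hs.toL2 n s v))] with ξ h
    rw [h, Pi.add_apply, Pi.add_apply, mul_add]
  map_smul' c u := by
    rw [RingHom.id_apply, ← MemLp.toLp_const_smul]
    refine MemLp.toLp_congr _ _ ?_
    rw [map_smul, fhat_smul]
    filter_upwards [Lp.coeFn_smul (c : ℂ) (fhat (Hs.toL2 n s u))] with ξ h
    rw [h, Pi.smul_apply, Pi.smul_apply, smul_eq_mul, mul_left_comm, Complex.real_smul]

lemma coeFn_rieszMap (u : Hs n s) : ∀ᵐ ξ, rieszMap n s u ξ =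
    ((‖ξ‖ ^ (s : ℝ) : ℝ) : ℂ) * fhat (Hs.toL2 n s u) ξ := (memLp_riesz u).coeFn_toLp

lemma norm_rieszMap_sq (u : Hs n s) :
    ‖rieszMap n s u‖ ^ 2 = ∫ ξ, (‖ξ‖ ^ (s : ℝ)) ^ 2 * ‖fhat (Hs.toL2 n s u) ξ‖ ^ 2 := by
  rw [norm_Lp_sq]
  refine integral_congr_ae ?_
  filter_upwards [coeFn_rieszMap u] with ξ h
  rw [h, norm_mul, mul_pow, Complex.norm_real, Real.norm_of_nonneg (by positivity)]

lemma integrable_riesz (u : Hs n s) :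
    Integrable fun ξ => (‖ξ‖ ^ (s : ℝ)) ^ 2 * ‖fhat (Hs.toL2 n s u) ξ‖ ^ 2 := by
  refine ((memLp_riesz u).integrable_norm_pow (p := 2) (by norm_num)).congr (.of_forall fun ξ => ?_)
  simp only [norm_mul, mul_pow, Complex.norm_real]
  rw [Real.norm_of_nonneg (by positivity)]

lemma Hs.integrable_wgt_mul (u : Hs n s) :
    Integrable fun ξ => wgt n s ξ ^ 2 * ‖fhat (Hs.toL2 n s u) ξ‖ ^ 2 := by
  refine ((Hs.memLp_wgt_mul u).integrable_norm_pow (p := 2) (by norm_num)).congr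
    (.of_forall fun ξ => ?_)
  simp only [norm_mul, mul_pow, Complex.norm_real, Real.norm_of_nonneg (wgt_pos _ _).le]

lemma norm_rieszMap_le (u : Hs n s) : ‖rieszMap n s u‖ ≤ ‖u‖ := by
  refine (sq_le_sq₀ (norm_nonneg _) (norm_nonneg _)).1 ?_
  rw [norm_rieszMap_sq, Hs.norm_sq_eq]
  refine integral_mono (integrable_riesz u) (Hs.integrable_wgt_mul u) fun ξ => ?_
  dsimp only
  gcongr
  exact norm_rpow_le_wgt s.2 ξ

lemma norm_fhat_sq (u : L2 n) : ‖u‖ ^ 2 = ∫ ξ, ‖fhat u ξ‖ ^ 2 := by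
  rw [← norm_fhat, norm_Lp_sq]

lemma Hs.norm_sq_le (hs : s ≤ 1) (u : Hs n s) :
    ‖u‖ ^ 2 ≤ ‖Hs.toL2 n s u‖ ^ 2 + ‖rieszMap n s u‖ ^ 2 := by
  have h1 : Integrable fun ξ => ‖fhat (Hs.toL2 n s u) ξ‖ ^ 2 :=
    (Lp.memLp (fhat (Hs.toL2 n s u))).integrable_norm_pow (by norm_num)
  rw [Hs.norm_sq_eq, norm_rieszMap_sq, norm_fhat_sq, ← integral_add h1 (integrable_riesz u)]
  refine integral_mono (Hs.integrable_wgt_mul u) (h1.add (integrable_riesz u)) fun ξ => ?_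
  have := wgt_sq_le s.2 (by exact_mod_cast hs) ξ
  change wgt n s ξ ^ 2 * ‖fhat (Hs.toL2 n s u) ξ‖ ^ 2 ≤ ‖fhat (Hs.toL2 n s u) ξ‖ ^ 2 +
    (‖ξ‖ ^ (s : ℝ)) ^ 2 * ‖fhat (Hs.toL2 n s u) ξ‖ ^ 2
  rw [← one_add_mul]
  gcongr
  exact this

/-- The smoother factor can carry all derivatives. -/
lemma abs_inner_rieszMap_le {b : ℝ≥0} (hb : b = 2 * s) (hle : s ≤ b) (f : Hs n b) (v : Hs n s) :
    |inner ℝ (rieszMap n s (Hs.incl hle f)) (rieszMap n s v)| ≤ ‖f‖ * ‖Hs.toL2 n s v‖ := by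
  rw [inner_complex_Lp]
  have h1 : ‖∫ ξ, (rieszMap n s (Hs.incl hle f) ξ * (starRingEnd ℂ) (rieszMap n s v ξ)).re‖ ≤
      ∫ ξ, ‖(wgt n b ξ : ℂ) * fhat (Hs.toL2 n b f) ξ‖ * ‖fhat (Hs.toL2 n s v) ξ‖ := by
    refine norm_integral_le_of_norm_le
      (integrable_norm_mul_norm (Hs.memLp_wgt_mul f) (Lp.memLp _)) ?_
    filter_upwards [coeFn_rieszMap (Hs.incl hle f), coeFn_rieszMap v] with ξ e1 e2
    refine (Complex.abs_re_le_norm _).trans ?_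
    rw [e1, e2, Hs.toL2_incl, norm_mul, RCLike.norm_conj, norm_mul, norm_mul, norm_mul,
      Complex.norm_real, Complex.norm_real, Real.norm_of_nonneg (by positivity),
      Real.norm_of_nonneg (wgt_pos _ _).le]
    have h2 : ‖ξ‖ ^ (s : ℝ) * ‖ξ‖ ^ (s : ℝ) ≤ wgt n b ξ := by
      have h3 : (b : ℝ) = s + s := by rw [hb]; push_cast; ring
      rw [h3, wgt_add]
      exact mul_le_mul (norm_rpow_le_wgt s.2 ξ) (norm_rpow_le_wgt s.2 ξ) (by positivity)
        (wgt_pos _ _).le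
    calc _ = ‖ξ‖ ^ (s : ℝ) * ‖ξ‖ ^ (s : ℝ) * (‖fhat (Hs.toL2 n b f) ξ‖ *
          ‖fhat (Hs.toL2 n s v) ξ‖) := by ring
      _ ≤ wgt n b ξ * (‖fhat (Hs.toL2 n b f) ξ‖ * ‖fhat (Hs.toL2 n s v) ξ‖) := by gcongr
      _ = _ := by ring
  refine h1.trans ((integral_mul_le_norm_toLp (Hs.memLp_wgt_mul f) (Lp.memLp _)).trans ?_)
  rw [Lp.toLp_coeFn, norm_fhat]
  gcongr
  refine (sq_le_sq₀ (norm_nonneg _) (norm_nonneg _)).1 ?_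
  rw [norm_toLp_sq, Hs.norm_sq_eq]
  refine (integral_congr_ae (.of_forall fun ξ => ?_)).le
  simp only [norm_mul, mul_pow, Complex.norm_real, Real.norm_of_nonneg (wgt_pos _ _).le]

/-! ### The Gagliardo map -/

lemma exists_unit_vector (hn : 0 < n) : ∃ e : Euc n, ‖e‖ = 1 :=
  ⟨EuclideanSpace.single ⟨0, hn⟩ 1, by simp⟩

/-- The constant is the Gagliardo symbol at a unit vector, which is finite because `0 < s < 1`. -/
lemma exists_eLpNorm_quot (h : Adm n s) : ∃ c : ℝ, 0 < c ∧ ∀ u : Hs n s,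
    eLpNorm (quot s (Hs.toL2 n s u)) 2 volume ^ 2 = ENNReal.ofReal c * ‖rieszMap n s u‖ₑ ^ 2 := by
  obtain ⟨hs0, hs1, hn⟩ := h
  obtain ⟨e, he⟩ := exists_unit_vector hn
  have hs0' : (0 : ℝ) < s := by exact_mod_cast hs0
  have htop := gsymb_lt_top hs0' (by exact_mod_cast hs1) hn e
  refine ⟨(gsymb s e).toReal, ENNReal.toReal_pos (gsymb_pos he).ne' htop.ne, fun u => ?_⟩
  rw [ENNReal.ofReal_toReal htop.ne, ← lintegral_enorm_sq, lintegral_quot_sq, Lp.enorm_def,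
    ← lintegral_enorm_sq, ← lintegral_const_mul' _ _ htop.ne]
  refine lintegral_congr_ae ?_
  filter_upwards [coeFn_rieszMap u] with ξ h1
  rw [gsymb_eq s hs0' he, h1, enorm_mul, mul_pow, mul_comm (ENNReal.ofReal _), mul_assoc]
  congr 2
  rw [← ofReal_norm, Complex.norm_real, Real.norm_of_nonneg (by positivity),
    ← ENNReal.ofReal_pow (by positivity), ← Real.rpow_natCast, ← Real.rpow_mul (norm_nonneg _)]
  congr 2
  push_cast; ring

lemma memLp_quot (h : Adm n s) (u : Hs n s) :
    MemLp (quot s (Hs.toL2 n s u)) 2 (volume : Measure (Euc n × Euc n)) := by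
  refine ⟨aestronglyMeasurable_quot (Lp.aestronglyMeasurable _), ?_⟩
  obtain ⟨c, -, hc⟩ := exists_eLpNorm_quot h
  have h1 : eLpNorm (quot s (Hs.toL2 n s u)) 2 volume ^ 2 < ⊤ := by
    rw [hc u]
    exact ENNReal.mul_lt_top ENNReal.ofReal_lt_top (ENNReal.pow_lt_top enorm_lt_top)
  exact (ENNReal.pow_lt_top_iff).1 h1 |>.resolve_right two_ne_zero

/-- The (scalar) fractional gradient as a map `Hˢ(ℝⁿ) → L²(ℝ²ⁿ)`. -/
def gagMapₗ (h : Adm n s) : Hs n s →ₗ[ℝ] Lp ℝ 2 (volume : Measure (Euc n × Euc n)) where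
  toFun u := (memLp_quot h u).toLp _
  map_add' u v := by
    rw [← MemLp.toLp_add]
    refine MemLp.toLp_congr _ _ ?_
    rw [map_add]
    have h1 := Lp.coeFn_add (Hs.toL2 n s u) (Hs.toL2 n s v)
    filter_upwards [ae_fst h1, ae_snd h1] with z h2 h3
    rw [Pi.add_apply]
    unfold quot
    rw [h2, h3, Pi.add_apply, Pi.add_apply]
    ring
  map_smul' c u := by
    rw [RingHom.id_apply, ← MemLp.toLp_const_smul]
    refine MemLp.toLp_congr _ _ ?_
    rw [map_smul]
    have h1 := Lp.coeFn_smul c (Hs.toL2 n s u)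
    filter_upwards [ae_fst h1, ae_snd h1] with z h2 h3
    rw [Pi.smul_apply]
    unfold quot
    rw [h2, h3, Pi.smul_apply, Pi.smul_apply, smul_eq_mul, smul_eq_mul, smul_eq_mul]
    ring

lemma exists_inner_gagMapₗ (h : Adm n s) : ∃ c : ℝ, 0 < c ∧ (∀ u : Hs n s,
    ‖gagMapₗ h u‖ ^ 2 = c * ‖rieszMap n s u‖ ^ 2) ∧ ∀ u v : Hs n s,
    inner ℝ (gagMapₗ h u) (gagMapₗ h v) = c * inner ℝ (rieszMap n s u) (rieszMap n s v) := by
  obtain ⟨c, hc0, hc⟩ := exists_eLpNorm_quot h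
  have key : ∀ u : Hs n s, ‖gagMapₗ h u‖ ^ 2 = c * ‖rieszMap n s u‖ ^ 2 := fun u => by
    have h1 : ‖gagMapₗ h u‖ₑ ^ 2 = ENNReal.ofReal c * ‖rieszMap n s u‖ₑ ^ 2 := by
      rw [← hc u, Lp.enorm_def]
      congr 1
      exact eLpNorm_congr_ae (memLp_quot h u).coeFn_toLp
    have h2 := congrArg ENNReal.toReal h1
    simpa [ENNReal.toReal_mul, ENNReal.toReal_ofReal hc0.le] using h2
  refine ⟨c, hc0, key, fun u v => ?_⟩
  rw [real_inner_eq_norm_add_mul_self_sub_norm_mul_self_sub_norm_mul_self_div_two,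
    real_inner_eq_norm_add_mul_self_sub_norm_mul_self_sub_norm_mul_self_div_two, ← map_add,
    ← map_add]
  simp only [← pow_two, key]
  ring

/-- The continuous version of `gagMapₗ`. -/
def gagMap (h : Adm n s) : Hs n s →L[ℝ] Lp ℝ 2 (volume : Measure (Euc n × Euc n)) :=
  (gagMapₗ h).mkContinuous (√(exists_inner_gagMapₗ h).choose) fun u => by
    obtain ⟨hc0, hc, -⟩ := (exists_inner_gagMapₗ h).choose_spec
    refine (sq_le_sq₀ (norm_nonneg _) (by positivity)).1 ?_
    rw [hc, mul_pow, Real.sq_sqrt hc0.le]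
    gcongr
    exact norm_rieszMap_le u

lemma coeFn_gagMap (h : Adm n s) (u : Hs n s) :
    ∀ᵐ z, gagMap h u z = quot s (Hs.toL2 n s u) z := (memLp_quot h u).coeFn_toLp

lemma exists_inner_gagMap (h : Adm n s) : ∃ c : ℝ, 0 < c ∧ (∀ u : Hs n s,
    ‖gagMap h u‖ ^ 2 = c * ‖rieszMap n s u‖ ^ 2) ∧ ∀ u v : Hs n s,
    inner ℝ (gagMap h u) (gagMap h v) = c * inner ℝ (rieszMap n s u) (rieszMap n s v) :=
  exists_inner_gagMapₗ h

/-- Gårding's inequality for the Gagliardo form. -/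
lemma exists_garding (h : Adm n s) : ∃ c : ℝ, 0 < c ∧ ∀ u : Hs n s,
    c * ‖u‖ ^ 2 ≤ ‖gagMap h u‖ ^ 2 + c * ‖Hs.toL2 n s u‖ ^ 2 := by
  obtain ⟨c, hc0, hc, -⟩ := exists_inner_gagMap h
  refine ⟨c, hc0, fun u => ?_⟩
  rw [hc, ← mul_add]
  gcongr
  rw [add_comm]
  exact Hs.norm_sq_le h.2.1.le u

/-- Integration by parts for the Gagliardo form. -/
lemma exists_abs_inner_gagMap_le (h : Adm n s) {b : ℝ≥0} (hb : b = 2 * s) (hle : s ≤ b) :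
    ∃ C : ℝ, 0 < C ∧ ∀ (f : Hs n b) (v : Hs n s),
      |inner ℝ (gagMap h (Hs.incl hle f)) (gagMap h v)| ≤ C * ‖f‖ * ‖Hs.toL2 n s v‖ := by
  obtain ⟨c, hc0, -, hc⟩ := exists_inner_gagMap h
  refine ⟨c, hc0, fun f v => ?_⟩
  rw [hc, abs_mul, abs_of_pos hc0, mul_assoc]
  gcongr
  exact abs_inner_rieszMap_le hb hle f v

end Gagliardo

set_option maxSynthPendingDepth 3

/-! ### Nonlocal bilinear forms with bounded coefficients -/

section Forms

open Filter Topology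

variable {n : ℕ} {s : ℝ≥0}

lemma inner_real_eq (a b : ℝ) : inner ℝ a b = a * b := by
  simp [mul_comm]

/-- Multiplication by a bounded function on `L²`. -/
def mulLp {X : Type*} [MeasurableSpace X] {μ : Measure X} (θ : Lp ℝ ⊤ μ) : Lp ℝ 2 μ →L[ℝ] Lp ℝ 2 μ :=
  (ContinuousLinearMap.mul ℝ ℝ).holderL μ ⊤ 2 2 θ

lemma coeFn_mulLp {X : Type*} [MeasurableSpace X] {μ : Measure X} (θ : Lp ℝ ⊤ μ) (f : Lp ℝ 2 μ) :
    ∀ᵐ x ∂μ, mulLp θ f x = θ x * f x :=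
  (ContinuousLinearMap.mul ℝ ℝ).coeFn_holder θ f

lemma norm_mulLp_le {X : Type*} [MeasurableSpace X] {μ : Measure X} (θ : Lp ℝ ⊤ μ) (f : Lp ℝ 2 μ) :
    ‖mulLp θ f‖ ≤ ‖θ‖ * ‖f‖ := by
  refine ((ContinuousLinearMap.mul ℝ ℝ).norm_holder_apply_apply_le θ f).trans ?_
  have := ContinuousLinearMap.opNorm_mul_le ℝ ℝ
  gcongr
  calc _ ≤ 1 * ‖θ‖ := by gcongr
    _ = ‖θ‖ := one_mul _

/-- The bilinear form `(u,v) ↦ ∫ θ (u(x)-u(y)) (v(x)-v(y)) / |x-y|^{n+2s} dx dy`. -/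
def gagForm (h : Adm n s) (θ : Lp ℝ ⊤ (volume : Measure (Euc n × Euc n))) :
    Hs n s →L[ℝ] Hs n s →L[ℝ] ℝ :=
  LinearMap.mkContinuous₂
    (LinearMap.mk₂ ℝ (fun u v => (inner ℝ (mulLp θ (gagMap h u)) (gagMap h v) : ℝ))
      (fun u v w => by simp only [map_add, inner_add_left])
      (fun c u v => by simp only [map_smul, real_inner_smul_left, smul_eq_mul])
      (fun u v w => by simp only [map_add, inner_add_right])
      (fun c u v => by simp only [map_smul, real_inner_smul_right, smul_eq_mul]))
    (‖θ‖ * ‖gagMap h‖ ^ 2) fun u v => by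
      rw [LinearMap.mk₂_apply]
      refine (abs_real_inner_le_norm _ _).trans ?_
      have h1 := norm_mulLp_le θ (gagMap h u)
      have h2 := (gagMap h).le_opNorm u
      have h3 := (gagMap h).le_opNorm v
      calc _ ≤ (‖θ‖ * (‖gagMap h‖ * ‖u‖)) * (‖gagMap h‖ * ‖v‖) := by
            refine mul_le_mul (h1.trans ?_) h3 (norm_nonneg _) (by positivity)
            gcongr
        _ = _ := by ring

variable (h : Adm n s) (θ θ' : Lp ℝ ⊤ (volume : Measure (Euc n × Euc n)))

lemma gagForm_apply (u v : Hs n s) :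
    gagForm h θ u v = inner ℝ (mulLp θ (gagMap h u)) (gagMap h v) := rfl

lemma norm_gagForm_le : ‖gagForm h θ‖ ≤ ‖θ‖ * ‖gagMap h‖ ^ 2 :=
  LinearMap.mkContinuous₂_norm_le _ (by positivity) _

lemma gagForm_sub : gagForm h (θ - θ') = gagForm h θ - gagForm h θ' := by
  ext u v
  have h1 : ∀ f, mulLp (θ - θ') f = mulLp θ f - mulLp θ' f := fun f => by
    unfold mulLp
    rw [map_sub]; rfl
  simp only [_root_.sub_apply, gagForm_apply, h1, inner_sub_left]

lemma gagForm_eq_integral (u v : Hs n s) : gagForm h θ u v =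
    ∫ z : Euc n × Euc n, θ z * (quot s (Hs.toL2 n s u) z * quot s (Hs.toL2 n s v) z) := by
  rw [gagForm_apply, L2.inner_def]
  refine integral_congr_ae ?_
  filter_upwards [coeFn_mulLp θ (gagMap h u), coeFn_gagMap h u, coeFn_gagMap h v] with z h1 h2 h3
  rw [h1, h2, h3]
  simp only [inner_real_eq]
  ring

lemma gagForm_symm (u v : Hs n s) : gagForm h θ u v = gagForm h θ v u := by
  rw [gagForm_eq_integral, gagForm_eq_integral]
  exact integral_congr_ae (.of_forall fun z => by simp only [mul_comm])

lemma gagForm_ge {c : ℝ} (hc : ∀ᵐ z, c ≤ θ z) (u : Hs n s) :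
    c * ‖gagMap h u‖ ^ 2 ≤ gagForm h θ u u := by
  rw [gagForm_apply, L2.inner_def, norm_Lp_sq, ← integral_const_mul]
  refine integral_mono_ae (((Lp.memLp (gagMap h u)).integrable_norm_pow (by norm_num)).const_mul c)
    (L2.integrable_inner _ _) ?_
  filter_upwards [coeFn_mulLp θ (gagMap h u), hc] with z h1 h2
  rw [h1]
  simp only [inner_real_eq, Real.norm_eq_abs, sq_abs]
  nlinarith [mul_le_mul_of_nonneg_right h2 (sq_nonneg (gagMap h u z))]

/-! ### Conductivities -/

/-- `g` is a measurable version of `γ^{1/2}`, bounded from above and below. -/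
structure IsRootCoef (T : ℝ) (γ : Euc n → ℝ → ℝ) (g : ℝ → Euc n → ℝ) (c Λ : ℝ) : Prop where
  meas : Measurable (Function.uncurry g)
  pos : 0 < c
  lower : ∀ t x, c ≤ g t x
  upper : ∀ t x, g t x ≤ Λ
  ae_cylinder : ∀ᵐ z ∂(cylinderMeasure n T), √(γ z.1 z.2) = g z.2 z.1

lemma cylinderMeasure_eq (T : ℝ) :
    cylinderMeasure n T = (volume : Measure (Euc n)).prod (timeMeasure T) := by
  rw [cylinderMeasure, timeMeasure, Measure.volume_eq_prod, ← Measure.prod_restrict,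
    Measure.restrict_univ]

lemma ae_ae_of_ae_cylinder {T : ℝ} {P : Euc n → ℝ → Prop}
    (h : ∀ᵐ z ∂(cylinderMeasure n T), P z.1 z.2) :
    ∀ᵐ t ∂(timeMeasure T), ∀ᵐ x, P x t := by
  rw [cylinderMeasure_eq] at h
  have h1 : ∀ᵐ z ∂((timeMeasure T).prod (volume : Measure (Euc n))), P z.2 z.1 := by
    have : SFinite (timeMeasure T) := by unfold timeMeasure; infer_instance
    rw [← Measure.prod_swap] at h
    exact (MeasurableEquiv.prodComm (α := ℝ) (β := Euc n)).measurableEmbedding.ae_map_iff.1 h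
  exact Measure.ae_ae_of_ae_prod h1

lemma UniformlyElliptic.exists_isRootCoef {T : ℝ} {γ : Euc n → ℝ → ℝ} (hγ : UniformlyElliptic T γ) :
    ∃ g c Λ, IsRootCoef T γ g c Λ := by
  obtain ⟨hm, γ₀, hγ₀, hb⟩ := hγ
  -- Truncating a measurable version of `γ` makes the bounds hold at every point and every real
  -- time, as the abstract theory asks of its forms. The maximum in the upper bound covers the case
  -- `γ₀ > 1`.
  refine ⟨fun t x => √(max γ₀ (min (hm.mk _ (x, t)) γ₀⁻¹)), √γ₀, √(max γ₀ γ₀⁻¹), ?_,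
    Real.sqrt_pos.2 hγ₀, fun t x => Real.sqrt_le_sqrt (le_max_left _ _),
    fun t x => Real.sqrt_le_sqrt (max_le_max le_rfl (min_le_right _ _)), ?_⟩
  · have := hm.stronglyMeasurable_mk.measurable
    have h1 : Measurable fun z : ℝ × Euc n => hm.mk _ (z.2, z.1) := this.comp measurable_swap
    unfold Function.uncurry
    exact ((measurable_const.max (h1.min measurable_const))).sqrt
  · have h1 : ∀ᵐ z ∂(cylinderMeasure n T),
        √(γ z.1 z.2) = √(max γ₀ (min (hm.mk _ (z.1, z.2)) γ₀⁻¹)) := by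
      filter_upwards [hm.ae_eq_mk, hb] with z h1 h2
      rw [← h1, Function.uncurry, min_eq_left h2.2, max_eq_right h2.1]
    exact h1

lemma IsRootCoef.ae_eq {T : ℝ} {γ : Euc n → ℝ → ℝ} {g : ℝ → Euc n → ℝ} {c Λ : ℝ}
    (hg : IsRootCoef T γ g c Λ) : ∀ᵐ t ∂(timeMeasure T), ∀ᵐ x, √(γ x t) = g t x :=
  ae_ae_of_ae_cylinder hg.ae_cylinder

section Coef

variable {T : ℝ} {γ : Euc n → ℝ → ℝ} {g : ℝ → Euc n → ℝ} {c Λ : ℝ}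

lemma fracConst_pos (h : Adm n s) : 0 < fracConst n s := by
  have hs0 : (0 : ℝ) < s := by exact_mod_cast h.1
  have hs1 : (s : ℝ) < 1 := by exact_mod_cast h.2.1
  have h1 : Real.Gamma (-s) ≠ 0 := Real.Gamma_ne_zero fun m hm => by
    have h2 : (s : ℝ) = m := by linarith
    rw [h2] at hs0 hs1
    have h3 : 0 < m := by exact_mod_cast hs0
    have h4 : m < 1 := by exact_mod_cast hs1
    omega
  have h2 : 0 < Real.Gamma (n / 2 + s) := Real.Gamma_pos_of_pos (by positivity)
  unfold fracConst
  positivity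

lemma measurable_coef (hg : IsRootCoef T γ g c Λ) (t : ℝ) :
    Measurable fun z : Euc n × Euc n => fracConst n s / 2 * (g t z.1 * g t z.2) := by
  have h1 : Measurable (g t) := hg.meas.comp (measurable_const.prodMk measurable_id)
  exact ((h1.comp measurable_fst).mul (h1.comp measurable_snd)).const_mul _

lemma IsRootCoef.upper_pos (hg : IsRootCoef T γ g c Λ) : 0 < Λ :=
  hg.pos.trans_le ((hg.lower 0 0).trans (hg.upper 0 0))

lemma coef_le (h : Adm n s) (hg : IsRootCoef T γ g c Λ) (t : ℝ) (z : Euc n × Euc n) :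
    ‖fracConst n s / 2 * (g t z.1 * g t z.2)‖ ≤ fracConst n s / 2 * Λ ^ 2 := by
  have h1 := hg.pos.trans_le (hg.lower t z.1)
  have h2 := hg.pos.trans_le (hg.lower t z.2)
  have h3 := fracConst_pos h
  rw [Real.norm_of_nonneg (by positivity), pow_two]
  gcongr
  · exact hg.upper_pos.le
  · exact hg.upper _ _
  · exact hg.upper _ _

lemma memLp_coef (h : Adm n s) (hg : IsRootCoef T γ g c Λ) (t : ℝ) :
    MemLp (fun z : Euc n × Euc n => fracConst n s / 2 * (g t z.1 * g t z.2)) ⊤ volume :=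
  memLp_top_of_bound (measurable_coef hg t).aestronglyMeasurable _
    (.of_forall (coef_le h hg t))

/-- The coefficient of the fractional diffusion operator as an element of `L^∞(ℝ²ⁿ)`. -/
def coefLp (h : Adm n s) (hg : IsRootCoef T γ g c Λ) (t : ℝ) :
    Lp ℝ ⊤ (volume : Measure (Euc n × Euc n)) := (memLp_coef h hg t).toLp _

lemma coeFn_coefLp (h : Adm n s) (hg : IsRootCoef T γ g c Λ) (t : ℝ) :
    ∀ᵐ z, coefLp h hg t z = fracConst n s / 2 * (g t z.1 * g t z.2) := (memLp_coef h hg t).coeFn_toLp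

lemma norm_coefLp_le (h : Adm n s) (hg : IsRootCoef T γ g c Λ) (t : ℝ) :
    ‖coefLp h hg t‖ ≤ fracConst n s / 2 * Λ ^ 2 := by
  have h3 := fracConst_pos h
  rw [coefLp, Lp.norm_toLp]
  refine ENNReal.toReal_le_of_le_ofReal (by positivity) ?_
  rw [eLpNorm_exponent_top]
  exact eLpNormEssSup_le_of_ae_bound (.of_forall (coef_le h hg t))

/-- The form `B_γ(t)` on `Hˢ(ℝⁿ)`, for every `t`. -/
def rootForm (h : Adm n s) (hg : IsRootCoef T γ g c Λ) (t : ℝ) : Hs n s →L[ℝ] Hs n s →L[ℝ] ℝ :=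
  gagForm h (coefLp h hg t)

lemma rootForm_eq_integral (h : Adm n s) (hg : IsRootCoef T γ g c Λ) (t : ℝ) (u v : Hs n s) :
    rootForm h hg t u v = ∫ z : Euc n × Euc n, fracConst n s / 2 * (g t z.1 * g t z.2) *
      (quot s (Hs.toL2 n s u) z * quot s (Hs.toL2 n s v) z) := by
  rw [rootForm, gagForm_eq_integral]
  refine integral_congr_ae ?_
  filter_upwards [coeFn_coefLp h hg t] with z hz
  rw [hz]

lemma norm_rootForm_le (h : Adm n s) (hg : IsRootCoef T γ g c Λ) (t : ℝ) :
    ‖rootForm h hg t‖ ≤ fracConst n s / 2 * Λ ^ 2 * ‖gagMap h‖ ^ 2 := by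
  refine (norm_gagForm_le h _).trans ?_
  have := norm_coefLp_le h hg t
  gcongr

/-- The vectors `x - y` contribute `|x-y|²`, which lowers the exponent `2(n/2+s+1)` to `n + 2s`, so
only scalar difference quotients matter. On the diagonal both sides are zero. -/
lemma inner_fracGrad (h : Adm n s) (t : ℝ) (u v : Euc n → ℝ) (z : Euc n × Euc n) :
    inner ℝ (conductivity γ t z (fracGrad s u z)) (fracGrad s v z) =
      fracConst n s / 2 * (√(γ z.1 t) * √(γ z.2 t)) * (quot s u z * quot s v z) := by
  simp only [conductivity, fracGrad, real_inner_smul_left, real_inner_smul_right,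
    real_inner_self_eq_norm_sq]
  have hC : √(fracConst n s / 2) * √(fracConst n s / 2) = fracConst n s / 2 :=
    Real.mul_self_sqrt (by have := fracConst_pos h; positivity)
  unfold quot
  rcases eq_or_ne z.1 z.2 with h0 | h0
  · rw [h0]; simp
  · have h1 : 0 < ‖z.1 - z.2‖ := norm_sub_pos_iff.2 h0
    rw [Real.rpow_add h1, Real.rpow_one, Real.rpow_neg h1.le]
    have h2 : 0 < ‖z.1 - z.2‖ ^ ((n : ℝ) / 2 + s) := Real.rpow_pos_of_pos h1 _
    rw [show fracConst n s / 2 * (√(γ z.1 t) * √(γ z.2 t)) = √(fracConst n s / 2) *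
      √(fracConst n s / 2) * (√(γ z.1 t) * √(γ z.2 t)) by rw [hC]]
    field_simp

lemma condForm_eq (h : Adm n s) (hg : IsRootCoef T γ g c Λ) :
    ∀ᵐ t ∂(timeMeasure T), ∀ u v : Hs n s, condForm s γ t u v = rootForm h hg t u v := by
  filter_upwards [hg.ae_eq] with t ht u v
  rw [rootForm_eq_integral, condForm]
  refine integral_congr_ae ?_
  filter_upwards [ae_fst ht, ae_snd ht] with z h1 h2
  rw [inner_fracGrad h, h1, h2]

lemma aestronglyMeasurable_rootForm (h : Adm n s) (hg : IsRootCoef T γ g c Λ) (μ : Measure ℝ)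
    [SFinite μ] (u v : Hs n s) : AEStronglyMeasurable (fun t => rootForm h hg t u v) μ := by
  have h0 : ∀ w : Hs n s, AEStronglyMeasurable
      (fun p : ℝ × (Euc n × Euc n) => quot s (Hs.toL2 n s w) p.2) (μ.prod volume) := fun w =>
    (aestronglyMeasurable_quot (Lp.aestronglyMeasurable _)).comp_quasiMeasurePreserving
      Measure.quasiMeasurePreserving_snd
  have h1 : Measurable fun p : ℝ × (Euc n × Euc n) =>
      fracConst n s / 2 * (g p.1 p.2.1 * g p.1 p.2.2) := by
    have e1 : Measurable fun p : ℝ × (Euc n × Euc n) => g p.1 p.2.1 :=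
      hg.meas.comp (measurable_fst.prodMk (measurable_fst.comp measurable_snd))
    have e2 : Measurable fun p : ℝ × (Euc n × Euc n) => g p.1 p.2.2 :=
      hg.meas.comp (measurable_fst.prodMk (measurable_snd.comp measurable_snd))
    exact (e1.mul e2).const_mul _
  have h2 := (h1.aestronglyMeasurable (μ := μ.prod volume)).mul ((h0 u).mul (h0 v))
  refine h2.integral_prod_right'.congr (.of_forall fun t => ?_)
  simp only [rootForm_eq_integral]
  rfl

lemma exists_garding_rootForm (h : Adm n s) (hg : IsRootCoef T γ g c Λ) :
    ∃ α l : ℝ, 0 < α ∧ 0 ≤ l ∧ ∀ t (u : Hs n s),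
      α * ‖u‖ ^ 2 ≤ rootForm h hg t u u + l * ‖Hs.toL2 n s u‖ ^ 2 := by
  obtain ⟨d, hd, hdu⟩ := exists_garding h
  have hC := fracConst_pos h
  have hc := hg.pos
  refine ⟨fracConst n s / 2 * c ^ 2 * d, fracConst n s / 2 * c ^ 2 * d, by positivity,
    by positivity, fun t u => ?_⟩
  have h1 : fracConst n s / 2 * c ^ 2 * ‖gagMap h u‖ ^ 2 ≤ rootForm h hg t u u := by
    refine gagForm_ge h _ ?_ u
    filter_upwards [coeFn_coefLp h hg t] with z hz
    rw [hz, pow_two]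
    have e1 := hg.lower t z.1
    have e2 := hg.lower t z.2
    have e3 : 0 ≤ g t z.1 := hc.le.trans e1
    gcongr
  have h2 := mul_le_mul_of_nonneg_left (hdu u) (by positivity : 0 ≤ fracConst n s / 2 * c ^ 2)
  nlinarith

end Coef

/-- Restriction of a form on `Hˢ(ℝⁿ)` to `H̃ˢ(Ω)`. -/
def restrForm (Ω : Opens (Euc n)) (a : Hs n s →L[ℝ] Hs n s →L[ℝ] ℝ) :
    Htilde Ω s →L[ℝ] Htilde Ω s →L[ℝ] ℝ :=
  a.bilinearComp (Htilde Ω s).subtypeL (Htilde Ω s).subtypeL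

lemma norm_restrForm_le (Ω : Opens (Euc n)) (a : Hs n s →L[ℝ] Hs n s →L[ℝ] ℝ) :
    ‖restrForm Ω a‖ ≤ ‖a‖ :=
  ContinuousLinearMap.opNorm_le_bound₂ _ (norm_nonneg _) fun u v => a.le_opNorm₂ u v

lemma restrForm_sub (Ω : Opens (Euc n)) (a b : Hs n s →L[ℝ] Hs n s →L[ℝ] ℝ) :
    restrForm Ω (a - b) = restrForm Ω a - restrForm Ω b := rfl

/-- Elements of `H̃ˢ(Ω)` have the same norm in `L²(Ω)` and in `L²(ℝⁿ)`, so the Gårding inequality on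
the whole space restricts to `Ω`. -/
lemma exists_isParabolicForm {T : ℝ} {γ : Euc n → ℝ → ℝ} {g : ℝ → Euc n → ℝ} {c Λ : ℝ}
    (h : Adm n s) (hg : IsRootCoef T γ g c Λ) (Ω : Opens (Euc n)) : ∃ M α l : ℝ,
    IsParabolicForm T (embΩ Ω s) (fun t => restrForm Ω (rootForm h hg t)) M α l := by
  obtain ⟨α, l, hα, hl, hau⟩ := exists_garding_rootForm h hg
  refine ⟨_, α, l, fun u v => ?_, fun t => (norm_restrForm_le Ω _).trans (norm_rootForm_le h hg t),
    fun t u => ?_, hα, hl⟩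
  · have : SFinite (timeMeasure T) := by unfold timeMeasure; infer_instance
    exact aestronglyMeasurable_rootForm h hg _ u v
  · rw [Htilde.norm_emb]
    exact hau t u

end Forms

/-! ### Heat kernels and the Bessel symbol -/

section Bessel

open Filter Topology

variable {n : ℕ}

/-- The heat kernel with symbol `exp (-τ |ξ|²)`. -/
def heatKer (n : ℕ) (τ : ℝ) (z : Euc n) : ℝ :=
  (Real.pi / τ) ^ ((n : ℝ) / 2) * Real.exp (-Real.pi ^ 2 * ‖z‖ ^ 2 / τ)

/-- A majorant of the heat kernel and of its difference quotients. -/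
def heatMaj (n : ℕ) (τ : ℝ) (z : Euc n) : ℝ :=
  (Real.pi / τ) ^ ((n : ℝ) / 2) * Real.exp (-(Real.pi * ‖z‖ / √(2 * τ)) ^ 2)

/-- Up to the prefactor the kernel is the square of the Gaussian in `heatMaj`. Hence a difference of
kernels factors into a sum of majorants and a difference of Gaussians. -/
lemma heatKer_eq {τ : ℝ} (hτ : 0 < τ) (z : Euc n) : heatKer n τ z =
    (Real.pi / τ) ^ ((n : ℝ) / 2) * Real.exp (-(Real.pi * ‖z‖ / √(2 * τ)) ^ 2) ^ 2 := by
  rw [heatKer, ← Real.exp_nat_mul, div_pow, Real.sq_sqrt (by positivity)]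
  congr 2
  push_cast
  field_simp

lemma heatKer_nonneg {τ : ℝ} (hτ : 0 < τ) (z : Euc n) : 0 ≤ heatKer n τ z := by
  unfold heatKer; positivity

lemma heatMaj_nonneg {τ : ℝ} (hτ : 0 < τ) (z : Euc n) : 0 ≤ heatMaj n τ z := by
  unfold heatMaj; positivity

lemma heatKer_neg (τ : ℝ) (z : Euc n) : heatKer n τ (-z) = heatKer n τ z := by
  rw [heatKer, norm_neg, heatKer]

lemma heatKer_le_heatMaj {τ : ℝ} (hτ : 0 < τ) (z : Euc n) : heatKer n τ z ≤ heatMaj n τ z := by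
  rw [heatKer_eq hτ, heatMaj]
  gcongr
  refine pow_le_of_le_one (Real.exp_nonneg _) (Real.exp_le_one_iff.2 ?_) two_ne_zero
  rw [neg_nonpos]; positivity

lemma measurable_heatKer : Measurable fun q : ℝ × Euc n => heatKer n q.1 q.2 := by
  unfold heatKer; fun_prop

lemma measurable_heatMaj : Measurable fun q : ℝ × Euc n => heatMaj n q.1 q.2 := by
  unfold heatMaj; fun_prop

/-- The derivative is bounded by `1`, since `2|x| ≤ 1 + x² ≤ exp(x²)`. -/
lemma abs_exp_neg_sq_sub_le (a b : ℝ) : |Real.exp (-a ^ 2) - Real.exp (-b ^ 2)| ≤ |a - b| := by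
  have h : ∀ x ∈ (univ : Set ℝ), HasDerivWithinAt (fun x : ℝ => Real.exp (-x ^ 2))
      (Real.exp (-x ^ 2) * (-(2 * x))) univ x := fun x _ => by
    have := ((hasDerivAt_pow 2 x).neg).exp
    simpa using this
  have hb : ∀ x ∈ (univ : Set ℝ), ‖Real.exp (-x ^ 2) * (-(2 * x))‖ ≤ 1 := fun x _ => by
    rw [norm_mul, Real.norm_of_nonneg (Real.exp_nonneg _), Real.exp_neg, norm_neg,
      inv_mul_le_one₀ (Real.exp_pos _), Real.norm_eq_abs, abs_mul, abs_two]
    have h1 := Real.add_one_le_exp (x ^ 2)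
    nlinarith [sq_nonneg (|x| - 1), sq_abs x]
  have := convex_univ.norm_image_sub_le_of_norm_hasDerivWithin_le h hb (mem_univ b) (mem_univ a)
  simpa using this

/-- The difference of the two Gaussians is at most `1` and at most `π ‖z - z'‖ / √τ`; hence it is at
most the power `α` of the latter. The cost of Hölder continuity of order `α` is thus the factor
`τ^{-α/2}`. -/
lemma abs_heatKer_sub_le {τ α : ℝ} (hτ : 0 < τ) (hα0 : 0 < α) (hα : α ≤ 1) (z z' : Euc n) :
    |heatKer n τ z - heatKer n τ z'| ≤
      Real.pi ^ α * ‖z - z'‖ ^ α * τ ^ (-α / 2) * (heatMaj n τ z + heatMaj n τ z') := by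
  rw [heatKer_eq hτ, heatKer_eq hτ, heatMaj, heatMaj]
  obtain ⟨b, hb⟩ : ∃ b, b = Real.pi * ‖z‖ / √(2 * τ) := ⟨_, rfl⟩
  obtain ⟨b', hb'⟩ : ∃ b', b' = Real.pi * ‖z'‖ / √(2 * τ) := ⟨_, rfl⟩
  rw [← hb, ← hb']
  have h0 : 0 < (Real.pi / τ) ^ ((n : ℝ) / 2) := by positivity
  have hsq : √τ ≤ √(2 * τ) := Real.sqrt_le_sqrt (by linarith)
  have h1 : |b - b'| ≤ Real.pi * ‖z - z'‖ / √τ := by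
    rw [hb, hb', ← sub_div, ← mul_sub, abs_div, abs_mul, abs_of_pos Real.pi_pos,
      abs_of_nonneg (Real.sqrt_nonneg _)]
    have := abs_norm_sub_norm_le z z'
    gcongr
  have h2 : |Real.exp (-b ^ 2) - Real.exp (-b' ^ 2)| ≤ 1 := by
    have e1 := Real.exp_pos (-b ^ 2)
    have e2 := Real.exp_pos (-b' ^ 2)
    have e3 : Real.exp (-b ^ 2) ≤ 1 := Real.exp_le_one_iff.2 (by nlinarith)
    have e4 : Real.exp (-b' ^ 2) ≤ 1 := Real.exp_le_one_iff.2 (by nlinarith)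
    rw [abs_le]; constructor <;> linarith
  have h3 : |Real.exp (-b ^ 2) - Real.exp (-b' ^ 2)| ≤ (Real.pi * ‖z - z'‖ / √τ) ^ α := by
    rcases le_or_gt (Real.pi * ‖z - z'‖ / √τ) 1 with h | h
    · refine (abs_exp_neg_sq_sub_le b b').trans (h1.trans ?_)
      have := Real.rpow_le_rpow_of_exponent_ge' (by positivity) h hα0.le hα
      rwa [Real.rpow_one] at this
    · exact h2.trans (Real.one_le_rpow h.le hα0.le)
  have h4 : (Real.pi * ‖z - z'‖ / √τ) ^ α = Real.pi ^ α * ‖z - z'‖ ^ α * τ ^ (-α / 2) := by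
    rw [Real.div_rpow (by positivity) (by positivity), Real.mul_rpow (by positivity)
      (norm_nonneg _), Real.sqrt_eq_rpow, ← Real.rpow_mul hτ.le, div_eq_mul_inv, ← Real.rpow_neg hτ.le]
    congr 2; ring
  rw [← mul_sub, abs_mul, abs_of_pos h0, sq_sub_sq, abs_mul, ← h4, ← mul_add,
    abs_of_pos (add_pos (Real.exp_pos _) (Real.exp_pos _))]
  calc _ = (Real.pi / τ) ^ ((n : ℝ) / 2) * ((Real.exp (-b ^ 2) + Real.exp (-b' ^ 2)) *
        |Real.exp (-b ^ 2) - Real.exp (-b' ^ 2)|) := rfl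
    _ ≤ (Real.pi / τ) ^ ((n : ℝ) / 2) * ((Real.exp (-b ^ 2) + Real.exp (-b' ^ 2)) *
        (Real.pi * ‖z - z'‖ / √τ) ^ α) := by gcongr
    _ = _ := by ring

/-- The multiplication formula moves the Fourier transform from `φ` to the modulated Gaussian, whose
transform is a translated heat kernel. -/
lemma integral_gauss_fourier {τ : ℝ} (hτ : 0 < τ) {φ : Euc n → ℂ} (hφ : Integrable φ) (x : Euc n) :
    ∫ ξ, Complex.exp (-τ * ‖ξ‖ ^ 2 + 2 * Real.pi * Complex.I * inner ℝ x ξ) * 𝓕 φ ξ =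
      ∫ y, (heatKer n τ (x - y) : ℂ) * φ y := by
  have hb : 0 < ((τ : ℂ)).re := by simpa using hτ
  have h := VectorFourier.integral_fourierIntegral_smul_eq_flip (L := innerₗ (Euc n))
    (e := Real.fourierChar) (μ := volume) (ν := volume)
    (f := fun ξ : Euc n => Complex.exp (-τ * ‖ξ‖ ^ 2 + 2 * Real.pi * Complex.I * inner ℝ x ξ))
    (g := φ) Real.continuous_fourierChar continuous_inner
    (GaussianFourier.integrable_cexp_neg_mul_sq_norm_add hb _ x) hφ
  rw [flip_innerₗ] at h
  simp only [smul_eq_mul] at h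
  refine Eq.trans h.symm (integral_congr_ae (.of_forall fun y => ?_))
  dsimp only
  congr 1
  refine (fourier_gaussian_innerProductSpace' hb x y).trans ?_
  rw [heatKer, finrank_euclideanSpace_fin]
  push_cast
  rw [Complex.ofReal_cpow (by positivity)]
  push_cast
  rfl

lemma integrableOn_gamma {e : ℝ} (he : 0 < e) :
    IntegrableOn (fun τ : ℝ => τ ^ (e - 1) * Real.exp (-τ)) (Ioi 0) := by
  refine (Real.GammaIntegral_convergent he).congr_fun (fun x _ => mul_comm _ _) measurableSet_Ioi

lemma lintegral_gamma_lt_top {e : ℝ} (he : 0 < e) :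
    ∫⁻ τ in Ioi 0, ENNReal.ofReal (τ ^ (e - 1) * Real.exp (-τ)) < ⊤ := by
  have := (integrableOn_gamma he).lintegral_lt_top
  exact this

/-- The Bessel symbol as a superposition of Gaussians. -/
lemma besselSymbol_eq {a : ℝ} (ha : 0 < a) (ξ : Euc n) : (1 + ‖ξ‖ ^ 2) ^ (-a) =
    (Real.Gamma a)⁻¹ * ∫ τ in Ioi 0, τ ^ (a - 1) * Real.exp (-τ) * Real.exp (-τ * ‖ξ‖ ^ 2) := by
  have h := Real.integral_rpow_mul_exp_neg_mul_Ioi ha (by positivity : 0 < 1 + ‖ξ‖ ^ 2)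
  have h1 : ∀ τ : ℝ, τ ^ (a - 1) * Real.exp (-τ) * Real.exp (-τ * ‖ξ‖ ^ 2) =
      τ ^ (a - 1) * Real.exp (-((1 + ‖ξ‖ ^ 2) * τ)) := fun τ => by
    rw [mul_assoc, ← Real.exp_add]; congr 2; ring
  simp only [h1]
  rw [h, mul_comm _ (Real.Gamma a), inv_mul_cancel_left₀ (Real.Gamma_pos_of_pos ha).ne',
    one_div, Real.inv_rpow (by positivity), Real.rpow_neg (by positivity)]

/-- Subordination: the Gamma integral writes the symbol as a mixture of Gaussians. Integrability of
the transform of `φ` and finiteness of `∫ τ^{a-1} exp(-τ)` permit the exchange of integrals. -/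
lemma integral_bessel_fourier {a : ℝ} (ha : 0 < a) (φ : 𝓢(Euc n, ℂ)) (x : Euc n) :
    𝓕 (SchwartzMap.smulLeftCLM ℂ (fun ξ : Euc n => (((1 + ‖ξ‖ ^ 2) ^ (-a) : ℝ) : ℂ)) (𝓕⁻ φ)) x =
      ((Real.Gamma a)⁻¹ : ℝ) * ∫ τ in Ioi (0 : ℝ), ((τ ^ (a - 1) * Real.exp (-τ) : ℝ) : ℂ) *
        ∫ y, (heatKer n τ (x - y) : ℂ) * φ y := by
  have hg : (fun ξ : Euc n => (((1 + ‖ξ‖ ^ 2) ^ (-a) : ℝ) : ℂ)).HasTemperateGrowth := by fun_prop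
  obtain ⟨e, he⟩ : ∃ e : Euc n → ℂ, e = fun ξ => Complex.exp
      (2 * Real.pi * Complex.I * inner ℝ x ξ) := ⟨_, rfl⟩
  have hen : ∀ ξ, ‖e ξ‖ = 1 := fun ξ => by
    rw [he]
    have : (2 * Real.pi * Complex.I * inner ℝ x ξ : ℂ) =
        ((2 * Real.pi * inner ℝ x ξ : ℝ) : ℂ) * Complex.I := by push_cast; ring
    simp only [this, Complex.norm_exp_ofReal_mul_I]
  have hec : Continuous e := by rw [he]; fun_prop
  have h1 : 𝓕 (SchwartzMap.smulLeftCLM ℂ (fun ξ : Euc n => (((1 + ‖ξ‖ ^ 2) ^ (-a) : ℝ) : ℂ))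
      (𝓕⁻ φ)) x = ∫ ξ, e ξ * ((((1 + ‖ξ‖ ^ 2) ^ (-a) : ℝ) : ℂ) * 𝓕 φ ξ) := by
    rw [SchwartzMap.fourier_coe, Real.fourier_eq', ← integral_neg_eq_self]
    refine integral_congr_ae (.of_forall fun ξ => ?_)
    dsimp only
    rw [SchwartzMap.smulLeftCLM_apply_apply hg, SchwartzMap.fourierInv_coe,
      Real.fourierInv_eq_fourier_neg, neg_neg, norm_neg, smul_eq_mul, smul_eq_mul, he]
    congr 2
    rw [inner_neg_left, real_inner_comm]
    push_cast; ring
  rw [h1]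
  have h2 : ∀ ξ : Euc n, e ξ * ((((1 + ‖ξ‖ ^ 2) ^ (-a) : ℝ) : ℂ) * 𝓕 φ ξ) =
      ((Real.Gamma a)⁻¹ : ℝ) * ∫ τ in Ioi (0 : ℝ), ((τ ^ (a - 1) * Real.exp (-τ) : ℝ) : ℂ) *
        (((Real.exp (-τ * ‖ξ‖ ^ 2) : ℝ) : ℂ) * (e ξ * 𝓕 φ ξ)) := fun ξ => by
    rw [besselSymbol_eq ha, Complex.ofReal_mul, ← integral_complex_ofReal]
    simp only [← mul_assoc, integral_mul_const, Complex.ofReal_mul]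
    ring
  simp only [h2]
  rw [integral_const_mul]
  congr 1
  have hint : Integrable (fun q : Euc n × ℝ => ((q.2 ^ (a - 1) * Real.exp (-q.2) : ℝ) : ℂ) *
        (((Real.exp (-q.2 * ‖q.1‖ ^ 2) : ℝ) : ℂ) * (e q.1 * 𝓕 φ q.1)))
        (volume.prod (volume.restrict (Ioi 0))) := by
    have i1 : Integrable (fun q : Euc n × ℝ => (𝓕 φ : 𝓢(Euc n, ℂ)) q.1 *
        ((q.2 ^ (a - 1) * Real.exp (-q.2) : ℝ) : ℂ)) (volume.prod (volume.restrict (Ioi 0))) :=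
      (𝓕 φ).integrable.mul_prod (integrableOn_gamma ha).ofReal
    have hφc : Continuous ((𝓕 φ : 𝓢(Euc n, ℂ)) : Euc n → ℂ) := (𝓕 φ).continuous
    refine i1.mono ?_ ?_
    · have m1 : Measurable fun q : Euc n × ℝ => ((q.2 ^ (a - 1) * Real.exp (-q.2) : ℝ) : ℂ) := by
        fun_prop
      have m2 : Measurable fun q : Euc n × ℝ =>
        (((Real.exp (-q.2 * ‖q.1‖ ^ 2) : ℝ) : ℂ)) := by fun_prop
      exact (m1.mul (m2.mul ((hec.measurable.comp measurable_fst).mul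
        (hφc.measurable.comp measurable_fst)))).aestronglyMeasurable
    · have : ∀ᵐ q : Euc n × ℝ ∂(volume.prod (volume.restrict (Ioi 0))), q.2 ∈ Ioi (0 : ℝ) :=
        Measure.quasiMeasurePreserving_snd.ae (ae_restrict_mem measurableSet_Ioi)
      filter_upwards [this] with q hq
      rw [norm_mul, norm_mul, norm_mul, norm_mul, hen, one_mul, mul_comm]
      gcongr
      refine mul_le_of_le_one_left (norm_nonneg _) ?_
      rw [Complex.norm_real, Real.norm_of_nonneg (Real.exp_nonneg _), Real.exp_le_one_iff]
      have : (0 : ℝ) < q.2 := hq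
      nlinarith [mul_nonneg this.le (sq_nonneg ‖q.1‖)]
  rw [integral_integral_swap hint]
  refine setIntegral_congr_fun measurableSet_Ioi fun τ hτ => ?_
  rw [integral_const_mul, ← integral_gauss_fourier hτ φ.integrable]
  congr 1
  refine integral_congr_ae (.of_forall fun ξ => ?_)
  dsimp only
  rw [he, Complex.exp_add, ← mul_assoc, SchwartzMap.fourier_coe]
  push_cast
  rfl

/-- Parabolic scaling: the substitution by `√τ` produces `τ^{n/2}`, and the prefactor of the kernel
produces `τ^{-nq/2}`. -/
lemma lintegral_heatMaj_rpow {τ q : ℝ} (hτ : 0 < τ) (hq : 0 < q) (x : Euc n) :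
    ∫⁻ y, ENNReal.ofReal (heatMaj n τ (x - y)) ^ q = ENNReal.ofReal (τ ^ ((n : ℝ) / 2 * (1 - q))) *
      ∫⁻ y, ENNReal.ofReal (heatMaj n 1 y) ^ q := by
  have hm : Measurable fun y : Euc n => ENNReal.ofReal (heatMaj n 1 y) ^ q :=
    ((measurable_heatMaj.comp (measurable_const.prodMk measurable_id)).ennreal_ofReal).pow_const q
  rw [lintegral_sub_left_eq_self (fun y => ENNReal.ofReal (heatMaj n τ y) ^ q) x]
  have h1 := lintegral_smul_comp _ hm (inv_pos.2 (Real.sqrt_pos.2 hτ))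
  have h2 : ∀ y : Euc n, ENNReal.ofReal (heatMaj n τ y) ^ q = ENNReal.ofReal
      (τ ^ (-((n : ℝ) / 2) * q)) * ENNReal.ofReal (heatMaj n 1 ((√τ)⁻¹ • y)) ^ q := fun y => by
    rw [Real.rpow_mul hτ.le, ← ENNReal.ofReal_rpow_of_nonneg (by positivity) hq.le,
      ← ENNReal.mul_rpow_of_nonneg _ _ hq.le, ← ENNReal.ofReal_mul (by positivity)]
    congr 2
    rw [heatMaj, heatMaj, ← mul_assoc, div_one, Real.div_rpow Real.pi_pos.le hτ.le, Real.rpow_neg hτ.le,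
      norm_smul, Real.norm_of_nonneg (by positivity), mul_one, Real.sqrt_mul zero_le_two]
    congr 1
    · field_simp
    · congr 3; field_simp
  simp only [h2]
  rw [lintegral_const_mul' _ _ ENNReal.ofReal_ne_top, h1, ← mul_assoc,
    ← ENNReal.ofReal_mul (by positivity)]
  congr 2
  rw [inv_pow, inv_inv, Real.sqrt_eq_rpow, ← Real.rpow_natCast, ← Real.rpow_mul hτ.le,
    ← Real.rpow_add hτ]
  congr 1; ring

lemma lintegral_heatMaj_one_lt_top {q : ℝ} (hq : 0 < q) :
    ∫⁻ y, ENNReal.ofReal (heatMaj n 1 y) ^ q < ⊤ := by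
  have hb : 0 < (((q * Real.pi ^ 2 / 2 : ℝ) : ℂ)).re := by
    rw [Complex.ofReal_re]; positivity
  have h := (GaussianFourier.integrable_cexp_neg_mul_sq_norm_add hb 0 (0 : Euc n)).norm.const_mul
    ((Real.pi ^ ((n : ℝ) / 2)) ^ q)
  refine lt_of_eq_of_lt (lintegral_congr fun y => ?_) h.lintegral_lt_top
  rw [ENNReal.ofReal_rpow_of_nonneg (heatMaj_nonneg one_pos y) hq.le]
  congr 1
  rw [heatMaj, Real.mul_rpow (by positivity) (Real.exp_nonneg _), div_one, ← Real.exp_mul,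
    Complex.norm_exp]
  congr 2
  simp only [zero_mul, add_zero, mul_one]
  rw [div_pow, Real.sq_sqrt (by norm_num), ← Complex.ofReal_pow, ← Complex.ofReal_neg,
    ← Complex.ofReal_mul, Complex.ofReal_re]
  ring

/-- Hölder's inequality for the heat kernel. -/
lemma exists_lintegral_heatMaj_le {p : ℝ} (hp : 1 < p) : ∃ A : ℝ≥0, ∀ (τ : ℝ), 0 < τ →
    ∀ (x : Euc n) (w : Euc n → ℂ), AEMeasurable w →
    ∫⁻ y, ENNReal.ofReal (heatMaj n τ (x - y)) * ‖w y‖ₑ ≤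
      A * ENNReal.ofReal (τ ^ (-(n / (2 * p)))) * eLpNorm w (ENNReal.ofReal p) volume := by
  have hpq : p.HolderConjugate (Real.conjExponent p) := Real.HolderConjugate.conjExponent hp
  obtain ⟨q, hq⟩ : ∃ q, q = Real.conjExponent p := ⟨_, rfl⟩
  rw [← hq] at hpq
  have hq0 : 0 < q := hpq.symm.pos
  have htop := lintegral_heatMaj_one_lt_top (n := n) hq0
  refine ⟨((∫⁻ y, ENNReal.ofReal (heatMaj n 1 y) ^ q) ^ (1 / q)).toNNReal, fun τ hτ x w hw => ?_⟩
  have hm : Measurable fun y : Euc n => ENNReal.ofReal (heatMaj n τ (x - y)) :=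
    (measurable_heatMaj.comp (measurable_const.prodMk (measurable_const.sub measurable_id))).ennreal_ofReal
  refine (ENNReal.lintegral_mul_le_Lp_mul_Lq volume hpq.symm hm.aemeasurable hw.enorm).trans
    (le_of_eq ?_)
  rw [ENNReal.coe_toNNReal (ENNReal.rpow_lt_top_of_nonneg (by positivity) htop.ne).ne,
    lintegral_heatMaj_rpow hτ hq0, ENNReal.mul_rpow_of_nonneg _ _ (by positivity),
    ENNReal.ofReal_rpow_of_nonneg (by positivity) (by positivity), ← Real.rpow_mul hτ.le,
    eLpNorm_eq_lintegral_rpow_enorm_toReal (by simpa using (one_pos.trans hp)) ENNReal.ofReal_ne_top,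
    ENNReal.toReal_ofReal (by positivity), mul_comm (ENNReal.ofReal _)]
  congr 4
  have h1 := hpq.symm.inv_add_inv_eq_one
  have : (n : ℝ) / 2 * (1 - q) * (1 / q) = n / 2 * (q⁻¹ - 1) := by field_simp
  rw [this, show q⁻¹ - 1 = -p⁻¹ by linarith]
  field_simp

end Bessel

/-! ### Hölder continuity of Bessel potentials -/

section Holder

open Filter Topology

variable {n : ℕ}

/-- The product of the measure on `(0,∞)` and Lebesgue measure. -/
def heatMeasure (n : ℕ) : Measure (ℝ × Euc n) := (volume.restrict (Ioi (0 : ℝ))).prod volume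

/-- The integrand in the representation of the Bessel potential of `w` by heat kernels. -/
def besselIntegrand (a : ℝ) (w : Euc n → ℂ) (x : Euc n) (q : ℝ × Euc n) : ℂ :=
  ((q.1 ^ (a - 1) * Real.exp (-q.1) * heatKer n q.1 (x - q.2) : ℝ) : ℂ) * w q.2

/-- The Bessel potential `(1+|D|²)^{-a} w` as a function defined everywhere. -/
def besselRep (a : ℝ) (w : Euc n → ℂ) (x : Euc n) : ℂ :=
  ((Real.Gamma a)⁻¹ : ℝ) * ∫ q, besselIntegrand a w x q ∂(heatMeasure n)

lemma measurable_besselIntegrand (a : ℝ) {w : Euc n → ℂ} (hw : Measurable w) :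
    Measurable fun q : Euc n × (ℝ × Euc n) => besselIntegrand a w q.1 q.2 := by
  have h1 : Measurable fun q : Euc n × (ℝ × Euc n) => heatKer n q.2.1 (q.1 - q.2.2) :=
    measurable_heatKer.comp (by fun_prop : Measurable
      fun q : Euc n × (ℝ × Euc n) => (q.2.1, q.1 - q.2.2))
  unfold besselIntegrand
  fun_prop

lemma ae_heatMeasure_pos : ∀ᵐ q ∂(heatMeasure n), 0 < q.1 := by
  have : ∀ᵐ τ ∂(volume.restrict (Ioi (0 : ℝ))), 0 < τ := ae_restrict_mem measurableSet_Ioi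
  exact Measure.quasiMeasurePreserving_fst.ae this

/-- Hölder's inequality in space costs `τ^{-n/(2p)}`; what remains in `τ` is a Gamma integral of
positive order `e - n/(2p)`, uniformly in `x`. -/
lemma exists_lintegral_heatMeasure_le {p e : ℝ} (hp : 1 < p) (he : 0 < e - n / (2 * p)) :
    ∃ B : ℝ≥0, ∀ (w : Euc n → ℂ), Measurable w → ∀ x : Euc n,
      ∫⁻ q, ENNReal.ofReal (q.1 ^ (e - 1) * Real.exp (-q.1)) *
        (ENNReal.ofReal (heatMaj n q.1 (x - q.2)) * ‖w q.2‖ₑ) ∂(heatMeasure n) ≤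
      B * eLpNorm w (ENNReal.ofReal p) volume := by
  obtain ⟨A, hA⟩ := exists_lintegral_heatMaj_le (n := n) hp
  have hG := lintegral_gamma_lt_top he
  refine ⟨A * (∫⁻ τ in Ioi 0, ENNReal.ofReal
    (τ ^ (e - n / (2 * p) - 1) * Real.exp (-τ))).toNNReal, fun w hw x => ?_⟩
  have m1 : Measurable fun q : ℝ × Euc n => ENNReal.ofReal (heatMaj n q.1 (x - q.2)) * ‖w q.2‖ₑ := by
    have h1 : Measurable fun q : ℝ × Euc n => heatMaj n q.1 (x - q.2) :=
      measurable_heatMaj.comp (by fun_prop : Measurable fun q : ℝ × Euc n => (q.1, x - q.2))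
    fun_prop
  have m2 : Measurable fun q : ℝ × Euc n => ENNReal.ofReal (q.1 ^ (e - 1) * Real.exp (-q.1)) := by
    fun_prop
  have m3 : Measurable fun q : ℝ × Euc n => ENNReal.ofReal (q.1 ^ (e - 1) * Real.exp (-q.1)) *
      (ENNReal.ofReal (heatMaj n q.1 (x - q.2)) * ‖w q.2‖ₑ) := m2.mul m1
  rw [heatMeasure, lintegral_prod _ m3.aemeasurable, ENNReal.coe_mul,
    ENNReal.coe_toNNReal hG.ne, mul_comm (A : ℝ≥0∞), mul_assoc]
  have hfin : ∀ τ ∈ Ioi (0 : ℝ), (∫⁻ y, ENNReal.ofReal (τ ^ (e - 1) * Real.exp (-τ)) *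
      (ENNReal.ofReal (heatMaj n τ (x - y)) * ‖w y‖ₑ)) ≤ ENNReal.ofReal
      (τ ^ (e - n / (2 * p) - 1) * Real.exp (-τ)) *
        (A * eLpNorm w (ENNReal.ofReal p) volume) := fun τ hτ => by
    have hτ' : (0 : ℝ) < τ := hτ
    rw [lintegral_const_mul' _ _ ENNReal.ofReal_ne_top]
    refine (mul_le_mul_right (hA τ hτ x w hw.aemeasurable) _).trans (le_of_eq ?_)
    rw [show e - n / (2 * p) - 1 = (e - 1) + (-(n / (2 * p))) by ring, Real.rpow_add hτ',
      mul_right_comm (τ ^ (e - 1)),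
      ENNReal.ofReal_mul (p := τ ^ (e - 1) * Real.exp (-τ)) (by positivity)]
    ring
  refine (setLIntegral_mono' measurableSet_Ioi hfin).trans (le_of_eq ?_)
  rw [lintegral_mul_const]
  fun_prop

lemma enorm_besselIntegrand_le {a : ℝ} (w : Euc n → ℂ) (x : Euc n) {q : ℝ × Euc n} (hq : 0 < q.1) :
    ‖besselIntegrand a w x q‖ₑ ≤ ENNReal.ofReal (q.1 ^ (a - 1) * Real.exp (-q.1)) *
        (ENNReal.ofReal (heatMaj n q.1 (x - q.2)) * ‖w q.2‖ₑ) := by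
  rw [besselIntegrand, enorm_mul, ← mul_assoc, ← ENNReal.ofReal_mul (by positivity), ← ofReal_norm,
    Complex.norm_real, Real.norm_of_nonneg (mul_nonneg (by positivity) (heatKer_nonneg hq _))]
  gcongr
  exact heatKer_le_heatMaj hq _

/-- Hölder continuity of Bessel potentials. -/
lemma exists_norm_besselRep_sub_le {p a α : ℝ} (hp : 1 < p) (ha : 0 < a) (hα0 : 0 < α) (hα : α ≤ 1)
    (h : 0 < a - α / 2 - n / (2 * p)) : ∃ C : ℝ, 0 ≤ C ∧
    ∀ w : Euc n → ℂ, Measurable w → MemLp w (ENNReal.ofReal p) volume → ∀ x x' : Euc n,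
      ‖besselRep a w x - besselRep a w x'‖ ≤
        C * (eLpNorm w (ENNReal.ofReal p) volume).toReal * ‖x - x'‖ ^ α := by
  obtain ⟨B₁, hB₁⟩ := exists_lintegral_heatMeasure_le (n := n) (e := a) hp (by linarith)
  -- The loss `τ^{-α/2}` from differences of heat kernels lowers the order of the time integral from
  -- `a` to `a - α/2`. The bound at order `a` above serves only integrability.
  obtain ⟨B, hB⟩ := exists_lintegral_heatMeasure_le (n := n) (e := a - α / 2) hp h
  have hΓ := Real.Gamma_pos_of_pos ha
  refine ⟨(Real.Gamma a)⁻¹ * (Real.pi ^ α * (2 * B)), by positivity, fun w hw hwp x x' => ?_⟩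
  have hint : ∀ x, Integrable (besselIntegrand a w x) (heatMeasure n) := fun x => by
    refine ⟨((measurable_besselIntegrand a hw).comp
      (measurable_const.prodMk measurable_id)).aestronglyMeasurable, ?_⟩
    refine (lintegral_mono_ae ?_).trans_lt ((hB₁ w hw x).trans_lt
      (ENNReal.mul_lt_top ENNReal.coe_lt_top hwp.2))
    filter_upwards [ae_heatMeasure_pos] with q hq using enorm_besselIntegrand_le w x hq
  rw [besselRep, besselRep, ← mul_sub, norm_mul, Complex.norm_real,
    Real.norm_of_nonneg (by positivity), mul_assoc, mul_assoc, ← integral_sub (hint x) (hint x')]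
  gcongr
  have key : ∫⁻ q, ‖besselIntegrand a w x q - besselIntegrand a w x' q‖ₑ ∂(heatMeasure n) ≤
      ENNReal.ofReal (Real.pi ^ α * ‖x - x'‖ ^ α) *
        (2 * (B * eLpNorm w (ENNReal.ofReal p) volume)) := by
    have m1 : ∀ x, Measurable fun q : ℝ × Euc n =>
        ENNReal.ofReal (q.1 ^ (a - α / 2 - 1) * Real.exp (-q.1)) *
        (ENNReal.ofReal (heatMaj n q.1 (x - q.2)) * ‖w q.2‖ₑ) := fun x => by
      have h1 : Measurable fun q : ℝ × Euc n => heatMaj n q.1 (x - q.2) :=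
        measurable_heatMaj.comp (by fun_prop : Measurable fun q : ℝ × Euc n => (q.1, x - q.2))
      fun_prop
    calc _ ≤ ∫⁻ q, ENNReal.ofReal (Real.pi ^ α * ‖x - x'‖ ^ α) *
          (ENNReal.ofReal (q.1 ^ (a - α / 2 - 1) * Real.exp (-q.1)) *
            (ENNReal.ofReal (heatMaj n q.1 (x - q.2)) * ‖w q.2‖ₑ) +
          ENNReal.ofReal (q.1 ^ (a - α / 2 - 1) * Real.exp (-q.1)) *
            (ENNReal.ofReal (heatMaj n q.1 (x' - q.2)) * ‖w q.2‖ₑ)) ∂(heatMeasure n) := by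
          refine lintegral_mono_ae ?_
          filter_upwards [ae_heatMeasure_pos] with q hq
          have hM1 := heatMaj_nonneg hq (x - q.2)
          have hM2 := heatMaj_nonneg hq (x' - q.2)
          have h2 := abs_heatKer_sub_le hq hα0 hα (x - q.2) (x' - q.2)
          rw [sub_sub_sub_cancel_right] at h2
          rw [besselIntegrand, besselIntegrand, ← sub_mul, ← Complex.ofReal_sub, ← mul_sub, enorm_mul,
            ← mul_assoc (ENNReal.ofReal (q.1 ^ (a - α / 2 - 1) * Real.exp (-q.1))),
            ← mul_assoc (ENNReal.ofReal (q.1 ^ (a - α / 2 - 1) * Real.exp (-q.1))),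
            ← add_mul, ← mul_assoc, ← mul_add, ← ENNReal.ofReal_add hM1 hM2,
            ← ENNReal.ofReal_mul (by positivity), ← ENNReal.ofReal_mul (by positivity)]
          gcongr
          rw [← ofReal_norm, Complex.norm_real, Real.norm_eq_abs, abs_mul,
            abs_of_nonneg (by positivity)]
          refine ENNReal.ofReal_le_ofReal ?_
          calc _ ≤ q.1 ^ (a - 1) * Real.exp (-q.1) * (Real.pi ^ α * ‖x - x'‖ ^ α * q.1 ^ (-α / 2) *
                (heatMaj n q.1 (x - q.2) + heatMaj n q.1 (x' - q.2))) := by gcongr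
            _ = _ := by
              rw [show a - α / 2 - 1 = (a - 1) + (-α / 2) by ring, Real.rpow_add hq]
              ring
      _ ≤ _ := by
          rw [lintegral_const_mul' _ _ ENNReal.ofReal_ne_top, lintegral_add_left (m1 x), two_mul]
          gcongr
          · exact hB w hw x
          · exact hB w hw x'
  refine (norm_integral_le_lintegral_norm _).trans ?_
  simp only [ofReal_norm]
  refine (ENNReal.toReal_mono ?_ key).trans (le_of_eq ?_)
  · exact ENNReal.mul_ne_top ENNReal.ofReal_ne_top (ENNReal.mul_ne_top (by simp)
      (ENNReal.mul_ne_top ENNReal.coe_ne_top hwp.2.ne))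
  · rw [ENNReal.toReal_mul, ENNReal.toReal_ofReal (by positivity), ENNReal.toReal_mul,
      ENNReal.toReal_mul]
    simp only [ENNReal.toReal_ofNat, ENNReal.coe_toReal]
    ring

/-- The Bessel potential is inverted and the inverse is moved to the test function. The order is
written `2a`, so that the inverse has the symbol `(1+|ξ|²)^{-a}`. -/
lemma besselPotential_symm_apply {p : ℝ≥0∞} [Fact (1 ≤ p)] {a : ℝ}
    {g w : Lp ℂ p (volume : Measure (Euc n))}
    (h : TemperedDistribution.besselPotential (Euc n) ℂ (2 * a) (g : 𝓢'(Euc n, ℂ)) = w)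
    (φ : 𝓢(Euc n, ℂ)) : ∫ x, φ x • g x = ∫ x, (𝓕 (SchwartzMap.smulLeftCLM ℂ
      (fun ξ : Euc n => (((1 + ‖ξ‖ ^ 2) ^ (-a) : ℝ) : ℂ)) (𝓕⁻ φ))) x • w x := by
  have h1 := (TemperedDistribution.besselPotential_neg_apply_eq_iff (2 * a) (w : 𝓢'(Euc n, ℂ))
    (g : 𝓢'(Euc n, ℂ))).2 h
  rw [← Lp.toTemperedDistribution_apply, ← h1, TemperedDistribution.besselPotential,
    TemperedDistribution.fourierMultiplierCLM_apply_apply, Lp.toTemperedDistribution_apply]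
  rw [show -(2 * a) / 2 = -a by ring]

/-- Paired with a test function, both sides become the same triple integral over `τ`, `x` and `y`.
Fubini applies by the uniform bound on the heat kernel integral, and the kernel is even. -/
lemma ae_eq_besselRep {p a : ℝ} [Fact (1 ≤ ENNReal.ofReal p)] (hp : 1 < p) (ha : 0 < a)
    (h : 0 < a - n / (2 * p)) {g w : Lp ℂ (ENNReal.ofReal p) (volume : Measure (Euc n))}
    (hgw : TemperedDistribution.besselPotential (Euc n) ℂ (2 * a) (g : 𝓢'(Euc n, ℂ)) = w)
    (hloc : LocallyIntegrable (besselRep a w) (volume : Measure (Euc n))) :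
    ∀ᵐ x, g x = besselRep a w x := by
  have hw : Measurable w := (Lp.stronglyMeasurable w).measurable
  obtain ⟨B, hB⟩ := exists_lintegral_heatMeasure_le (n := n) (e := a) hp h
  refine ae_eq_of_integral_contDiff_smul_eq ((Lp.memLp g).locallyIntegrable Fact.out) hloc ?_
  intro η hη hηc
  have h₁ : HasCompactSupport (Complex.ofRealCLM ∘ η) := hηc.comp_left rfl
  have h₂ : ContDiff ℝ ∞ (Complex.ofRealCLM ∘ η) := by fun_prop
  obtain ⟨φ, hφ⟩ : ∃ φ : 𝓢(Euc n, ℂ), φ = h₁.toSchwartzMap h₂ := ⟨_, rfl⟩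
  have hφη : ∀ x, φ x = (η x : ℂ) := fun x => by rw [hφ]; rfl
  have e1 : ∫ x, η x • g x = ∫ x, φ x • g x :=
    integral_congr_ae (.of_forall fun x => by simp only [hφη, Complex.real_smul, smul_eq_mul])
  rw [e1, besselPotential_symm_apply hgw]
  simp only [integral_bessel_fourier ha]
  have hint : Integrable (fun q : Euc n × (ℝ × Euc n) => φ q.1 * besselIntegrand a w q.1 q.2)
      (volume.prod (heatMeasure n)) := by
    have m0 := (measurable_besselIntegrand a hw)
    have hm : Measurable fun q : Euc n × (ℝ × Euc n) => φ q.1 * besselIntegrand a w q.1 q.2 :=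
      (φ.continuous.measurable.comp measurable_fst).mul m0
    have : SFinite (heatMeasure n) := by unfold heatMeasure; infer_instance
    refine ⟨hm.aestronglyMeasurable, ?_⟩
    rw [hasFiniteIntegral_iff_enorm, lintegral_prod _ hm.enorm.aemeasurable]
    have hb : ∀ y : Euc n, ∫⁻ q, ‖φ y * besselIntegrand a w y q‖ₑ ∂(heatMeasure n) ≤
        ‖φ y‖ₑ * (B * eLpNorm w (ENNReal.ofReal p) volume) := fun y => by
      simp only [enorm_mul]
      rw [lintegral_const_mul' _ _ enorm_ne_top]
      gcongr
      refine (lintegral_mono_ae ?_).trans (hB w hw y)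
      filter_upwards [ae_heatMeasure_pos] with q hq using enorm_besselIntegrand_le _ y hq
    refine (lintegral_mono hb).trans_lt ?_
    rw [lintegral_mul_const _ φ.continuous.measurable.enorm]
    exact ENNReal.mul_lt_top φ.integrable.2 (ENNReal.mul_lt_top ENNReal.coe_lt_top (Lp.memLp w).2)
  have : SFinite (heatMeasure n) := by unfold heatMeasure; infer_instance
  have e2 : ∫ y, η y • besselRep a w y = ((Real.Gamma a)⁻¹ : ℝ) *
      ∫ q, (∫ y, φ y * besselIntegrand a w y q) ∂(heatMeasure n) := by
    rw [← integral_integral_swap hint, ← integral_const_mul]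
    refine integral_congr_ae (.of_forall fun y => ?_)
    dsimp only
    rw [besselRep, integral_const_mul, hφη, Complex.real_smul]
    ring
  rw [e2, heatMeasure, integral_prod_symm _ (by
    have := hint.integral_prod_right
    rwa [heatMeasure] at this), ← integral_const_mul]
  refine integral_congr_ae (.of_forall fun x => ?_)
  dsimp only
  rw [smul_eq_mul, mul_assoc, mul_comm _ (w x), ← integral_const_mul]
  congr 1
  refine setIntegral_congr_fun measurableSet_Ioi fun τ hτ => ?_
  rw [← mul_assoc, ← integral_const_mul]
  refine integral_congr_ae (.of_forall fun y => ?_)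
  dsimp only
  rw [besselIntegrand, ← neg_sub y x, heatKer_neg]
  push_cast
  ring

/-- The embedding of a Bessel potential space in a Hölder space. -/
theorem exists_holder_of_besselPotential {p a α : ℝ} [Fact (1 ≤ ENNReal.ofReal p)] (hp : 1 < p)
    (ha : 0 < a) (hα0 : 0 < α) (hα : α ≤ 1) (h : 0 < a - α / 2 - n / (2 * p)) :
    ∃ C : ℝ, 0 ≤ C ∧ ∀ g w : Lp ℂ (ENNReal.ofReal p) (volume : Measure (Euc n)),
      TemperedDistribution.besselPotential (Euc n) ℂ (2 * a) (g : 𝓢'(Euc n, ℂ)) = w →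
      ∃ M : Euc n → ℂ, (∀ᵐ x, g x = M x) ∧ ∀ x y, ‖M x - M y‖ ≤ C * ‖w‖ * ‖x - y‖ ^ α := by
  obtain ⟨C, hC0, hC⟩ := exists_norm_besselRep_sub_le (n := n) hp ha hα0 hα h
  refine ⟨C, hC0, fun g w hgw => ?_⟩
  have hw : Measurable w := (Lp.stronglyMeasurable w).measurable
  have hM := hC w hw (Lp.memLp w)
  have hcont : Continuous (besselRep a w) := by
    rw [continuous_iff_continuousAt]
    intro x
    rw [ContinuousAt, tendsto_iff_norm_sub_tendsto_zero]
    refine squeeze_zero (fun y => norm_nonneg _) (fun y => hM y x) ?_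
    have : Continuous fun y : Euc n => C * (eLpNorm w (ENNReal.ofReal p) volume).toReal *
        ‖y - x‖ ^ α := by
      have : Continuous fun y : Euc n => ‖y - x‖ ^ α :=
        Continuous.rpow_const (by fun_prop) fun _ => Or.inr hα0.le
      fun_prop
    have h1 := this.tendsto x
    rwa [sub_self, norm_zero, Real.zero_rpow hα0.ne', mul_zero] at h1
  exact ⟨besselRep a w, ae_eq_besselRep hp ha (by linarith) hgw hcont.locallyIntegrable, hM⟩

end Holder

/-! ### Boundedness of the form on `H²ˢ(ℝⁿ) × L²(ℝⁿ)` -/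

section Smoothing

open Filter Topology

variable {n : ℕ} {s : ℝ≥0}

lemma eLpNorm_two_lt_top {X E : Type*} [MeasurableSpace X] {μ : Measure X} [NormedAddCommGroup E]
    {f : X → E} (hf : ∫⁻ x, ‖f x‖ₑ ^ 2 ∂μ < ⊤) : eLpNorm f 2 μ < ⊤ := by
  rw [lintegral_enorm_sq] at hf
  exact (ENNReal.pow_lt_top_iff.1 hf).resolve_right two_ne_zero

/-- A square integrable function with finite Gagliardo seminorm belongs to `Hˢ(ℝⁿ)`. -/
lemma Hs.exists_of_memLp_quot (h : Adm n s) {u : L2 n}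
    (hu : MemLp (quot s u) 2 (volume : Measure (Euc n × Euc n))) : ∃ v : Hs n s, Hs.toL2 n s v = u := by
  obtain ⟨hs0, hs1, hn⟩ := h
  obtain ⟨e, he⟩ := exists_unit_vector hn
  have hs0' : (0 : ℝ) < s := by exact_mod_cast hs0
  have hpos := gsymb_pos (s := s) he
  have htop := gsymb_lt_top hs0' (by exact_mod_cast hs1) hn e
  have h1 : ∫⁻ ξ, gsymb s ξ * ‖fhat u ξ‖ₑ ^ 2 < ⊤ := by
    rw [← lintegral_quot_sq, lintegral_enorm_sq]
    exact ENNReal.pow_lt_top hu.2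
  have h2 : ∫⁻ ξ, ENNReal.ofReal (‖ξ‖ ^ (2 * (s : ℝ))) * ‖fhat u ξ‖ₑ ^ 2 < ⊤ := by
    have h3 : ∀ ξ, gsymb s ξ * ‖fhat u ξ‖ₑ ^ 2 =
        gsymb s e * (ENNReal.ofReal (‖ξ‖ ^ (2 * (s : ℝ))) * ‖fhat u ξ‖ₑ ^ 2) := fun ξ => by
      rw [gsymb_eq s hs0' he ξ]; ring
    simp only [h3] at h1
    rw [lintegral_const_mul' _ _ htop.ne] at h1
    by_contra hcon
    rw [not_lt, top_le_iff] at hcon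
    rw [hcon, ENNReal.mul_top hpos.ne'] at h1
    exact lt_irrefl _ h1
  refine Hs.exists_of_memLp ⟨?_, ?_⟩
  · exact ((Complex.continuous_ofReal.comp (continuous_wgt _)).aestronglyMeasurable).mul
      (Lp.aestronglyMeasurable _)
  · refine eLpNorm_two_lt_top ?_
    have h4 : ∫⁻ ξ, ‖fhat u ξ‖ₑ ^ 2 < ⊤ := by
      rw [lintegral_enorm_sq]
      exact ENNReal.pow_lt_top (Lp.memLp _).2
    have hm : Measurable fun ξ => ‖fhat u ξ‖ₑ ^ 2 :=
      (Lp.stronglyMeasurable (fhat u)).measurable.enorm.pow_const 2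
    refine lt_of_le_of_lt (lintegral_mono fun ξ => ?_)
      ((lintegral_add_left hm _).trans_lt (ENNReal.add_lt_top.2 ⟨h4, h2⟩))
    rw [enorm_mul, mul_pow, ← one_add_mul]
    gcongr
    have h5 := wgt_sq_le s.2 (by exact_mod_cast hs1.le) ξ
    rw [← ofReal_norm, Complex.norm_real, Real.norm_of_nonneg (wgt_pos _ _).le,
      ← ENNReal.ofReal_pow (wgt_pos _ _).le, ← ENNReal.ofReal_one,
      ← ENNReal.ofReal_add zero_le_one (by positivity)]
    refine ENNReal.ofReal_le_ofReal (h5.trans_eq ?_)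
    rw [← Real.rpow_natCast, ← Real.rpow_mul (norm_nonneg _)]
    push_cast
    ring_nf
    rfl

/-- The commutator term in the product rule for difference quotients. -/
def commQuot (s : ℝ) (g v : Euc n → ℝ) (z : Euc n × Euc n) : ℝ :=
  (g z.1 - g z.2) * (g z.1 * v z.1 + g z.2 * v z.2) * ‖z.1 - z.2‖ ^ (-((n : ℝ) / 2 + s))

/-- This moves the coefficient onto `v`. The quotient of `g² v` is paired with an element of `H²ˢ`
at the cost of an `L²` norm only, and the commutator contains a difference of `g` but none of `v`.
-/
lemma mul_quot_eq (σ : ℝ) (g v : Euc n → ℝ) (z : Euc n × Euc n) :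
    g z.1 * g z.2 * quot σ v z = quot σ (fun x => g x ^ 2 * v x) z - commQuot σ g v z := by
  unfold quot commQuot; ring

lemma lintegral_weight_le {k : Euc n → Euc n → ℝ≥0∞} (hk : Measurable (Function.uncurry k)) {K : ℝ≥0∞}
    (hK : ∀ᵐ x, ∫⁻ y, k x y ≤ K) {f : Euc n → ℝ≥0∞} (hf : Measurable f) :
    ∫⁻ z : Euc n × Euc n, k z.1 z.2 * f z.1 ≤ K * ∫⁻ x, f x := by
  have hm : Measurable fun z : Euc n × Euc n => k z.1 z.2 * f z.1 := hk.mul (hf.comp measurable_fst)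
  rw [Measure.volume_eq_prod, lintegral_prod _ hm.aemeasurable, ← lintegral_const_mul _ hf]
  refine lintegral_mono_ae ?_
  filter_upwards [hK] with x hx
  have hkx : Measurable fun y => k x y := hk.comp (measurable_const.prodMk measurable_id)
  rw [lintegral_mul_const _ hkx]
  gcongr

/-- The kernel is symmetric, so the terms with `v(x)` and `v(y)` contribute equally and each is
estimated by integrating out the other variable. This explains `4Λ² = 2 · 2Λ²`. -/
lemma lintegral_commQuot_sq_le {σ Λ : ℝ} {g : Euc n → ℝ} (hg : Measurable g)
    (hΛ : ∀ x, |g x| ≤ Λ) {K : ℝ≥0∞}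
    (hK : ∀ᵐ x, ∫⁻ y, ‖g x - g y‖ₑ ^ 2 * gker n σ (x - y) ≤ K) (v : L2 n) :
    ∫⁻ z, ‖commQuot σ g v z‖ₑ ^ 2 ≤ ENNReal.ofReal (4 * Λ ^ 2) * K * ‖v‖ₑ ^ 2 := by
  have hv : Measurable fun x => ‖v x‖ₑ ^ 2 :=
    (Lp.stronglyMeasurable v).measurable.enorm.pow_const 2
  have hk : Measurable (Function.uncurry fun x y : Euc n => ‖g x - g y‖ₑ ^ 2 * gker n σ (x - y)) := by
    have := measurable_gker (n := n) σ
    unfold Function.uncurry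
    fun_prop
  have hsw : ∫⁻ z : Euc n × Euc n, ‖g z.1 - g z.2‖ₑ ^ 2 * gker n σ (z.1 - z.2) * ‖v z.2‖ₑ ^ 2 =
      ∫⁻ z : Euc n × Euc n, ‖g z.1 - g z.2‖ₑ ^ 2 * gker n σ (z.1 - z.2) * ‖v z.1‖ₑ ^ 2 := by
    have := (Measure.measurePreserving_swap (μ := (volume : Measure (Euc n)))
      (ν := (volume : Measure (Euc n)))).lintegral_comp (f := fun z : Euc n × Euc n =>
        ‖g z.1 - g z.2‖ₑ ^ 2 * gker n σ (z.1 - z.2) * ‖v z.2‖ₑ ^ 2)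
        (hk.mul (hv.comp measurable_snd))
    rw [Measure.volume_eq_prod, ← this]
    refine lintegral_congr fun z => ?_
    simp only [Prod.fst_swap, Prod.snd_swap]
    rw [← neg_sub (g z.1) (g z.2), enorm_neg, ← neg_sub z.1 z.2, gker_neg]
  have hmain := lintegral_weight_le (k := fun x y => ‖g x - g y‖ₑ ^ 2 * gker n σ (x - y)) hk hK hv
  have hm1 : Measurable fun z : Euc n × Euc n =>
      ‖g z.1 - g z.2‖ₑ ^ 2 * gker n σ (z.1 - z.2) * ‖v z.1‖ₑ ^ 2 := hk.mul (hv.comp measurable_fst)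
  have h1 : ∀ z : Euc n × Euc n, ‖commQuot σ g v z‖ₑ ^ 2 ≤ ENNReal.ofReal (2 * Λ ^ 2) *
      (‖g z.1 - g z.2‖ₑ ^ 2 * gker n σ (z.1 - z.2) * ‖v z.1‖ₑ ^ 2 +
        ‖g z.1 - g z.2‖ₑ ^ 2 * gker n σ (z.1 - z.2) * ‖v z.2‖ₑ ^ 2) := fun z => by
    have e1 : ‖commQuot σ g v z‖ₑ ^ 2 = ‖g z.1 - g z.2‖ₑ ^ 2 * gker n σ (z.1 - z.2) *
        ‖g z.1 * v z.1 + g z.2 * v z.2‖ₑ ^ 2 := by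
      have := enorm_quot_sq σ g z
      rw [← this, ← mul_pow, ← enorm_mul, quot, commQuot]
      congr 2; ring
    have e2 : ‖g z.1 * v z.1 + g z.2 * v z.2‖ₑ ^ 2 ≤ ENNReal.ofReal (2 * Λ ^ 2) *
        (‖v z.1‖ₑ ^ 2 + ‖v z.2‖ₑ ^ 2) := by
      rw [Real.enorm_eq_ofReal_abs, Real.enorm_eq_ofReal_abs, Real.enorm_eq_ofReal_abs,
        ← ENNReal.ofReal_pow (abs_nonneg _), ← ENNReal.ofReal_pow (abs_nonneg _),
        ← ENNReal.ofReal_pow (abs_nonneg _), ← ENNReal.ofReal_add (by positivity) (by positivity),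
        ← ENNReal.ofReal_mul (by positivity), sq_abs, sq_abs, sq_abs]
      refine ENNReal.ofReal_le_ofReal ?_
      have b1 : (g z.1) ^ 2 ≤ Λ ^ 2 := sq_le_sq' (abs_le.1 (hΛ z.1)).1 (abs_le.1 (hΛ z.1)).2
      have b2 : (g z.2) ^ 2 ≤ Λ ^ 2 := sq_le_sq' (abs_le.1 (hΛ z.2)).1 (abs_le.1 (hΛ z.2)).2
      have c1 := mul_le_mul_of_nonneg_right b1 (sq_nonneg (v z.1))
      have c2 := mul_le_mul_of_nonneg_right b2 (sq_nonneg (v z.2))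
      nlinarith [sq_nonneg (g z.1 * v z.1 - g z.2 * v z.2)]
    rw [e1]
    calc _ ≤ _ := mul_le_mul_right e2 _
      _ = _ := by ring
  refine (lintegral_mono h1).trans ?_
  rw [lintegral_const_mul' _ _ ENNReal.ofReal_ne_top, lintegral_add_left hm1, hsw, Lp.enorm_def, ← lintegral_enorm_sq, ← two_mul]
  calc _ ≤ ENNReal.ofReal (2 * Λ ^ 2) * (2 * (K * ∫⁻ x, ‖v x‖ₑ ^ 2)) := by gcongr
    _ = _ := by
      have he : ENNReal.ofReal (4 * Λ ^ 2) = ENNReal.ofReal (2 * Λ ^ 2) * 2 := by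
        rw [← ENNReal.ofReal_ofNat, ← ENNReal.ofReal_mul (by positivity)]
        congr 1; ring
      rw [he, mul_assoc, mul_assoc]

/-- If the coefficient is regular, then the form is bounded on `H²ˢ × L²`. -/
theorem exists_abs_rootForm_le (h : Adm n s) {T : ℝ} {γ : Euc n → ℝ → ℝ} {g : ℝ → Euc n → ℝ}
    {c Λ : ℝ} (hg : IsRootCoef T γ g c Λ) {b : ℝ≥0} (hb : b = 2 * s) (hle : s ≤ b) (K : ℝ≥0) :
    ∃ C : ℝ, 0 ≤ C ∧ ∀ t, (∀ᵐ x, ∫⁻ y, ‖g t x - g t y‖ₑ ^ 2 * gker n s (x - y) ≤ K) →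
      ∀ (f : Hs n b) (v : Hs n s),
        |rootForm h hg t (Hs.incl hle f) v| ≤ C * ‖f‖ * ‖Hs.toL2 n s v‖ := by
  obtain ⟨C₀, hC₀, hf⟩ := exists_abs_inner_gagMap_le h hb hle
  have hF := fracConst_pos h
  have hΛ0 := hg.upper_pos
  refine ⟨fracConst n s / 2 * (C₀ * Λ ^ 2 + ‖gagMap h‖ * ‖Hs.incl (n := n) hle‖ *
    √(4 * Λ ^ 2 * K)), by positivity, fun t hK f v => ?_⟩
  have hgm : Measurable (g t) := hg.meas.comp (measurable_const.prodMk measurable_id)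
  have hgb : ∀ x, |g t x| ≤ Λ := fun x => by
    rw [abs_of_pos (hg.pos.trans_le (hg.lower t x))]; exact hg.upper t x
  have hcm : AEStronglyMeasurable (commQuot s (g t) (Hs.toL2 n s v)) volume := by
    have hv : Measurable (Hs.toL2 n s v) := (Lp.stronglyMeasurable _).measurable
    unfold commQuot
    have : Measurable fun z : Euc n × Euc n => (g t z.1 - g t z.2) * (g t z.1 * Hs.toL2 n s v z.1 +
      g t z.2 * Hs.toL2 n s v z.2) * ‖z.1 - z.2‖ ^ (-((n : ℝ) / 2 + s)) := by fun_prop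
    exact this.aestronglyMeasurable
  have hcl := lintegral_commQuot_sq_le (σ := s) hgm hgb hK (Hs.toL2 n s v)
  have hcb : MemLp (commQuot s (g t) (Hs.toL2 n s v)) 2 volume := by
    refine ⟨hcm, eLpNorm_two_lt_top ?_⟩
    exact hcl.trans_lt (ENNReal.mul_lt_top (ENNReal.mul_lt_top ENNReal.ofReal_lt_top
      ENNReal.coe_lt_top) (ENNReal.pow_lt_top enorm_lt_top))
  have hcn : ‖hcb.toLp _‖ ≤ √(4 * Λ ^ 2 * K) * ‖Hs.toL2 n s v‖ := by
    refine (sq_le_sq₀ (norm_nonneg _) (by positivity)).1 ?_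
    rw [Lp.norm_toLp, mul_pow, Real.sq_sqrt (by positivity), ← ENNReal.toReal_pow,
      ← lintegral_enorm_sq]
    refine (ENNReal.toReal_mono ?_ hcl).trans (le_of_eq ?_)
    · exact (ENNReal.mul_lt_top (ENNReal.mul_lt_top ENNReal.ofReal_lt_top
        ENNReal.coe_lt_top) (ENNReal.pow_lt_top enorm_lt_top)).ne
    · rw [ENNReal.toReal_mul, ENNReal.toReal_mul, ENNReal.toReal_ofReal (by positivity)]
      simp
  -- the product `g² v`
  have hg2 : MemLp (fun x => g t x ^ 2) ⊤ (volume : Measure (Euc n)) :=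
    memLp_top_of_bound (hgm.pow_const 2).aestronglyMeasurable (Λ ^ 2) (.of_forall fun x => by
      rw [norm_pow]; exact pow_le_pow_left₀ (norm_nonneg _) (hgb x) 2)
  obtain ⟨w, hw⟩ : ∃ w, w = mulLp (hg2.toLp _) (Hs.toL2 n s v) := ⟨_, rfl⟩
  have hwx : ∀ᵐ x, w x = g t x ^ 2 * Hs.toL2 n s v x := by
    filter_upwards [coeFn_mulLp (hg2.toLp _) (Hs.toL2 n s v), hg2.coeFn_toLp] with x h1 h2
    rw [hw, h1, h2]
  have hwn : ‖w‖ ≤ Λ ^ 2 * ‖Hs.toL2 n s v‖ := by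
    rw [hw]
    refine (norm_mulLp_le _ _).trans ?_
    gcongr
    rw [Lp.norm_toLp]
    refine ENNReal.toReal_le_of_le_ofReal (by positivity) ?_
    rw [eLpNorm_exponent_top]
    refine eLpNormEssSup_le_of_ae_bound (.of_forall fun x => ?_)
    rw [norm_pow]; exact pow_le_pow_left₀ (norm_nonneg _) (hgb x) 2
  have hkey : ∀ᵐ z : Euc n × Euc n, g t z.1 * g t z.2 * quot s (Hs.toL2 n s v) z =
      quot s w z - commQuot s (g t) (Hs.toL2 n s v) z := by
    filter_upwards [quot_congr (σ := s) hwx] with z hz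
    rw [hz, mul_quot_eq]
  have hwq : MemLp (quot s w) 2 (volume : Measure (Euc n × Euc n)) := by
    have h1 : MemLp (fun z : Euc n × Euc n => g t z.1 * g t z.2 * quot s (Hs.toL2 n s v) z) 2
        volume := by
      have h2 : MemLp (fun z : Euc n × Euc n => g t z.1 * g t z.2) ⊤ volume :=
        memLp_top_of_bound ((hgm.comp measurable_fst).mul
          (hgm.comp measurable_snd)).aestronglyMeasurable (Λ * Λ) (.of_forall fun z => by
            rw [norm_mul]; exact mul_le_mul (hgb _) (hgb _) (norm_nonneg _) hΛ0.le)
      exact (memLp_quot h v).mul h2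
    refine (h1.add hcb).ae_eq ?_
    filter_upwards [hkey] with z hz
    rw [Pi.add_apply, hz, sub_add_cancel]
  -- Multiplication by `g²` preserves `Hˢ`: the difference quotient of `g² v` is a bounded multiple
  -- of that of `v` plus the square integrable commutator.
  obtain ⟨v', hv'⟩ := Hs.exists_of_memLp_quot h hwq
  have heq : rootForm h hg t (Hs.incl hle f) v = fracConst n s / 2 *
      (inner ℝ (gagMap h (Hs.incl hle f)) (gagMap h v') -
        inner ℝ (gagMap h (Hs.incl hle f)) (hcb.toLp _)) := by
    rw [rootForm_eq_integral, ← inner_sub_right, L2.inner_def, ← integral_const_mul]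
    refine integral_congr_ae ?_
    filter_upwards [hkey, coeFn_gagMap h (Hs.incl hle f), coeFn_gagMap h v', hcb.coeFn_toLp,
      Lp.coeFn_sub (gagMap h v') (hcb.toLp _)] with z h1 h2 h3 h4 h5
    rw [h5, Pi.sub_apply, h2, h3, h4, inner_real_eq, hv', ← h1]
    ring
  rw [heq, abs_mul, abs_of_pos (by positivity), mul_assoc, mul_assoc]
  gcongr
  refine (abs_sub _ _).trans ?_
  have e1 := hf f v'
  have e2 := abs_real_inner_le_norm (gagMap h (Hs.incl hle f)) (hcb.toLp _)
  have e3 : ‖gagMap h (Hs.incl hle f)‖ ≤ ‖gagMap h‖ * (‖Hs.incl (n := n) hle‖ * ‖f‖) :=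
    ((gagMap h).le_opNorm _).trans (by gcongr; exact (Hs.incl hle).le_opNorm f)
  have e4 := mul_le_mul e3 hcn (norm_nonneg _) (by positivity)
  rw [hv'] at e1
  have e5 : C₀ * ‖f‖ * ‖w‖ ≤ C₀ * ‖f‖ * (Λ ^ 2 * ‖Hs.toL2 n s v‖) := by gcongr
  calc _ ≤ C₀ * ‖f‖ * (Λ ^ 2 * ‖Hs.toL2 n s v‖) + ‖gagMap h‖ * (‖Hs.incl (n := n) hle‖ * ‖f‖) *
        (√(4 * Λ ^ 2 * K) * ‖Hs.toL2 n s v‖) := add_le_add (e1.trans e5) (e2.trans e4)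
    _ = _ := by ring

end Smoothing

/-! ### Lipschitz dependence of the form on time -/

section TimeLipschitz

open Filter Topology

variable {n : ℕ} {s : ℝ≥0} {T : ℝ}

/-- A Lipschitz function on a dense subset of `[0,T]` extends to a Lipschitz function on `ℝ`. -/
lemma exists_lipschitzWith_extension {X : Type*} [MetricSpace X] [CompleteSpace X] (hT : 0 < T)
    {p : ℝ → Prop} (hp : ∀ᵐ t ∂(timeMeasure T), p t) {f : ℝ → X} {L : ℝ≥0}
    (hf : LipschitzOnWith L f {t | t ∈ Ioo 0 T ∧ p t}) :
    ∃ F : ℝ → X, LipschitzWith L F ∧ (∀ t, F t ∈ closure (f '' {t | t ∈ Ioo 0 T ∧ p t})) ∧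
      ∀ t, t ∈ Ioo 0 T → p t → F t = f t := by
  obtain ⟨S, hS⟩ : ∃ S, S = {t | t ∈ Ioo 0 T ∧ p t} := ⟨_, rfl⟩
  have hSc : Icc 0 T ⊆ closure S := hS ▸ subset_closure_of_ae hT hp
  have hSI : closure S ⊆ Icc 0 T :=
    closure_minimal (by rw [hS]; exact fun t ht => Ioo_subset_Icc_self ht.1) isClosed_Icc
  rw [← hS] at hf ⊢
  obtain ⟨h, hc, he⟩ := exists_continuousOn_extension hSc (f := f) (by
    intro ε hε
    refine ⟨ε / (L + 1), by positivity, fun s hs t ht hst hd => ?_⟩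
    have h1 := hf.dist_le_mul s hs t ht
    have h2 : dist s t < ε / (L + 1) := by
      rw [dist_comm, Real.dist_eq, abs_of_pos (sub_pos.2 hst)]; exact hd
    rw [lt_div_iff₀ (by positivity)] at h2
    nlinarith [dist_nonneg (x := s) (y := t), L.2])
  have hL : LipschitzOnWith L h (closure S) := by
    refine LipschitzOnWith.closure (hc.mono hSI) fun s hs t ht => ?_
    rw [he s hs, he t ht]
    exact hf hs ht
  refine ⟨fun t => h (projIcc 0 T hT.le t), ?_, fun t => ?_, fun t ht hpt => ?_⟩
  · have h1 : LipschitzWith 1 (fun t => (projIcc 0 T hT.le t : ℝ)) :=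
      LipschitzWith.projIcc hT.le
    have := hL.comp (g := h) (f := fun t => (projIcc 0 T hT.le t : ℝ)) (s := univ)
      (h1.lipschitzOnWith) (fun t _ => hSc (projIcc 0 T hT.le t).2)
    rw [mul_one] at this
    exact lipschitzOnWith_univ.1 this
  · have hm : (projIcc 0 T hT.le t : ℝ) ∈ closure S := hSc (projIcc 0 T hT.le t).2
    have h2 := (hc.mono hSI).image_closure
    have h3 : h '' S = f '' S := image_congr he
    rw [← h3]
    exact h2 ⟨_, hm, rfl⟩
  · dsimp only
    rw [projIcc_of_mem hT.le (Ioo_subset_Icc_self ht)]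
    exact he t (by rw [hS]; exact ⟨ht, hpt⟩)

/-! ### Lipschitz continuity in time of bounded functions with bounded time derivative -/

/-- A smooth positive weight. -/
def decayWgt (n : ℕ) (x : Euc n) : ℝ := wgt n (-(n + 1)) x

lemma decayWgt_pos (x : Euc n) : 0 < decayWgt n x := wgt_pos _ _

lemma contDiff_decayWgt : ContDiff ℝ ∞ (decayWgt n) := by
  have : (fun x : Euc n => (1 + ‖x‖ ^ 2) ^ ((-(n + 1) : ℝ) / 2)).HasTemperateGrowth := by fun_prop
  exact this.1

/-- The square of the weight is `(1+|x|²)^{-(n+1)}`. Multiplication by the weight puts bounded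
functions into the Hilbert space `L²(ℝⁿ)`, where vector valued integration in time is available. -/
lemma memLp_decayWgt : MemLp (decayWgt n) 2 volume := by
  rw [memLp_two_iff_integrable_sq contDiff_decayWgt.continuous.aestronglyMeasurable]
  have := integrable_rpow_neg_one_add_norm_sq (E := Euc n) (μ := volume) (r := 2 * (n + 1))
    (by rw [finrank_euclideanSpace_fin]; linarith)
  refine this.congr (.of_forall fun x => ?_)
  dsimp only
  rw [decayWgt, wgt, ← Real.rpow_mul_natCast (by positivity)]
  congr 1; push_cast; ring

/-- `q` is a bounded measurable function on `ℝ × ℝⁿ`. -/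
structure IsBddCurve (q : ℝ → Euc n → ℝ) (Q : ℝ) : Prop where
  meas : Measurable (Function.uncurry q)
  nonneg : 0 ≤ Q
  bound : ∀ t x, |q t x| ≤ Q

variable {q : ℝ → Euc n → ℝ} {Q : ℝ}

lemma IsBddCurve.measurable (hq : IsBddCurve q Q) (t : ℝ) : Measurable (q t) :=
  hq.meas.comp (measurable_const.prodMk measurable_id)

lemma IsBddCurve.memLp (hq : IsBddCurve q Q) (t : ℝ) :
    MemLp (fun x => q t x * decayWgt n x) 2 volume := by
  refine memLp_decayWgt.of_le_mul (c := Q)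
    ((hq.measurable t).aestronglyMeasurable.mul memLp_decayWgt.1) (.of_forall fun x => ?_)
  rw [norm_mul]
  gcongr
  exact hq.bound t x

/-- The curve `t ↦ q(t) w` in `L²`, `w` the weight. -/
def IsBddCurve.curve (hq : IsBddCurve q Q) (t : ℝ) : L2 n := (hq.memLp t).toLp _

lemma IsBddCurve.coeFn_curve (hq : IsBddCurve q Q) (t : ℝ) :
    ∀ᵐ x, hq.curve t x = q t x * decayWgt n x := (hq.memLp t).coeFn_toLp

lemma IsBddCurve.inner_curve (hq : IsBddCurve q Q) (v : L2 n) (t : ℝ) :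
    inner ℝ v (hq.curve t) = ∫ x, v x * (q t x * decayWgt n x) := by
  rw [L2.inner_def]
  refine integral_congr_ae ?_
  filter_upwards [hq.coeFn_curve t] with x hx
  rw [hx, inner_real_eq]

lemma IsBddCurve.integrable_curve (hq : IsBddCurve q Q) :
    Integrable hq.curve (timeMeasure T) := by
  have : SFinite (timeMeasure T) := by unfold timeMeasure; infer_instance
  have hm : AEStronglyMeasurable hq.curve (timeMeasure T) := by
    have : Fact ((2 : ℝ≥0∞) ≠ ⊤) := ⟨by norm_num⟩
    refine aestronglyMeasurable_of_inner fun v => ?_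
    simp only [hq.inner_curve]
    have hv : Measurable v := (Lp.stronglyMeasurable v).measurable
    have hw : Measurable (decayWgt n) := (continuous_wgt _).measurable
    have : Measurable fun z : ℝ × Euc n => v z.2 * (q z.1 z.2 * decayWgt n z.2) :=
      (hv.comp measurable_snd).mul (hq.meas.mul (hw.comp measurable_snd))
    exact (this.stronglyMeasurable.integral_prod_right').aestronglyMeasurable
  refine Integrable.of_bound hm (Q * ‖memLp_decayWgt.toLp (decayWgt n)‖) (.of_forall fun t => ?_)
  refine Lp.norm_le_mul_norm_of_ae_le_mul ?_
  filter_upwards [hq.coeFn_curve t, (memLp_decayWgt (n := n)).coeFn_toLp] with x h1 h2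
  rw [h1, h2, norm_mul]
  gcongr
  exact hq.bound t x

lemma IsBddCurve.integral_mul_inner (hq : IsBddCurve q Q) {θ : ℝ → ℝ}
    (hθ : Integrable θ (timeMeasure T)) {χ : L2 n} (hχ : Integrable fun x => χ x * decayWgt n x) :
    ∫ t, θ t * inner ℝ χ (hq.curve t) ∂(timeMeasure T) =
      ∫ z, q z.2 z.1 * (θ z.2 * (χ z.1 * decayWgt n z.1)) ∂(cylinderMeasure n T) := by
  have : SFinite (timeMeasure T) := by unfold timeMeasure; infer_instance
  have h1 : Integrable (fun z : Euc n × ℝ => θ z.2 * (χ z.1 * decayWgt n z.1))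
      (cylinderMeasure n T) := by
    rw [cylinderMeasure_eq]
    exact (hχ.mul_prod hθ).congr (.of_forall fun z => mul_comm _ _)
  have h2 : Integrable (fun z : Euc n × ℝ => q z.2 z.1 * (θ z.2 * (χ z.1 * decayWgt n z.1)))
      (cylinderMeasure n T) := by
    have hm : Measurable fun z : Euc n × ℝ => q z.2 z.1 := hq.meas.comp measurable_swap
    exact h1.bdd_mul hm.aestronglyMeasurable (c := Q) (.of_forall fun z => hq.bound _ _)
  rw [cylinderMeasure_eq] at h2 ⊢
  rw [integral_prod_symm _ h2]
  refine integral_congr_ae (.of_forall fun t => ?_)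
  dsimp only
  rw [hq.inner_curve, ← integral_const_mul]
  exact integral_congr_ae (.of_forall fun x => by ring)

/-- The product of test functions in time and space. -/
def cylinderTest (η : 𝓓(timeInterval T, ℝ)) {χ : Euc n → ℝ} (hχ : ContDiff ℝ ∞ χ)
    (hc : HasCompactSupport χ) : 𝓓(cylinder n T, ℝ) where
  toFun z := η z.2 * χ z.1
  contDiff' := by
    have := η.contDiff
    exact (η.contDiff.comp contDiff_snd).mul (hχ.comp contDiff_fst)
  hasCompactSupport' := by
    refine HasCompactSupport.intro (hc.prod η.hasCompactSupport) fun z hz => ?_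
    by_contra hcon
    exact hz ⟨subset_tsupport _ (right_ne_zero_of_mul hcon), subset_tsupport _ (left_ne_zero_of_mul hcon)⟩
  tsupport_subset' := by
    have h : tsupport (fun z : Euc n × ℝ => η z.2 * χ z.1) ⊆ Prod.snd ⁻¹' tsupport η :=
      closure_minimal (fun z hz => subset_tsupport _ (left_ne_zero_of_mul hz))
        ((isClosed_tsupport _).preimage continuous_snd)
    exact fun z hz => ⟨mem_univ _, η.tsupport_subset (h hz)⟩

lemma ext_inner_test {A B : L2 n} (h : ∀ (χ : Euc n → ℝ) (_ : ContDiff ℝ ∞ χ)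
    (_ : HasCompactSupport χ) (hm : MemLp χ 2 volume),
    (inner ℝ (hm.toLp χ) A : ℝ) = inner ℝ (hm.toLp χ) B) : A = B := by
  refine Lp.ext (ae_eq_of_integral_contDiff_smul_eq ((Lp.memLp A).locallyIntegrable (by norm_num))
    ((Lp.memLp B).locallyIntegrable (by norm_num)) fun χ hχ hc => ?_)
  have hm : MemLp χ 2 (volume : Measure (Euc n)) := hχ.continuous.memLp_of_hasCompactSupport hc
  have h1 := h χ hχ hc hm
  rw [L2.inner_def, L2.inner_def] at h1
  have h2 : ∀ D : L2 n, ∫ x, χ x • D x = ∫ x, inner ℝ (hm.toLp χ x) (D x) := fun D => by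
    refine integral_congr_ae ?_
    filter_upwards [hm.coeFn_toLp] with x hx
    rw [hx, inner_real_eq, smul_eq_mul]
  rw [h2, h2, h1]

/-- Test the distributional derivative with `η(t) χ(x) w(x)`. The weight `w` is smooth, so these
products are admissible, and pairing with all `χ` determines an element of `L²`. -/
lemma IsBddCurve.isWeakTimeDeriv {q' : ℝ → Euc n → ℝ} {Q' : ℝ} (hq : IsBddCurve q Q)
    (hq' : IsBddCurve q' Q') (h : ∀ φ : 𝓓(cylinder n T, ℝ),
      -∫ z, q z.2 z.1 * deriv (fun τ => φ (z.1, τ)) z.2 ∂(cylinderMeasure n T) =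
        ∫ z, q' z.2 z.1 * φ z ∂(cylinderMeasure n T)) :
    IsWeakTimeDeriv T hq.curve hq'.curve := by
  intro η
  have hη : ContDiff ℝ ∞ η := η.contDiff
  have hdη : Continuous (deriv η) := hη.continuous_deriv (by simp)
  have iη : Integrable η (timeMeasure T) := integrable_continuous hη.continuous
  have idη : Integrable (deriv η) (timeMeasure T) := integrable_continuous hdη
  refine ext_inner_test fun χ hχ hc hm => ?_
  have hw := contDiff_decayWgt (n := n)
  have hχw : Integrable fun x => hm.toLp χ x * decayWgt n x := by
    have : Integrable fun x => χ x * decayWgt n x :=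
      (hχ.continuous.mul hw.continuous).integrable_of_hasCompactSupport hc.mul_right
    refine this.congr ?_
    filter_upwards [hm.coeFn_toLp] with x hx
    rw [hx]
  have i1 : Integrable (fun t => deriv η t • hq.curve t) (timeMeasure T) :=
    integrable_smul_continuous hdη hq.integrable_curve
  have i2 : Integrable (fun t => η t • hq'.curve t) (timeMeasure T) :=
    integrable_smul_continuous hη.continuous hq'.integrable_curve
  rw [inner_neg_right, ← integral_inner i1, ← integral_inner i2]
  simp only [real_inner_smul_right]
  rw [hq.integral_mul_inner idη hχw, hq'.integral_mul_inner iη hχw]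
  have hcw : ContDiff ℝ ∞ fun x => χ x * decayWgt n x := hχ.mul hw
  have key := h (cylinderTest η hcw hc.mul_right)
  have hae : ∀ᵐ z ∂(cylinderMeasure n T), hm.toLp χ z.1 = χ z.1 := by
    rw [cylinderMeasure_eq]
    have : SFinite (timeMeasure T) := by unfold timeMeasure; infer_instance
    exact Measure.quasiMeasurePreserving_fst.ae hm.coeFn_toLp
  refine Eq.trans (congrArg Neg.neg (integral_congr_ae ?_)) (key.trans (integral_congr_ae ?_))
  · filter_upwards [hae] with z hz
    have hd : deriv (fun τ => cylinderTest η hcw hc.mul_right (z.1, τ)) z.2 =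
        deriv η z.2 * (χ z.1 * decayWgt n z.1) := by
      have e : (fun τ => cylinderTest η hcw hc.mul_right (z.1, τ)) =
        fun τ => η τ * (χ z.1 * decayWgt n z.1) := rfl
      rw [e, deriv_mul_const (hη.differentiable (by simp) z.2)]
    rw [hd, hz]
  · filter_upwards [hae] with z hz
    rw [hz]
    rfl

/-- Closed convex sets contain the averages of curves lying in them. In this way a pointwise bound
on the time derivative passes to vector valued means. -/
lemma isClosed_convex_abs_le {w : Euc n → ℝ} (hw : MemLp w 2 volume) :
    IsClosed {f : L2 n | ∀ᵐ x, |f x| ≤ w x} ∧ Convex ℝ {f : L2 n | ∀ᵐ x, |f x| ≤ w x} := by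
  constructor
  · have : {f : L2 n | ∀ᵐ x, |f x| ≤ w x} = Icc (-hw.toLp w) (hw.toLp w) := by
      ext f
      rw [mem_Icc, ← Lp.coeFn_le, ← Lp.coeFn_le]
      have h1 := Lp.coeFn_neg (hw.toLp w)
      have h2 := hw.coeFn_toLp
      constructor
      · intro hf
        have hf' : ∀ᵐ x, |f x| ≤ w x := hf
        constructor
        · filter_upwards [hf', h1, h2] with x e1 e2 e3
          rw [e2, Pi.neg_apply, e3]
          exact (abs_le.1 e1).1
        · filter_upwards [hf', h2] with x e1 e3
          rw [e3]
          exact (abs_le.1 e1).2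
      · rintro ⟨hf1, hf2⟩
        change ∀ᵐ x, |f x| ≤ w x
        filter_upwards [hf1, hf2, h1, h2] with x e1 e2 e3 e4
        rw [e3, Pi.neg_apply, e4] at e1
        rw [e4] at e2
        exact abs_le.2 ⟨e1, e2⟩
    rw [this]
    exact isClosed_Icc
  · intro f hf f' hf' a b ha hb hab
    change ∀ᵐ x, _
    have hf1 : ∀ᵐ x, |f x| ≤ w x := hf
    have hf2 : ∀ᵐ x, |f' x| ≤ w x := hf'
    filter_upwards [hf1, hf2, Lp.coeFn_add (a • f) (b • f'), Lp.coeFn_smul a f,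
      Lp.coeFn_smul b f'] with x e1 e2 e3 e4 e5
    rw [e3, Pi.add_apply, e4, e5, Pi.smul_apply, Pi.smul_apply, smul_eq_mul, smul_eq_mul]
    calc |a * f x + b * f' x| ≤ a * |f x| + b * |f' x| := by
          refine (abs_add_le _ _).trans ?_
          rw [abs_mul, abs_mul, abs_of_nonneg ha, abs_of_nonneg hb]
      _ ≤ a * w x + b * w x := by gcongr
      _ = w x := by rw [← add_mul, hab, one_mul]

/-- A bounded function with bounded weak time derivative is Lipschitz in time. -/
lemma IsBddCurve.exists_ae_abs_sub_le {q' : ℝ → Euc n → ℝ} {Q' : ℝ} (hT : 0 < T)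
    (hq : IsBddCurve q Q) (hq' : IsBddCurve q' Q') (h : IsWeakTimeDeriv T hq.curve hq'.curve) :
    ∃ P : ℝ → Prop, (∀ᵐ t ∂(timeMeasure T), P t) ∧ ∀ t ∈ Ioo 0 T, ∀ t' ∈ Ioo 0 T, P t → P t' →
      ∀ᵐ x, |q t x - q t' x| ≤ Q' * |t - t'| := by
  obtain ⟨Y₀, hY⟩ := h.exists_isPrimitive hT hq.integrable_curve hq'.integrable_curve
  refine ⟨_, hY, ?_⟩
  have key : ∀ t ∈ Ioo 0 T, ∀ t' ∈ Ioo 0 T, t' < t →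
      hq.curve t = Y₀ + ∫ τ in 0..t, hq'.curve τ → hq.curve t' = Y₀ + ∫ τ in 0..t', hq'.curve τ →
      ∀ᵐ x, |q t x - q t' x| ≤ Q' * |t - t'| := by
    intro t ht t' ht' hlt ht1 ht2
    have hi : ∀ r ∈ Ioo 0 T, IntervalIntegrable hq'.curve volume 0 r := fun r hr =>
      intervalIntegrable_of_timeMeasure hq'.integrable_curve ⟨le_rfl, hr.1.le.trans hr.2.le⟩
        (Ioo_subset_Icc_self hr)
    have hD : hq.curve t - hq.curve t' = ∫ τ in t'..t, hq'.curve τ := by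
      rw [ht1, ht2, add_sub_add_left_eq_sub,
        intervalIntegral.integral_interval_sub_left (hi t ht) (hi t' ht')]
    have hW : MemLp (fun x => Q' * decayWgt n x) 2 volume := memLp_decayWgt.const_mul Q'
    obtain ⟨hcl, hcv⟩ := isClosed_convex_abs_le hW
    have hpos : (0 : ℝ) < t - t' := sub_pos.2 hlt
    have hvol : volume (Ioc t' t) = ENNReal.ofReal (t - t') := Real.volume_Ioc
    -- The mean of the derivative over `(t', t]` is the difference quotient of the weighted curve;
    -- dividing by the positive weight afterwards gives the pointwise bound.
    have havg := hcv.set_average_mem (μ := volume) (t := Ioc t' t) (f := hq'.curve) hcl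
      (by rw [hvol]; simpa using hlt) (by rw [hvol]; exact ENNReal.ofReal_ne_top)
      (.of_forall fun τ => by
        change ∀ᵐ x, _
        filter_upwards [hq'.coeFn_curve τ] with x hx
        rw [hx, abs_mul, abs_of_pos (decayWgt_pos x)]
        have := hq'.bound τ x
        have := decayWgt_pos x
        gcongr)
      (((hi t' ht').symm.trans (hi t ht)).1)
    rw [setAverage_eq, ← intervalIntegral.integral_of_le hlt.le, ← hD] at havg
    have havg' : ∀ᵐ x, |((volume.real (Ioc t' t))⁻¹ • (hq.curve t - hq.curve t')) x| ≤
        Q' * decayWgt n x := havg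
    have hr : volume.real (Ioc t' t) = t - t' := by
      rw [measureReal_def, hvol, ENNReal.toReal_ofReal hpos.le]
    rw [hr] at havg'
    filter_upwards [havg', Lp.coeFn_smul (t - t')⁻¹ (hq.curve t - hq.curve t'),
      Lp.coeFn_sub (hq.curve t) (hq.curve t'), hq.coeFn_curve t, hq.coeFn_curve t']
      with x e1 e2 e3 e4 e5
    rw [e2, Pi.smul_apply, e3, Pi.sub_apply, e4, e5, smul_eq_mul, ← sub_mul, abs_mul, abs_mul,
      abs_of_pos (inv_pos.2 hpos), abs_of_pos (decayWgt_pos x), ← mul_assoc,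
      mul_le_mul_iff_left₀ (decayWgt_pos x), inv_mul_le_iff₀ hpos] at e1
    rwa [abs_of_pos hpos, mul_comm Q']
  intro t ht t' ht' h1 h2
  rcases lt_trichotomy t' t with hlt | heq | hgt
  · exact key t ht t' ht' hlt h1 h2
  · exact .of_forall fun x => by simp [heq]
  · filter_upwards [key t' ht' t ht hgt h2 h1] with x hx
    rwa [abs_sub_comm, abs_sub_comm t]

lemma TimeDerivBounded.exists_isBddCurve {γ : Euc n → ℝ → ℝ} (h : TimeDerivBounded T γ) :
    ∃ q' Q', IsBddCurve q' Q' ∧ ∀ φ : 𝓓(cylinder n T, ℝ),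
      -∫ z, γ z.1 z.2 * deriv (fun τ => φ (z.1, τ)) z.2 ∂(cylinderMeasure n T) =
        ∫ z, q' z.2 z.1 * φ z ∂(cylinderMeasure n T) := by
  obtain ⟨G, hG, hφ⟩ := h
  obtain ⟨R, hR⟩ : ∃ R : ℝ, ∀ᵐ z ∂(cylinderMeasure n T), |G z| ≤ R := by
    refine ⟨(eLpNorm G ⊤ (cylinderMeasure n T)).toReal, ?_⟩
    filter_upwards [ae_le_eLpNormEssSup (f := G) (μ := cylinderMeasure n T)] with z hz
    rw [← Real.norm_eq_abs, ← toReal_enorm]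
    rw [← eLpNorm_exponent_top] at hz
    exact ENNReal.toReal_mono hG.2.ne hz
  refine ⟨fun t x => max (-|R|) (min (hG.1.mk G (x, t)) |R|), |R|, ⟨?_, abs_nonneg _, fun t x => ?_⟩,
    fun φ => ?_⟩
  · have h1 : Measurable fun z : ℝ × Euc n => hG.1.mk G (z.2, z.1) :=
      hG.1.stronglyMeasurable_mk.measurable.comp measurable_swap
    unfold Function.uncurry
    exact measurable_const.max (h1.min measurable_const)
  · exact abs_le.2 ⟨le_max_left _ _, max_le (by linarith [abs_nonneg R]) (min_le_right _ _)⟩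
  · rw [hφ]
    refine integral_congr_ae ?_
    filter_upwards [hG.1.ae_eq_mk, hR] with z h1 h2
    have h3 := abs_le.1 (h2.trans (le_abs_self R))
    rw [← h1, min_eq_left h3.2, max_eq_right h3.1]

variable {γ : Euc n → ℝ → ℝ} {g : ℝ → Euc n → ℝ} {c Λ : ℝ}

/-- The square of `g` is a version of `γ` and hence Lipschitz on a set of times of full measure. As
`g` is bounded below by `c`, dividing `g(t)² - g(t')²` by `g(t) + g(t')` makes `g` Lipschitz too,
and then also the product of its values at `x` and `y`. -/
lemma exists_norm_coefLp_sub_le (h : Adm n s) (hT : 0 < T) (hγ : UniformlyElliptic T γ)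
    (hg : IsRootCoef T γ g c Λ) (hd : TimeDerivBounded T γ) : ∃ (L : ℝ≥0) (P : ℝ → Prop),
    (∀ᵐ t ∂(timeMeasure T), P t) ∧ ∀ t ∈ Ioo 0 T, ∀ t' ∈ Ioo 0 T, P t → P t' →
      ‖coefLp h hg t - coefLp h hg t'‖ ≤ L * |t - t'| := by
  obtain ⟨q', Q', hq', hφ⟩ := hd.exists_isBddCurve
  have hΛ := hg.upper_pos
  have hC := fracConst_pos h
  have hc := hg.pos
  have hq : IsBddCurve (fun t x => g t x ^ 2) (Λ ^ 2) := by
    refine ⟨hg.meas.pow_const 2, by positivity, fun t x => ?_⟩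
    rw [abs_pow, abs_of_pos (hc.trans_le (hg.lower t x))]
    exact pow_le_pow_left₀ (hc.le.trans (hg.lower t x)) (hg.upper t x) 2
  have hw : IsWeakTimeDeriv T hq.curve hq'.curve := by
    refine hq.isWeakTimeDeriv hq' fun φ => ?_
    rw [← hφ]
    congr 1
    refine integral_congr_ae ?_
    obtain ⟨-, γ₀, hγ₀, hb⟩ := hγ
    filter_upwards [hg.ae_cylinder, hb] with z h1 h2
    rw [← h1, Real.sq_sqrt (hγ₀.le.trans h2.1)]
  obtain ⟨P, hP, hPt⟩ := hq.exists_ae_abs_sub_le hT hq' hw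
  have hQ' := hq'.nonneg
  obtain ⟨L, hL⟩ : ∃ L : ℝ≥0, (L : ℝ) = fracConst n s / 2 * (2 * Λ * (Q' / c)) :=
    ⟨⟨fracConst n s / 2 * (2 * Λ * (Q' / c)), by positivity⟩, rfl⟩
  refine ⟨L, P, hP, fun t ht t' ht' h1 h2 => ?_⟩
  have hx : ∀ᵐ x, |g t x - g t' x| ≤ Q' / c * |t - t'| := by
    filter_upwards [hPt t ht t' ht' h1 h2] with x hx
    have e1 := hg.lower t x
    have e2 := hg.lower t' x
    rw [sq_sub_sq, abs_mul, abs_of_pos (by linarith)] at hx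
    rw [div_mul_eq_mul_div, le_div_iff₀ hc]
    nlinarith [abs_nonneg (g t x - g t' x)]
  rw [coefLp, coefLp, ← MemLp.toLp_sub, Lp.norm_toLp]
  refine ENNReal.toReal_le_of_le_ofReal (by positivity) ?_
  rw [eLpNorm_exponent_top]
  refine eLpNormEssSup_le_of_ae_bound ?_
  filter_upwards [ae_fst hx, ae_snd hx] with z e1 e2
  have f1 := hg.upper t z.1
  have f2 := hg.upper t' z.2
  have f3 := hc.trans_le (hg.lower t z.1)
  have f4 := hc.trans_le (hg.lower t' z.2)
  rw [Pi.sub_apply, ← mul_sub, Real.norm_eq_abs, abs_mul, abs_of_pos (by positivity : 0 < fracConst n s / 2),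
    show g t z.1 * g t z.2 - g t' z.1 * g t' z.2 =
      g t z.1 * (g t z.2 - g t' z.2) + g t' z.2 * (g t z.1 - g t' z.1) by ring, hL, mul_assoc]
  gcongr
  refine (abs_add_le _ _).trans ?_
  rw [abs_mul, abs_mul, abs_of_pos f3, abs_of_pos f4]
  calc _ ≤ Λ * (Q' / c * |t - t'|) + Λ * (Q' / c * |t - t'|) := by gcongr
    _ = _ := by ring

/-- If `∂_t γ` is bounded, then the form has a version that is Lipschitz in time. -/
theorem exists_lipschitz_form (h : Adm n s) (hT : 0 < T) (hγ : UniformlyElliptic T γ)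
    (hg : IsRootCoef T γ g c Λ) (hd : TimeDerivBounded T γ) (Ω : Opens (Euc n)) :
    ∃ (a : ℝ → Htilde Ω s →L[ℝ] Htilde Ω s →L[ℝ] ℝ) (M α l : ℝ) (L : ℝ≥0),
      IsParabolicForm T (embΩ Ω s) a M α l ∧ (∀ t u v, a t u v = a t v u) ∧ LipschitzWith L a ∧
      ∀ᵐ t ∂(timeMeasure T), a t = restrForm Ω (rootForm h hg t) := by
  obtain ⟨L₀, P, hP, hL⟩ := exists_norm_coefLp_sub_le h hT hγ hg hd
  obtain ⟨M, α, l, ha⟩ := exists_isParabolicForm h hg Ω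
  obtain ⟨L, hLe⟩ : ∃ L : ℝ≥0, (L : ℝ) = L₀ * ‖gagMap (n := n) h‖ ^ 2 :=
    ⟨⟨L₀ * ‖gagMap (n := n) h‖ ^ 2, by positivity⟩, rfl⟩
  have hlip : LipschitzOnWith L (fun t => restrForm Ω (rootForm h hg t)) {t | t ∈ Ioo 0 T ∧ P t} := by
    refine LipschitzOnWith.of_dist_le_mul fun t ht t' ht' => ?_
    rw [dist_eq_norm, ← restrForm_sub, Real.dist_eq, hLe]
    refine (norm_restrForm_le Ω _).trans ?_
    rw [rootForm, rootForm, ← gagForm_sub]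
    refine (norm_gagForm_le h _).trans ?_
    rw [mul_right_comm]
    gcongr
    exact hL t ht.1 t' ht'.1 ht.2 ht'.2
  obtain ⟨a, haL, hac, hae⟩ := exists_lipschitzWith_extension hT hP hlip
  -- Every value of the extension is a limit of original forms, so the closed conditions (bound,
  -- Gårding inequality, symmetry) hold for all times.
  have hcl : ∀ (p : (Htilde Ω s →L[ℝ] Htilde Ω s →L[ℝ] ℝ) → Prop), IsClosed {b | p b} →
      (∀ t, p (restrForm Ω (rootForm h hg t))) → ∀ t, p (a t) := fun p hp hpt t => by
    refine closure_minimal ?_ hp (hac t)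
    rintro _ ⟨r, -, rfl⟩
    exact hpt r
  have hcont : ∀ u v : Htilde Ω s, Continuous fun b : Htilde Ω s →L[ℝ] Htilde Ω s →L[ℝ] ℝ => b u v :=
    fun u v => by fun_prop
  refine ⟨a, M, α, l, L, ⟨fun u v => ?_, ?_, ?_, ha.alpha_pos, ha.l_nonneg⟩, ?_, haL, ?_⟩
  · exact ((hcont u v).comp haL.continuous).aestronglyMeasurable
  · exact hcl _ (isClosed_le continuous_norm continuous_const) ha.bound
  · intro t u
    exact hcl (fun b => α * ‖u‖ ^ 2 ≤ b u u + l * ‖embΩ Ω s u‖ ^ 2)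
      (isClosed_le continuous_const ((hcont u u).add continuous_const)) (fun t => ha.garding t u) t
  · intro t u v
    exact hcl (fun b => b u v = b v u) (isClosed_eq (hcont u v) (hcont v u))
      (fun t => gagForm_symm h _ _ _) t
  · filter_upwards [hP, ae_timeMeasure_mem] with t h1 h2 using hae t h2 h1

end TimeLipschitz

/-! ### The kernel bound from the Bessel regularity of `m_γ` -/

section KernelBound

open Filter Topology

variable {n : ℕ} {s : ℝ≥0} {T : ℝ} {γ : Euc n → ℝ → ℝ} {g : ℝ → Euc n → ℝ} {c Λ : ℝ}

/-- For `p = n/(2s)` one has `4s - n/p = 2s`, so the root of `γ` is Hölder continuous of some order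
`α` with `s < α ≤ 1` and `α < 2s`. With the upper bound on `g`, the square of its difference is at
most `D² min(1, |x-y|^{2α})`, and `2α > 2s` makes this integrable against the kernel. -/
lemma exists_kernel_bound (h : Adm n s) (hsn : (s : ℝ) < (n : ℝ) / 2) (hg : IsRootCoef T γ g c Λ)
    (hm : MemLinftyBessel (4 * s) (ENNReal.ofReal ((n : ℝ) / (2 * s))) T (backgroundDeviation γ)) :
    ∃ K : ℝ≥0, ∀ᵐ t ∂(timeMeasure T), ∀ᵐ x, ∫⁻ y, ‖g t x - g t y‖ₑ ^ 2 * gker n s (x - y) ≤ K := by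
  obtain ⟨hp1, w, hw, hwt⟩ := hm
  have hs0 : (0 : ℝ) < s := by exact_mod_cast h.1
  have hs1 : (s : ℝ) < 1 := by exact_mod_cast h.2.1
  obtain ⟨α, hαs, hα1, hα2⟩ : ∃ α : ℝ, (s : ℝ) < α ∧ α ≤ 1 ∧ α < 2 * s := by
    obtain ⟨α, h1, h2⟩ := exists_between (lt_min hs1 (by linarith : (s : ℝ) < 2 * s))
    exact ⟨α, h1, (h2.trans_le (min_le_left _ _)).le, h2.trans_le (min_le_right _ _)⟩
  have hα0 : 0 < α := hs0.trans hαs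
  obtain ⟨C, hC0, hC⟩ := exists_holder_of_besselPotential (n := n) (p := (n : ℝ) / (2 * s))
    (a := 2 * s) (α := α) (by rw [one_lt_div (by positivity)]; linarith) (by positivity) hα0 hα1 (by
      have hn : (0 : ℝ) < n := by exact_mod_cast h.2.2
      have : (n : ℝ) / (2 * (n / (2 * s))) = s := by field_simp
      rw [this]; linarith)
  have hΛ := hg.upper_pos
  have hI := lintegral_min_gker_lt_top (n := n) hs0 (β := 2 * α) (by linarith) h.2.2
  obtain ⟨R, hR⟩ : ∃ R : ℝ, R = (eLpNorm w ⊤ (timeMeasure T)).toReal := ⟨_, rfl⟩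
  have hR0 : 0 ≤ R := hR ▸ ENNReal.toReal_nonneg
  obtain ⟨D, hD⟩ : ∃ D : ℝ, D = C * R + Λ := ⟨_, rfl⟩
  have hD0 : 0 < D := by rw [hD]; positivity
  refine ⟨(ENNReal.ofReal (D ^ 2) * ∫⁻ h : Euc n, ENNReal.ofReal (min 1 (‖h‖ ^ (2 * α))) *
    gker n s h).toNNReal, ?_⟩
  rw [ENNReal.coe_toNNReal (ENNReal.mul_lt_top ENNReal.ofReal_lt_top hI).ne]
  have hwR : ∀ᵐ t ∂(timeMeasure T), ‖w t‖ ≤ R := by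
    filter_upwards [ae_le_eLpNormEssSup (f := w) (μ := timeMeasure T)] with t ht
    rw [← eLpNorm_exponent_top] at ht
    rw [hR, ← toReal_enorm]
    exact ENNReal.toReal_mono hw.2.ne ht
  filter_upwards [hwt, hwR, hg.ae_eq] with t ⟨f, hf, hfw⟩ htR hgt
  obtain ⟨M, hfM, hM⟩ := hC f (w t) (by
    rw [← hfw]
    congr 2
    push_cast; ring)
  have hgM : ∀ᵐ x, M x = ((g t x - 1 : ℝ) : ℂ) := by
    filter_upwards [hf, hfM, hgt] with x h1 h2 h3
    rw [← h2, h1, backgroundDeviation, h3]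
  filter_upwards [hgM] with x hx
  have hmeas : Measurable fun h : Euc n => ENNReal.ofReal (min 1 (‖h‖ ^ (2 * α))) * gker n s h := by
    have := measurable_gker (n := n) s
    fun_prop
  rw [← lintegral_sub_left_eq_self (fun h : Euc n => ENNReal.ofReal (min 1 (‖h‖ ^ (2 * α))) *
    gker n s h) x, ← lintegral_const_mul' _ _ ENNReal.ofReal_ne_top]
  refine lintegral_mono_ae ?_
  filter_upwards [hgM] with y hy
  rw [← mul_assoc]
  gcongr
  have e1 : |g t x - g t y| ≤ C * R * ‖x - y‖ ^ α := by
    have e2 := hM x y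
    rw [hx, hy, ← Complex.ofReal_sub, Complex.norm_real, Real.norm_eq_abs,
      sub_sub_sub_cancel_right] at e2
    refine e2.trans ?_
    gcongr
  have e2 : |g t x - g t y| ≤ Λ := by
    have f1 := hg.upper t x
    have f2 := hg.upper t y
    have f3 := hg.pos.trans_le (hg.lower t x)
    have f4 := hg.pos.trans_le (hg.lower t y)
    rw [abs_le]; constructor <;> linarith
  have e3 : |g t x - g t y| ≤ D * min 1 (‖x - y‖ ^ α) := by
    rcases le_total (1 : ℝ) (‖x - y‖ ^ α) with h1 | h1
    · rw [min_eq_left h1, mul_one, hD]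
      have : 0 ≤ C * R := by positivity
      linarith
    · rw [min_eq_right h1]
      refine e1.trans ?_
      gcongr
      rw [hD]; linarith
  have e4 : min 1 (‖x - y‖ ^ α) ^ 2 = min 1 (‖x - y‖ ^ (2 * α)) := by
    have e5 : ‖x - y‖ ^ (2 * α) = (‖x - y‖ ^ α) ^ 2 := by
      rw [← Real.rpow_mul_natCast (norm_nonneg _)]
      congr 1; push_cast; ring
    have e6 : 0 ≤ ‖x - y‖ ^ α := by positivity
    rw [e5]
    rcases le_total (1 : ℝ) (‖x - y‖ ^ α) with h1 | h1
    · rw [min_eq_left h1, min_eq_left (one_le_pow₀ h1), one_pow]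
    · rw [min_eq_right h1, min_eq_right (pow_le_one₀ e6 h1)]
  rw [Real.enorm_eq_ofReal_abs, ← ENNReal.ofReal_pow (abs_nonneg _),
    ← ENNReal.ofReal_mul (by positivity), ← e4, ← mul_pow]
  exact ENNReal.ofReal_le_ofReal (pow_le_pow_left₀ (abs_nonneg _) e3 2)

end KernelBound

/-! ### Space-time test functions as differentiable curves in `H̃ˢ(Ω)` -/

section Slices

open Filter Topology

variable {n : ℕ} {s : ℝ≥0} {T : ℝ} {Ω : Opens (Euc n)}

lemma coeFn_testToHs (χ : 𝓓(Ω, ℝ)) : ∀ᵐ x, Hs.toL2 n s (testToHs Ω s χ) x = χ x :=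
  (memLp_test χ).coeFn_toLp

lemma norm_testToHtilde (χ : 𝓓(Ω, ℝ)) : ‖testToHtilde Ω s χ‖ = ‖testToHs Ω s χ‖ := rfl

/-- The `Hˢ` norm of a test function is controlled by its `C^{0,1}` norm and its support. -/
lemma exists_norm_testToHs_le (h : Adm n s) {K : Set (Euc n)} (hK : IsCompact K) :
    ∃ C : ℝ, 0 ≤ C ∧ ∀ (χ : 𝓓(Ω, ℝ)) (B : ℝ), 0 ≤ B → (∀ x, |χ x| ≤ B) →
      (∀ x y, |χ x - χ y| ≤ B * ‖x - y‖) → (∀ x, x ∉ K → χ x = 0) → ‖testToHs Ω s χ‖ ≤ C * B := by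
  obtain ⟨c, hc, hgr, -⟩ := exists_inner_gagMap h
  have hs0 : (0 : ℝ) < s := by exact_mod_cast h.1
  have hs1 : (s : ℝ) < 1 := by exact_mod_cast h.2.1
  have hI := lintegral_min_gker_lt_top (n := n) hs0 (β := 2) (by linarith) h.2.2
  obtain ⟨I, hIe⟩ : ∃ I, I = ∫⁻ h : Euc n, ENNReal.ofReal (min 1 (‖h‖ ^ (2 : ℝ))) * gker n s h :=
    ⟨_, rfl⟩
  rw [← hIe] at hI
  have hv : volume K < ⊤ := hK.measure_lt_top
  obtain ⟨v, hve⟩ : ∃ v : ℝ≥0, (v : ℝ≥0∞) = volume K := ⟨_, ENNReal.coe_toNNReal hv.ne⟩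
  obtain ⟨J, hJe⟩ : ∃ J : ℝ≥0, (J : ℝ≥0∞) = I := ⟨_, ENNReal.coe_toNNReal hI.ne⟩
  -- Here `v` is the measure of `K` and `J` the integral of `min(1,|h|²)` against the kernel. The
  -- `8` is `4 · 2`: the squared difference of `χ` is at most `4B² min(1,|x-y|²)`, and one of the
  -- two points must lie in `K`.
  refine ⟨√(v + c⁻¹ * (8 * (J * v))), by positivity, fun χ B hB hb hl hs => ?_⟩
  obtain ⟨u, hu⟩ : ∃ u, u = testToHs Ω s χ := ⟨_, rfl⟩
  have hux : ∀ᵐ x, Hs.toL2 n s u x = χ x := hu ▸ coeFn_testToHs χ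
  rw [← hu]
  obtain ⟨f, hf⟩ : ∃ f : Euc n → ℝ≥0∞, f = K.indicator 1 := ⟨_, rfl⟩
  have hfm : Measurable f := hf ▸ measurable_one.indicator hK.measurableSet
  have hfi : ∫⁻ x, f x = v := by
    rw [hf, lintegral_indicator_one hK.measurableSet, hve]
  have hf1 : ∀ x ∈ K, f x = 1 := fun x hx => by rw [hf, indicator_of_mem hx]; rfl
  have e1 : ‖Hs.toL2 n s u‖ ^ 2 ≤ B ^ 2 * v := by
    have : ‖Hs.toL2 n s u‖ₑ ^ 2 ≤ ENNReal.ofReal (B ^ 2) * v := by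
      rw [Lp.enorm_def, ← lintegral_enorm_sq, ← hfi, ← lintegral_const_mul _ hfm]
      refine lintegral_mono_ae ?_
      filter_upwards [hux] with x hx
      rw [hx]
      by_cases hxK : x ∈ K
      · rw [hf1 x hxK, mul_one, Real.enorm_eq_ofReal_abs, ← ENNReal.ofReal_pow (abs_nonneg _)]
        exact ENNReal.ofReal_le_ofReal (pow_le_pow_left₀ (abs_nonneg _) (hb x) 2)
      · rw [hs x hxK]; simp
    have := ENNReal.toReal_mono (ENNReal.mul_lt_top ENNReal.ofReal_lt_top ENNReal.coe_lt_top).ne this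
    rwa [ENNReal.toReal_pow, toReal_enorm, ENNReal.toReal_mul, ENNReal.toReal_ofReal (by positivity),
      ENNReal.coe_toReal] at this
  have e2 : ‖gagMap h u‖ ^ 2 ≤ B ^ 2 * (8 * (J * v)) := by
    have hkm : Measurable (Function.uncurry fun x y : Euc n =>
        ENNReal.ofReal (min 1 (‖x - y‖ ^ (2 : ℝ))) * gker n s (x - y)) := by
      have := measurable_gker (n := n) s
      unfold Function.uncurry
      fun_prop
    have hkI : ∀ᵐ x : Euc n, ∫⁻ y, ENNReal.ofReal (min 1 (‖x - y‖ ^ (2 : ℝ))) * gker n s (x - y) ≤ I :=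
      .of_forall fun x => by
        rw [lintegral_sub_left_eq_self (fun h : Euc n => ENNReal.ofReal (min 1 (‖h‖ ^ (2 : ℝ))) *
          gker n s h) x, hIe]
    have hmain := lintegral_weight_le hkm hkI hfm
    have hm1 : Measurable fun z : Euc n × Euc n =>
        ENNReal.ofReal (min 1 (‖z.1 - z.2‖ ^ (2 : ℝ))) * gker n s (z.1 - z.2) * f z.1 :=
      hkm.mul (hfm.comp measurable_fst)
    have hsw : ∫⁻ z : Euc n × Euc n,
        ENNReal.ofReal (min 1 (‖z.1 - z.2‖ ^ (2 : ℝ))) * gker n s (z.1 - z.2) * f z.2 =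
        ∫⁻ z : Euc n × Euc n,
        ENNReal.ofReal (min 1 (‖z.1 - z.2‖ ^ (2 : ℝ))) * gker n s (z.1 - z.2) * f z.1 := by
      have := (Measure.measurePreserving_swap (μ := (volume : Measure (Euc n)))
        (ν := (volume : Measure (Euc n)))).lintegral_comp hm1
      rw [Measure.volume_eq_prod, ← this]
      refine lintegral_congr fun z => ?_
      simp only [Prod.fst_swap, Prod.snd_swap]
      rw [norm_sub_rev z.2, ← neg_sub z.1 z.2, gker_neg]
    have hpt : ‖gagMap h u‖ₑ ^ 2 ≤ ENNReal.ofReal (4 * B ^ 2) * (2 * (I * v)) := by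
      rw [Lp.enorm_def, ← lintegral_enorm_sq]
      calc _ ≤ ∫⁻ z : Euc n × Euc n, ENNReal.ofReal (4 * B ^ 2) *
            (ENNReal.ofReal (min 1 (‖z.1 - z.2‖ ^ (2 : ℝ))) * gker n s (z.1 - z.2) * f z.1 +
            ENNReal.ofReal (min 1 (‖z.1 - z.2‖ ^ (2 : ℝ))) * gker n s (z.1 - z.2) * f z.2) := by
            refine lintegral_mono_ae ?_
            filter_upwards [coeFn_gagMap h u, quot_congr (σ := s) hux] with z h1 h2
            rw [h1, h2, enorm_quot_sq, ← mul_add, ← mul_assoc, ← mul_assoc]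
            by_cases hz : z.1 ∈ K ∨ z.2 ∈ K
            · have hone : 1 ≤ f z.1 + f z.2 := by
                rcases hz with hz | hz
                · rw [hf1 _ hz]; exact le_self_add
                · rw [hf1 _ hz]; exact le_add_self
              refine le_trans ?_ (le_mul_of_one_le_right (zero_le) hone)
              gcongr
              rw [Real.enorm_eq_ofReal_abs, ← ENNReal.ofReal_pow (abs_nonneg _),
                ← ENNReal.ofReal_mul (by positivity)]
              refine ENNReal.ofReal_le_ofReal ?_
              have f1 : |χ z.1 - χ z.2| ≤ 2 * B := by
                refine (abs_sub _ _).trans ?_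
                linarith [hb z.1, hb z.2]
              have f2 : |χ z.1 - χ z.2| ^ 2 ≤ (2 * B) ^ 2 := pow_le_pow_left₀ (abs_nonneg _) f1 2
              have f3 : |χ z.1 - χ z.2| ^ 2 ≤ (B * ‖z.1 - z.2‖) ^ 2 :=
                pow_le_pow_left₀ (abs_nonneg _) (hl z.1 z.2) 2
              rw [Real.rpow_two]
              rcases le_total (1 : ℝ) (‖z.1 - z.2‖ ^ 2) with g1 | g1
              · rw [min_eq_left g1]; linarith
              · rw [min_eq_right g1]
                nlinarith [mul_nonneg (sq_nonneg B) (sq_nonneg ‖z.1 - z.2‖)]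
            · push Not at hz
              rw [hs _ hz.1, hs _ hz.2]; simp
        _ = ENNReal.ofReal (4 * B ^ 2) * (2 * ∫⁻ z : Euc n × Euc n,
            ENNReal.ofReal (min 1 (‖z.1 - z.2‖ ^ (2 : ℝ))) * gker n s (z.1 - z.2) * f z.1) := by
            rw [lintegral_const_mul' _ _ ENNReal.ofReal_ne_top, lintegral_add_left hm1, hsw, two_mul]
        _ ≤ _ := by
            rw [← hfi]
            gcongr
    have := ENNReal.toReal_mono (ENNReal.mul_lt_top ENNReal.ofReal_lt_top (ENNReal.mul_lt_top
      (by simp) (ENNReal.mul_lt_top hI ENNReal.coe_lt_top))).ne hpt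
    rw [ENNReal.toReal_pow, toReal_enorm, ENNReal.toReal_mul, ENNReal.toReal_ofReal (by positivity),
      ENNReal.toReal_mul, ENNReal.toReal_mul, ENNReal.coe_toReal, ← hJe, ENNReal.coe_toReal] at this
    refine this.trans_eq ?_
    simp only [ENNReal.toReal_ofNat]
    ring
  refine (sq_le_sq₀ (norm_nonneg _) (by positivity)).1 ?_
  rw [mul_pow, Real.sq_sqrt (by positivity)]
  have e3 := Hs.norm_sq_le h.2.1.le u
  have e4 : ‖rieszMap n s u‖ ^ 2 = c⁻¹ * ‖gagMap h u‖ ^ 2 := by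
    rw [hgr, inv_mul_cancel_left₀ hc.ne']
  rw [e4] at e3
  have e5 : c⁻¹ * ‖gagMap h u‖ ^ 2 ≤ c⁻¹ * (B ^ 2 * (8 * (J * v))) := by gcongr
  calc _ ≤ B ^ 2 * v + c⁻¹ * (B ^ 2 * (8 * (J * v))) := by linarith
    _ = _ := by ring

/-- The gradient of `ψ` is itself Lipschitz, so an increment in time has a spatial Lipschitz
constant proportional to the time step. This controls the increment in the norm that dominates `Hˢ`
for functions supported in a fixed compact set. -/
lemma exists_mixed_lipschitz {ψ : Euc n × ℝ → ℝ} (hψ : ContDiff ℝ ∞ ψ) (hc : HasCompactSupport ψ) :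
    ∃ C : ℝ, 0 ≤ C ∧ ∀ t τ : ℝ, (∀ x, |ψ (x, τ) - ψ (x, t)| ≤ C * |τ - t|) ∧
      ∀ x y, |(ψ (x, τ) - ψ (x, t)) - (ψ (y, τ) - ψ (y, t))| ≤ C * |τ - t| * ‖x - y‖ := by
  obtain ⟨C₁, h1⟩ := hψ.lipschitzWith_of_hasCompactSupport hc (by simp)
  have hdc : HasCompactSupport (fderiv ℝ ψ) := hc.fderiv ℝ
  have hd : ContDiff ℝ ∞ (fderiv ℝ ψ) := hψ.fderiv_right (by simp)
  obtain ⟨C₂, h2⟩ := hd.lipschitzWith_of_hasCompactSupport hdc (by simp)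
  have hpt : ∀ (x : Euc n) (t τ : ℝ), dist (x, τ) (x, t) = |τ - t| := fun x t τ => by
    rw [Prod.dist_eq, dist_self, Real.dist_eq, max_eq_right (abs_nonneg _)]
  refine ⟨C₁ + C₂, by positivity, fun t τ => ⟨fun x => ?_, fun x y => ?_⟩⟩
  · have := h1.dist_le_mul (x, τ) (x, t)
    rw [hpt, Real.dist_eq] at this
    refine this.trans ?_
    gcongr
    exact le_add_of_nonneg_right C₂.2
  · have hD : ∀ (r : ℝ) (x : Euc n), HasFDerivAt (fun x => ψ (x, r))
        ((fderiv ℝ ψ (x, r)).comp (ContinuousLinearMap.inl ℝ (Euc n) ℝ)) x := fun r x =>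
      ((hψ.differentiable (by simp) (x, r)).hasFDerivAt).comp x (hasFDerivAt_prodMk_left x r)
    have := convex_univ.norm_image_sub_le_of_norm_hasFDerivWithin_le (𝕜 := ℝ)
      (f := fun x => ψ (x, τ) - ψ (x, t)) (C := C₂ * |τ - t|)
      (fun x _ => ((hD τ x).sub (hD t x)).hasFDerivWithinAt) (fun x _ => ?_) (mem_univ y) (mem_univ x)
    · rw [Real.norm_eq_abs] at this
      refine this.trans ?_
      gcongr
      exact le_add_of_nonneg_left C₁.2
    · rw [← ContinuousLinearMap.sub_comp]
      refine (ContinuousLinearMap.opNorm_comp_le _ _).trans ?_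
      have h3 := h2.dist_le_mul (x, τ) (x, t)
      rw [hpt, dist_eq_norm] at h3
      have h4 := ContinuousLinearMap.norm_inl_le_one ℝ (Euc n) ℝ
      calc _ ≤ (C₂ * |τ - t|) * 1 := by gcongr
        _ = _ := mul_one _

lemma abs_sub_le_of_deriv {f f' : ℝ → ℝ} {A t : ℝ} (hf : ∀ r, HasDerivAt f (f' r) r)
    (hb : ∀ r, |f' r| ≤ A * |r - t|) (hA : 0 ≤ A) (τ : ℝ) : |f τ - f t| ≤ A * |τ - t| ^ 2 := by
  have := (convex_uIcc t τ).norm_image_sub_le_of_norm_hasDerivWithin_le (f := f) (f' := f')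
    (C := A * |τ - t|) (fun r _ => (hf r).hasDerivWithinAt) (fun r hr => ?_) left_mem_uIcc right_mem_uIcc
  · rw [Real.norm_eq_abs, Real.norm_eq_abs] at this
    rw [pow_two, ← mul_assoc]
    exact this
  · refine (hb r).trans ?_
    gcongr 1
    exact abs_sub_left_of_mem_uIcc hr

/-- The time derivative of a space-time test function. -/
def timeDeriv (φ : 𝓓(spaceTime Ω T, ℝ)) : 𝓓(spaceTime Ω T, ℝ) where
  toFun z := fderiv ℝ φ z (0, 1)
  contDiff' := by
    have hd : ContDiff ℝ ∞ (fderiv ℝ φ) := φ.contDiff.fderiv_right (by simp)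
    exact hd.clm_apply contDiff_const
  hasCompactSupport' := (φ.hasCompactSupport.fderiv ℝ).comp_left
    (g := fun L : (Euc n × ℝ) →L[ℝ] ℝ => L (0, 1)) rfl
  tsupport_subset' := by
    refine (closure_mono fun z hz => ?_).trans ((tsupport_fderiv_subset ℝ).trans φ.tsupport_subset)
    intro h0
    exact hz (by simp [h0])

lemma hasDerivAt_time (φ : 𝓓(spaceTime Ω T, ℝ)) (x : Euc n) (t : ℝ) :
    HasDerivAt (fun τ => φ (x, τ)) (timeDeriv φ (x, t)) t := by
  have h1 : HasFDerivAt φ (fderiv ℝ φ (x, t)) (x, t) :=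
    (φ.contDiff.differentiable (by simp) (x, t)).hasFDerivAt
  have h2 : HasDerivAt (fun τ : ℝ => (x, τ)) ((0 : Euc n), (1 : ℝ)) t :=
    (hasDerivAt_const t x).prodMk (hasDerivAt_id t)
  exact h1.comp_hasDerivAt t h2

lemma slice_eq_zero (φ : 𝓓(spaceTime Ω T, ℝ)) (t : ℝ) {x : Euc n}
    (hx : x ∉ Prod.fst '' tsupport φ) : slice φ t x = 0 := by
  by_contra hcon
  exact hx ⟨(x, t), subset_tsupport _ hcon, rfl⟩

/-- The Taylor remainder in time is a test function supported in a fixed compact set, and it is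
`O(|τ - t|²)` both in supremum and in Lipschitz constant; hence it has the same order in `Hˢ`. -/
lemma hasDerivAt_slice (h : Adm n s) (φ : 𝓓(spaceTime Ω T, ℝ)) (t : ℝ) :
    HasDerivAt (fun t => testToHtilde Ω s (slice φ t)) (testToHtilde Ω s (slice (timeDeriv φ) t)) t := by
  obtain ⟨C, hC0, hC⟩ := exists_mixed_lipschitz (timeDeriv φ).contDiff (timeDeriv φ).hasCompactSupport
  obtain ⟨C', hC'0, hC'⟩ := exists_norm_testToHs_le (Ω := Ω) h
    ((φ.hasCompactSupport.image continuous_fst).union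
      ((timeDeriv φ).hasCompactSupport.image continuous_fst))
  have key : ∀ τ : ℝ, ‖testToHtilde Ω s (slice φ τ) - testToHtilde Ω s (slice φ t) -
      (τ - t) • testToHtilde Ω s (slice (timeDeriv φ) t)‖ ≤ C' * C * ‖(τ - t) ^ 2‖ := fun τ => by
    have e1 : testToHtilde Ω s (slice φ τ) - testToHtilde Ω s (slice φ t) -
      (τ - t) • testToHtilde Ω s (slice (timeDeriv φ) t) =
        testToHtilde Ω s (slice φ τ - slice φ t - (τ - t) • slice (timeDeriv φ) t) := by
      refine Subtype.ext ?_
      change testToHs Ω s _ - testToHs Ω s _ - (τ - t) • testToHs Ω s _ = testToHs Ω s _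
      rw [map_sub, map_sub, map_smul]
    rw [e1, norm_testToHtilde, mul_assoc, norm_pow, Real.norm_eq_abs]
    have hval : ∀ x, (slice φ τ - slice φ t - (τ - t) • slice (timeDeriv φ) t) x =
        φ (x, τ) - φ (x, t) - (τ - t) * timeDeriv φ (x, t) := fun x => rfl
    have hder : ∀ x r, HasDerivAt (fun r => φ (x, r) - φ (x, t) - (r - t) * timeDeriv φ (x, t))
        (timeDeriv φ (x, r) - timeDeriv φ (x, t)) r := fun x r => by
      have := ((hasDerivAt_time φ x r).sub_const (φ (x, t))).sub
        (((hasDerivAt_id r).sub_const t).mul_const (timeDeriv φ (x, t)))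
      rwa [one_mul] at this
    refine hC' _ (C * |τ - t| ^ 2) (by positivity) (fun x => ?_) (fun x y => ?_) fun x hx => ?_
    · rw [hval]
      have := abs_sub_le_of_deriv (t := t) (hder x) (fun r => (hC t r).1 x) hC0 τ
      simpa using this
    · rw [hval, hval]
      have := abs_sub_le_of_deriv (A := C * ‖x - y‖) (t := t) (fun r => (hder x r).sub (hder y r))
        (fun r => ((hC t r).2 x y).trans_eq (by ring)) (by positivity) τ
      simp only [Pi.sub_apply, sub_self, zero_mul, sub_zero] at this
      refine this.trans_eq (by ring)
    · rw [mem_union, not_or] at hx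
      change slice φ τ x - slice φ t x - (τ - t) * slice (timeDeriv φ) t x = 0
      rw [slice_eq_zero φ _ hx.1, slice_eq_zero φ _ hx.1, slice_eq_zero _ _ hx.2]
      ring
  rw [hasDerivAt_iff_isLittleO]
  refine (Asymptotics.IsBigO.of_bound (C' * C) (.of_forall key)).trans_isLittleO ?_
  refine (Asymptotics.isLittleO_pow_sub_sub t one_lt_two).congr_left fun x => ?_
  rw [Real.norm_eq_abs, sq_abs]

lemma continuous_slice (h : Adm n s) (φ : 𝓓(spaceTime Ω T, ℝ)) :
    Continuous fun t => testToHtilde Ω s (slice φ t) :=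
  continuous_iff_continuousAt.2 fun t => (hasDerivAt_slice h φ t).continuousAt

lemma slice_T (φ : 𝓓(spaceTime Ω T, ℝ)) : testToHtilde Ω s (slice φ T) = 0 := by
  have : slice φ T = 0 := by
    ext x
    change φ (x, T) = 0
    exact image_eq_zero_of_notMem_tsupport fun hx => lt_irrefl T (φ.tsupport_subset hx).2
  rw [this]
  exact Subtype.ext (map_zero (testToHs Ω s))

lemma integral_slice (h : Adm n s) (φ : 𝓓(spaceTime Ω T, ℝ)) (t : ℝ) :
    ∫ τ in t..T, testToHtilde Ω s (slice (timeDeriv φ) τ) = -testToHtilde Ω s (slice φ t) := by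
  rw [intervalIntegral.integral_eq_sub_of_hasDerivAt (fun τ _ => hasDerivAt_slice h φ τ)
    ((continuous_slice h _).intervalIntegrable _ _), slice_T, zero_sub]

end Slices

/-! ### Equivalence of the weak formulation and the integrated equation -/

section WeakFormulation

variable {n : ℕ} {s : ℝ≥0} {T : ℝ} {Ω : Opens (Euc n)} {γ : Euc n → ℝ → ℝ} {g : ℝ → Euc n → ℝ}
  {c Λ : ℝ}

/-- The functional `div_s(Θ_γ(t) ∇ˢu)` on `H̃ˢ(Ω)`. -/
def fracDiffusion (h : Adm n s) (hg : IsRootCoef T γ g c Λ) (Ω : Opens (Euc n)) (t : ℝ)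
    (u : Hs n s) : HnegOn Ω s :=
  (rootForm h hg t u).comp (Htilde Ω s).subtypeL

lemma fracDiffusion_add (h : Adm n s) (hg : IsRootCoef T γ g c Λ) (t : ℝ) (u v : Hs n s) :
    fracDiffusion h hg Ω t (u + v) = fracDiffusion h hg Ω t u + fracDiffusion h hg Ω t v := by
  unfold fracDiffusion; rw [map_add]; rfl

lemma fracDiffusion_coe (h : Adm n s) (hg : IsRootCoef T γ g c Λ) (t : ℝ) (w : Htilde Ω s) :
    fracDiffusion h hg Ω t (w : Hs n s) = restrForm Ω (rootForm h hg t) w := rfl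

lemma memLp_fracDiffusion (h : Adm n s) (hg : IsRootCoef T γ g c Λ) {p : ℝ≥0∞} {u : ℝ → Hs n s}
    (hu : MemLp u p (timeMeasure T)) :
    MemLp (fun t => fracDiffusion h hg Ω t (u t)) p (timeMeasure T) := by
  have h1 : AEStronglyMeasurable (fun t => rootForm h hg t (u t)) (timeMeasure T) :=
    aestronglyMeasurable_form (fun u v => aestronglyMeasurable_rootForm h hg _ u v) hu.1
  refine hu.of_le_mul (c := fracConst n s / 2 * Λ ^ 2 * ‖gagMap h‖ ^ 2) ?_
    (.of_forall fun t => ?_)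
  · refine aestronglyMeasurable_dual fun v => ?_
    exact (ContinuousLinearMap.apply ℝ ℝ (v : Hs n s)).continuous.comp_aestronglyMeasurable h1
  · have h2 := (rootForm h hg t).le_of_opNorm_le (norm_rootForm_le h hg t) (u t)
    refine ContinuousLinearMap.opNorm_le_bound _ (le_trans (norm_nonneg _) h2) fun v => ?_
    exact (rootForm h hg t (u t)).le_of_opNorm_le h2 v

lemma isFracDiv_fracDiffusion (h : Adm n s) (hg : IsRootCoef T γ g c Λ) :
    ∀ᵐ t ∂(timeMeasure T), ∀ u : Hs n s,
      IsFracDiv Ω s (fun z => conductivity γ t z (fracGrad s u z)) (fracDiffusion h hg Ω t u) := by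
  filter_upwards [condForm_eq h hg] with t ht u v
  exact (ht u v).symm

lemma dualEmb_testToHtilde (q : L2On Ω) (χ : 𝓓(Ω, ℝ)) :
    dualEmb (embΩ Ω s) q (testToHtilde Ω s χ) = ∫ x in (Ω : Set (Euc n)), q x * χ x := by
  rw [dualEmb_apply, L2.inner_def]
  refine integral_congr_ae ?_
  have h1 := restr_ae (Ω := Ω) (Hs.toL2 n s (testToHs Ω s χ))
  filter_upwards [h1, ae_restrict_of_ae (coeFn_testToHs (s := s) χ)] with x hx hx'
  rw [inner_real_eq]
  congr 1
  exact hx.trans hx'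

lemma condForm_congr_right {t : ℝ} (u : Euc n → ℝ) {v v' : Euc n → ℝ} (hv : ∀ᵐ x, v x = v' x) :
    condForm s γ t u v = condForm s γ t u v' := by
  unfold condForm
  refine integral_congr_ae ?_
  filter_upwards [ae_fst hv, ae_snd hv] with z h1 h2
  have : fracGrad s v z = fracGrad s v' z := by rw [fracGrad, h1, h2]; rfl
  rw [this]

lemma condForm_slice (h : Adm n s) (hg : IsRootCoef T γ g c Λ) :
    ∀ᵐ t ∂(timeMeasure T), ∀ (u : Hs n s) (χ : 𝓓(Ω, ℝ)),
      condForm s γ t u χ = fracDiffusion h hg Ω t u (testToHtilde Ω s χ) := by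
  filter_upwards [condForm_eq h hg] with t ht u χ
  rw [condForm_congr_right u (v' := Hs.toL2 n s (testToHs Ω s χ))
    (by filter_upwards [coeFn_testToHs (s := s) χ] with x hx using hx.symm)]
  exact ht u (testToHs Ω s χ)

/-- The weak formulation, in terms of curves in `H̃ˢ(Ω)`. -/
lemma weak_eq_iff (h : Adm n s) (hg : IsRootCoef T γ g c Λ) {F : ℝ → HnegOn Ω s} {u₀ : L2On Ω}
    {u : ℝ → Hs n s} (φ : 𝓓(spaceTime Ω T, ℝ)) :
    (-(∫ t, (∫ x in (Ω : Set (Euc n)), u t x * deriv (fun τ => φ (x, τ)) t) ∂(timeMeasure T)) +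
        ∫ t, condForm s γ t (u t) (slice φ t) ∂(timeMeasure T) =
      (∫ t, F t (testToHtilde Ω s (slice φ t)) ∂(timeMeasure T)) +
        ∫ x in (Ω : Set (Euc n)), u₀ x * φ (x, 0)) ↔
    -(∫ t, dualEmb (embΩ Ω s) (restr Ω (Hs.toL2 n s (u t)))
        (testToHtilde Ω s (slice (timeDeriv φ) t)) ∂(timeMeasure T)) +
        ∫ t, fracDiffusion h hg Ω t (u t) (testToHtilde Ω s (slice φ t)) ∂(timeMeasure T) =
      (∫ t, F t (testToHtilde Ω s (slice φ t)) ∂(timeMeasure T)) +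
        dualEmb (embΩ Ω s) u₀ (testToHtilde Ω s (slice φ 0)) := by
  have e1 : ∀ t, ∫ x in (Ω : Set (Euc n)), u t x * deriv (fun τ => φ (x, τ)) t =
      dualEmb (embΩ Ω s) (restr Ω (Hs.toL2 n s (u t)))
        (testToHtilde Ω s (slice (timeDeriv φ) t)) := fun t => by
    rw [dualEmb_testToHtilde]
    refine integral_congr_ae ?_
    filter_upwards [restr_ae (Ω := Ω) (Hs.toL2 n s (u t))] with x hx
    rw [hx, (hasDerivAt_time φ x t).deriv]
    rfl
  have e2 : ∫ t, condForm s γ t (u t) (slice φ t) ∂(timeMeasure T) =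
      ∫ t, fracDiffusion h hg Ω t (u t) (testToHtilde Ω s (slice φ t)) ∂(timeMeasure T) := by
    refine integral_congr_ae ?_
    filter_upwards [condForm_slice (Ω := Ω) h hg] with t ht using ht (u t) (slice φ t)
  rw [dualEmb_testToHtilde, e2]
  simp only [e1]
  rfl

/-- Fubini on the triangle plays the role of integration by parts. Test functions vanish at time
`T`, so the only boundary term is the one with `u₀`. -/
lemma weak_eq_of_isPrimitive (h : Adm n s) (hg : IsRootCoef T γ g c Λ) (hT : 0 < T)
    {F : ℝ → HnegOn Ω s} {u₀ : L2On Ω} {u : ℝ → Hs n s} (hF : MemLp F 2 (timeMeasure T))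
    (hu : MemLp u 2 (timeMeasure T))
    (hp : IsPrimitive T (fun t => dualEmb (embΩ Ω s) (restr Ω (Hs.toL2 n s (u t))))
      (fun t => F t - fracDiffusion h hg Ω t (u t)) (dualEmb (embΩ Ω s) u₀))
    (φ : 𝓓(spaceTime Ω T, ℝ)) :
    -(∫ t, (∫ x in (Ω : Set (Euc n)), u t x * deriv (fun τ => φ (x, τ)) t) ∂(timeMeasure T)) +
        ∫ t, condForm s γ t (u t) (slice φ t) ∂(timeMeasure T) =
      (∫ t, F t (testToHtilde Ω s (slice φ t)) ∂(timeMeasure T)) +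
        ∫ x in (Ω : Set (Euc n)), u₀ x * φ (x, 0) := by
  rw [weak_eq_iff h hg]
  have hD := memLp_fracDiffusion (Ω := Ω) h hg hu
  have hψ : MemLp (fun t => testToHtilde Ω s (slice φ t)) 2 (timeMeasure T) :=
    memLp_continuous (continuous_slice h φ) 2
  have hψ' : MemLp (fun t => testToHtilde Ω s (slice (timeDeriv φ) t)) 2 (timeMeasure T) :=
    memLp_continuous (continuous_slice h (timeDeriv φ)) 2
  have hZ : MemLp (fun t => F t - fracDiffusion h hg Ω t (u t)) 2 (timeMeasure T) := hF.sub hD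
  have hZ1 := hZ.integrable one_le_two
  have hψ1 := hψ'.integrable one_le_two
  have hP : MemLp (fun t => ∫ τ in 0..t, (F τ - fracDiffusion h hg Ω τ (u τ))) 2 (timeMeasure T) :=
    memLp_continuousOn (continuousOn_primitive hT.le hZ1) 2
  have e1 : ∫ t, dualEmb (embΩ Ω s) (restr Ω (Hs.toL2 n s (u t)))
        (testToHtilde Ω s (slice (timeDeriv φ) t)) ∂(timeMeasure T) =
      (∫ t, dualEmb (embΩ Ω s) u₀ (testToHtilde Ω s (slice (timeDeriv φ) t)) ∂(timeMeasure T)) +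
      ∫ t, (∫ τ in 0..t, (F τ - fracDiffusion h hg Ω τ (u τ)))
        (testToHtilde Ω s (slice (timeDeriv φ) t)) ∂(timeMeasure T) := by
    rw [← integral_add ((dualEmb (embΩ Ω s) u₀).integrable_comp hψ1) (integrable_dual_apply hP hψ')]
    refine integral_congr_ae ?_
    filter_upwards [hp] with t ht
    rw [ht]; rfl
  have e2 : ∫ t, dualEmb (embΩ Ω s) u₀ (testToHtilde Ω s (slice (timeDeriv φ) t)) ∂(timeMeasure T) =
      -dualEmb (embΩ Ω s) u₀ (testToHtilde Ω s (slice φ 0)) := by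
    rw [(dualEmb (embΩ Ω s) u₀).integral_comp_comm hψ1, integral_timeMeasure hT.le,
      integral_slice h, map_neg]
  have e3 : ∫ t, (∫ τ in 0..t, (F τ - fracDiffusion h hg Ω τ (u τ)))
        (testToHtilde Ω s (slice (timeDeriv φ) t)) ∂(timeMeasure T) =
      -∫ t, (F t - fracDiffusion h hg Ω t (u t)) (testToHtilde Ω s (slice φ t)) ∂(timeMeasure T) := by
    have := integral_bilin_primitive (ContinuousLinearMap.id ℝ (HnegOn Ω s)) hZ1 hψ1
    simp only [ContinuousLinearMap.id_apply, integral_slice h, map_neg, integral_neg] at this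
    exact this.symm
  have e4 : ∫ t, (F t - fracDiffusion h hg Ω t (u t)) (testToHtilde Ω s (slice φ t)) ∂(timeMeasure T) =
      (∫ t, F t (testToHtilde Ω s (slice φ t)) ∂(timeMeasure T)) -
      ∫ t, fracDiffusion h hg Ω t (u t) (testToHtilde Ω s (slice φ t)) ∂(timeMeasure T) :=
    integral_sub (integrable_dual_apply hF hψ) (integrable_dual_apply hD hψ)
  rw [e1, e2, e3, e4]
  ring

/-- The space-time test function `χ(x) η(t)`. -/
def prodTest (η : ℝ → ℝ) (hη : ContDiff ℝ ∞ η) (hc : HasCompactSupport η) (hs : tsupport η ⊆ Iio T)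
    (χ : 𝓓(Ω, ℝ)) : 𝓓(spaceTime Ω T, ℝ) where
  toFun z := η z.2 * χ z.1
  contDiff' := (hη.comp contDiff_snd).mul (χ.contDiff.comp contDiff_fst)
  hasCompactSupport' := HasCompactSupport.intro (χ.hasCompactSupport.isCompact.prod hc.isCompact)
    fun z hz => by
      by_contra hcon
      exact hz ⟨subset_tsupport _ (right_ne_zero_of_mul hcon),
        subset_tsupport _ (left_ne_zero_of_mul hcon)⟩
  tsupport_subset' := by
    have h1 : tsupport (fun z : Euc n × ℝ => η z.2 * χ z.1) ⊆ tsupport χ ×ˢ tsupport η :=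
      closure_minimal (fun z hz => ⟨subset_tsupport _ (right_ne_zero_of_mul hz),
        subset_tsupport _ (left_ne_zero_of_mul hz)⟩)
        ((isClosed_tsupport _).prod (isClosed_tsupport _))
    exact h1.trans (prod_mono χ.tsupport_subset hs)

lemma dense_range_testToHtilde : Dense (range (testToHtilde Ω s)) := by
  refine Subtype.dense_iff.2 fun v hv => closure_mono ?_ hv
  rintro _ ⟨χ, rfl⟩
  exact ⟨testToHtilde Ω s χ, ⟨χ, rfl⟩, rfl⟩

/-- Products `η(t) χ(x)` suffice: the functions `χ` are dense in `H̃ˢ(Ω)`, and factors `η` that do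
not vanish at `0` detect the initial value. -/
lemma isPrimitive_of_weak_eq (h : Adm n s) (hg : IsRootCoef T γ g c Λ) (hT : 0 < T)
    {F : ℝ → HnegOn Ω s} {u₀ : L2On Ω} {u : ℝ → Hs n s} (hF : MemLp F 2 (timeMeasure T))
    (hu : MemLp u 2 (timeMeasure T))
    (hw : ∀ φ : 𝓓(spaceTime Ω T, ℝ),
    -(∫ t, (∫ x in (Ω : Set (Euc n)), u t x * deriv (fun τ => φ (x, τ)) t) ∂(timeMeasure T)) +
        ∫ t, condForm s γ t (u t) (slice φ t) ∂(timeMeasure T) =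
      (∫ t, F t (testToHtilde Ω s (slice φ t)) ∂(timeMeasure T)) +
        ∫ x in (Ω : Set (Euc n)), u₀ x * φ (x, 0)) :
    IsPrimitive T (fun t => dualEmb (embΩ Ω s) (restr Ω (Hs.toL2 n s (u t))))
      (fun t => F t - fracDiffusion h hg Ω t (u t)) (dualEmb (embΩ Ω s) u₀) := by
  have hD := (memLp_fracDiffusion (Ω := Ω) h hg hu).integrable one_le_two
  have hF1 := hF.integrable one_le_two
  have hu1 := hu.integrable one_le_two
  have hY : Integrable (fun t => dualEmb (embΩ Ω s) (restr Ω (Hs.toL2 n s (u t)))) (timeMeasure T) :=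
    ((dualEmb (embΩ Ω s)).comp ((restr Ω).comp (Hs.toL2 n s))).integrable_comp hu1
  have hZ : Integrable (fun t => F t - fracDiffusion h hg Ω t (u t)) (timeMeasure T) := hF1.sub hD
  refine isPrimitive_of_forall_test hT hY hZ fun η hη hc hs => ?_
  have hη' : Continuous (deriv η) := hη.continuous_deriv (by simp)
  have i1 := integrable_smul_continuous hη' hY
  have i2 := integrable_smul_continuous hη.continuous hZ
  refine ContinuousLinearMap.coeFn_injective (Continuous.ext_on dense_range_testToHtilde
    (ContinuousLinearMap.continuous _) (ContinuousLinearMap.continuous _) ?_)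
  rintro _ ⟨χ, rfl⟩
  have h1 := (weak_eq_iff h hg _).1 (hw (prodTest η hη hc hs χ))
  have e1 : ∀ t, testToHtilde Ω s (slice (prodTest η hη hc hs χ) t) = η t • testToHtilde Ω s χ :=
    fun t => Subtype.ext ((testToHs Ω s).map_smul (η t) χ)
  have e2 : ∀ t, testToHtilde Ω s (slice (timeDeriv (prodTest η hη hc hs χ)) t) =
      deriv η t • testToHtilde Ω s χ := fun t => by
    have : slice (timeDeriv (prodTest η hη hc hs χ)) t = deriv η t • χ := by
      ext x
      have h2 : HasDerivAt (fun τ => η τ * χ x) (deriv η t * χ x) t :=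
        ((hη.differentiable (by simp)) t).hasDerivAt.mul_const _
      exact (hasDerivAt_time (prodTest η hη hc hs χ) x t).unique h2
    rw [this]
    exact Subtype.ext ((testToHs Ω s).map_smul (deriv η t) χ)
  simp only [e1, e2, map_smul] at h1
  have j1 := ContinuousLinearMap.integral_apply i1 (testToHtilde Ω s χ)
  have j2 := ContinuousLinearMap.integral_apply i2 (testToHtilde Ω s χ)
  have j3 : ∫ t, (η t • (F t - fracDiffusion h hg Ω t (u t))) (testToHtilde Ω s χ) ∂(timeMeasure T) =
      (∫ t, η t • F t (testToHtilde Ω s χ) ∂(timeMeasure T)) -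
      ∫ t, η t • fracDiffusion h hg Ω t (u t) (testToHtilde Ω s χ) ∂(timeMeasure T) := by
    have k1 : Integrable (fun t => η t • F t (testToHtilde Ω s χ)) (timeMeasure T) :=
      integrable_smul_continuous hη.continuous
        ((ContinuousLinearMap.apply ℝ ℝ (testToHtilde Ω s χ)).integrable_comp hF1)
    have k2 : Integrable (fun t => η t • fracDiffusion h hg Ω t (u t) (testToHtilde Ω s χ))
        (timeMeasure T) := integrable_smul_continuous hη.continuous
        ((ContinuousLinearMap.apply ℝ ℝ (testToHtilde Ω s χ)).integrable_comp hD)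
    rw [← integral_sub k1 k2]
    refine integral_congr_ae (.of_forall fun t => ?_)
    exact smul_sub (η t) _ _
  change -((∫ t, deriv η t • dualEmb (embΩ Ω s) (restr Ω (Hs.toL2 n s (u t))) ∂(timeMeasure T))
      (testToHtilde Ω s χ)) = (∫ t, η t • (F t - fracDiffusion h hg Ω t (u t)) ∂(timeMeasure T))
      (testToHtilde Ω s χ) + η 0 • dualEmb (embΩ Ω s) u₀ (testToHtilde Ω s χ)
  rw [j1, j2, j3]
  simp only [smul_eq_mul] at h1 ⊢
  have j4 : ∫ t, (deriv η t • dualEmb (embΩ Ω s) (restr Ω (Hs.toL2 n s (u t))))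
      (testToHtilde Ω s χ) ∂(timeMeasure T) = ∫ t, deriv η t * dualEmb (embΩ Ω s)
      (restr Ω (Hs.toL2 n s (u t))) (testToHtilde Ω s χ) ∂(timeMeasure T) := rfl
  rw [j4]
  linarith

end WeakFormulation

/-! ### Quantitative bounds for the abstract problem -/

section Estimates

variable {T : ℝ} {V H : Type*} [NormedAddCommGroup V] [InnerProductSpace ℝ V] [CompleteSpace V]
  [NormedAddCommGroup H] [InnerProductSpace ℝ H] [SeparableSpace V] [CompleteSpace H]
  {ι : V →L[ℝ] H} {a : ℝ → V →L[ℝ] V →L[ℝ] ℝ} {M α l : ℝ} {L : ℝ≥0}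

lemma IsParabolicForm.norm_toLp_le (ha : IsParabolicForm T ι a M α l) {w : ℝ → V}
    (hw : MemLp w 2 (timeMeasure T)) :
    ‖(ha.memLp hw).toLp (fun t => a t (w t))‖ ≤ M * ‖hw.toLp w‖ := by
  refine Lp.norm_le_mul_norm_of_ae_le_mul ?_
  filter_upwards [(ha.memLp hw).coeFn_toLp, hw.coeFn_toLp] with t h1 h2
  rw [h1, h2]
  exact ha.norm_apply_le t _

/-- Existence of mild solutions with bounds in the natural spaces. -/
lemma exists_mildSolution_bounds (hT : 0 < T) (ha : IsParabolicForm T ι a M α l) :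
    ∃ C : ℝ, 0 ≤ C ∧ ∀ (G : ℝ → StrongDual ℝ V) (hG : MemLp G 2 (timeMeasure T)) (w₀ : H),
      ∃ (w : ℝ → V) (hw : MemLp w 2 (timeMeasure T))
        (hv : MemLp (fun t => G t - a t (w t)) 2 (timeMeasure T)),
        IsMildSolution T ι a G w₀ w ∧
        (∀ᵐ t ∂(timeMeasure T), ‖ι (w t)‖ ^ 2 ≤ C * (‖hG.toLp G‖ + ‖w₀‖) ^ 2) ∧
        ‖hw.toLp w‖ ^ 2 ≤ C * (‖hG.toLp G‖ + ‖w₀‖) ^ 2 ∧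
        ‖hv.toLp _‖ ^ 2 ≤ C * (‖hG.toLp G‖ + ‖w₀‖) ^ 2 := by
  have hM := ha.bound_nonneg
  have hα := ha.alpha_pos
  obtain ⟨A, hA⟩ : ∃ A : ℝ, A = Real.exp (2 * l * T) * (1 / α + √(2 / α)) := ⟨_, rfl⟩
  have hA0 : 0 ≤ A := by rw [hA]; positivity
  -- The summands are the bounds for the initial value, for `w` and for its derivative `G - a w`;
  -- the energy bound in `L^∞(0,T;H)` needs all three.
  refine ⟨1 + A ^ 2 + (1 + M * A) ^ 2, by positivity, fun G hG w₀ => ?_⟩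
  obtain ⟨w, hw, hsol, hb⟩ := exists_isMildSolution ha hT hG w₀
  have hv : MemLp (fun t => G t - a t (w t)) 2 (timeMeasure T) := hG.sub (ha.memLp hw)
  obtain ⟨X, hX⟩ : ∃ X, X = ‖hG.toLp G‖ + ‖w₀‖ := ⟨_, rfl⟩
  have hX0 : 0 ≤ X := by rw [hX]; positivity
  have hG1 : ‖hG.toLp G‖ ≤ X := by rw [hX]; exact le_add_of_nonneg_right (norm_nonneg _)
  have hw1 : ‖w₀‖ ≤ X := by rw [hX]; exact le_add_of_nonneg_left (norm_nonneg _)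
  have b1 : ‖hw.toLp w‖ ≤ A * X := by
    rw [hA]
    calc _ ≤ Real.exp (2 * l * T) * (X / α + √(2 / α) * X) := hb.trans (by gcongr)
      _ = _ := by ring
  have b2 : ‖hv.toLp _‖ ≤ (1 + M * A) * X := by
    have e : hv.toLp _ = hG.toLp G - (ha.memLp hw).toLp _ := rfl
    rw [e]
    refine (norm_sub_le _ _).trans ?_
    have := ha.norm_toLp_le hw
    calc _ ≤ X + M * (A * X) := by gcongr; exact this.trans (by gcongr)
      _ = _ := by ring
  have c1 : ‖hw.toLp w‖ ^ 2 ≤ A ^ 2 * X ^ 2 := by rw [← mul_pow]; gcongr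
  have c2 : ‖hv.toLp _‖ ^ 2 ≤ (1 + M * A) ^ 2 * X ^ 2 := by rw [← mul_pow]; gcongr
  have c0 : ‖w₀‖ ^ 2 ≤ X ^ 2 := by gcongr
  have p1 := mul_nonneg (sq_nonneg A) (sq_nonneg X)
  have p2 := mul_nonneg (sq_nonneg (1 + M * A)) (sq_nonneg X)
  have p0 := sq_nonneg X
  rw [← hX]
  refine ⟨w, hw, hv, hsol, ?_, by linarith, by linarith⟩
  filter_upwards [ae_norm_sq_le hT hw hv hsol] with t ht
  linarith

/-- Existence of regular solutions with bounds in the natural spaces. -/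
lemma exists_regularSolution_bounds (hT : 0 < T) (ha : IsParabolicForm T ι a M α l)
    (hs : ∀ t u v, a t u v = a t v u) (hL : LipschitzWith L a) :
    ∃ C : ℝ, 0 ≤ C ∧ ∀ (G : ℝ → StrongDual ℝ V) (g : ℝ → ℝ) (w₀ : V),
      MemLp G 2 (timeMeasure T) → ∀ (hg : MemLp g 2 (timeMeasure T)),
      (∀ᵐ t ∂(timeMeasure T), ∀ v, |G t v| ≤ g t * ‖ι v‖) →
      ∃ (w : ℝ → V) (p : ℝ → H) (_ : MemLp w 2 (timeMeasure T)) (hp : MemLp p 2 (timeMeasure T)),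
        IsPrimitive T (fun t => ι (w t)) p (ι w₀) ∧
        (∀ᵐ t ∂(timeMeasure T), dualEmb ι (p t) = G t - a t (w t)) ∧
        (∀ᵐ t ∂(timeMeasure T), ‖w t‖ ^ 2 ≤ C * (‖hg.toLp g‖ + ‖w₀‖) ^ 2) ∧
        ‖hp.toLp p‖ ^ 2 ≤ C * (‖hg.toLp g‖ + ‖w₀‖) ^ 2 := by
  have hM := ha.bound_nonneg
  have hα := ha.alpha_pos
  have hl := ha.l_nonneg
  obtain ⟨A, hA0, hreg⟩ := exists_regular_solution hT ha hs hL
  obtain ⟨N, hN⟩ : ∃ N : ℝ, N = ‖dualEmb ι‖ := ⟨_, rfl⟩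
  have hN0 : 0 ≤ N := hN ▸ norm_nonneg _
  obtain ⟨B, hB⟩ : ∃ B : ℝ, B = ‖ι‖ ^ 2 + A ^ 2 + (N * A) ^ 2 := ⟨_, rfl⟩
  have hB0 : 0 ≤ B := by rw [hB]; positivity
  obtain ⟨D, hD⟩ : ∃ D : ℝ,
    D = M * A ^ 2 + T * ((1 + A) ^ 2 + A ^ 2 + L * A ^ 2) := ⟨_, rfl⟩
  have hD0 : 0 ≤ D := by rw [hD]; positivity
  refine ⟨A ^ 2 + (D / T + l * B) / α, by positivity, fun G g w₀ hG hg hb => ?_⟩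
  obtain ⟨w, p, hw, hp, hprim, heq, bw, bp⟩ := hreg G g w₀ hG hg hb
  obtain ⟨X, hX⟩ : ∃ X, X = ‖hg.toLp g‖ + ‖w₀‖ := ⟨_, rfl⟩
  have hX0 : 0 ≤ X := by rw [hX]; positivity
  have hG1 : ‖hg.toLp g‖ ≤ X := by rw [hX]; exact le_add_of_nonneg_right (norm_nonneg _)
  have hw1 : ‖w₀‖ ≤ X := by rw [hX]; exact le_add_of_nonneg_left (norm_nonneg _)
  rw [← hX] at bw bp ⊢
  have cw : ‖hw.toLp w‖ ^ 2 ≤ A ^ 2 * X ^ 2 := by rw [← mul_pow]; gcongr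
  have cp : ‖hp.toLp p‖ ^ 2 ≤ A ^ 2 * X ^ 2 := by rw [← mul_pow]; gcongr
  -- Because `a w = G - p` and both terms on the right act through `ι`, the functional `a(t; w(t),
  -- ·)` is bounded by this function times the norm of `H`. The energy increments require exactly
  -- this.
  have hk : MemLp (fun t => g t + ‖p t‖) 2 (timeMeasure T) := hg.add hp.norm
  have ck : ‖hk.toLp _‖ ^ 2 ≤ (1 + A) ^ 2 * X ^ 2 := by
    have e : hk.toLp _ = hg.toLp g + hp.norm.toLp _ := rfl
    have e2 : ‖hp.norm.toLp _‖ = ‖hp.toLp p‖ := by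
      rw [Lp.norm_toLp, Lp.norm_toLp, eLpNorm_norm]
    rw [← mul_pow]
    gcongr
    rw [e]
    refine (norm_add_le _ _).trans ?_
    rw [e2, add_mul, one_mul]
    gcongr
  have hwk : ∀ᵐ t ∂(timeMeasure T), ∀ v, |a t (w t) v| ≤ (g t + ‖p t‖) * ‖ι v‖ := by
    filter_upwards [heq, hb] with t h1 h2 v
    have h3 : a t (w t) v = G t v - inner ℝ (p t) (ι v) := by
      have := congrArg (fun q : StrongDual ℝ V => q v) h1
      simp only [dualEmb_apply, _root_.sub_apply] at this
      linarith
    rw [h3, add_mul]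
    refine (abs_sub _ _).trans (add_le_add (h2 v) (abs_real_inner_le_norm _ _))
  have hv : MemLp (fun t => dualEmb ι (p t)) 2 (timeMeasure T) := (dualEmb ι).comp_memLp' hp
  have cv : ‖hv.toLp _‖ ^ 2 ≤ (N * A) ^ 2 * X ^ 2 := by
    rw [← mul_pow, mul_assoc]
    gcongr
    refine (Lp.norm_le_mul_norm_of_ae_le_mul (g := hp.toLp p) (c := N) ?_).trans (by gcongr)
    filter_upwards [hv.coeFn_toLp, hp.coeFn_toLp] with t h1 h2
    rw [h1, h2, hN]
    exact (dualEmb ι).le_opNorm _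
  have cι : ‖ι w₀‖ ^ 2 ≤ ‖ι‖ ^ 2 * X ^ 2 := by
    rw [← mul_pow]
    gcongr
    exact (ι.le_opNorm _).trans (by gcongr)
  have hE := ae_norm_sq_le (w₀ := ι w₀) hT hw hv (hprim.comp (dualEmb ι) (hp.integrable one_le_two))
  have hR := ae_regular_norm_sq_le hT ha hs hL hw hp hk hprim hwk
  rw [← norm_toLp_sq hw, ← norm_toLp_sq hp, ← norm_toLp_sq hk] at hR
  have q1 : 0 ≤ (D / T + l * B) / α * X ^ 2 := by positivity
  have q2 := mul_nonneg (sq_nonneg A) (sq_nonneg X)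
  refine ⟨w, p, hw, hp, hprim, heq, ?_, by linarith⟩
  filter_upwards [hE, hR] with t h1 h2
  have h3 : ‖ι (w t)‖ ^ 2 ≤ B * X ^ 2 := by rw [hB]; linarith
  have h4 : T * (α * ‖w t‖ ^ 2 - l * ‖ι (w t)‖ ^ 2) ≤ D * X ^ 2 := by
    refine h2.trans ?_
    calc _ ≤ M * (A ^ 2 * X ^ 2) + T * ((1 + A) ^ 2 * X ^ 2 + A ^ 2 * X ^ 2 +
          L * (A ^ 2 * X ^ 2)) := by gcongr
      _ = D * X ^ 2 := by rw [hD]; ring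
  have h5 : α * ‖w t‖ ^ 2 ≤ (D / T + l * B) * X ^ 2 := by
    have h6 : α * ‖w t‖ ^ 2 - l * ‖ι (w t)‖ ^ 2 ≤ D * X ^ 2 / T := by
      rw [le_div_iff₀ hT, mul_comm]; exact h4
    have h7 := mul_le_mul_of_nonneg_left h3 hl
    calc _ ≤ D * X ^ 2 / T + l * (B * X ^ 2) := by linarith
      _ = _ := by ring
  have h8 : ‖w t‖ ^ 2 ≤ (D / T + l * B) / α * X ^ 2 := by
    rw [div_mul_eq_mul_div, le_div_iff₀ hα, mul_comm]; exact h5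
  linarith

lemma eLpNorm_two_sq {α E : Type*} [MeasurableSpace α] {μ : Measure α} [NormedAddCommGroup E]
    {q : α → E} (hq : MemLp q 2 μ) :
    eLpNorm q 2 μ ^ 2 = ENNReal.ofReal (‖hq.toLp q‖ ^ 2) := by
  rw [ENNReal.ofReal_pow (norm_nonneg _), Lp.norm_toLp, ENNReal.ofReal_toReal hq.2.ne]

lemma eLpNorm_top_sq_le {α E : Type*} [MeasurableSpace α] {μ : Measure α} [NormedAddCommGroup E]
    {q : α → E} {B : ℝ} (hB : 0 ≤ B) (hq : ∀ᵐ t ∂μ, ‖q t‖ ^ 2 ≤ B) :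
    eLpNorm q ∞ μ ^ 2 ≤ ENNReal.ofReal B := by
  rw [← Real.sq_sqrt hB, ENNReal.ofReal_pow (Real.sqrt_nonneg _), eLpNorm_exponent_top]
  gcongr
  refine eLpNormEssSup_le_of_ae_bound ?_
  filter_upwards [hq] with t ht using Real.le_sqrt_of_sq_le ht

lemma enorm_sq_eq_ofReal {E : Type*} [NormedAddCommGroup E] (x : E) :
    ‖x‖ₑ ^ 2 = ENNReal.ofReal (‖x‖ ^ 2) := by
  rw [ENNReal.ofReal_pow (norm_nonneg _), ofReal_norm]

end Estimates

/-! ### Traces at the initial time -/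

section InitialValue

variable {n : ℕ} {s : ℝ≥0} {T : ℝ} {Ω : Opens (Euc n)}

/-- The restriction `H⁻ˢ(ℝⁿ) → H⁻ˢ(Ω)` as a continuous linear map. -/
def restrNegL (Ω : Opens (Euc n)) (s : ℝ≥0) : Hneg n s →L[ℝ] HnegOn Ω s :=
  (ContinuousLinearMap.compL ℝ (Htilde Ω s) (Hs n s) ℝ).flip (Htilde Ω s).subtypeL

lemma restrNegL_apply (ℓ : Hneg n s) : restrNegL Ω s ℓ = restrNeg Ω s ℓ := rfl

lemma restrNeg_l2ToHneg (q : L2 n) :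
    restrNeg Ω s (l2ToHneg n s q) = dualEmb (embΩ Ω s) (restr Ω q) := by
  refine ContinuousLinearMap.coeFn_injective (Continuous.ext_on dense_range_testToHtilde
    (ContinuousLinearMap.continuous _) (ContinuousLinearMap.continuous _) ?_)
  rintro _ ⟨χ, rfl⟩
  change inner ℝ q (Hs.toL2 n s (testToHs Ω s χ)) =
    dualEmb (embΩ Ω s) (restr Ω q) (testToHtilde Ω s χ)
  rw [dualEmb_testToHtilde, L2.inner_def]
  calc _ = ∫ x, q x * χ x := integral_congr_ae (by
        filter_upwards [coeFn_testToHs (s := s) χ] with x hx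
        rw [hx, inner_real_eq])
    _ = ∫ x in (Ω : Set (Euc n)), q x * χ x := by
        refine (setIntegral_eq_integral_of_forall_compl_eq_zero fun x hx => ?_).symm
        rw [image_eq_zero_of_notMem_tsupport fun h => hx (χ.tsupport_subset h), mul_zero]
    _ = _ := integral_congr_ae (by filter_upwards [restr_ae (Ω := Ω) q] with x hx; rw [hx])

/-- The Lions-Magenes lemma for `Hˢ(ℝⁿ)` and `L²(ℝⁿ)` gives the continuous representative.
Restricting the integrated equation to `Ω` keeps the initial value, because restriction of
functionals is compatible with restriction of functions. -/
lemma exists_hasInitialValue (hT : 0 < T) {f : ℝ → Hs n s} {f' : ℝ → Hneg n s}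
    (hf : MemLp f 2 (timeMeasure T)) (hf' : MemLp f' 2 (timeMeasure T))
    (hd : IsWeakTimeDeriv T (fun t => l2ToHneg n s (Hs.toL2 n s (f t))) f') :
    ∃ f₀ : L2 n, HasInitialValue T (fun t => Hs.toL2 n s (f t)) f₀ ∧
      ∀ Ω : Opens (Euc n), IsPrimitive T (fun t => dualEmb (embΩ Ω s) (restr Ω (Hs.toL2 n s (f t))))
        (fun t => restrNeg Ω s (f' t)) (dualEmb (embΩ Ω s) (restr Ω f₀)) := by
  have hY : Integrable (fun t => l2ToHneg n s (Hs.toL2 n s (f t))) (timeMeasure T) :=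
    ((dualEmb (Hs.toL2 n s)).comp (Hs.toL2 n s)).integrable_comp (hf.integrable one_le_two)
  obtain ⟨Y₀, hp⟩ := hd.exists_isPrimitive hT hY (hf'.integrable one_le_two)
  obtain ⟨U, hU, hUf, hUg, -, -⟩ := lionsMagenes hT (Hs.toL2 n s) hf hf' hp
  refine ⟨U 0, ⟨U, hU, hUf, rfl⟩, fun Ω => ?_⟩
  have h0 : l2ToHneg n s (U 0) = Y₀ := by
    have := hUg 0 (left_mem_Icc.2 hT.le)
    rwa [intervalIntegral.integral_same, add_zero] at this
  rw [← h0] at hp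
  have := hp.comp (restrNegL Ω s) (hf'.integrable one_le_two)
  simp only [restrNegL_apply, restrNeg_l2ToHneg] at this
  exact this

/-- Two continuous representatives agree on a dense set of times and hence at `0`. -/
lemma IsPrimitive.eq_of_hasInitialValue {X : Type*} [NormedAddCommGroup X] [NormedSpace ℝ X]
    [CompleteSpace X] (hT : 0 < T) {Y Z : ℝ → X} {Y₀ g : X} (h : IsPrimitive T Y Z Y₀)
    (hZ : Integrable Z (timeMeasure T)) (hg : HasInitialValue T Y g) : Y₀ = g := by
  obtain ⟨q, hq, hYq, rfl⟩ := hg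
  have h1 : ∀ᵐ t ∂(timeMeasure T), Y₀ + ∫ τ in 0..t, Z τ = q t := by
    filter_upwards [h, hYq] with t h1 h2 using h1.symm.trans h2
  have h2 : EqOn (fun t => Y₀ + ∫ τ in 0..t, Z τ) q (Icc 0 T) :=
    EqOn.of_subset_closure (fun t ht => ht.2)
      (continuousOn_const.add (continuousOn_primitive hT.le hZ)) hq
      (fun t ht => Ioo_subset_Icc_self ht.1) (subset_closure_of_ae hT h1)
  simpa using h2 (left_mem_Icc.2 hT.le)

end InitialValue

/-! ### Well-posedness in the energy space -/

section WellPosedness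

variable {n : ℕ} {s : ℝ≥0} {T : ℝ} {Ω : Opens (Euc n)} {γ : Euc n → ℝ → ℝ} {g : ℝ → Euc n → ℝ}
  {c Λ : ℝ}

/-- Adding a mild solution with vanishing exterior data to a lift of the exterior data. -/
lemma isPrimitive_add_mildSolution (h : Adm n s) (hg : IsRootCoef T γ g c Λ)
    {F q : ℝ → HnegOn Ω s} {f : ℝ → Hs n s} {f₀ : L2On Ω} {w : ℝ → Htilde Ω s} {w₀ : L2On Ω}
    (hF : MemLp F 2 (timeMeasure T)) (hf : MemLp f 2 (timeMeasure T))
    (hq : MemLp q 2 (timeMeasure T)) (hw : MemLp w 2 (timeMeasure T))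
    (hpf : IsPrimitive T (fun t => dualEmb (embΩ Ω s) (restr Ω (Hs.toL2 n s (f t)))) q
      (dualEmb (embΩ Ω s) f₀))
    (hsol : IsMildSolution T (embΩ Ω s) (fun t => restrForm Ω (rootForm h hg t))
      (fun t => F t - q t - fracDiffusion h hg Ω t (f t)) w₀ w) :
    IsPrimitive T (fun t => dualEmb (embΩ Ω s) (restr Ω (Hs.toL2 n s (f t + w t))))
      (fun t => F t - fracDiffusion h hg Ω t (f t + w t)) (dualEmb (embΩ Ω s) (f₀ + w₀)) := by
  have hw' : MemLp (fun t => (w t : Hs n s)) 2 (timeMeasure T) := (Htilde Ω s).subtypeL.comp_memLp' hw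
  have hq1 := hq.integrable one_le_two
  have hv : MemLp (fun t => F t - q t - fracDiffusion h hg Ω t (f t) -
      restrForm Ω (rootForm h hg t) (w t)) 2 (timeMeasure T) :=
    ((hF.sub hq).sub (memLp_fracDiffusion h hg hf)).sub (memLp_fracDiffusion h hg hw')
  have h1 := hpf.add hq1 (hv.integrable one_le_two) hsol
  rw [← map_add] at h1
  refine h1.congr (.of_forall fun t => ?_) (.of_forall fun t => ?_)
  · simp only [map_add]; rfl
  · simp only [fracDiffusion_add, fracDiffusion_coe]
    abel

/-- Uniqueness in terms of the integrated equation. -/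
lemma ae_eq_of_isPrimitive (h : Adm n s) (hg : IsRootCoef T γ g c Λ) (hT : 0 < T)
    {F : ℝ → HnegOn Ω s} {f u v : ℝ → Hs n s} {u₀ : L2On Ω} {w₁ w₂ : ℝ → Htilde Ω s}
    (hF : MemLp F 2 (timeMeasure T)) (hu : MemLp u 2 (timeMeasure T))
    (hv : MemLp v 2 (timeMeasure T)) (hw₁ : MemLp w₁ 2 (timeMeasure T))
    (hw₂ : MemLp w₂ 2 (timeMeasure T))
    (h₁ : ∀ᵐ t ∂(timeMeasure T), u t - f t = w₁ t) (h₂ : ∀ᵐ t ∂(timeMeasure T), v t - f t = w₂ t)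
    (hpu : IsPrimitive T (fun t => dualEmb (embΩ Ω s) (restr Ω (Hs.toL2 n s (u t))))
      (fun t => F t - fracDiffusion h hg Ω t (u t)) (dualEmb (embΩ Ω s) u₀))
    (hpv : IsPrimitive T (fun t => dualEmb (embΩ Ω s) (restr Ω (Hs.toL2 n s (v t))))
      (fun t => F t - fracDiffusion h hg Ω t (v t)) (dualEmb (embΩ Ω s) u₀)) :
    u =ᵐ[timeMeasure T] v := by
  obtain ⟨M, α, l, ha⟩ := exists_isParabolicForm h hg Ω
  have hw : MemLp (fun t => w₁ t - w₂ t) 2 (timeMeasure T) := hw₁.sub hw₂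
  have hpu' : Integrable (fun t => F t - fracDiffusion h hg Ω t (u t)) (timeMeasure T) :=
    (hF.sub (memLp_fracDiffusion h hg hu)).integrable one_le_two
  have hpv' : Integrable (fun t => F t - fracDiffusion h hg Ω t (v t)) (timeMeasure T) :=
    (hF.sub (memLp_fracDiffusion h hg hv)).integrable one_le_two
  have hd : ∀ᵐ t ∂(timeMeasure T), u t = v t + (w₁ t - w₂ t : Htilde Ω s) := by
    filter_upwards [h₁, h₂] with t e1 e2
    rw [Submodule.coe_sub, ← e1, ← e2]
    abel
  have h1 := hpu.sub hpu' hpv' hpv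
  rw [sub_self] at h1
  have h2 := ha.eq_zero hT hw (h1.congr (Y' := fun t => dualEmb (embΩ Ω s) (embΩ Ω s (w₁ t - w₂ t)))
    (Z' := fun t => -restrForm Ω (rootForm h hg t) (w₁ t - w₂ t)) ?_ ?_)
  · filter_upwards [hd, h2] with t e1 e2
    rw [e1, e2]
    simp
  · filter_upwards [hd] with t e1
    rw [e1, ← map_sub, ← map_sub, ← map_sub, add_sub_cancel_left]
    rfl
  · filter_upwards [hd] with t e1
    rw [e1, fracDiffusion_add, fracDiffusion_coe]
    abel

lemma IsWeakSolution.ae_eq (h : Adm n s) (hg : IsRootCoef T γ g c Λ) (hT : 0 < T)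
    {F : ℝ → HnegOn Ω s} {f u v : ℝ → Hs n s} {u₀ : L2On Ω} (hF : MemLp F 2 (timeMeasure T))
    (hu : IsWeakSolution Ω s T γ F f u₀ u) (hv : IsWeakSolution Ω s T γ F f u₀ v) :
    u =ᵐ[timeMeasure T] v := by
  obtain ⟨w₁, hw₁, h₁⟩ := hu.exterior
  obtain ⟨w₂, hw₂, h₂⟩ := hv.exterior
  exact ae_eq_of_isPrimitive h hg hT hF hu.memLp_two hv.memLp_two hw₁ hw₂ h₁ h₂
    (isPrimitive_of_weak_eq h hg hT hF hu.memLp_two hu.weak_eq)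
    (isPrimitive_of_weak_eq h hg hT hF hv.memLp_two hv.weak_eq)

lemma add_sq_le_five (a b c d e : ℝ) :
    (a + b + c + (d + e)) ^ 2 ≤ 5 * (d ^ 2 + e ^ 2 + a ^ 2 + b ^ 2 + c ^ 2) := by
  nlinarith [sq_nonneg (a - b), sq_nonneg (a - c), sq_nonneg (a - d), sq_nonneg (a - e),
    sq_nonneg (b - c), sq_nonneg (b - d), sq_nonneg (b - e), sq_nonneg (c - d), sq_nonneg (c - e),
    sq_nonneg (d - e)]

/-- Well-posedness of the weak formulation. -/
theorem exists_weakSolution (h : Adm n s) (hT : 0 < T) (hγ : UniformlyElliptic T γ) :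
    ∃ C : ℝ≥0, 0 < C ∧
      ∀ (F : ℝ → HnegOn Ω s) (f : ℝ → Hs n s) (f' : ℝ → Hneg n s) (u₀ : L2On Ω),
        MemLp F 2 (timeMeasure T) →
        MemLp f 2 (timeMeasure T) →
        MemLp f' 2 (timeMeasure T) →
        IsWeakTimeDeriv T (fun t => l2ToHneg n s (Hs.toL2 n s (f t))) f' →
        ∃ f₀ : L2 n, HasInitialValue T (fun t => Hs.toL2 n s (f t)) f₀ ∧
        ∃ D : ℝ → HnegOn Ω s, MemLp D 2 (timeMeasure T) ∧
          (∀ᵐ t ∂(timeMeasure T),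
            IsFracDiv Ω s (fun z => conductivity γ t z (fracGrad s (f t) z)) (D t)) ∧
        ∃ (u : ℝ → Hs n s) (u' : ℝ → HnegOn Ω s),
          IsWeakSolution Ω s T γ F f u₀ u ∧
          (∀ v : ℝ → Hs n s, IsWeakSolution Ω s T γ F f u₀ v → v =ᵐ[timeMeasure T] u) ∧
          MemLp u' 2 (timeMeasure T) ∧
          IsWeakTimeDeriv T (fun t => l2ToHnegOn Ω s (restr Ω (Hs.toL2 n s (u t)))) u' ∧
          eLpNorm (fun t => restr Ω (Hs.toL2 n s (u t - f t))) ∞ (timeMeasure T) ^ 2 +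
              eLpNorm (fun t => u t - f t) 2 (timeMeasure T) ^ 2 +
              eLpNorm (fun t => u' t - restrNeg Ω s (f' t)) 2 (timeMeasure T) ^ 2 ≤
            C * (‖u₀‖ₑ ^ 2 + ‖restr Ω f₀‖ₑ ^ 2 + eLpNorm F 2 (timeMeasure T) ^ 2 +
              eLpNorm (fun t => restrNeg Ω s (f' t)) 2 (timeMeasure T) ^ 2 +
              eLpNorm D 2 (timeMeasure T) ^ 2) := by
  obtain ⟨g, c, Λ, hg⟩ := hγ.exists_isRootCoef
  obtain ⟨M, α, l, ha⟩ := exists_isParabolicForm h hg Ω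
  obtain ⟨C, hC, hex⟩ := exists_mildSolution_bounds hT ha
  -- Three terms are each at most `C X²`, and `X²` is at most `5` times the sum of the squared data.
  -- The summand `1` ensures positivity.
  obtain ⟨K, hK⟩ : ∃ K : ℝ≥0, (K : ℝ) = 15 * C + 1 := ⟨⟨15 * C + 1, by positivity⟩, rfl⟩
  refine ⟨K, by rw [← NNReal.coe_pos, hK]; positivity, fun F f f' u₀ hF hf hf' hd => ?_⟩
  obtain ⟨f₀, hf₀, hpf⟩ := exists_hasInitialValue hT hf hf' hd
  have hD : MemLp (fun t => fracDiffusion h hg Ω t (f t)) 2 (timeMeasure T) :=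
    memLp_fracDiffusion h hg hf
  have hq : MemLp (fun t => restrNeg Ω s (f' t)) 2 (timeMeasure T) := (restrNegL Ω s).comp_memLp' hf'
  -- The source of the problem for `w = u - f`, which has vanishing exterior data and initial value
  -- `u₀ - f(0)`.
  have hG : MemLp (fun t => F t - restrNeg Ω s (f' t) - fracDiffusion h hg Ω t (f t)) 2
    (timeMeasure T) := (hF.sub hq).sub hD
  obtain ⟨w, hw, hv, hsol, b1, b2, b3⟩ := hex _ hG (u₀ - restr Ω f₀)
  have hw' : MemLp (fun t => (w t : Hs n s)) 2 (timeMeasure T) := (Htilde Ω s).subtypeL.comp_memLp' hw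
  have hu : MemLp (fun t => f t + w t) 2 (timeMeasure T) := hf.add hw'
  have hpu := isPrimitive_add_mildSolution h hg hF hf hq hw (hpf Ω) hsol
  rw [add_sub_cancel] at hpu
  have hweak : IsWeakSolution Ω s T γ F f u₀ (fun t => f t + w t) := by
    refine ⟨hu, ?_, ⟨w, hw, .of_forall fun t => add_sub_cancel_left _ _⟩,
      weak_eq_of_isPrimitive h hg hT hF hu hpu⟩
    have m1 : MemLp (fun t => restr Ω (Hs.toL2 n s (f t))) ∞ (timeMeasure T) := by
      obtain ⟨U, hU, hUf, -⟩ := hf₀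
      exact (restr Ω).comp_memLp' ((memLp_continuousOn hU ∞).ae_eq hUf.symm)
    have m2 : MemLp (fun t => embΩ Ω s (w t)) ∞ (timeMeasure T) := by
      refine memLp_top_of_bound ((embΩ Ω s).continuous.comp_aestronglyMeasurable hw.1)
        (√(C * (‖hG.toLp _‖ + ‖u₀ - restr Ω f₀‖) ^ 2)) ?_
      filter_upwards [b1] with t ht using Real.le_sqrt_of_sq_le ht
    refine (m1.add m2).ae_eq (.of_forall fun t => ?_)
    simp only [map_add]; rfl
  refine ⟨f₀, hf₀, _, hD, ?_, fun t => f t + w t, fun t => restrNeg Ω s (f' t) +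
    (F t - restrNeg Ω s (f' t) - fracDiffusion h hg Ω t (f t) - restrForm Ω (rootForm h hg t) (w t)),
    hweak, fun v hv => hv.ae_eq h hg hT hF hweak, hq.add hv, ?_, ?_⟩
  · filter_upwards [isFracDiv_fracDiffusion (Ω := Ω) h hg] with t ht using ht (f t)
  · refine ((hpu.congr (.of_forall fun t => rfl) (.of_forall fun t => ?_)).isWeakTimeDeriv hT
      ((hq.add hv).integrable one_le_two))
    simp only [fracDiffusion_add, fracDiffusion_coe]
    abel
  · obtain ⟨X, hX⟩ : ∃ X, X = ‖hG.toLp _‖ + ‖u₀ - restr Ω f₀‖ := ⟨_, rfl⟩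
    rw [← hX] at b1 b2 b3
    have hX2 : X ^ 2 ≤ 5 * (‖u₀‖ ^ 2 + ‖restr Ω f₀‖ ^ 2 + ‖hF.toLp F‖ ^ 2 + ‖hq.toLp _‖ ^ 2 +
        ‖hD.toLp _‖ ^ 2) := by
      refine le_trans ?_ (add_sq_le_five ‖hF.toLp F‖ ‖hq.toLp _‖ ‖hD.toLp _‖ ‖u₀‖ ‖restr Ω f₀‖)
      have e : hG.toLp _ = hF.toLp F - hq.toLp _ - hD.toLp _ := rfl
      have e1 : ‖hG.toLp _‖ ≤ ‖hF.toLp F‖ + ‖hq.toLp _‖ + ‖hD.toLp _‖ := by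
        rw [e]
        exact (norm_sub_le _ _).trans (add_le_add_left (norm_sub_le _ _) _)
      have e2 := norm_sub_le u₀ (restr Ω f₀)
      rw [hX]
      gcongr
    have e1 : eLpNorm (fun t => restr Ω (Hs.toL2 n s (f t + w t - f t))) ∞ (timeMeasure T) ^ 2 ≤
        ENNReal.ofReal (C * X ^ 2) := by
      refine eLpNorm_top_sq_le (by positivity) ?_
      filter_upwards [b1] with t ht
      rw [add_sub_cancel_left]; exact ht
    have e2 : eLpNorm (fun t => f t + w t - f t) 2 (timeMeasure T) ^ 2 ≤
        ENNReal.ofReal (C * X ^ 2) := by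
      simp only [add_sub_cancel_left]
      have : eLpNorm (fun t => (w t : Hs n s)) 2 (timeMeasure T) = eLpNorm w 2 (timeMeasure T) :=
        eLpNorm_congr_norm_ae (.of_forall fun t => rfl)
      rw [this, eLpNorm_two_sq hw]
      exact ENNReal.ofReal_le_ofReal b2
    have e3 : eLpNorm (fun t => restrNeg Ω s (f' t) + (F t - restrNeg Ω s (f' t) -
        fracDiffusion h hg Ω t (f t) - restrForm Ω (rootForm h hg t) (w t)) - restrNeg Ω s (f' t)) 2
        (timeMeasure T) ^ 2 ≤ ENNReal.ofReal (C * X ^ 2) := by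
      simp only [add_sub_cancel_left]
      rw [eLpNorm_two_sq hv]
      exact ENNReal.ofReal_le_ofReal b3
    refine (add_le_add (add_le_add e1 e2) e3).trans ?_
    rw [eLpNorm_two_sq hF, eLpNorm_two_sq hq, eLpNorm_two_sq hD, enorm_sq_eq_ofReal,
      enorm_sq_eq_ofReal, ← ENNReal.ofReal_coe_nnreal, hK]
    repeat rw [← ENNReal.ofReal_add (by positivity) (by positivity)]
    rw [← ENNReal.ofReal_mul (by positivity)]
    refine ENNReal.ofReal_le_ofReal ?_
    have := mul_le_mul_of_nonneg_left hX2 hC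
    have p : 0 ≤ ‖u₀‖ ^ 2 + ‖restr Ω f₀‖ ^ 2 + ‖hF.toLp F‖ ^ 2 + ‖hq.toLp _‖ ^ 2 +
        ‖hD.toLp _‖ ^ 2 := by positivity
    linarith

end WellPosedness

/-! ### Higher regularity of weak solutions -/

section Regularity

variable {n : ℕ} {s : ℝ≥0} {T : ℝ} {Ω : Opens (Euc n)} {γ : Euc n → ℝ → ℝ} {g : ℝ → Euc n → ℝ}
  {c Λ : ℝ}

/-- `H¹(0,T;L²) ∩ L²(0,T;H²ˢ) ⊆ L^∞(0,T;Hˢ)`. -/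
lemma memLp_top_of_isPrimitive (hT : 0 < T) {b : ℝ≥0} (hb : b = 2 * s) (hle : s ≤ b)
    {f : ℝ → Hs n s} {f₂ : ℝ → Hs n b} {f' : ℝ → L2 n} {f₀ : L2 n}
    (hf₂ : MemLp f₂ 2 (timeMeasure T)) (hf' : MemLp f' 2 (timeMeasure T))
    (hff : ∀ᵐ t ∂(timeMeasure T), f t = Hs.incl hle (f₂ t))
    (hp : IsPrimitive T (fun t => Hs.toL2 n s (f t)) f' f₀) : MemLp f ∞ (timeMeasure T) := by
  -- The map `g ↦ (g, ⟨D⟩^{2s} ·)` from `L²` to the dual of `H²ˢ` extends the embedding given by the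
  -- inner product of `Hˢ`. Hence `f'` is a derivative in the dual of `H²ˢ`, and the Lions-Magenes
  -- lemma applies to `H²ˢ ⊆ Hˢ`.
  obtain ⟨Φ, hΦ⟩ : ∃ Φ : L2 n →L[ℝ] StrongDual ℝ (Hs n b),
      Φ = (dualEmb (besselIsom n b).toContinuousLinearMap).comp (complexify n) := ⟨_, rfl⟩
  have hΦf : ∀ u : Hs n s, Φ (Hs.toL2 n s u) = dualEmb (Hs.incl hle) u := fun u => by
    ext χ
    rw [hΦ, dualEmb_apply, Hs.inner_incl hb hle]
    rfl
  have h1 := hp.comp Φ (hf'.integrable one_le_two)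
  have h2 : IsPrimitive T (fun t => dualEmb (Hs.incl hle) (Hs.incl hle (f₂ t))) (fun t => Φ (f' t))
      (Φ f₀) := by
    refine h1.congr ?_ (.of_forall fun t => rfl)
    filter_upwards [hff] with t ht
    rw [hΦf, ht]
  obtain ⟨U, hU, hUf, -⟩ := lionsMagenes hT (Hs.incl hle) hf₂ (Φ.comp_memLp' hf') h2
  refine (memLp_continuousOn hU ∞).ae_eq ?_
  filter_upwards [hff, hUf] with t e1 e2
  rw [e1, e2]

/-- Regularity of weak solutions. -/
theorem IsWeakSolution.regularity (h : Adm n s) (hsn : (s : ℝ) < (n : ℝ) / 2) (hT : 0 < T)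
    (hγ : UniformlyElliptic T γ)
    (hm : MemLinftyBessel (4 * s) (ENNReal.ofReal ((n : ℝ) / (2 * s))) T (backgroundDeviation γ))
    (hd : TimeDerivBounded T γ) :
    ∃ C : ℝ≥0, 0 < C ∧
      ∀ (F : ℝ → L2On Ω) (f : ℝ → Hs n s) (f₂ : ℝ → Hs n (2 * s)) (f' : ℝ → L2 n)
        (f₀ u₀ : Hs n s),
        MemLp F 2 (timeMeasure T) →
        (∀ᵐ t ∂(timeMeasure T), Hs.toL2 n s (f t) = Hs.toL2 n (2 * s) (f₂ t)) →
        MemLp f₂ 2 (timeMeasure T) →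
        MemLp f' 2 (timeMeasure T) →
        IsWeakTimeDeriv T (fun t => Hs.toL2 n s (f t)) f' →
        HasInitialValue T (fun t => Hs.toL2 n s (f t)) (Hs.toL2 n s f₀) →
        u₀ - f₀ ∈ Htilde Ω s →
        ∀ u : ℝ → Hs n s,
          IsWeakSolution Ω s T γ (fun t => l2ToHnegOn Ω s (F t)) f
            (restr Ω (Hs.toL2 n s u₀)) u →
          MemLp u ∞ (timeMeasure T) ∧
          ∃ u' : ℝ → L2On Ω, MemLp u' 2 (timeMeasure T) ∧
            IsWeakTimeDeriv T (fun t => restr Ω (Hs.toL2 n s (u t))) u' ∧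
            eLpNorm (fun t => u' t - restr Ω (f' t)) 2 (timeMeasure T) ^ 2 +
                eLpNorm (fun t => u t - f t) ∞ (timeMeasure T) ^ 2 ≤
              C * (‖u₀‖ₑ ^ 2 + eLpNorm F 2 (timeMeasure T) ^ 2 + ‖f₀‖ₑ ^ 2 +
                eLpNorm (fun t => restr Ω (f' t)) 2 (timeMeasure T) ^ 2 +
                eLpNorm f₂ 2 (timeMeasure T) ^ 2) := by
  obtain ⟨g, c, Λ, hg⟩ := hγ.exists_isRootCoef
  obtain ⟨a, M, α, l, L, ha, hsym, hL, haf⟩ := exists_lipschitz_form h hT hγ hg hd Ω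
  obtain ⟨K, hK⟩ := exists_kernel_bound h hsn hg hm
  have hle : s ≤ 2 * s := by rw [two_mul]; exact le_add_of_nonneg_left zero_le
  obtain ⟨B, hB, hform⟩ := exists_abs_rootForm_le h hg rfl hle K
  obtain ⟨C, hC, hex⟩ := exists_regularSolution_bounds hT ha hsym hL
  -- Two terms are each at most `C X²`, and `X²` is at most `5 (1 + B²)` times the sum of the
  -- squared data.
  obtain ⟨N, hN⟩ : ∃ N : ℝ≥0, (N : ℝ) = 10 * C * (1 + B ^ 2) + 1 :=
    ⟨⟨10 * C * (1 + B ^ 2) + 1, by positivity⟩, rfl⟩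
  refine ⟨N, by rw [← NNReal.coe_pos, hN]; positivity,
    fun F f f₂ f' f₀ u₀ hF hff hf₂ hf' hfd hf₀ hu₀ u hu => ?_⟩
  have hff' : ∀ᵐ t ∂(timeMeasure T), f t = Hs.incl hle (f₂ t) := by
    filter_upwards [hff] with t ht
    exact Hs.toL2_injective (by rw [ht, Hs.toL2_incl])
  have hf : MemLp f 2 (timeMeasure T) :=
    ((Hs.incl hle).comp_memLp' hf₂).ae_eq (by filter_upwards [hff'] with t ht using ht.symm)
  have hpf : IsPrimitive T (fun t => Hs.toL2 n s (f t)) f' (Hs.toL2 n s f₀) := by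
    obtain ⟨Y₀, hp⟩ := hfd.exists_isPrimitive hT
      ((Hs.toL2 n s).integrable_comp (hf.integrable one_le_two)) (hf'.integrable one_le_two)
    rwa [hp.eq_of_hasInitialValue hT (hf'.integrable one_le_two) hf₀] at hp
  have hr : MemLp (fun t => restr Ω (f' t)) 2 (timeMeasure T) := (restr Ω).comp_memLp' hf'
  have hpr := hpf.comp (restr Ω) (hf'.integrable one_le_two)
  have hpd := hpr.comp (dualEmb (embΩ Ω s)) (hr.integrable one_le_two)
  have hFd : MemLp (fun t => l2ToHnegOn Ω s (F t)) 2 (timeMeasure T) :=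
    (dualEmb (embΩ Ω s)).comp_memLp' hF
  have hrd : MemLp (fun t => dualEmb (embΩ Ω s) (restr Ω (f' t))) 2 (timeMeasure T) :=
    (dualEmb (embΩ Ω s)).comp_memLp' hr
  have hG : MemLp (fun t => l2ToHnegOn Ω s (F t) - dualEmb (embΩ Ω s) (restr Ω (f' t)) -
      fracDiffusion h hg Ω t (f t)) 2 (timeMeasure T) :=
    (hFd.sub hrd).sub (memLp_fracDiffusion h hg hf)
  have hk : MemLp (fun t => ‖F t‖ + ‖restr Ω (f' t)‖ + B * ‖f₂ t‖) 2 (timeMeasure T) :=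
    (hF.norm.add hr.norm).add (hf₂.norm.const_mul B)
  -- The source must act through the `L²` norm of `v`. For the diffusion of `f` this is where the
  -- `H²ˢ` regularity and the kernel bound enter.
  have hbound : ∀ᵐ t ∂(timeMeasure T), ∀ v, |(l2ToHnegOn Ω s (F t) -
      dualEmb (embΩ Ω s) (restr Ω (f' t)) - fracDiffusion h hg Ω t (f t)) v| ≤
      (‖F t‖ + ‖restr Ω (f' t)‖ + B * ‖f₂ t‖) * ‖embΩ Ω s v‖ := by
    filter_upwards [hff', hK] with t e1 e2 v
    have e3 := hform t e2 (f₂ t) v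
    rw [← e1, ← Htilde.norm_emb] at e3
    have e4 := abs_real_inner_le_norm (F t) (embΩ Ω s v)
    have e5 := abs_real_inner_le_norm (restr Ω (f' t)) (embΩ Ω s v)
    rw [add_mul, add_mul]
    exact (abs_sub _ _).trans (add_le_add ((abs_sub _ _).trans (add_le_add e4 e5)) e3)
  obtain ⟨w, p, hw, hp, hprim, heq, bw, bp⟩ := hex _ _ ⟨u₀ - f₀, hu₀⟩ hG hk hbound
  have hsol : IsMildSolution T (embΩ Ω s) (fun t => restrForm Ω (rootForm h hg t))
      (fun t => l2ToHnegOn Ω s (F t) - dualEmb (embΩ Ω s) (restr Ω (f' t)) -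
        fracDiffusion h hg Ω t (f t)) (embΩ Ω s ⟨u₀ - f₀, hu₀⟩) w := by
    refine (hprim.comp (dualEmb (embΩ Ω s)) (hp.integrable one_le_two)).congr
      (.of_forall fun t => rfl) ?_
    filter_upwards [heq, haf] with t e1 e2
    rw [e1, e2]
  have hpu := isPrimitive_add_mildSolution h hg hFd hf hrd hw hpd hsol
  have hsum : restr Ω (Hs.toL2 n s f₀) + embΩ Ω s ⟨u₀ - f₀, hu₀⟩ = restr Ω (Hs.toL2 n s u₀) := by
    change restr Ω (Hs.toL2 n s f₀) + restr Ω (Hs.toL2 n s (u₀ - f₀)) = _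
    rw [← map_add, ← map_add, add_sub_cancel]
  rw [hsum] at hpu
  have hw' : MemLp (fun t => (w t : Hs n s)) 2 (timeMeasure T) := (Htilde Ω s).subtypeL.comp_memLp' hw
  obtain ⟨w₁, hw₁, h₁⟩ := hu.exterior
  -- The regular solution satisfies the same integrated equation as the given weak solution, so
  -- uniqueness transfers its regularity.
  have huw : ∀ᵐ t ∂(timeMeasure T), u t = f t + w t :=
    ae_eq_of_isPrimitive h hg hT hFd hu.memLp_two (hf.add hw') hw₁ hw h₁
      (.of_forall fun t => add_sub_cancel_left _ _)
      (isPrimitive_of_weak_eq h hg hT hFd hu.memLp_two hu.weak_eq) hpu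
  have hftop := memLp_top_of_isPrimitive hT rfl hle hf₂ hf' hff' hpf
  obtain ⟨X, hX⟩ : ∃ X, X = ‖hk.toLp _‖ + ‖(⟨u₀ - f₀, hu₀⟩ : Htilde Ω s)‖ := ⟨_, rfl⟩
  rw [← hX] at bw bp
  refine ⟨?_, fun t => restr Ω (f' t) + p t, hr.add hp, ?_, ?_⟩
  · have hwtop : MemLp (fun t => (w t : Hs n s)) ∞ (timeMeasure T) := by
      refine memLp_top_of_bound hw'.1 (√(C * X ^ 2)) ?_
      filter_upwards [bw] with t ht using Real.le_sqrt_of_sq_le ht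
    exact (hftop.add hwtop).ae_eq (by filter_upwards [huw] with t ht using ht.symm)
  · refine ((hpr.add (hr.integrable one_le_two) (hp.integrable one_le_two) hprim).congr ?_
      (.of_forall fun t => rfl)).isWeakTimeDeriv hT ((hr.add hp).integrable one_le_two)
    filter_upwards [huw] with t ht
    rw [ht, map_add, map_add]
    rfl
  · have hX2 : X ^ 2 ≤ 5 * (1 + B ^ 2) * (‖u₀‖ ^ 2 + ‖hF.toLp F‖ ^ 2 + ‖f₀‖ ^ 2 +
        ‖hr.toLp _‖ ^ 2 + ‖hf₂.toLp f₂‖ ^ 2) := by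
      have e1 : ‖hk.toLp _‖ ≤ ‖hF.toLp F‖ + ‖hr.toLp _‖ + B * ‖hf₂.toLp f₂‖ := by
        have e : hk.toLp _ = hF.norm.toLp _ + hr.norm.toLp _ + (hf₂.norm.const_mul B).toLp _ := rfl
        have n1 : ‖hF.norm.toLp _‖ = ‖hF.toLp F‖ := by
          rw [Lp.norm_toLp, Lp.norm_toLp, eLpNorm_norm]
        have n2 : ‖hr.norm.toLp _‖ = ‖hr.toLp _‖ := by
          rw [Lp.norm_toLp, Lp.norm_toLp, eLpNorm_norm]
        have n3 : ‖(hf₂.norm.const_mul B).toLp _‖ ≤ B * ‖hf₂.toLp f₂‖ := by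
          refine Lp.norm_le_mul_norm_of_ae_le_mul ?_
          filter_upwards [(hf₂.norm.const_mul B).coeFn_toLp, hf₂.coeFn_toLp] with t q1 q2
          rw [q1, q2, norm_mul, norm_norm, Real.norm_of_nonneg hB]
        rw [e, ← n1, ← n2]
        exact (norm_add_le _ _).trans (add_le_add (norm_add_le _ _) n3)
      have e2 : ‖(⟨u₀ - f₀, hu₀⟩ : Htilde Ω s)‖ ≤ ‖u₀‖ + ‖f₀‖ := norm_sub_le u₀ f₀
      have e3 : X ^ 2 ≤ (‖hF.toLp F‖ + ‖hr.toLp _‖ + B * ‖hf₂.toLp f₂‖ + (‖u₀‖ + ‖f₀‖)) ^ 2 := by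
        rw [hX]
        gcongr
      have e4 := add_sq_le_five ‖hF.toLp F‖ ‖hr.toLp _‖ (B * ‖hf₂.toLp f₂‖) ‖u₀‖ ‖f₀‖
      have p1 := mul_nonneg (sq_nonneg B) (sq_nonneg ‖u₀‖)
      have p2 := mul_nonneg (sq_nonneg B) (sq_nonneg ‖hF.toLp F‖)
      have p3 := mul_nonneg (sq_nonneg B) (sq_nonneg ‖f₀‖)
      have p4 := mul_nonneg (sq_nonneg B) (sq_nonneg ‖hr.toLp _‖)
      have p5 := sq_nonneg ‖hf₂.toLp f₂‖
      rw [mul_pow] at e4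
      linarith
    have e1 : eLpNorm (fun t => restr Ω (f' t) + p t - restr Ω (f' t)) 2 (timeMeasure T) ^ 2 ≤
        ENNReal.ofReal (C * X ^ 2) := by
      simp only [add_sub_cancel_left]
      rw [eLpNorm_two_sq hp]
      exact ENNReal.ofReal_le_ofReal bp
    have e2 : eLpNorm (fun t => u t - f t) ∞ (timeMeasure T) ^ 2 ≤ ENNReal.ofReal (C * X ^ 2) := by
      refine eLpNorm_top_sq_le (by positivity) ?_
      filter_upwards [bw, huw] with t q1 q2
      rw [q2, add_sub_cancel_left]
      exact q1
    refine (add_le_add e1 e2).trans ?_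
    rw [eLpNorm_two_sq hF, eLpNorm_two_sq hr, eLpNorm_two_sq hf₂, enorm_sq_eq_ofReal,
      enorm_sq_eq_ofReal, ← ENNReal.ofReal_coe_nnreal, hN]
    repeat rw [← ENNReal.ofReal_add (by positivity) (by positivity)]
    rw [← ENNReal.ofReal_mul (by positivity)]
    refine ENNReal.ofReal_le_ofReal ?_
    have := mul_le_mul_of_nonneg_left hX2 hC
    have q : 0 ≤ ‖u₀‖ ^ 2 + ‖hF.toLp F‖ ^ 2 + ‖f₀‖ ^ 2 + ‖hr.toLp _‖ ^ 2 +
        ‖hf₂.toLp f₂‖ ^ 2 := by positivity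
    linarith

end Regularity

end NonlocalDiffusion

end

theorem mainTheorem5 (n : ℕ) (s : ℝ≥0) (hs0 : 0 < s) (hs1 : s < 1) (hsn : (s : ℝ) < (n : ℝ) / 2)
    (T : ℝ) (hT : 0 < T) (Ω : Opens (Euc n)) (hΩ : BoundedInOneDirection (Ω : Set (Euc n)))
    (γ : Euc n → ℝ → ℝ) (hγ : UniformlyElliptic T γ) :
    (∃ C : ℝ≥0, 0 < C ∧
      ∀ (F : ℝ → HnegOn Ω s) (f : ℝ → Hs n s) (f' : ℝ → Hneg n s) (u₀ : L2On Ω),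
        MemLp F 2 (timeMeasure T) →
        MemLp f 2 (timeMeasure T) →
        MemLp f' 2 (timeMeasure T) →
        IsWeakTimeDeriv T (fun t => l2ToHneg n s (Hs.toL2 n s (f t))) f' →
        -- the trace `f(0)`, and `div_s(Θ_γ ∇ˢf) ∈ L²(0,T;H⁻ˢ(Ω))`
        ∃ f₀ : L2 n, HasInitialValue T (fun t => Hs.toL2 n s (f t)) f₀ ∧
        ∃ D : ℝ → HnegOn Ω s, MemLp D 2 (timeMeasure T) ∧
          (∀ᵐ t ∂(timeMeasure T),
            IsFracDiv Ω s (fun z => conductivity γ t z (fracGrad s (f t) z)) (D t)) ∧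
        ∃ (u : ℝ → Hs n s) (u' : ℝ → HnegOn Ω s),
          IsWeakSolution Ω s T γ F f u₀ u ∧
          (∀ v : ℝ → Hs n s, IsWeakSolution Ω s T γ F f u₀ v → v =ᵐ[timeMeasure T] u) ∧
          MemLp u' 2 (timeMeasure T) ∧
          IsWeakTimeDeriv T (fun t => l2ToHnegOn Ω s (restr Ω (Hs.toL2 n s (u t)))) u' ∧
          eLpNorm (fun t => restr Ω (Hs.toL2 n s (u t - f t))) ∞ (timeMeasure T) ^ 2 +
              eLpNorm (fun t => u t - f t) 2 (timeMeasure T) ^ 2 +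
              eLpNorm (fun t => u' t - restrNeg Ω s (f' t)) 2 (timeMeasure T) ^ 2 ≤
            C * (‖u₀‖ₑ ^ 2 + ‖restr Ω f₀‖ₑ ^ 2 + eLpNorm F 2 (timeMeasure T) ^ 2 +
              eLpNorm (fun t => restrNeg Ω s (f' t)) 2 (timeMeasure T) ^ 2 +
              eLpNorm D 2 (timeMeasure T) ^ 2)) ∧
    (MemLinftyBessel (4 * s) (ENNReal.ofReal ((n : ℝ) / (2 * s))) T (backgroundDeviation γ) →
      TimeDerivBounded T γ →
      ∃ C : ℝ≥0, 0 < C ∧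
        ∀ (F : ℝ → L2On Ω) (f : ℝ → Hs n s) (f₂ : ℝ → Hs n (2 * s)) (f' : ℝ → L2 n)
          (f₀ u₀ : Hs n s),
          MemLp F 2 (timeMeasure T) →
          -- `f ∈ L²(0,T;H²ˢ(ℝⁿ))`, where `f₂` is `f` as a function with values in `H²ˢ(ℝⁿ)`
          (∀ᵐ t ∂(timeMeasure T), Hs.toL2 n s (f t) = Hs.toL2 n (2 * s) (f₂ t)) →
          MemLp f₂ 2 (timeMeasure T) →
          -- `f ∈ H¹(0,T;L²(ℝⁿ))`
          MemLp f' 2 (timeMeasure T) →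
          IsWeakTimeDeriv T (fun t => Hs.toL2 n s (f t)) f' →
          HasInitialValue T (fun t => Hs.toL2 n s (f t)) (Hs.toL2 n s f₀) →
          u₀ - f₀ ∈ Htilde Ω s →
          ∀ u : ℝ → Hs n s,
            IsWeakSolution Ω s T γ (fun t => l2ToHnegOn Ω s (F t)) f
              (restr Ω (Hs.toL2 n s u₀)) u →
            MemLp u ∞ (timeMeasure T) ∧
            ∃ u' : ℝ → L2On Ω, MemLp u' 2 (timeMeasure T) ∧
              IsWeakTimeDeriv T (fun t => restr Ω (Hs.toL2 n s (u t))) u' ∧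
              eLpNorm (fun t => u' t - restr Ω (f' t)) 2 (timeMeasure T) ^ 2 +
                  eLpNorm (fun t => u t - f t) ∞ (timeMeasure T) ^ 2 ≤
                C * (‖u₀‖ₑ ^ 2 + eLpNorm F 2 (timeMeasure T) ^ 2 + ‖f₀‖ₑ ^ 2 +
                  eLpNorm (fun t => restr Ω (f' t)) 2 (timeMeasure T) ^ 2 +
                  eLpNorm f₂ 2 (timeMeasure T) ^ 2)) := by
  have h : Adm n s := ⟨hs0, hs1, Nat.pos_of_ne_zero fun h0 => by
    have h1 : (0 : ℝ) ≤ s := s.2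
    simp only [h0, Nat.cast_zero, zero_div] at hsn
    linarith⟩
  exact ⟨exists_weakSolution h hT hγ, fun hm hd => IsWeakSolution.regularity h hsn hT hγ hm hd⟩
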